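/- Fix $\alpha\in(1,2)$, real numbers $0<r<M$ and $x_0\in\mathbb R^2$ with $|x_0|=1$. Write $B_R=\{y\in\mathbb R^2:|y|<R\}$. For $n\ge 1$ and $y\in\frac1n\mathbb Z^2$ let $F_n(y)=n^2\,\mathrm{Leb}\big((y+[-\tfrac1{2n},\tfrac1{2n}]^2)\cap (B_M\setminus B_{r/n})\big)$, and put $$k_n=\frac{n^{2-\alpha}}4\Big(\int_{B_M}\frac{dy}{|y|^\alpha}-\frac1{n^2}\sum_{y\in\frac1n\mathbb Z^2\setminus\{0\}}\frac{F_n(y)}{|y|^\alpha}\Big),$$ $$p_n(y)=c_n\Big(k_n\mathbf 1_{\{|y|=1/n\}}+\frac{F_n(y)}{n^{2+\alpha}|y|^{2+\alpha}}\Big)\quad(y\in\tfrac1n\mathbb Z^2\setminus\{0\}),\qquad p_n(0)=0,$$ where $c_n$ is the normalizing constant that makes $\sum_y p_n(y)=1$. Assume that $k_1>0$. Let $$\psi_{M,n}(\theta)=n^\alpha\sum_{y\in\frac1n\mathbb Z^2}p_n(y)(1-\cos(\theta\cdot y)),\qquad G_{M,n}(x)=\frac1{(2\pi)^2}\int_{[-n\pi,n\pi]^2}\frac{\cos(\theta\cdot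 x)-\cos(\theta\cdot x_0)}{\psi_{M,n}(\theta)}\,d\theta .$$ The integrals defining $G_{M,n}(x)$, $x\in\mathbb R^2$, converge absolutely. The limit $c=\lim_{n\to\infty}c_n$ exists and is positive. Let $$\psi_M(\theta)=c\int_{B_M}\frac{1-\cos(\theta\cdot y)}{|y|^{2+\alpha}}\,dy,\qquad G_M(x)=\frac1{(2\pi)^2}\lim_{R\to\infty}\int_{[-R,R]^2}\frac{\cos(\theta\cdot x)-\cos(\theta\cdot x_0)}{\psi_M(\theta)}\,d\theta ;$$ for $x\ne0$ each of these integrals over $[-R,R]^2$ converges absolutely and the limit exists. Let $\sigma_M^2=c\int_{B_M}|y|^{-\alpha}dy$ and $$\beta_n=\frac{2}{\pi\sigma_M^2}\Big(1-\frac{c}{c_n}\Big).$$ Then there is a constant $K>0$, depending only on the fixed parameters $\alpha,r,M,x_0$, such that for all $n\ge1$ and all $x\in\frac1n\mathbb Z^2\setminus\{0\}$ $$\big|G_M(x)-G_{M,n}(x)+\beta_n\log|x|\big|\le\frac{K}{n^\alpha}\Big(1+\frac1{|x|^{2-\alpha}}+\frac1{|x|^2}\Big),$$ and $|\beta_n|\le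 K n^{-\alpha}$ for all $n\ge1$. In particular $\beta_n\to0$ at rate $n^{-\alpha}$. Moreover $G_{M,n}\to G_M$ uniformly on every compact subset of $\mathbb R^2\setminus\{0\}$. -/

import Mathlib

open MeasureTheory Filter Topology

noncomputable section

namespace TruncatedStable

/-- The Euclidean plane. -/
abbrev Plane : Type := EuclideanSpace ℝ (Fin 2)

/-- The point `z / n` of the rescaled lattice `(1/n) ℤ²`. -/
def latticePt (n : ℕ) (z : Fin 2 → ℤ) : Plane :=
  WithLp.toLp 2 (fun i => (z i : ℝ) / (n : ℝ))

/-- The rescaled lattice `(1/n) ℤ²`, as a subset of the plane. -/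
def rescaledLattice (n : ℕ) : Set Plane := Set.range (latticePt n)

/-- The closed square of side `1/n` centred at `y`. -/
def cell (n : ℕ) (y : Plane) : Set Plane :=
  {x | ∀ i, |x i - y i| ≤ 1 / (2 * (n : ℝ))}

/-- The closed square `[-R, R]²`. -/
def box (R : ℝ) : Set Plane := {θ | ∀ i, |θ i| ≤ R}

/-- The annulus `B_b \ B_a`, with open balls centred at the origin. -/
def annulus (a b : ℝ) : Set Plane := Metric.ball 0 b \ Metric.ball 0 a

/-- `F_n(y)`: the proportion of the cell of `y` that lies in the annulus `B_M \ B_{r/n}`. -/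
def cellFraction (r M : ℝ) (n : ℕ) (y : Plane) : ℝ :=
  (n : ℝ) ^ 2 * volume.real (cell n y ∩ annulus (r / (n : ℝ)) M)

/-- The integral of `|y|^{-α}` over the ball `B_M`. -/
def ballMoment (α M : ℝ) : ℝ :=
  ∫ y in Metric.ball (0 : Plane) M, 1 / ‖y‖ ^ α

/-- The nearest-neighbour correction `k_n`. The sum is over the nonzero lattice points; only
finitely many terms do not vanish. -/
def kn (α r M : ℝ) (n : ℕ) : ℝ :=
  (n : ℝ) ^ (2 - α) / 4 *
    (ballMoment α M - 1 / (n : ℝ) ^ 2 *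
      ∑' z : Fin 2 → ℤ,
        if z = 0 then 0 else cellFraction r M n (latticePt n z) / ‖latticePt n z‖ ^ α)

/-- The jump weight at the lattice point `z / n`, before normalization. -/
def jumpWeight (α r M : ℝ) (n : ℕ) (z : Fin 2 → ℤ) : ℝ :=
  if z = 0 then 0 else
    kn α r M n * (if ‖latticePt n z‖ = 1 / (n : ℝ) then 1 else 0) +
      cellFraction r M n (latticePt n z) /
        ((n : ℝ) ^ (2 + α) * ‖latticePt n z‖ ^ (2 + α))

/-- The normalizing constant `c_n`. Only finitely many weights do not vanish. -/
def cn (α r M : ℝ) (n : ℕ) : ℝ := (∑' z : Fin 2 → ℤ, jumpWeight α r M n z)⁻¹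

/-- The jump probability `p_n` at the lattice point `z / n`. -/
def pn (α r M : ℝ) (n : ℕ) (z : Fin 2 → ℤ) : ℝ := cn α r M n * jumpWeight α r M n z

/-- The symbol `ψ_{M,n}` of the discrete truncated fractional Laplacian. -/
def psiDisc (α r M : ℝ) (n : ℕ) (θ : Plane) : ℝ :=
  (n : ℝ) ^ α *
    ∑' z : Fin 2 → ℤ, pn α r M n z * (1 - Real.cos (inner ℝ θ (latticePt n z)))

/-- The constant `c = lim c_n`. -/
def cLim (α r M : ℝ) : ℝ := limUnder atTop (fun n : ℕ => cn α r M n)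

/-- The symbol `ψ_M` of the truncated fractional Laplacian. -/
def psiCont (α r M : ℝ) (θ : Plane) : ℝ :=
  cLim α r M *
    ∫ y in Metric.ball (0 : Plane) M, (1 - Real.cos (inner ℝ θ y)) / ‖y‖ ^ (2 + α)

/-- The variance `σ_M²`. -/
def sigmaSq (α r M : ℝ) : ℝ := cLim α r M * ballMoment α M

/-- The integrand of the Green's function of a symbol `ψ`, normalized at `x₀`. -/
def greenIntegrand (ψ : Plane → ℝ) (x₀ x θ : Plane) : ℝ :=
  (Real.cos (inner ℝ θ x) - Real.cos (inner ℝ θ x₀)) / ψ θ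

/-- `(2π)^{-2}` times the integral of the Green integrand over the square `[-R, R]²`. -/
def greenOnBox (ψ : Plane → ℝ) (x₀ : Plane) (R : ℝ) (x : Plane) : ℝ :=
  1 / (2 * Real.pi) ^ 2 * ∫ θ in box R, greenIntegrand ψ x₀ x θ

/-- The rescaled discrete Green's function `G_{M,n}`. -/
def greenDisc (α r M : ℝ) (x₀ : Plane) (n : ℕ) (x : Plane) : ℝ :=
  greenOnBox (psiDisc α r M n) x₀ ((n : ℝ) * Real.pi) x

/-- The continuum Green's function `G_M`. The integral over the plane is not absolutely convergent;
it is the limit of the integrals over the squares `[-R, R]²`. -/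
def greenCont (α r M : ℝ) (x₀ x : Plane) : ℝ :=
  limUnder atTop (fun R : ℝ => greenOnBox (psiCont α r M) x₀ R x)

/-- The constant `β_n`. -/
def betaN (α r M : ℝ) (n : ℕ) : ℝ :=
  2 / (Real.pi * sigmaSq α r M) * (1 - cLim α r M / cn α r M n)

end TruncatedStable

end

noncomputable section

namespace TruncatedStable

/-! ### Radial integrals in the plane -/

/-! Why the theorem holds. Dilation by n turns (1/n)ℤ² into ℤ² and B_M into B_R with R = nM; the
weights then depend on n only through R. The nearest-neighbour correction is exactly what makes the
second moments of the jump weights equal to those of |v|^{-2-α} on B_R (`sum_unitWeight_moment`). So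
the Hessians of the two symbols agree at frequency 0, and what remains is the error of replacing the
integral of K(v)(cos(η·v) - 1) by its lattice sum, K being a second moment kernel, homogeneous of
degree -α. It is estimated cell by cell (`exists_hessSum_sub_hessInt_le`). Scaled back, the Hessians
differ on [-nπ,nπ]² by O(n^{-2} min(|θ|²,|θ|^α)), and integration from the origin gives the
gradients and the symbols themselves (`exists_discSymb_sub_contSymb_le`). A lower bound of the
nearest-neighbour weight that is uniform in R (`exists_nnWeight_ge`) keeps the discrete symbol away
from zero on the rest of the square.

For a symbol φ without its constant, 1/φ = (1+φ)^{-1} + (1+φ)^{-2} + φ^{-1}(1+φ)^{-2}. Against the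
difference of cosines the last summand is absolutely integrable, decays like |θ|^{-3α}, and
contributes an error O(n^{-α}) (`exists_resid_sub_le`). The first two are only O(|θ|^{-α}) at
infinity, but they are C². Two integrations by parts in a coordinate with x_i ≠ 0 give an integrable
Hessian divided by x_i², plus a boundary term. The Hessians differ by O(n^{-2}|θ|^{-α}), which
integrates to O(n^{-α}) over the square. By periodicity the boundary term carries the factor
sin(nπx_i): it vanishes at lattice points. At x₀ it vanishes too if x₀ lies on an axis; otherwise
one more integration by parts along the edges makes it O(n^{-α}). At a general point it is
O(n^{1-α}), which still suffices for uniform convergence (`exists_disc_reg_le`).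

This compares c G_M with c_n G_{M,n} (`exists_green_sub_le`). The constants themselves satisfy 1 -
c/c_n = O(n^{-α}) (`exists_cn_rate`), and G_M + (2/(πσ_M²)) log|x| is O(1 + |x|^{-2}), because the
symbol is quadratic near 0 (`exists_greenCont_log_le`). The identity G_M - G_{M,n} + β_n log|x| = (1
- c/c_n)(G_M + (2/(πσ_M²)) log|x|) + c_n^{-1}(c G_M - c_n G_{M,n}) explains β_n and gives the
expansion (`exists_green_expansion_le`). -/

lemma volume_real_unit_ball : (volume : Measure Plane).real (Metric.ball 0 1) = Real.pi := by
  rw [Measure.real, EuclideanSpace.volume_ball_fin_two]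
  simp [Real.pi_pos.le]

lemma integrableOn_radial_iff {I : Set ℝ} (hI : MeasurableSet I) (f : ℝ → ℝ) :
    IntegrableOn (fun x : Plane => f ‖x‖) {x | ‖x‖ ∈ I} ↔
      IntegrableOn (fun y => y * f y) (Set.Ioi 0 ∩ I) := by
  have hm : MeasurableSet {x : Plane | ‖x‖ ∈ I} := measurable_norm hI
  rw [← integrable_indicator_iff hm]
  have : Set.indicator {x : Plane | ‖x‖ ∈ I} (fun x => f ‖x‖)
      = fun x : Plane => (I.indicator f) ‖x‖ := by
    ext x; simp [Set.indicator]
  rw [this, integrable_fun_norm_addHaar volume (f := I.indicator f)]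
  have h2 : (fun y : ℝ => y ^ (Module.finrank ℝ Plane - 1) • I.indicator f y)
      = I.indicator (fun y => y * f y) := by
    ext y; simp [Set.indicator]
  rw [h2, integrableOn_indicator_iff hI, Set.inter_comm]

lemma setIntegral_radial {I : Set ℝ} (hI : MeasurableSet I) (f : ℝ → ℝ) :
    ∫ x in {x : Plane | ‖x‖ ∈ I}, f ‖x‖ = 2 * Real.pi * ∫ y in Set.Ioi 0 ∩ I, y * f y := by
  have hm : MeasurableSet {x : Plane | ‖x‖ ∈ I} := measurable_norm hI
  rw [← integral_indicator hm]
  have : Set.indicator {x : Plane | ‖x‖ ∈ I} (fun x => f ‖x‖)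
      = fun x : Plane => (I.indicator f) ‖x‖ := by
    ext x; simp [Set.indicator]
  rw [this, integral_fun_norm_addHaar volume (I.indicator f), volume_real_unit_ball]
  have h2 : (fun y : ℝ => y ^ (Module.finrank ℝ Plane - 1) • I.indicator f y)
      = I.indicator (fun y => y * f y) := by
    ext y; simp [Set.indicator]
  rw [h2, setIntegral_indicator hI]
  simp; ring

lemma ball_eq_norm_mem (ρ : ℝ) : Metric.ball (0 : Plane) ρ = {x | ‖x‖ ∈ Set.Iio ρ} := by
  ext; simp

lemma annulus_eq_norm_mem (a b : ℝ) : annulus a b = {x | ‖x‖ ∈ Set.Ico a b} := by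
  ext; simp [annulus, and_comm]

lemma measurableSet_annulus (a b : ℝ) : MeasurableSet (annulus a b) :=
  measurableSet_ball.diff measurableSet_ball

lemma mem_annulus {a b : ℝ} {v : Plane} : v ∈ annulus a b ↔ a ≤ ‖v‖ ∧ ‖v‖ < b := by
  simp [annulus, and_comm]

lemma mul_rpow_neg {y p : ℝ} (hy : 0 < y) : y * y ^ (-p) = y ^ (1 - p) := by
  rw [sub_eq_add_neg, Real.rpow_add hy, Real.rpow_one]

lemma integrableOn_ball_rpow {p : ℝ} (hp : p < 2) (ρ : ℝ) :
    IntegrableOn (fun u : Plane => ‖u‖ ^ (-p)) (Metric.ball 0 ρ) := by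
  rw [ball_eq_norm_mem, integrableOn_radial_iff measurableSet_Iio (fun y => y ^ (-p))]
  rw [Set.Ioi_inter_Iio]
  rcases le_or_gt ρ 0 with h | h
  · simp [Set.Ioo_eq_empty (not_lt.2 h)]
  have h1 : IntegrableOn (fun y : ℝ => y ^ (1 - p)) (Set.Ioo 0 ρ) :=
    (intervalIntegral.integrableOn_Ioo_rpow_iff h).2 (by linarith)
  exact h1.congr_fun (fun y hy => (mul_rpow_neg hy.1).symm) measurableSet_Ioo

lemma integral_ball_rpow {p : ℝ} (hp : p < 2) {ρ : ℝ} (hρ : 0 ≤ ρ) :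
    ∫ u in Metric.ball (0 : Plane) ρ, ‖u‖ ^ (-p) = 2 * Real.pi / (2 - p) * ρ ^ (2 - p) := by
  rw [ball_eq_norm_mem, setIntegral_radial measurableSet_Iio (fun y => y ^ (-p)),
    Set.Ioi_inter_Iio]
  have : ∫ y in Set.Ioo 0 ρ, y * y ^ (-p) = ∫ y in (0 : ℝ)..ρ, y ^ (1 - p) := by
    rw [intervalIntegral.integral_of_le hρ, integral_Ioc_eq_integral_Ioo]
    exact setIntegral_congr_fun measurableSet_Ioo (fun y hy => mul_rpow_neg hy.1)
  rw [this, integral_rpow (Or.inl (by linarith))]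
  rw [Real.zero_rpow (by linarith), show 1 - p + 1 = 2 - p by ring]
  have : 2 - p ≠ 0 := by linarith
  field_simp; ring

lemma compl_ball_eq_norm_mem (ρ : ℝ) : (Metric.ball (0 : Plane) ρ)ᶜ = {x | ‖x‖ ∈ Set.Ici ρ} := by
  ext; simp

lemma integrableOn_compl_ball_rpow {p : ℝ} (hp : 2 < p) {ρ : ℝ} (hρ : 0 < ρ) :
    IntegrableOn (fun u : Plane => ‖u‖ ^ (-p)) (Metric.ball 0 ρ)ᶜ := by
  rw [compl_ball_eq_norm_mem, integrableOn_radial_iff measurableSet_Ici (fun y => y ^ (-p))]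
  have hs : Set.Ioi 0 ∩ Set.Ici ρ = Set.Ici ρ :=
    Set.inter_eq_right.2 (fun y hy => lt_of_lt_of_le hρ hy)
  rw [hs, integrableOn_Ici_iff_integrableOn_Ioi]
  exact ((integrableOn_Ioi_rpow_iff hρ).2 (by linarith : 1 - p < -1)).congr_fun
    (fun y hy => (mul_rpow_neg (hρ.trans hy)).symm) measurableSet_Ioi

lemma integral_compl_ball_rpow {p : ℝ} (hp : 2 < p) {ρ : ℝ} (hρ : 0 < ρ) :
    ∫ u in (Metric.ball (0 : Plane) ρ)ᶜ, ‖u‖ ^ (-p)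
      = 2 * Real.pi / (p - 2) * ρ ^ (2 - p) := by
  rw [compl_ball_eq_norm_mem, setIntegral_radial measurableSet_Ici (fun y => y ^ (-p))]
  have hs : Set.Ioi 0 ∩ Set.Ici ρ = Set.Ici ρ :=
    Set.inter_eq_right.2 (fun y hy => lt_of_lt_of_le hρ hy)
  rw [hs, integral_Ici_eq_integral_Ioi,
    setIntegral_congr_fun (g := fun y : ℝ => y ^ (1 - p)) measurableSet_Ioi
      (fun y hy => mul_rpow_neg (hρ.trans hy)),
    integral_Ioi_rpow_of_lt (by linarith) hρ, show 1 - p + 1 = 2 - p by ring]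
  have : 2 - p ≠ 0 := by linarith
  have : p - 2 ≠ 0 := by linarith
  field_simp; ring

lemma integrableOn_annulus_rpow {a : ℝ} (ha : 0 < a) (b q : ℝ) :
    IntegrableOn (fun u : Plane => ‖u‖ ^ (-q)) (annulus a b) := by
  rw [annulus_eq_norm_mem, integrableOn_radial_iff measurableSet_Ico (fun y => y ^ (-q))]
  have hs : Set.Ioi 0 ∩ Set.Ico a b = Set.Ico a b :=
    Set.inter_eq_right.2 (fun y hy => lt_of_lt_of_le ha hy.1)
  rw [hs]
  refine IntegrableOn.mono_set (ContinuousOn.integrableOn_Icc ?_) Set.Ico_subset_Icc_self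
  exact continuousOn_id.mul (continuousOn_id.rpow_const
    (fun y hy => Or.inl (lt_of_lt_of_le ha hy.1).ne'))

/-- Meant for thin shells: the radial density `y ^ (1 - q)` is nonincreasing, so its value on the
inner circle times the width is a good bound. -/
lemma integral_annulus_rpow_le {a : ℝ} (ha : 0 < a) {b q : ℝ} (hab : a ≤ b) (hq : 1 ≤ q) :
    ∫ u in annulus a b, ‖u‖ ^ (-q) ≤ 2 * Real.pi * ((b - a) * a ^ (1 - q)) := by
  have hi := integrableOn_annulus_rpow ha b q
  rw [annulus_eq_norm_mem] at hi ⊢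
  rw [integrableOn_radial_iff measurableSet_Ico (fun y => y ^ (-q))] at hi
  rw [setIntegral_radial measurableSet_Ico (fun y => y ^ (-q))]
  have hs : Set.Ioi 0 ∩ Set.Ico a b = Set.Ico a b :=
    Set.inter_eq_right.2 (fun y hy => lt_of_lt_of_le ha hy.1)
  rw [hs] at hi ⊢
  gcongr
  calc ∫ y in Set.Ico a b, y * y ^ (-q) ≤ ∫ y in Set.Ico a b, a ^ (1 - q) := by
        refine setIntegral_mono_on hi (by simp) measurableSet_Ico ?_
        intro y hy
        rw [mul_rpow_neg (lt_of_lt_of_le ha hy.1)]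
        exact Real.rpow_le_rpow_of_nonpos ha hy.1 (by linarith)
    _ = _ := by simp [hab]

lemma integral_annulus_rpow_neg_two {a : ℝ} (ha : 0 < a) {b : ℝ} (hab : a ≤ b) :
    ∫ u in annulus a b, ‖u‖ ^ (-2 : ℝ) = 2 * Real.pi * Real.log (b / a) := by
  rw [annulus_eq_norm_mem, setIntegral_radial measurableSet_Ico (fun y => y ^ (-2 : ℝ))]
  have hs : Set.Ioi 0 ∩ Set.Ico a b = Set.Ico a b :=
    Set.inter_eq_right.2 (fun y hy => lt_of_lt_of_le ha hy.1)
  rw [hs, ← integral_inv_of_pos ha (ha.trans_le hab), intervalIntegral.integral_of_le hab,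
    integral_Ioc_eq_integral_Ioo, integral_Ico_eq_integral_Ioo]
  congr 1
  refine setIntegral_congr_fun measurableSet_Ioo (fun y hy => ?_)
  have hy0 : 0 < y := ha.trans hy.1
  rw [mul_rpow_neg hy0, ← Real.rpow_neg_one]; norm_num

lemma volume_real_annulus {a b : ℝ} (ha : 0 ≤ a) (hab : a ≤ b) :
    volume.real (annulus a b) = Real.pi * (b ^ 2 - a ^ 2) := by
  have h : ∀ r : ℝ, 0 ≤ r → volume.real (Metric.ball (0 : Plane) r) = Real.pi * r ^ 2 := by
    intro r hr
    rw [Measure.real, EuclideanSpace.volume_ball_fin_two]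
    simp [Real.pi_pos.le, hr]; ring
  rw [annulus, measureReal_sdiff (Metric.ball_subset_ball hab) measurableSet_ball, h _ ha,
    h _ (ha.trans hab)]
  ring

lemma volume_real_ball {r : ℝ} (hr : 0 ≤ r) :
    volume.real (Metric.ball (0 : Plane) r) = Real.pi * r ^ 2 := by
  rw [Measure.real, EuclideanSpace.volume_ball_fin_two]
  simp [Real.pi_pos.le, hr]; ring

/-! ### Kernels with the regularity of a homogeneous function -/

/-- Size, Lipschitz and second difference bounds of a kernel that is smooth and homogeneous of
degree `-a` away from the origin. -/
structure KernelBound (a C : ℝ) (K : Plane → ℝ) : Prop where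
  size : ∀ z, |K z| ≤ C * ‖z‖ ^ (-a)
  lip : ∀ z w, ‖w‖ ≤ 3 / 4 * ‖z‖ → |K (z + w) - K z| ≤ C * ‖z‖ ^ (-a - 1) * ‖w‖
  second : ∀ z w, ‖w‖ ≤ 3 / 4 * ‖z‖ →
    |K (z + w) + K (z - w) - 2 * K z| ≤ C * ‖z‖ ^ (-a - 2) * ‖w‖ ^ 2

/-- Homogeneity reduces the three bounds to |z| = 1. A displacement of length at most 3/4 then stays
in the compact annulus 1/4 ≤ |v| ≤ 7/4, where the first two derivatives are bounded. The ratio 3/4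
exceeds √2/2, the half diagonal of the unit cell, so the bounds cover the whole cell of any nonzero
lattice point. -/
lemma exists_kernelBound {a : ℝ} {K : Plane → ℝ} (h0 : K 0 = 0)
    (hK : ContDiffOn ℝ 2 K {0}ᶜ)
    (hom : ∀ (t : ℝ) (v : Plane), 0 < t → K (t • v) = t ^ (-a) * K v) :
    ∃ C, 0 ≤ C ∧ KernelBound a C K := by
  have hopen : IsOpen ({0}ᶜ : Set Plane) := isOpen_compl_singleton
  set A : Set Plane := Metric.closedBall 0 (7 / 4) \ Metric.ball 0 (1 / 4) with hA
  have hAc : IsCompact A := (isCompact_closedBall _ _).diff Metric.isOpen_ball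
  have hA0 : A ⊆ {0}ᶜ := by
    intro v hv h
    rw [Set.mem_singleton_iff] at h
    subst h
    simp [hA] at hv
  have hmemA : ∀ z w : Plane, ‖z‖ = 1 → ‖w‖ ≤ 3 / 4 → ∀ t : ℝ, |t| ≤ 1 → z + t • w ∈ A := by
    intro z w hz hw t ht
    have h1 : ‖t • w‖ ≤ 3 / 4 := by
      rw [norm_smul, Real.norm_eq_abs]
      nlinarith [norm_nonneg w, abs_nonneg t]
    have h2 := norm_add_le z (t • w)
    have h3 := norm_sub_le_norm_add z (t • w)
    simp only [hA, Set.mem_sdiff, Metric.mem_closedBall, dist_zero_right, Metric.mem_ball, not_lt]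
    constructor <;> linarith
  have hd1 : ContDiffOn ℝ 1 (fderiv ℝ K) {0}ᶜ := hK.fderiv_of_isOpen hopen (by norm_num)
  have hd2 : ContinuousOn (fderiv ℝ (fderiv ℝ K)) {0}ᶜ :=
    (hd1.fderiv_of_isOpen (m := 0) hopen (by norm_num)).continuousOn
  obtain ⟨C0, hC0⟩ := hAc.exists_bound_of_continuousOn (hK.continuousOn.mono hA0)
  obtain ⟨C1, hC1⟩ := hAc.exists_bound_of_continuousOn (hd1.continuousOn.mono hA0)
  obtain ⟨C2, hC2⟩ := hAc.exists_bound_of_continuousOn (f := fderiv ℝ (fderiv ℝ K)) (hd2.mono hA0)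
  have hdiff : ∀ v ∈ A, HasFDerivAt K (fderiv ℝ K v) v := fun _ hv =>
    ((hK.differentiableOn (by norm_num)).differentiableAt
      (hopen.mem_nhds (hA0 hv))).hasFDerivAt
  have hdiff2 : ∀ v ∈ A, HasFDerivAt (fderiv ℝ K) (fderiv ℝ (fderiv ℝ K) v) v := fun _ hv =>
    ((hd1.differentiableOn (by norm_num)).differentiableAt
      (hopen.mem_nhds (hA0 hv))).hasFDerivAt
  have line : ∀ (z w : Plane) (t : ℝ), HasDerivAt (fun t : ℝ => z + t • w) w t := by
    intro z w t
    simpa using ((hasDerivAt_id t).smul_const w).const_add z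
  have b1 : ∀ z w : Plane, ‖z‖ = 1 → ‖w‖ ≤ 3 / 4 → |K (z + w) - K z| ≤ C1 * ‖w‖ := by
    intro z w hz hw
    have := norm_image_sub_le_of_norm_deriv_le_segment_01' (f := fun t : ℝ => K (z + t • w))
      (f' := fun t => fderiv ℝ K (z + t • w) w) (C := C1 * ‖w‖) ?_ ?_
    · simpa using this
    · intro t ht
      exact ((hdiff _ (hmemA z w hz hw t (abs_le.2 ⟨by linarith [ht.1], ht.2⟩))).comp_hasDerivAt t
        (line z w t)).hasDerivWithinAt
    · intro t ht
      refine ((fderiv ℝ K (z + t • w)).le_opNorm w).trans ?_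
      gcongr
      exact hC1 _ (hmemA z w hz hw t (abs_le.2 ⟨by linarith [ht.1], ht.2.le⟩))
  have b2 : ∀ z w : Plane, ‖z‖ = 1 → ‖w‖ ≤ 3 / 4 →
      |K (z + w) + K (z - w) - 2 * K z| ≤ 2 * C2 * ‖w‖ ^ 2 := by
    intro z w hz hw
    -- The gradients at z + tw and z - tw are compared along the segment that joins them;
    -- integrating this bound in t yields the second difference.
    have hgrad : ∀ t ∈ Set.Icc (0 : ℝ) 1,
        ‖fderiv ℝ K (z + t • w) - fderiv ℝ K (z + (-t) • w)‖ ≤ 2 * C2 * ‖w‖ := by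
      intro t ht
      have key := norm_image_sub_le_of_norm_deriv_le_segment_01'
        (f := fun s : ℝ => fderiv ℝ K (z + (-t + s * (2 * t)) • w))
        (f' := fun s => fderiv ℝ (fderiv ℝ K) (z + (-t + s * (2 * t)) • w) ((2 * t) • w))
        (C := 2 * C2 * ‖w‖) ?_ ?_
      · simpa [show -t + 2 * t = t by ring] using key
      · intro s hs
        have hm := hmemA z w hz hw (-t + s * (2 * t)) (abs_le.2
          ⟨by nlinarith [ht.1, ht.2, hs.1, hs.2], by nlinarith [ht.1, ht.2, hs.1, hs.2]⟩)
        have hl : HasDerivAt (fun s : ℝ => z + (-t + s * (2 * t)) • w) ((2 * t) • w) s := by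
          have h1 : HasDerivAt (fun s : ℝ => -t + s * (2 * t)) (2 * t) s := by
            simpa using ((hasDerivAt_id s).mul_const (2 * t)).const_add (-t)
          exact (h1.smul_const w).const_add z
        exact ((hdiff2 _ hm).comp_hasDerivAt s hl).hasDerivWithinAt
      · intro s hs
        have hm := hmemA z w hz hw (-t + s * (2 * t)) (abs_le.2
          ⟨by nlinarith [ht.1, ht.2, hs.1, hs.2], by nlinarith [ht.1, ht.2, hs.1, hs.2]⟩)
        refine ((fderiv ℝ (fderiv ℝ K) _).le_opNorm _).trans ?_
        have h2 : ‖(2 * t) • w‖ ≤ 2 * ‖w‖ := by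
          rw [norm_smul, Real.norm_eq_abs, abs_of_nonneg (by linarith [ht.1])]
          nlinarith [norm_nonneg w, ht.2]
        have h3 := hC2 _ hm
        calc _ ≤ C2 * (2 * ‖w‖) := by
              gcongr
              exact (norm_nonneg _).trans h3
          _ = _ := by ring
    have := norm_image_sub_le_of_norm_deriv_le_segment_01'
      (f := fun t : ℝ => K (z + t • w) + K (z + t • (-w)))
      (f' := fun t => fderiv ℝ K (z + t • w) w + fderiv ℝ K (z + t • (-w)) (-w))
      (C := 2 * C2 * ‖w‖ ^ 2) ?_ ?_
    · have e : K (z + w) + K (z - w) - 2 * K z = K (z + w) + K (z + -w) - (K z + K z) := by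
        rw [sub_eq_add_neg z w]; ring
      rw [e]
      simpa using this
    · intro t ht
      have ht' : |t| ≤ 1 := abs_le.2 ⟨by linarith [ht.1], ht.2⟩
      exact (((hdiff _ (hmemA z w hz hw t ht')).comp_hasDerivAt t (line z w t)).add
        ((hdiff _ (hmemA z (-w) hz (by simpa using hw) t ht')).comp_hasDerivAt t
          (line z (-w) t))).hasDerivWithinAt
    · intro t ht
      have e : fderiv ℝ K (z + t • w) w + fderiv ℝ K (z + t • (-w)) (-w)
          = (fderiv ℝ K (z + t • w) - fderiv ℝ K (z + (-t) • w)) w := by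
        simp [sub_eq_add_neg]
      rw [e]
      refine (ContinuousLinearMap.le_opNorm _ w).trans ?_
      have := hgrad t ⟨ht.1, ht.2.le⟩
      nlinarith [norm_nonneg w]
  -- Some point of A is needed to see that the three constants are nonnegative.
  have he : (EuclideanSpace.single 0 1 : Plane) ∈ A := by
    simpa using hmemA (EuclideanSpace.single 0 1) 0 (by simp) (by simp; norm_num) 0 (by simp)
  have hC1n : 0 ≤ C1 := (norm_nonneg _).trans (hC1 _ he)
  have hC2n : 0 ≤ C2 := (norm_nonneg _).trans (hC2 _ he)
  have hC0n : 0 ≤ C0 := (norm_nonneg _).trans (hC0 _ he)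
  have scale : ∀ z w : Plane, z ≠ 0 → ‖w‖ ≤ 3 / 4 * ‖z‖ → ∃ z' w' : Plane, ‖z'‖ = 1 ∧
      ‖w'‖ ≤ 3 / 4 ∧ z = ‖z‖ • z' ∧ w = ‖z‖ • w' ∧ ‖w'‖ = ‖z‖⁻¹ * ‖w‖ := by
    intro z w hz hw
    have hz' : ‖z‖ ≠ 0 := norm_ne_zero_iff.2 hz
    have hzp : 0 < ‖z‖ := norm_pos_iff.2 hz
    refine ⟨‖z‖⁻¹ • z, ‖z‖⁻¹ • w, ?_, ?_, ?_, ?_, ?_⟩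
    · simp [norm_smul, hz']
    · rw [norm_smul, norm_inv, norm_norm, inv_mul_le_iff₀ hzp]; linarith
    · rw [smul_smul, mul_inv_cancel₀ hz', one_smul]
    · rw [smul_smul, mul_inv_cancel₀ hz', one_smul]
    · rw [norm_smul, norm_inv, norm_norm]
  set C := C0 + C1 + 2 * C2 with hC
  refine ⟨C, by positivity, ⟨?_, ?_, ?_⟩⟩
  · intro z
    rcases eq_or_ne z 0 with rfl | hz
    · rw [h0]; simp only [abs_zero]; positivity
    obtain ⟨z', w', h1, -, h3, -, -⟩ := scale z 0 hz (by simp)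
    have hzp : 0 < ‖z‖ := norm_pos_iff.2 hz
    have h5 : |K z'| ≤ C0 := hC0 z' (by simpa using hmemA z' 0 h1 (by simp; norm_num) 0 (by simp))
    have h6 : K z = ‖z‖ ^ (-a) * K z' := by
      conv_lhs => rw [h3]
      exact hom _ _ hzp
    rw [h6, abs_mul, abs_of_nonneg (by positivity), mul_comm]
    gcongr
    linarith
  · intro z w hw
    rcases eq_or_ne z 0 with rfl | hz
    · have : w = 0 := by simpa using hw
      subst this; simp
    have hzp : 0 < ‖z‖ := norm_pos_iff.2 hz
    obtain ⟨z', w', h1, h2, h3, h4, h5⟩ := scale z w hz hw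
    have h6 : K (z + w) - K z = ‖z‖ ^ (-a) * (K (z' + w') - K z') := by
      have e : z + w = ‖z‖ • (z' + w') := by rw [smul_add, ← h3, ← h4]
      rw [e, hom _ _ hzp, mul_sub]
      congr 1
      conv_lhs => rw [h3]
      exact hom _ _ hzp
    rw [h6, abs_mul, abs_of_nonneg (by positivity)]
    calc ‖z‖ ^ (-a) * |K (z' + w') - K z'| ≤ ‖z‖ ^ (-a) * (C * ‖w'‖) := by
          gcongr
          refine (b1 z' w' h1 h2).trans ?_
          gcongr
          linarith
      _ = _ := by
          rw [h5, Real.rpow_sub_one hzp.ne']; field_simp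
  · intro z w hw
    rcases eq_or_ne z 0 with rfl | hz
    · have : w = 0 := by simpa using hw
      subst this; simp [h0]
    have hzp : 0 < ‖z‖ := norm_pos_iff.2 hz
    obtain ⟨z', w', h1, h2, h3, h4, h5⟩ := scale z w hz hw
    have h6 : K (z + w) + K (z - w) - 2 * K z
        = ‖z‖ ^ (-a) * (K (z' + w') + K (z' - w') - 2 * K z') := by
      have e : z + w = ‖z‖ • (z' + w') := by rw [smul_add, ← h3, ← h4]
      have e' : z - w = ‖z‖ • (z' - w') := by rw [smul_sub, ← h3, ← h4]
      have e2 : K z = ‖z‖ ^ (-a) * K z' := by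
        conv_lhs => rw [h3]
        exact hom _ _ hzp
      rw [e, e', hom _ _ hzp, hom _ _ hzp, e2]; ring
    rw [h6, abs_mul, abs_of_nonneg (by positivity)]
    calc ‖z‖ ^ (-a) * |K (z' + w') + K (z' - w') - 2 * K z'|
        ≤ ‖z‖ ^ (-a) * (C * ‖w'‖ ^ 2) := by
          gcongr
          refine (b2 z' w' h1 h2).trans ?_
          gcongr
          linarith
      _ = _ := by
          rw [h5, Real.rpow_sub hzp, Real.rpow_two]; field_simp

lemma contDiffOn_norm_rpow (p : ℝ) :
    ContDiffOn ℝ 2 (fun v : Plane => ‖v‖ ^ p) {0}ᶜ := fun _ hv =>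
  ((contDiffAt_norm ℝ hv).rpow_const_of_ne (norm_ne_zero_iff.2 hv)).contDiffWithinAt

lemma exists_kernelBound_rpow {a : ℝ} (ha : 0 < a) :
    ∃ C, 0 ≤ C ∧ KernelBound a C (fun v : Plane => ‖v‖ ^ (-a)) := by
  refine exists_kernelBound ?_ (contDiffOn_norm_rpow _) ?_
  -- The kernel vanishes at the origin by the convention that 0 to a nonzero power is 0.
  · simp [Real.zero_rpow (neg_ne_zero.2 ha.ne')]
  · intro t v ht
    rw [norm_smul, Real.norm_of_nonneg ht.le, Real.mul_rpow ht.le (norm_nonneg _)]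

/-- The second moment kernel `v_i v_j |v|^{-2-α}`. -/
def momentKernel (α : ℝ) (i j : Fin 2) (v : Plane) : ℝ := v i * v j * ‖v‖ ^ (-2 - α)

lemma exists_kernelBound_moment (α : ℝ) (i j : Fin 2) :
    ∃ C, 0 ≤ C ∧ KernelBound α C (momentKernel α i j) := by
  refine exists_kernelBound (by simp [momentKernel]) ?_ ?_
  · unfold momentKernel
    refine ContDiffOn.mul (ContDiff.contDiffOn ?_) (contDiffOn_norm_rpow _)
    fun_prop
  · intro t v ht
    unfold momentKernel
    rw [norm_smul, Real.norm_of_nonneg ht.le, Real.mul_rpow ht.le (norm_nonneg _)]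
    have : t ^ (-2 - α) = t ^ (-α) * (t ^ 2)⁻¹ := by
      rw [← Real.rpow_natCast t 2, ← Real.rpow_neg ht.le, ← Real.rpow_add ht]; push_cast; ring_nf
    rw [this]
    simp only [PiLp.smul_apply, smul_eq_mul]
    field_simp

/-! ### Unit cells of the lattice `ℤ²` -/

/-- A point of `ℤ²` in the plane. -/
abbrev intPt (z : Fin 2 → ℤ) : Plane := latticePt 1 z

/-- The closed unit square centred at the origin. -/
def unitCell : Set Plane := {w | ∀ i, |w i| ≤ 1 / 2}

/-- The closed unit square centred at `z`. -/
def intCell (z : Fin 2 → ℤ) : Set Plane := {v | v - intPt z ∈ unitCell}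

@[simp] lemma intPt_apply (z : Fin 2 → ℤ) (i : Fin 2) : intPt z i = z i := by
  simp [intPt, latticePt]

@[simp] lemma intPt_zero : intPt 0 = 0 := by ext i; simp

lemma plane_norm_sq (v : Plane) : ‖v‖ ^ 2 = v 0 ^ 2 + v 1 ^ 2 := by
  simp [EuclideanSpace.norm_sq_eq, Fin.sum_univ_two]

lemma plane_inner (v w : Plane) : inner ℝ v w = v 0 * w 0 + v 1 * w 1 := by
  simp [PiLp.inner_apply, Fin.sum_univ_two, mul_comm]

lemma abs_apply_le_norm (v : Plane) (i : Fin 2) : |v i| ≤ ‖v‖ := by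
  simpa using PiLp.norm_apply_le v i

lemma intPt_eq_zero {z : Fin 2 → ℤ} : intPt z = 0 ↔ z = 0 := by
  constructor
  · intro h
    ext i
    have := congrArg (fun v : Plane => v i) h
    simpa using this
  · rintro rfl; simp

lemma one_le_norm_intPt {z : Fin 2 → ℤ} (hz : z ≠ 0) : 1 ≤ ‖intPt z‖ := by
  obtain ⟨i, hi⟩ := Function.ne_iff.1 hz
  refine le_trans ?_ (abs_apply_le_norm _ i)
  rw [intPt_apply, ← Int.cast_abs]
  exact_mod_cast Int.one_le_abs hi

lemma norm_intPt_pos {z : Fin 2 → ℤ} (hz : z ≠ 0) : 0 < ‖intPt z‖ :=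
  zero_lt_one.trans_le (one_le_norm_intPt hz)

lemma norm_sq_le_of_mem_unitCell {w : Plane} (hw : w ∈ unitCell) : ‖w‖ ^ 2 ≤ 1 / 2 := by
  rw [plane_norm_sq, ← sq_abs (w 0), ← sq_abs (w 1)]
  have h0 := hw 0
  have h1 := hw 1
  nlinarith [abs_nonneg (w 0), abs_nonneg (w 1)]

lemma norm_le_of_mem_unitCell {w : Plane} (hw : w ∈ unitCell) : ‖w‖ ≤ 3 / 4 := by
  have := norm_sq_le_of_mem_unitCell hw
  nlinarith [norm_nonneg w]

lemma norm_le_mul_of_mem_unitCell {w : Plane} (hw : w ∈ unitCell) {z : Fin 2 → ℤ} (hz : z ≠ 0) :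
    ‖w‖ ≤ 3 / 4 * ‖intPt z‖ := by
  have := norm_le_of_mem_unitCell hw
  have := one_le_norm_intPt hz
  linarith

lemma neg_mem_unitCell {w : Plane} : -w ∈ unitCell ↔ w ∈ unitCell := by
  simp [unitCell]

lemma isClosed_unitCell : IsClosed unitCell := by
  have : unitCell = ⋂ i : Fin 2, {w : Plane | |w i| ≤ 1 / 2} := by ext; simp [unitCell]
  rw [this]
  exact isClosed_iInter fun i => isClosed_le (by fun_prop) continuous_const

lemma isCompact_unitCell : IsCompact unitCell :=
  Metric.isCompact_of_isClosed_isBounded isClosed_unitCell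
    ((Metric.isBounded_closedBall (x := (0 : Plane)) (r := 3 / 4)).subset fun w hw => by
      simpa using norm_le_of_mem_unitCell hw)

lemma measurableSet_unitCell : MeasurableSet unitCell := isClosed_unitCell.measurableSet

lemma measurableSet_intCell (z : Fin 2 → ℤ) : MeasurableSet (intCell z) :=
  (measurable_id.sub_const (intPt z)) measurableSet_unitCell

lemma preimage_intCell (z : Fin 2 → ℤ) : (fun w => intPt z + w) ⁻¹' intCell z = unitCell := by
  ext w; simp [intCell]

lemma setIntegral_intCell (z : Fin 2 → ℤ) (g : Plane → ℝ) :
    ∫ v in intCell z, g v = ∫ w in unitCell, g (intPt z + w) := by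
  rw [← preimage_intCell z]
  exact ((measurePreserving_add_left volume (intPt z)).setIntegral_preimage_emb
    (measurableEmbedding_addLeft _) g (intCell z)).symm

lemma integrableOn_intCell (z : Fin 2 → ℤ) (g : Plane → ℝ) :
    IntegrableOn g (intCell z) ↔ IntegrableOn (fun w => g (intPt z + w)) unitCell := by
  rw [← preimage_intCell z]
  exact ((measurePreserving_add_left volume (intPt z)).integrableOn_comp_preimage
    (measurableEmbedding_addLeft _)).symm

lemma volume_unitCell : volume unitCell = 1 := by
  have h : unitCell = (MeasurableEquiv.toLp 2 (Fin 2 → ℝ)).symm ⁻¹'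
      (Set.univ.pi fun _ => Set.Icc (-(1 / 2) : ℝ) (1 / 2)) := by
    ext w
    simp only [unitCell, abs_le, Set.mem_ofPred_eq, Set.mem_preimage, Set.mem_univ_pi, Set.mem_Icc]
    rfl
  rw [h, (EuclideanSpace.volume_preserving_symm_measurableEquiv_toLp (Fin 2)).measure_preimage
    (MeasurableSet.univ_pi fun _ => measurableSet_Icc).nullMeasurableSet, volume_pi_pi]
  simp; norm_num

lemma volume_real_unitCell : volume.real unitCell = 1 := by simp [Measure.real, volume_unitCell]

lemma volume_intCell (z : Fin 2 → ℤ) : volume (intCell z) = 1 := by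
  have := (measurePreserving_add_left volume (intPt z)).measure_preimage
    (measurableSet_intCell z).nullMeasurableSet
  rw [preimage_intCell, volume_unitCell] at this
  exact this.symm

lemma setIntegral_unitCell_neg (g : Plane → ℝ) :
    ∫ w in unitCell, g (-w) = ∫ w in unitCell, g w := by
  have h : (fun w : Plane => -w) ⁻¹' unitCell = unitCell := by ext w; exact neg_mem_unitCell
  have := (Measure.measurePreserving_neg (volume : Measure Plane)).setIntegral_preimage_emb
    (MeasurableEquiv.neg Plane).measurableEmbedding g unitCell
  simpa only [h, Function.comp] using this

/-- The nearest lattice point. -/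
def roundPt (v : Plane) : Fin 2 → ℤ := fun i => round (v i)

lemma measurable_roundPt : Measurable roundPt := by
  refine measurable_pi_lambda _ fun i => ?_
  have : Measurable (fun t : ℝ => round t) := by
    simp only [round_eq]
    exact Int.measurable_floor.comp (measurable_id.add_const _)
  exact this.comp (by fun_prop)

lemma mem_intCell_roundPt (v : Plane) : v ∈ intCell (roundPt v) := by
  intro i
  simpa [roundPt] using abs_sub_round (v i)

lemma ae_coord_notMem (i : Fin 2) {S : Set ℝ} (hS : S.Countable) :
    ∀ᵐ v : Plane, v i ∉ S := by
  have h1 : Measure.QuasiMeasurePreserving (fun v : Plane => v i) volume volume :=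
    (Measure.quasiMeasurePreserving_eval (fun _ : Fin 2 => (volume : Measure ℝ)) i).comp
      (EuclideanSpace.volume_preserving_symm_measurableEquiv_toLp (Fin 2)).quasiMeasurePreserving
  exact h1.ae (hS.ae_notMem volume)

/-- Closed cells overlap only where a coordinate is a half-integer, which is a null set. Off it the
cells are the fibres of `roundPt`, a measurable partition. -/
lemma ae_mem_intCell_iff : ∀ᵐ v : Plane, ∀ z, v ∈ intCell z ↔ roundPt v = z := by
  have hS : (Set.range fun k : ℤ => (k : ℝ) + 1 / 2).Countable := Set.countable_range _
  filter_upwards [ae_coord_notMem 0 hS, ae_coord_notMem 1 hS] with v h0 h1 z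
  have h : ∀ i, v i ∉ Set.range fun k : ℤ => (k : ℝ) + 1 / 2 := by
    intro i; fin_cases i; exacts [h0, h1]
  constructor
  · intro hv
    ext i
    have h2 : |v i - z i| ≤ 1 / 2 := by simpa using hv i
    rw [abs_le] at h2
    have h3 : v i ≠ (z i : ℝ) + 1 / 2 := fun h' => h i ⟨z i, h'.symm⟩
    have h4 : v i < z i + 1 / 2 := lt_of_le_of_ne (by linarith [h2.2]) h3
    simp only [roundPt, round_eq, Int.floor_eq_iff]
    constructor <;> linarith [h2.1]
  · rintro rfl; exact mem_intCell_roundPt v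

lemma intCell_ae_eq (z : Fin 2 → ℤ) : intCell z =ᵐ[volume] (roundPt ⁻¹' {z} : Set Plane) := by
  filter_upwards [ae_mem_intCell_iff] with v hv
  exact propext (hv z)

lemma setIntegral_eq_sum_cells {A : Set Plane} (hA : MeasurableSet A) {g : Plane → ℝ}
    (hg : IntegrableOn g A) (Z : Finset (Fin 2 → ℤ)) (hZ : ∀ v ∈ A, roundPt v ∈ Z) :
    ∫ v in A, g v = ∑ z ∈ Z, ∫ v in intCell z ∩ A, g v := by
  have h1 : A = ⋃ z ∈ Z, (roundPt ⁻¹' {z} ∩ A) := by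
    ext v; simp only [Set.mem_iUnion, Set.mem_inter_iff, Set.mem_preimage, Set.mem_singleton_iff]
    exact ⟨fun hv => ⟨_, hZ v hv, rfl, hv⟩, fun ⟨_, _, _, hv⟩ => hv⟩
  conv_lhs => rw [h1]
  rw [integral_biUnion_finset]
  · refine Finset.sum_congr rfl fun z _ => ?_
    exact setIntegral_congr_set (((intCell_ae_eq z).symm).inter (ae_eq_refl A))
  · exact fun z _ => (measurable_roundPt (measurableSet_singleton z)).inter hA
  · intro x _ y _ hxy
    refine Set.disjoint_left.2 fun v hv hv' => hxy ?_
    exact (hv.1 : roundPt v = x).symm.trans hv'.1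
  · exact fun z _ => hg.mono_set Set.inter_subset_right

lemma sum_cells_le_setIntegral {B : Set Plane} (hB : MeasurableSet B) {g : Plane → ℝ}
    (hg : IntegrableOn g B) (hg0 : ∀ v ∈ B, 0 ≤ g v) (Z : Finset (Fin 2 → ℤ))
    (hZ : ∀ z ∈ Z, intCell z ⊆ B) :
    ∑ z ∈ Z, ∫ v in intCell z, g v ≤ ∫ v in B, g v := by
  have e : ∀ z ∈ Z, ∫ v in intCell z, g v = ∫ v in B ∩ roundPt ⁻¹' {z}, g v := by
    intro z hz
    have h1 : intCell z = B ∩ intCell z := (Set.inter_eq_right.2 (hZ z hz)).symm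
    rw [h1]
    exact setIntegral_congr_set ((ae_eq_refl B).inter (intCell_ae_eq z))
  rw [Finset.sum_congr rfl e, ← integral_biUnion_finset]
  · refine setIntegral_mono_set hg ?_ (Eventually.of_forall ?_)
    · exact (ae_restrict_iff' hB).2 (Eventually.of_forall hg0)
    · intro v hv
      obtain ⟨z, -, hz⟩ := Set.mem_iUnion₂.1 hv
      exact hz.1
  · exact fun z _ => hB.inter (measurable_roundPt (measurableSet_singleton z))
  · intro x _ y _ hxy
    refine Set.disjoint_left.2 fun v hv hv' => hxy ?_
    exact (hv.2 : roundPt v = x).symm.trans hv'.2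
  · exact fun z _ => hg.mono_set Set.inter_subset_left

/-! ### Lattice sums -/

/-- The lattice points of norm at most `ρ`. -/
def latDisk (ρ : ℝ) : Finset (Fin 2 → ℤ) :=
  (Fintype.piFinset fun _ => Finset.Icc (-⌈ρ⌉) ⌈ρ⌉).filter fun z => ‖intPt z‖ ≤ ρ

lemma mem_latDisk {ρ : ℝ} {z : Fin 2 → ℤ} : z ∈ latDisk ρ ↔ ‖intPt z‖ ≤ ρ := by
  simp only [latDisk, Finset.mem_filter, Fintype.mem_piFinset, Finset.mem_Icc,
    and_iff_right_iff_imp]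
  intro h i
  have h1 : |(z i : ℝ)| ≤ ρ := by
    rw [← intPt_apply]; exact (abs_apply_le_norm _ i).trans h
  rw [abs_le] at h1
  have h2 := Int.le_ceil ρ
  constructor
  · have : (-⌈ρ⌉ : ℝ) ≤ z i := by linarith
    exact_mod_cast this
  · have : (z i : ℝ) ≤ ⌈ρ⌉ := by linarith
    exact_mod_cast this

lemma norm_sub_le_of_mem_intCell {v : Plane} {z : Fin 2 → ℤ} (hv : v ∈ intCell z) :
    ‖v - intPt z‖ ≤ 3 / 4 := norm_le_of_mem_unitCell hv

lemma norm_le_add_of_mem_intCell {v : Plane} {z : Fin 2 → ℤ} (hv : v ∈ intCell z) :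
    ‖v‖ ≤ ‖intPt z‖ + 3 / 4 := by
  have h := norm_sub_le_of_mem_intCell hv
  have h1 : ‖v‖ ≤ ‖intPt z‖ + ‖v - intPt z‖ := by
    simpa using norm_add_le (intPt z) (v - intPt z)
  linarith

lemma norm_intPt_le_add_of_mem_intCell {v : Plane} {z : Fin 2 → ℤ} (hv : v ∈ intCell z) :
    ‖intPt z‖ ≤ ‖v‖ + 3 / 4 := by
  have h := norm_sub_le_of_mem_intCell hv
  have h1 := norm_sub_norm_le (intPt z) v
  rw [norm_sub_rev] at h1
  linarith

lemma roundPt_mem_latDisk {R : ℝ} {v : Plane} (hv : ‖v‖ ≤ R) : roundPt v ∈ latDisk (R + 1) := by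
  rw [mem_latDisk]
  have := norm_intPt_le_add_of_mem_intCell (mem_intCell_roundPt v)
  linarith

/-- Since |z| ≥ 1, every point of the cell of z has norm at most 7/4 |z|, so each term is at most a
multiple of the integral over its own cell. -/
lemma sum_rpow_le_setIntegral {p : ℝ} (hp : 0 ≤ p) {B : Set Plane} (hB : MeasurableSet B)
    (hg : IntegrableOn (fun v : Plane => ‖v‖ ^ (-p)) B) (Z : Finset (Fin 2 → ℤ))
    (hZ0 : ∀ z ∈ Z, z ≠ 0) (hZ : ∀ z ∈ Z, intCell z ⊆ B) :
    ∑ z ∈ Z, ‖intPt z‖ ^ (-p) ≤ (7 / 4) ^ p * ∫ v in B, ‖v‖ ^ (-p) := by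
  calc ∑ z ∈ Z, ‖intPt z‖ ^ (-p) ≤ ∑ z ∈ Z, (7 / 4) ^ p * ∫ v in intCell z, ‖v‖ ^ (-p) := by
        refine Finset.sum_le_sum fun z hz => ?_
        have hz1 := one_le_norm_intPt (hZ0 z hz)
        have h1 : ‖intPt z‖ ^ (-p) = ∫ v in intCell z, ‖intPt z‖ ^ (-p) := by
          simp [Measure.real, volume_intCell]
        rw [h1, ← integral_const_mul]
        refine setIntegral_mono_on (by simp [volume_intCell])
          ((hg.mono_set (hZ z hz)).const_mul _) (measurableSet_intCell z) fun v hv => ?_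
        have h2 := norm_le_add_of_mem_intCell hv
        have h3 := norm_intPt_le_add_of_mem_intCell hv
        have hv0 : 0 < ‖v‖ := by linarith
        have h4 : ((7 / 4 : ℝ) * ‖intPt z‖) ^ (-p) ≤ ‖v‖ ^ (-p) :=
          Real.rpow_le_rpow_of_nonpos hv0 (by linarith) (by linarith)
        rw [Real.mul_rpow (by norm_num) (norm_nonneg _), Real.rpow_neg (by norm_num)] at h4
        have h5 : (0 : ℝ) < (7 / 4 : ℝ) ^ p := by positivity
        rwa [inv_mul_le_iff₀ h5] at h4
    _ = (7 / 4) ^ p * ∑ z ∈ Z, ∫ v in intCell z, ‖v‖ ^ (-p) := by rw [Finset.mul_sum]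
    _ ≤ _ := by
        gcongr
        exact sum_cells_le_setIntegral hB hg (fun v _ => by positivity) Z hZ

lemma exists_sum_rpow_le_inner {p : ℝ} (hp0 : 0 ≤ p) (hp : p < 2) :
    ∃ C, 0 ≤ C ∧ ∀ (ρ : ℝ) (Z : Finset (Fin 2 → ℤ)), 0 ≤ ρ →
      (∀ z ∈ Z, z ≠ 0 ∧ ‖intPt z‖ ≤ ρ) → ∑ z ∈ Z, ‖intPt z‖ ^ (-p) ≤ C * ρ ^ (2 - p) := by
  have h2 : 0 < 2 - p := by linarith
  refine ⟨(7 / 4) ^ p * (2 * Real.pi / (2 - p) * 2 ^ (2 - p)), by positivity, ?_⟩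
  intro ρ Z hρ hZ
  refine (sum_rpow_le_setIntegral hp0 measurableSet_ball (integrableOn_ball_rpow hp (2 * ρ)) Z
    (fun z hz => (hZ z hz).1) ?_).trans ?_
  · intro z hz v hv
    have h1 := norm_le_add_of_mem_intCell hv
    have h3 := one_le_norm_intPt (hZ z hz).1
    have h4 := (hZ z hz).2
    simp only [Metric.mem_ball, dist_zero_right]
    linarith
  · rw [integral_ball_rpow hp (by linarith), Real.mul_rpow (by norm_num) hρ]
    apply le_of_eq; ring

lemma exists_sum_rpow_le_outer {p : ℝ} (hp : 2 < p) :
    ∃ C, 0 ≤ C ∧ ∀ (ρ : ℝ) (Z : Finset (Fin 2 → ℤ)), 0 < ρ →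
      (∀ z ∈ Z, z ≠ 0 ∧ ρ ≤ ‖intPt z‖) → ∑ z ∈ Z, ‖intPt z‖ ^ (-p) ≤ C * ρ ^ (2 - p) := by
  have h2 : 0 < p - 2 := by linarith
  refine ⟨(7 / 4) ^ p * (2 * Real.pi / (p - 2) * (1 / 4) ^ (2 - p)), by positivity, ?_⟩
  intro ρ Z hρ hZ
  refine (sum_rpow_le_setIntegral (by linarith) measurableSet_ball.compl
    (integrableOn_compl_ball_rpow hp (ρ := 1 / 4 * ρ) (by linarith)) Z
    (fun z hz => (hZ z hz).1) ?_).trans ?_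
  · intro z hz v hv
    have h1 := norm_intPt_le_add_of_mem_intCell hv
    have h3 := one_le_norm_intPt (hZ z hz).1
    have h4 := (hZ z hz).2
    simp only [Set.mem_compl_iff, Metric.mem_ball, dist_zero_right, not_lt]
    linarith
  · rw [integral_compl_ball_rpow hp (by linarith), Real.mul_rpow (by norm_num) hρ.le]
    apply le_of_eq; ring

/-- The cells of these points lie in a ring of width 4, so by area there are O(R) of them. The bound
M ≤ R absorbs the additive constants for small R. -/
lemma exists_sum_rpow_le_boundary {M : ℝ} (hM : 0 < M) {q : ℝ} (hq : 0 ≤ q) :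
    ∃ C, 0 ≤ C ∧ ∀ (R : ℝ) (Z : Finset (Fin 2 → ℤ)), M ≤ R →
      (∀ z ∈ Z, z ≠ 0 ∧ R - 1 ≤ ‖intPt z‖ ∧ ‖intPt z‖ ≤ R + 1) →
      ∑ z ∈ Z, ‖intPt z‖ ^ (-q) ≤ C * R ^ (1 - q) := by
  refine ⟨8 * Real.pi * (1 + 2 / M) * (1 / 2) ^ (-q), by positivity, ?_⟩
  intro R Z hR hZ
  have hR0 : 0 < R := hM.trans_le hR
  have hcard : (Z.card : ℝ) ≤ 8 * Real.pi * (R + 2) := by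
    have h1 : (Z.card : ℝ) = ∑ z ∈ Z, ∫ v in intCell z, (1 : ℝ) := by
      simp [Measure.real, volume_intCell]
    have hsub : ∀ z ∈ Z, intCell z ⊆ annulus (max (R - 2) 0) (R + 2) := by
      intro z hz v hv
      obtain ⟨-, h2, h3⟩ := hZ z hz
      have h4 := norm_le_add_of_mem_intCell hv
      have h5 := norm_intPt_le_add_of_mem_intCell hv
      rw [mem_annulus]
      exact ⟨max_le (by linarith) (norm_nonneg v), by linarith⟩
    have hfin : volume (annulus (max (R - 2) 0) (R + 2)) ≠ ⊤ :=
      ((measure_mono Set.sdiff_subset).trans_lt measure_ball_lt_top).ne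
    rw [h1]
    refine (sum_cells_le_setIntegral (measurableSet_annulus _ _)
      (integrableOn_const hfin) (fun _ _ => zero_le_one) Z hsub).trans ?_
    rw [setIntegral_const, smul_eq_mul, mul_one,
      volume_real_annulus (le_max_right _ _) (max_le (by linarith) (by linarith))]
    rw [show 8 * Real.pi * (R + 2) = Real.pi * (8 * (R + 2)) by ring]
    gcongr
    rcases le_total R 2 with h | h
    · rw [max_eq_right (by linarith)]; nlinarith
    · rw [max_eq_left (by linarith)]; nlinarith
  -- Both 1 ≤ |z| and R - 1 ≤ |z| hold, and the larger of 1 and R - 1 is at least R/2.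
  have hterm : ∀ z ∈ Z, ‖intPt z‖ ^ (-q) ≤ (1 / 2) ^ (-q) * R ^ (-q) := by
    intro z hz
    obtain ⟨h1, h2, -⟩ := hZ z hz
    have h3 := one_le_norm_intPt h1
    rw [← Real.mul_rpow (by norm_num) hR0.le]
    exact Real.rpow_le_rpow_of_nonpos (by linarith) (by linarith) (by linarith)
  have h5 : R + 2 ≤ (1 + 2 / M) * R := by
    have : 2 ≤ 2 / M * R := by
      rw [div_mul_eq_mul_div, le_div_iff₀ hM]; linarith
    linarith
  calc ∑ z ∈ Z, ‖intPt z‖ ^ (-q) ≤ ∑ z ∈ Z, (1 / 2) ^ (-q) * R ^ (-q) :=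
        Finset.sum_le_sum hterm
    _ = Z.card * ((1 / 2) ^ (-q) * R ^ (-q)) := by simp
    _ ≤ 8 * Real.pi * ((1 + 2 / M) * R) * ((1 / 2) ^ (-q) * R ^ (-q)) := by
        gcongr
        exact hcard.trans (by gcongr)
    _ = _ := by
        rw [sub_eq_add_neg, Real.rpow_add hR0, Real.rpow_one]; ring

/-! ### Coordinate symmetries -/

/-- Exchange of the two coordinates. -/
def swapIso : Plane ≃ₗᵢ[ℝ] Plane := LinearIsometryEquiv.piLpCongrLeft 2 ℝ ℝ (Equiv.swap 0 1)

/-- Change of the sign of the first coordinate. -/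
def flipIso : Plane ≃ₗᵢ[ℝ] Plane :=
  LinearIsometryEquiv.piLpCongrRight 2 fun i =>
    if i = 0 then LinearIsometryEquiv.neg ℝ else LinearIsometryEquiv.refl ℝ ℝ

@[simp] lemma swapIso_zero (v : Plane) : swapIso v 0 = v 1 := by
  simp [swapIso, LinearIsometryEquiv.piLpCongrLeft_apply, Equiv.piCongrLeft']

@[simp] lemma swapIso_one (v : Plane) : swapIso v 1 = v 0 := by
  simp [swapIso, LinearIsometryEquiv.piLpCongrLeft_apply, Equiv.piCongrLeft']

@[simp] lemma flipIso_zero (v : Plane) : flipIso v 0 = -v 0 := by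
  simp [flipIso]

@[simp] lemma flipIso_one (v : Plane) : flipIso v 1 = v 1 := by
  simp [flipIso]

lemma setIntegral_comp_iso (L : Plane ≃ₗᵢ[ℝ] Plane) {S : Set Plane} (hS : ∀ v, L v ∈ S ↔ v ∈ S)
    (g : Plane → ℝ) : ∫ v in S, g (L v) = ∫ v in S, g v := by
  have h : L ⁻¹' S = S := by ext v; exact hS v
  have := L.measurePreserving.setIntegral_preimage_emb
    L.toHomeomorph.measurableEmbedding g S
  rwa [h] at this

lemma swapIso_mem_ball {ρ : ℝ} (v : Plane) :
    swapIso v ∈ Metric.ball (0 : Plane) ρ ↔ v ∈ Metric.ball (0 : Plane) ρ := by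
  simp

lemma flipIso_mem_ball {ρ : ℝ} (v : Plane) :
    flipIso v ∈ Metric.ball (0 : Plane) ρ ↔ v ∈ Metric.ball (0 : Plane) ρ := by
  simp

lemma swapIso_mem_unitCell (v : Plane) : swapIso v ∈ unitCell ↔ v ∈ unitCell := by
  simp [unitCell, and_comm]

lemma flipIso_mem_unitCell (v : Plane) : flipIso v ∈ unitCell ↔ v ∈ unitCell := by
  simp [unitCell]

/-- Second moments of a symmetric function. -/
lemma setIntegral_coord_mul {S : Set Plane} (hs : ∀ v, swapIso v ∈ S ↔ v ∈ S)
    (hf : ∀ v, flipIso v ∈ S ↔ v ∈ S) (k : ℝ → ℝ)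
    (hk : ∀ i, IntegrableOn (fun v : Plane => v i * v i * k ‖v‖) S) (i j : Fin 2) :
    ∫ v in S, v i * v j * k ‖v‖ = if i = j then (∫ v in S, ‖v‖ ^ 2 * k ‖v‖) / 2 else 0 := by
  have h01 : ∫ v in S, v 0 * v 1 * k ‖v‖ = 0 := by
    have := setIntegral_comp_iso flipIso hf (fun v => v 0 * v 1 * k ‖v‖)
    simp only [flipIso_zero, flipIso_one, LinearIsometryEquiv.norm_map, neg_mul] at this
    rw [integral_neg] at this
    linarith
  have hd : ∫ v in S, v 0 * v 0 * k ‖v‖ = ∫ v in S, v 1 * v 1 * k ‖v‖ := by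
    have := setIntegral_comp_iso swapIso hs (fun v => v 1 * v 1 * k ‖v‖)
    simpa only [swapIso_zero, swapIso_one, LinearIsometryEquiv.norm_map] using this
  have ht : ∫ v in S, ‖v‖ ^ 2 * k ‖v‖
      = (∫ v in S, v 0 * v 0 * k ‖v‖) + ∫ v in S, v 1 * v 1 * k ‖v‖ := by
    rw [← integral_add (hk 0) (hk 1)]
    congr 1; ext v
    rw [plane_norm_sq]; ring
  fin_cases i <;> fin_cases j
  · simp only [Fin.zero_eta, if_true]; rw [ht, hd]; ring
  · simpa using h01
  · simp only [Fin.zero_eta, Fin.mk_one, one_ne_zero, if_false]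
    rw [← h01]; congr 1; ext v; ring
  · simp only [Fin.mk_one, if_true]; rw [ht, hd]; ring

/-! ### Cellwise comparison of an integral with a lattice sum -/

/-- A cell is symmetric about its centre, so averaging over w and -w trades the first-order error
for a second difference. -/
lemma abs_setIntegral_intCell_sub_le {g : Plane → ℝ} {z : Fin 2 → ℤ} {B : ℝ}
    (hg : IntegrableOn g (intCell z))
    (h : ∀ w ∈ unitCell, |g (intPt z + w) + g (intPt z - w) - 2 * g (intPt z)| ≤ B) :
    |∫ v in intCell z, (g v - g (intPt z))| ≤ B / 2 := by
  have hgi : IntegrableOn (fun w => g (intPt z + w)) unitCell := (integrableOn_intCell z g).1 hg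
  have hc : IntegrableOn (fun _ : Plane => g (intPt z)) unitCell := by
    simp [volume_unitCell]
  rw [setIntegral_intCell]
  have e1 := setIntegral_unitCell_neg (fun w => g (intPt z + w) - g (intPt z))
  have hgi' : IntegrableOn (fun w => g (intPt z + -w)) unitCell := by
    have hpre : (fun w : Plane => -w) ⁻¹' unitCell = unitCell := by
      ext w; exact neg_mem_unitCell
    have := ((Measure.measurePreserving_neg (volume : Measure Plane)).integrableOn_comp_preimage
      (MeasurableEquiv.neg Plane).measurableEmbedding (f := fun w => g (intPt z + w))
      (s := unitCell)).2 hgi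
    rw [hpre] at this
    exact this
  have e2 : 2 * ∫ w in unitCell, (g (intPt z + w) - g (intPt z))
      = ∫ w in unitCell, (g (intPt z + w) + g (intPt z - w) - 2 * g (intPt z)) := by
    rw [two_mul]
    nth_rewrite 2 [← e1]
    refine (integral_add (hgi.sub hc) (hgi'.sub hc)).symm.trans ?_
    congr 1; ext w; simp only [Pi.sub_apply, sub_eq_add_neg (intPt z) w]; ring
  have e3 : |∫ w in unitCell, (g (intPt z + w) + g (intPt z - w) - 2 * g (intPt z))| ≤ B := by
    have := norm_setIntegral_le_of_norm_le_const (μ := volume) (s := unitCell) (C := B)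
      (f := fun w => g (intPt z + w) + g (intPt z - w) - 2 * g (intPt z))
      (by simp [volume_unitCell]) h
    simpa [volume_real_unitCell] using this
  rw [← e2, abs_mul, abs_two] at e3
  linarith

/-- For cells cut by the boundary of A, where the symmetry is lost and only a pointwise bound is
available. -/
lemma abs_setIntegral_inter_sub_le {g : Plane → ℝ} {z : Fin 2 → ℤ} {B c : ℝ} (hB : 0 ≤ B)
    {A : Set Plane} (h : ∀ v ∈ intCell z, |g v - c| ≤ B) :
    |∫ v in intCell z ∩ A, (g v - c)| ≤ B := by
  have hv : volume (intCell z ∩ A) ≤ 1 :=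
    (measure_mono Set.inter_subset_left).trans (volume_intCell z).le
  have := norm_setIntegral_le_of_norm_le_const (μ := volume) (s := intCell z ∩ A) (C := B)
    (f := fun v => g v - c) (hv.trans_lt (by simp)) (fun v hv => h v hv.1)
  refine this.trans (mul_le_of_le_one_right hB ?_)
  exact ENNReal.toReal_le_of_le_ofReal zero_le_one (by simpa using hv)

lemma KernelBound.integrableOn_intCell {a C : ℝ} {K : Plane → ℝ} (hK : KernelBound a C K)
    (hm : Measurable K) {z : Fin 2 → ℤ} (hz : z ≠ 0) : IntegrableOn K (intCell z) := by
  refine (TruncatedStable.integrableOn_intCell z K).2 (Measure.integrableOn_of_bounded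
    (M := |K (intPt z)| + C * ‖intPt z‖ ^ (-a - 1) * ‖intPt z‖) (by simp [volume_unitCell])
    (hm.comp (measurable_const_add _)).aestronglyMeasurable ?_)
  refine (ae_restrict_iff' measurableSet_unitCell).2 (Eventually.of_forall fun w hw => ?_)
  have h1 := hK.lip (intPt z) w (norm_le_mul_of_mem_unitCell hw hz)
  have h2 : |K (intPt z + w)| ≤ |K (intPt z)| + |K (intPt z + w) - K (intPt z)| := by
    simpa using abs_add_le (K (intPt z)) (K (intPt z + w) - K (intPt z))
  have h3 : ‖w‖ ≤ ‖intPt z‖ := by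
    have := norm_le_of_mem_unitCell hw
    have := one_le_norm_intPt hz
    linarith
  -- The sign of C is not given; the Lipschitz bound at one nonzero displacement forces it.
  have hC : 0 ≤ C * ‖intPt z‖ ^ (-a - 1) := by
    by_contra hneg
    have := abs_nonneg (K (intPt z + (3 / 4 : ℝ) • intPt z) - K (intPt z))
    have h4 := hK.lip (intPt z) ((3 / 4 : ℝ) • intPt z) (by rw [norm_smul]; norm_num)
    have h5 : 0 < ‖(3 / 4 : ℝ) • intPt z‖ := by
      rw [norm_smul]; exact mul_pos (by norm_num) (norm_intPt_pos hz)
    nlinarith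
  rw [Real.norm_eq_abs]
  nlinarith [mul_le_mul_of_nonneg_left h3 hC]

lemma KernelBound.abs_sub_le_of_mem_intCell {a C : ℝ} {K : Plane → ℝ} (hK : KernelBound a C K)
    (hC : 0 ≤ C) {z : Fin 2 → ℤ} (hz : z ≠ 0) {v : Plane} (hv : v ∈ intCell z) :
    |K v - K (intPt z)| ≤ C * ‖intPt z‖ ^ (-a - 1) := by
  have h1 := hK.lip (intPt z) (v - intPt z) (norm_le_mul_of_mem_unitCell hv hz)
  rw [add_sub_cancel] at h1
  refine h1.trans (mul_le_of_le_one_right (by positivity) ?_)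
  have := norm_le_of_mem_unitCell hv
  linarith

lemma KernelBound.abs_second_le {a C : ℝ} {K : Plane → ℝ} (hK : KernelBound a C K)
    (hC : 0 ≤ C) {z : Fin 2 → ℤ} (hz : z ≠ 0) {w : Plane} (hw : w ∈ unitCell) :
    |K (intPt z + w) + K (intPt z - w) - 2 * K (intPt z)| ≤ C * ‖intPt z‖ ^ (-a - 2) := by
  refine (hK.second (intPt z) w (norm_le_mul_of_mem_unitCell hw hz)).trans
    (mul_le_of_le_one_right (by positivity) ?_)
  have := norm_sq_le_of_mem_unitCell hw
  linarith

/-! ### Reduction of the discrete objects to the unit lattice -/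

/-- The area of the part of the cell of `z` that lies in the annulus. -/
def cellMass (r R : ℝ) (z : Fin 2 → ℤ) : ℝ := volume.real (intCell z ∩ annulus r R)

/-- The nearest-neighbour correction on the unit lattice. -/
def nnWeight (α r R : ℝ) : ℝ :=
  1 / 4 * (ballMoment α R - ∑' z, if z = 0 then 0 else cellMass r R z * ‖intPt z‖ ^ (-α))

/-- The jump weights on the unit lattice. -/
def unitWeight (α r R : ℝ) (z : Fin 2 → ℤ) : ℝ :=
  if z = 0 then 0 else
    nnWeight α r R * (if ‖intPt z‖ = 1 then 1 else 0) + cellMass r R z * ‖intPt z‖ ^ (-2 - α)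

lemma norm_latticePt {n : ℕ} (z : Fin 2 → ℤ) : ‖latticePt n z‖ = ‖intPt z‖ / n := by
  have : latticePt n z = (n : ℝ)⁻¹ • intPt z := by
    ext i; simp [latticePt, div_eq_inv_mul]
  rw [this, norm_smul, norm_inv, Real.norm_natCast, div_eq_inv_mul]

/-- Dilation by n maps the cell of z/n onto the unit cell of z, and the prefactor n² is its
Jacobian. -/
lemma cellFraction_eq {r M : ℝ} {n : ℕ} (hn : n ≠ 0) (z : Fin 2 → ℤ) :
    cellFraction r M n (latticePt n z) = cellMass r (n * M) z := by
  have hn0 : (0 : ℝ) < n := by exact_mod_cast Nat.pos_of_ne_zero hn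
  have h : cell n (latticePt n z) ∩ annulus (r / n) M
      = (fun v : Plane => (n : ℝ) • v) ⁻¹' (intCell z ∩ annulus r (n * M)) := by
    ext v
    simp only [Set.mem_inter_iff, Set.mem_preimage, mem_annulus, norm_smul, Real.norm_natCast]
    have h1 : v ∈ cell n (latticePt n z) ↔ (n : ℝ) • v ∈ intCell z := by
      refine forall_congr' fun i => ?_
      have e : ((n : ℝ) • v - intPt z) i = n * (v i - latticePt n z i) := by
        simp [latticePt]; field_simp
      rw [e, abs_mul, abs_of_pos hn0, ← le_div_iff₀' hn0]
      rw [show (1 / 2 : ℝ) / n = 1 / (2 * n) by field_simp]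
    rw [h1, div_le_iff₀ hn0, mul_comm ‖v‖, mul_lt_mul_iff_right₀ hn0]
  rw [cellFraction, h, cellMass, Measure.real, Measure.addHaar_preimage_smul volume hn0.ne']
  simp only [finrank_euclideanSpace, Fintype.card_fin, ENNReal.toReal_mul]
  rw [ENNReal.toReal_ofReal (abs_nonneg _), abs_of_nonneg (by positivity), ← mul_assoc,
    mul_inv_cancel₀ (by positivity), one_mul]
  rfl

lemma ballMoment_eq (α M : ℝ) : ballMoment α M = ∫ v in Metric.ball (0 : Plane) M, ‖v‖ ^ (-α) := by
  simp only [ballMoment, Real.rpow_neg (norm_nonneg _), one_div]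

lemma ballMoment_value {α M : ℝ} (hα : α < 2) (hM : 0 ≤ M) :
    ballMoment α M = 2 * Real.pi / (2 - α) * M ^ (2 - α) := by
  rw [ballMoment_eq, integral_ball_rpow hα hM]

lemma ballMoment_mul {α M : ℝ} (hα : α < 2) (hM : 0 ≤ M) {n : ℝ} (hn : 0 ≤ n) :
    ballMoment α (n * M) = n ^ (2 - α) * ballMoment α M := by
  rw [ballMoment_value hα hM, ballMoment_value hα (by positivity), Real.mul_rpow hn hM]; ring

/-- The prefactor n^{2-α} is the scaling factor of the integral of |y|^{-α} in the plane, so n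
survives only in the radius nM. -/
lemma kn_eq {α r M : ℝ} (hα : α < 2) (hM : 0 ≤ M) {n : ℕ} (hn : n ≠ 0) :
    kn α r M n = nnWeight α r (n * M) := by
  have hn0 : (0 : ℝ) < n := by exact_mod_cast Nat.pos_of_ne_zero hn
  rw [kn, nnWeight, ballMoment_mul hα hM hn0.le, ← tsum_mul_left]
  have : ∀ z : Fin 2 → ℤ, 1 / (n : ℝ) ^ 2 * (if z = 0 then 0 else
      cellFraction r M n (latticePt n z) / ‖latticePt n z‖ ^ α)
      = ((n : ℝ) ^ (2 - α))⁻¹ * if z = 0 then 0 else cellMass r (n * M) z * ‖intPt z‖ ^ (-α) := by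
    intro z
    split_ifs with h
    · simp
    · rw [cellFraction_eq hn, norm_latticePt, Real.div_rpow (norm_nonneg _) hn0.le,
        Real.rpow_neg (norm_nonneg _), Real.rpow_sub hn0, Real.rpow_two]
      field_simp
  rw [tsum_congr this, tsum_mul_left]
  have : (n : ℝ) ^ (2 - α) ≠ 0 := by positivity
  field_simp

lemma jumpWeight_eq {α r M : ℝ} (hα : α < 2) (hM : 0 ≤ M) {n : ℕ} (hn : n ≠ 0)
    (z : Fin 2 → ℤ) : jumpWeight α r M n z = unitWeight α r (n * M) z := by
  have hn0 : (0 : ℝ) < n := by exact_mod_cast Nat.pos_of_ne_zero hn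
  rw [jumpWeight, unitWeight, kn_eq hα hM hn, cellFraction_eq hn, norm_latticePt]
  split_ifs with h h1 h2 h2
  · rfl
  · rw [Real.div_rpow (norm_nonneg _) hn0.le, sub_eq_add_neg, ← neg_add,
      Real.rpow_neg (norm_nonneg _)]
    field_simp
  · exact absurd (by field_simp at h1; exact h1) h2
  · exact absurd (by rw [h2]) h1
  · rw [Real.div_rpow (norm_nonneg _) hn0.le, sub_eq_add_neg, ← neg_add,
      Real.rpow_neg (norm_nonneg _)]
    field_simp

lemma cellMass_eq_zero {r R : ℝ} {z : Fin 2 → ℤ} (h : R + 1 ≤ ‖intPt z‖) :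
    cellMass r R z = 0 := by
  have : intCell z ∩ annulus r R = ∅ := by
    ext v
    simp only [Set.mem_inter_iff, mem_annulus, Set.mem_empty_iff_false, iff_false, not_and]
    intro hv _
    have := norm_intPt_le_add_of_mem_intCell hv
    linarith
  simp [cellMass, this]

lemma cellMass_nonneg (r R : ℝ) (z : Fin 2 → ℤ) : 0 ≤ cellMass r R z := measureReal_nonneg

lemma cellMass_le_one (r R : ℝ) (z : Fin 2 → ℤ) : cellMass r R z ≤ 1 :=
  ENNReal.toReal_le_of_le_ofReal zero_le_one
    (by simpa using (measure_mono Set.inter_subset_left).trans (volume_intCell z).le)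

/-- The nonzero lattice points of norm at most `ρ`. -/
def latPunct (ρ : ℝ) : Finset (Fin 2 → ℤ) := (latDisk ρ).erase 0

lemma mem_latPunct {ρ : ℝ} {z : Fin 2 → ℤ} : z ∈ latPunct ρ ↔ z ≠ 0 ∧ ‖intPt z‖ ≤ ρ := by
  rw [latPunct, Finset.mem_erase, mem_latDisk]

/-- The summation disk may be any larger one, so that the weights for two radii can be subtracted
term by term. -/
lemma four_mul_nnWeight (α r R : ℝ) {ρ : ℝ} (hρ : R + 1 ≤ ρ) : 4 * nnWeight α r R =
    ballMoment α R - ∑ z ∈ latPunct ρ, cellMass r R z * ‖intPt z‖ ^ (-α) := by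
  rw [nnWeight, tsum_eq_sum (s := latPunct ρ)]
  · rw [Finset.sum_congr rfl fun z hz => if_neg (mem_latPunct.1 hz).1]; ring
  · intro z hz
    split_ifs with h
    · rfl
    · rw [cellMass_eq_zero, zero_mul]
      by_contra hlt
      exact hz (mem_latPunct.2 ⟨h, by linarith⟩)

lemma unitWeight_eq_zero {α r R : ℝ} (hR : 0 ≤ R) {z : Fin 2 → ℤ} {ρ : ℝ} (hρ : R + 1 ≤ ρ)
    (hz : z ∉ latPunct ρ) : unitWeight α r R z = 0 := by
  rw [unitWeight]
  split_ifs with h h1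
  · rfl
  · exact absurd (mem_latPunct.2 ⟨h, by rw [h1]; linarith⟩) hz
  · rw [cellMass_eq_zero]
    · simp
    by_contra hlt
    exact hz (mem_latPunct.2 ⟨h, by linarith⟩)

/-- The nearest neighbours of the origin. -/
def nnPts : Finset (Fin 2 → ℤ) := {![1, 0], ![-1, 0], ![0, 1], ![0, -1]}

lemma mem_nnPts {z : Fin 2 → ℤ} : z ∈ nnPts ↔ ‖intPt z‖ = 1 := by
  have h : ‖intPt z‖ = 1 ↔ z 0 ^ 2 + z 1 ^ 2 = 1 := by
    rw [← sq_eq_sq₀ (norm_nonneg _) zero_le_one, plane_norm_sq]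
    simp only [intPt_apply, one_pow]
    exact_mod_cast Iff.rfl
  rw [h]
  constructor
  · intro hz
    simp only [nnPts, Finset.mem_insert, Finset.mem_singleton] at hz
    rcases hz with rfl | rfl | rfl | rfl <;> simp
  · intro hz
    have h0 : -1 ≤ z 0 ∧ z 0 ≤ 1 := ⟨by nlinarith [sq_nonneg (z 1)], by nlinarith [sq_nonneg (z 1)]⟩
    have h1 : -1 ≤ z 1 ∧ z 1 ≤ 1 := ⟨by nlinarith [sq_nonneg (z 0)], by nlinarith [sq_nonneg (z 0)]⟩
    have e : z = ![z 0, z 1] := by ext i; fin_cases i <;> rfl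
    obtain ⟨h0a, h0b⟩ := h0
    obtain ⟨h1a, h1b⟩ := h1
    rw [e]
    generalize z 0 = a at *
    generalize z 1 = b at *
    interval_cases a <;> interval_cases b <;> simp_all [nnPts]

lemma sum_nnPts (g : (Fin 2 → ℤ) → ℝ) :
    ∑ z ∈ nnPts, g z = g ![1, 0] + g ![-1, 0] + g ![0, 1] + g ![0, -1] := by
  rw [nnPts, Finset.sum_insert (by decide), Finset.sum_insert (by decide),
    Finset.sum_insert (by decide), Finset.sum_singleton]
  ring

lemma sum_unitWeight_mul {α r R : ℝ} (hR : 0 ≤ R) {ρ : ℝ} (hρ : R + 1 ≤ ρ)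
    (g : (Fin 2 → ℤ) → ℝ) :
    ∑ z ∈ latPunct ρ, unitWeight α r R z * g z =
      nnWeight α r R * ∑ z ∈ nnPts, g z +
        ∑ z ∈ latPunct ρ, cellMass r R z * ‖intPt z‖ ^ (-2 - α) * g z := by
  have h1 : ∑ z ∈ nnPts, g z = ∑ z ∈ latPunct ρ, (if ‖intPt z‖ = 1 then 1 else 0) * g z := by
    simp only [ite_mul, one_mul, zero_mul]
    rw [← Finset.sum_filter]
    refine Finset.sum_congr ?_ fun _ _ => rfl
    ext z
    rw [Finset.mem_filter, mem_nnPts, mem_latPunct]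
    constructor
    · intro h
      refine ⟨⟨?_, by rw [h]; linarith⟩, h⟩
      rintro rfl; simp at h
    · exact fun h => h.2
  rw [h1, Finset.mul_sum, ← Finset.sum_add_distrib]
  refine Finset.sum_congr rfl fun z hz => ?_
  rw [unitWeight, if_neg (mem_latPunct.1 hz).1]
  ring

/-! ### The nearest-neighbour weight is bounded below -/

/-- Bernoulli's inequality (1+T)^q ≤ 1 + qT, combined with (1 - qT)(1 + qT) ≤ 1. -/
lemma one_sub_mul_le_rpow_neg {q T : ℝ} (hq : 0 ≤ q) (hq1 : q ≤ 1) (hT : -1 < T) :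
    1 - q * T ≤ (1 + T) ^ (-q) := by
  have hT0 : 0 < 1 + T := by linarith
  have h1 : (1 + T) ^ q ≤ 1 + q * T := rpow_one_add_le_one_add_mul_self hT.le hq hq1
  have h2 : 0 < (1 + T) ^ q := Real.rpow_pos_of_pos hT0 q
  rw [Real.rpow_neg hT0.le, ← one_div, le_div_iff₀ h2]
  rcases le_or_gt (1 - q * T) 0 with h | h
  · nlinarith
  · nlinarith [sq_nonneg (q * T)]

/-- By the inequality of the means the right side is at least 2(|z+w||z-w|)^{-α/2}. The square of
that product is |z|⁴(1+T), with T the bracket of the statement. Bernoulli's inequality with exponent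
α/4 makes the bound linear in T, and hence easy to average over a cell. -/
lemma two_mul_rpow_le_add {α : ℝ} (hα : 0 ≤ α) (hα4 : α ≤ 4) {z w : Plane} (hz : z ≠ 0)
    (hw : ‖w‖ < ‖z‖) :
    2 * ‖z‖ ^ (-α) * (1 - α / 4 * (2 * ‖w‖ ^ 2 / ‖z‖ ^ 2 + ‖w‖ ^ 4 / ‖z‖ ^ 4
        - 4 * (inner ℝ z w) ^ 2 / ‖z‖ ^ 4))
      ≤ ‖z + w‖ ^ (-α) + ‖z - w‖ ^ (-α) := by
  have hzp : 0 < ‖z‖ := norm_pos_iff.2 hz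
  have ha : 0 < ‖z + w‖ := by
    have := norm_sub_le_norm_add z w
    linarith
  have hb : 0 < ‖z - w‖ := by
    have := norm_sub_norm_le z w
    linarith
  set T := 2 * ‖w‖ ^ 2 / ‖z‖ ^ 2 + ‖w‖ ^ 4 / ‖z‖ ^ 4 - 4 * (inner ℝ z w) ^ 2 / ‖z‖ ^ 4 with hT
  have hprod : (‖z + w‖ * ‖z - w‖) ^ 2 = ‖z‖ ^ 4 * (1 + T) := by
    rw [mul_pow, @norm_add_sq_real, @norm_sub_sq_real, hT]
    field_simp; ring
  have hT1 : 0 < 1 + T := by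
    have : 0 < ‖z‖ ^ 4 * (1 + T) := hprod ▸ by positivity
    exact (pos_iff_pos_of_mul_pos this).1 (by positivity)
  have h1 := one_sub_mul_le_rpow_neg (q := α / 4) (by linarith) (by linarith)
    (by linarith : -1 < T)
  have h2 : (‖z + w‖ * ‖z - w‖) ^ (-(α / 2)) = ‖z‖ ^ (-α) * (1 + T) ^ (-(α / 4)) := by
    have e : ∀ x : ℝ, 0 < x → x ^ (-(α / 2)) = (x ^ 2) ^ (-(α / 4)) := by
      intro x hx
      rw [← Real.rpow_natCast, ← Real.rpow_mul hx.le]; congr 1; push_cast; ring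
    rw [e _ (by positivity), hprod, Real.mul_rpow (by positivity) hT1.le, ← Real.rpow_natCast,
      ← Real.rpow_mul hzp.le]
    congr 2; push_cast; ring
  have h3 : 2 * (‖z + w‖ * ‖z - w‖) ^ (-(α / 2)) ≤ ‖z + w‖ ^ (-α) + ‖z - w‖ ^ (-α) := by
    have e : ∀ x : ℝ, 0 < x → x ^ (-α) = (x ^ (-(α / 2))) ^ 2 := by
      intro x hx
      rw [← Real.rpow_natCast, ← Real.rpow_mul hx.le]; congr 1; push_cast; ring
    rw [Real.mul_rpow ha.le hb.le, e _ ha, e _ hb]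
    nlinarith [sq_nonneg (‖z + w‖ ^ (-(α / 2)) - ‖z - w‖ ^ (-(α / 2)))]
  calc 2 * ‖z‖ ^ (-α) * (1 - α / 4 * T) ≤ 2 * ‖z‖ ^ (-α) * (1 + T) ^ (-(α / 4)) := by gcongr
    _ = 2 * (‖z + w‖ * ‖z - w‖) ^ (-(α / 2)) := by rw [h2]; ring
    _ ≤ _ := h3

lemma integrableOn_unitCell_of_continuous {g : Plane → ℝ} (hg : Continuous g) :
    IntegrableOn g unitCell := hg.continuousOn.integrableOn_compact isCompact_unitCell

/-- The second moment matrix of the square is a multiple of the identity. This cancels the quadratic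
part of the bracket in `two_mul_rpow_le_add` and leaves a loss of fourth order only. -/
lemma integral_unitCell_quadratic (z : Plane) :
    ∫ w in unitCell, (‖w‖ ^ 2 * ‖z‖ ^ 2 - 2 * (inner ℝ z w) ^ 2) = 0 := by
  have hi : ∀ i j : Fin 2, IntegrableOn (fun w : Plane => w i * w j) unitCell := fun i j =>
    integrableOn_unitCell_of_continuous (by fun_prop)
  have hm := fun i j => setIntegral_coord_mul swapIso_mem_unitCell flipIso_mem_unitCell
    (fun _ => 1) (fun i => by simpa using hi i i) i j
  simp only [mul_one] at hm
  have e : (fun w : Plane => ‖w‖ ^ 2 * ‖z‖ ^ 2 - 2 * (inner ℝ z w) ^ 2) = fun w : Plane =>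
      (z 1 ^ 2 - z 0 ^ 2) * (w 0 * w 0) + (z 0 ^ 2 - z 1 ^ 2) * (w 1 * w 1)
        + (-4 * z 0 * z 1) * (w 0 * w 1) := by
    ext w; rw [plane_norm_sq, plane_norm_sq, plane_inner]; ring
  rw [e, integral_add, integral_add, integral_const_mul, integral_const_mul, integral_const_mul,
    hm, hm, hm]
  · simp; ring
  · exact (hi 0 0).const_mul _
  · exact (hi 1 1).const_mul _
  · exact ((hi 0 0).const_mul _).add ((hi 1 1).const_mul _)
  · exact (hi 0 1).const_mul _

lemma measurable_norm_rpow (p : ℝ) : Measurable fun v : Plane => ‖v‖ ^ p := by fun_prop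

lemma integrableOn_intCell_rpow {α : ℝ} (hα : 0 < α) {z : Fin 2 → ℤ} (hz : z ≠ 0) :
    IntegrableOn (fun v : Plane => ‖v‖ ^ (-α)) (intCell z) := by
  obtain ⟨C, -, hC⟩ := exists_kernelBound_rpow hα
  exact hC.integrableOn_intCell (measurable_norm_rpow _) hz

/-- The mean of `|v|^{-α}` over a cell is almost as large as the value at the centre. -/
lemma cell_mean_rpow_ge {α : ℝ} (hα : 0 < α) (hα2 : α ≤ 2) {z : Fin 2 → ℤ} (hz : z ≠ 0) :
    -(1 / 8 * (‖intPt z‖ ^ 4)⁻¹) ≤ ∫ v in intCell z, (‖v‖ ^ (-α) - ‖intPt z‖ ^ (-α)) := by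
  set ζ := intPt z with hζ
  have hζ1 : 1 ≤ ‖ζ‖ := one_le_norm_intPt hz
  have hζ0 : 0 < ‖ζ‖ := by linarith
  have hne : ζ ≠ 0 := norm_pos_iff.1 hζ0
  have hgi := (integrableOn_intCell z _).1 (integrableOn_intCell_rpow hα hz)
  have hc : ∀ c : ℝ, IntegrableOn (fun _ : Plane => c) unitCell := by
    intro c; simp [volume_unitCell]
  rw [setIntegral_intCell]
  have e1 := setIntegral_unitCell_neg (fun w => ‖ζ + w‖ ^ (-α) - ‖ζ‖ ^ (-α))
  have hgi' : IntegrableOn (fun w => ‖ζ + -w‖ ^ (-α)) unitCell := by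
    have hpre : (fun w : Plane => -w) ⁻¹' unitCell = unitCell := by
      ext w; exact neg_mem_unitCell
    have := ((Measure.measurePreserving_neg (volume : Measure Plane)).integrableOn_comp_preimage
      (MeasurableEquiv.neg Plane).measurableEmbedding (f := fun w => ‖ζ + w‖ ^ (-α))
      (s := unitCell)).2 hgi
    rw [hpre] at this
    exact this
  have e2 : 2 * ∫ w in unitCell, (‖ζ + w‖ ^ (-α) - ‖ζ‖ ^ (-α))
      = ∫ w in unitCell, (‖ζ + w‖ ^ (-α) + ‖ζ - w‖ ^ (-α) - 2 * ‖ζ‖ ^ (-α)) := by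
    rw [two_mul]
    nth_rewrite 2 [← e1]
    refine (integral_add (hgi.sub (hc _)) (hgi'.sub (hc _))).symm.trans ?_
    congr 1; ext w; simp only [Pi.sub_apply, sub_eq_add_neg ζ w]; ring
  have hquad : IntegrableOn (fun w : Plane => ‖w‖ ^ 2 * ‖ζ‖ ^ 2 - 2 * (inner ℝ ζ w) ^ 2)
      unitCell := integrableOn_unitCell_of_continuous (by fun_prop)
  have e3 : ∫ w in unitCell, (-(α * ‖ζ‖ ^ (-α) / ‖ζ‖ ^ 4) *
        (‖w‖ ^ 2 * ‖ζ‖ ^ 2 - 2 * (inner ℝ ζ w) ^ 2) - 1 / 4 * (‖ζ‖ ^ 4)⁻¹)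
      ≤ ∫ w in unitCell, (‖ζ + w‖ ^ (-α) + ‖ζ - w‖ ^ (-α) - 2 * ‖ζ‖ ^ (-α)) := by
    refine setIntegral_mono_on ((hquad.const_mul _).sub (hc _)) ?_ measurableSet_unitCell ?_
    · refine (Integrable.add hgi ?_).sub (hc _)
      simp only [sub_eq_add_neg]
      exact hgi'
    · intro w hw
      have hw1 := norm_sq_le_of_mem_unitCell hw
      have hwz : ‖w‖ < ‖ζ‖ := by have := norm_le_of_mem_unitCell hw; linarith
      have h1 := two_mul_rpow_le_add hα.le (by linarith) hne hwz
      have hf1 : ‖ζ‖ ^ (-α) ≤ 1 := Real.rpow_le_one_of_one_le_of_nonpos hζ1 (by linarith)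
      have h4 : ‖w‖ ^ 4 ≤ 1 / 4 := by nlinarith [norm_nonneg w, sq_nonneg (‖w‖ ^ 2)]
      have hloss : α / 2 * ‖ζ‖ ^ (-α) * (‖w‖ ^ 4 / ‖ζ‖ ^ 4) ≤ 1 / 4 * (‖ζ‖ ^ 4)⁻¹ := by
        have h5 : α / 2 * ‖ζ‖ ^ (-α) ≤ 1 := by
          have : 0 ≤ ‖ζ‖ ^ (-α) := by positivity
          nlinarith
        rw [div_eq_mul_inv (‖w‖ ^ 4), ← mul_assoc]
        gcongr
        have : 0 ≤ ‖w‖ ^ 4 := by positivity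
        nlinarith
      have e : 2 * ‖ζ‖ ^ (-α) * (1 - α / 4 * (2 * ‖w‖ ^ 2 / ‖ζ‖ ^ 2 + ‖w‖ ^ 4 / ‖ζ‖ ^ 4
          - 4 * (inner ℝ ζ w) ^ 2 / ‖ζ‖ ^ 4)) = 2 * ‖ζ‖ ^ (-α)
          + -(α * ‖ζ‖ ^ (-α) / ‖ζ‖ ^ 4) * (‖w‖ ^ 2 * ‖ζ‖ ^ 2 - 2 * (inner ℝ ζ w) ^ 2)
          - α / 2 * ‖ζ‖ ^ (-α) * (‖w‖ ^ 4 / ‖ζ‖ ^ 4) := by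
        field_simp; ring
      linarith
  have e4 : ∫ w in unitCell, (-(α * ‖ζ‖ ^ (-α) / ‖ζ‖ ^ 4) *
        (‖w‖ ^ 2 * ‖ζ‖ ^ 2 - 2 * (inner ℝ ζ w) ^ 2) - 1 / 4 * (‖ζ‖ ^ 4)⁻¹)
      = -(1 / 4 * (‖ζ‖ ^ 4)⁻¹) := by
    rw [integral_sub (hquad.const_mul _) (hc _), integral_const_mul, integral_unitCell_quadratic]
    simp [volume_real_unitCell]
  linarith

/-- The full sum over ℤ is π²/3, because the term at 0 vanishes by the convention 1/0 = 0. -/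
lemma sum_inv_sq_int_le (S : Finset ℤ) : ∑ k ∈ S, 1 / (k : ℝ) ^ 2 ≤ 10 / 3 := by
  have h1 : HasSum (fun n : ℕ => 1 / (((n : ℤ) : ℝ)) ^ 2) (Real.pi ^ 2 / 6) := by
    simpa using hasSum_zeta_two
  have h2 : HasSum (fun n : ℕ => 1 / (((-(n : ℤ)) : ℤ) : ℝ) ^ 2) (Real.pi ^ 2 / 6) := by
    simpa using hasSum_zeta_two
  have h3 := HasSum.of_nat_of_neg (f := fun k : ℤ => 1 / (k : ℝ) ^ 2) h1 h2
  refine (sum_le_hasSum S (fun _ _ => by positivity) h3).trans ?_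
  have := Real.pi_lt_d2
  have := Real.pi_pos
  norm_num
  nlinarith

/-- On the axes |k|^{-4} ≤ k^{-2}; off the axes (a+b)² ≥ 4ab bounds the terms by products. The value
10 is good enough for `exists_nnWeight_ge`, where an eighth of it has to be beaten by π. -/
lemma sum_inv_norm_pow_four_le (Z : Finset (Fin 2 → ℤ)) (hZ : ∀ z ∈ Z, z ≠ 0) :
    ∑ z ∈ Z, (‖intPt z‖ ^ 4)⁻¹ ≤ 10 := by
  -- Here `q 0 = 0` by the convention on division, and `e` singles out the axes, so at each point
  -- only the appropriate summand of the majorant below is nonzero.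
  set q : ℤ → ℝ := fun k => 1 / (k : ℝ) ^ 2 with hq
  set e : ℤ → ℝ := fun k => if k = 0 then 1 else 0 with he
  have hq0 : ∀ k, 0 ≤ q k := fun k => by positivity
  have he0 : ∀ k, 0 ≤ e k := fun k => by simp only [he]; split_ifs <;> norm_num
  have hpt : ∀ z ∈ Z, (‖intPt z‖ ^ 4)⁻¹
      ≤ e (z 0) * q (z 1) + q (z 0) * e (z 1) + 1 / 4 * (q (z 0) * q (z 1)) := by
    intro z hz
    have h4 : ‖intPt z‖ ^ 4 = ((z 0 : ℝ) ^ 2 + (z 1 : ℝ) ^ 2) ^ 2 := by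
      rw [show ‖intPt z‖ ^ 4 = (‖intPt z‖ ^ 2) ^ 2 by ring, plane_norm_sq]; simp
    have hsq : ∀ k : ℤ, k ≠ 0 → (1 : ℝ) ≤ (k : ℝ) ^ 2 := by
      intro k hk
      have : 0 < k ^ 2 := by positivity
      exact_mod_cast this
    rw [h4]
    rcases eq_or_ne (z 0) 0 with h0 | h0 <;> rcases eq_or_ne (z 1) 0 with h1 | h1
    · exact absurd (by ext i; fin_cases i; exacts [h0, h1]) (hZ z hz)
    · have := hsq _ h1
      simp only [h0, he, hq, h1, if_true, if_false]
      norm_num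
      exact inv_anti₀ (by linarith) (by nlinarith)
    · have := hsq _ h0
      simp only [h0, he, hq, h1, if_true, if_false]
      norm_num
      exact inv_anti₀ (by linarith) (by nlinarith)
    · have ha := hsq _ h0
      have hb := hsq _ h1
      simp only [h0, he, hq, h1, if_false, zero_mul, mul_zero, zero_add]
      generalize (z 0 : ℝ) ^ 2 = a at *
      generalize (z 1 : ℝ) ^ 2 = b at *
      rw [show 1 / 4 * (1 / a * (1 / b)) = (4 * (a * b))⁻¹ by field_simp]
      exact inv_anti₀ (by positivity) (by nlinarith [sq_nonneg (a - b)])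
  set S0 := Z.image (fun z => z 0)
  set S1 := Z.image (fun z => z 1)
  have hes : ∀ S : Finset ℤ, ∑ k ∈ S, e k ≤ 1 := by
    intro S
    simp only [he, Finset.sum_ite_eq']
    split_ifs <;> norm_num
  have hen : ∀ S : Finset ℤ, 0 ≤ ∑ k ∈ S, e k := fun S => Finset.sum_nonneg fun k _ => he0 k
  have hqn : ∀ S : Finset ℤ, 0 ≤ ∑ k ∈ S, q k := fun S => Finset.sum_nonneg fun k _ => hq0 k
  have hqs := sum_inv_sq_int_le
  calc ∑ z ∈ Z, (‖intPt z‖ ^ 4)⁻¹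
      ≤ ∑ z ∈ Z, (e (z 0) * q (z 1) + q (z 0) * e (z 1) + 1 / 4 * (q (z 0) * q (z 1))) :=
        Finset.sum_le_sum hpt
    _ = ∑ p ∈ Z.image (fun z => (z 0, z 1)),
          (e p.1 * q p.2 + q p.1 * e p.2 + 1 / 4 * (q p.1 * q p.2)) := by
        rw [Finset.sum_image]
        intro x _ y _ hxy
        simp only [Prod.mk.injEq] at hxy
        ext i; fin_cases i; exacts [hxy.1, hxy.2]
    _ ≤ ∑ p ∈ S0 ×ˢ S1, (e p.1 * q p.2 + q p.1 * e p.2 + 1 / 4 * (q p.1 * q p.2)) := by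
        refine Finset.sum_le_sum_of_subset_of_nonneg ?_ fun p _ _ => ?_
        · intro p hp
          obtain ⟨z, hz, rfl⟩ := Finset.mem_image.1 hp
          exact Finset.mem_product.2
            ⟨Finset.mem_image_of_mem _ hz, Finset.mem_image_of_mem _ hz⟩
        · have := hq0 p.1; have := hq0 p.2; have := he0 p.1; have := he0 p.2
          positivity
    _ = (∑ k ∈ S0, e k) * (∑ k ∈ S1, q k) + (∑ k ∈ S0, q k) * (∑ k ∈ S1, e k)
          + 1 / 4 * ((∑ k ∈ S0, q k) * (∑ k ∈ S1, q k)) := by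
        rw [Finset.sum_add_distrib, Finset.sum_add_distrib, ← Finset.mul_sum,
          Finset.sum_product, Finset.sum_product, Finset.sum_product, Finset.sum_mul_sum,
          Finset.sum_mul_sum, Finset.sum_mul_sum]
    _ ≤ 1 * (10 / 3) + 10 / 3 * 1 + 1 / 4 * (10 / 3 * (10 / 3)) := by
        have := hes S0; have := hes S1; have := hqs S0; have := hqs S1
        have := hen S0; have := hen S1; have := hqn S0; have := hqn S1
        gcongr
    _ ≤ 10 := by norm_num

lemma cellMass_le {r R : ℝ} (z : Fin 2 → ℤ) :
    cellMass r R z ≤ volume.real (intCell z ∩ Metric.ball 0 R) :=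
  measureReal_mono (Set.inter_subset_inter_right _ Set.sdiff_subset)
    ((measure_mono Set.inter_subset_left).trans_lt (by simp [volume_intCell])).ne

lemma volume_intCell_inter_ne_top (z : Fin 2 → ℤ) (A : Set Plane) :
    volume (intCell z ∩ A) ≠ ⊤ :=
  ((measure_mono Set.inter_subset_left).trans_lt (by simp [volume_intCell])).ne

lemma ball_subset_intCell_zero {ρ : ℝ} (hρ : ρ ≤ 1 / 2) :
    Metric.ball (0 : Plane) ρ ⊆ intCell 0 := by
  intro v hv i
  have := abs_apply_le_norm v i
  simp only [Metric.mem_ball, dist_zero_right] at hv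
  simp only [intPt_zero, sub_zero]
  linarith

lemma ballMoment_eq_sum {α R ρ : ℝ} (hα2 : α < 2) (hρ : R + 1 ≤ ρ) (hR : 0 < R) :
    ballMoment α R = (∫ v in intCell 0 ∩ Metric.ball 0 R, ‖v‖ ^ (-α)) +
      ∑ z ∈ latPunct ρ, ∫ v in intCell z ∩ Metric.ball 0 R, ‖v‖ ^ (-α) := by
  rw [ballMoment_eq, setIntegral_eq_sum_cells measurableSet_ball
    (integrableOn_ball_rpow hα2 R) (latDisk ρ), latPunct]
  · refine (Finset.add_sum_erase _ _ ?_).symm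
    rw [mem_latDisk]; simp; linarith
  · intro v hv
    simp only [Metric.mem_ball, dist_zero_right] at hv
    have := mem_latDisk.1 (roundPt_mem_latDisk hv.le)
    exact mem_latDisk.2 (this.trans hρ)

/-- Four times the weight is the integral of |v|^{-α} over B_R minus a lattice sum from which the
origin is missing. For R > 1 the central cell gains at least π, while all other cells together lose
at most 10/8, by `cell_mean_rpow_ge`. For R ≤ 1 every nonzero lattice point has norm at least R, so
no other cell loses anything and a small disk around the origin gives the bound. -/
lemma exists_nnWeight_ge {α r M : ℝ} (hα₁ : 1 < α) (hα₂ : α < 2) (hM : 0 < M) :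
    ∃ κ, 0 < κ ∧ ∀ R, M ≤ R → κ ≤ nnWeight α r R := by
  set m := min M (1 / 2) with hm
  have hm0 : 0 < m := lt_min hM (by norm_num)
  have h2α : 0 < 2 - α := by linarith
  set g := ∫ v in Metric.ball (0 : Plane) m, ‖v‖ ^ (-α) with hg
  have hg0 : 0 < g := by
    rw [hg, integral_ball_rpow hα₂ hm0.le]
    have := Real.pi_pos
    positivity
  refine ⟨min (g / 4) (1 / 4), by positivity, fun R hR => ?_⟩
  have hR0 : 0 < R := hM.trans_le hR
  have hloc : ∀ z : Fin 2 → ℤ,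
      IntegrableOn (fun v : Plane => ‖v‖ ^ (-α)) (intCell z ∩ Metric.ball 0 R) := fun z =>
    (integrableOn_ball_rpow hα₂ R).mono_set Set.inter_subset_right
  have hgain : ∀ ρ ≤ 1 / 2, ρ ≤ R → ∫ v in Metric.ball (0 : Plane) ρ, ‖v‖ ^ (-α)
      ≤ ∫ v in intCell 0 ∩ Metric.ball 0 R, ‖v‖ ^ (-α) := by
    intro ρ h1 h2
    refine setIntegral_mono_set (hloc 0) (Eventually.of_forall fun v => by positivity)
      (LE.le.eventuallyLE ?_)
    exact Set.subset_inter (ball_subset_intCell_zero h1) (Metric.ball_subset_ball h2)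
  have hid : 4 * nnWeight α r R = (∫ v in intCell 0 ∩ Metric.ball 0 R, ‖v‖ ^ (-α)) +
      ∑ z ∈ latPunct (R + 1), ((∫ v in intCell z ∩ Metric.ball 0 R, ‖v‖ ^ (-α))
        - cellMass r R z * ‖intPt z‖ ^ (-α)) := by
    rw [four_mul_nnWeight α r R le_rfl, ballMoment_eq_sum hα₂ le_rfl hR0,
      Finset.sum_sub_distrib]
    ring
  have hcell : ∀ z : Fin 2 → ℤ,
      ∫ v in intCell z ∩ Metric.ball 0 R, (‖v‖ ^ (-α) - ‖intPt z‖ ^ (-α))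
      ≤ (∫ v in intCell z ∩ Metric.ball 0 R, ‖v‖ ^ (-α)) - cellMass r R z * ‖intPt z‖ ^ (-α) := by
    intro z
    rw [integral_sub (hloc z) (integrableOn_const (volume_intCell_inter_ne_top _ _)),
      setIntegral_const, smul_eq_mul]
    have := cellMass_le (r := r) (R := R) z
    gcongr
  -- If the centre is not in the ball, every point of the cell inside the ball is closer to the
  -- origin than the centre.
  have hfar : ∀ z : Fin 2 → ℤ, z ≠ 0 → R ≤ ‖intPt z‖ →
      0 ≤ ∫ v in intCell z ∩ Metric.ball 0 R, (‖v‖ ^ (-α) - ‖intPt z‖ ^ (-α)) := by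
    intro z hz hzR
    refine setIntegral_nonneg ((measurableSet_intCell z).inter measurableSet_ball) fun v hv => ?_
    have h1 := hv.2
    simp only [Metric.mem_ball, dist_zero_right] at h1
    have h2 := norm_intPt_le_add_of_mem_intCell hv.1
    have h3 := one_le_norm_intPt hz
    have := Real.rpow_le_rpow_of_nonpos (x := ‖v‖) (y := ‖intPt z‖) (z := -α) (by linarith)
      (by linarith) (by linarith)
    linarith
  rcases le_or_gt R 1 with h1 | h1
  · have hs : 0 ≤ ∑ z ∈ latPunct (R + 1), ((∫ v in intCell z ∩ Metric.ball 0 R, ‖v‖ ^ (-α))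
        - cellMass r R z * ‖intPt z‖ ^ (-α)) := by
      refine Finset.sum_nonneg fun z hz => ?_
      have hz0 := (mem_latPunct.1 hz).1
      exact (hfar z hz0 (h1.trans (one_le_norm_intPt hz0))).trans (hcell z)
    have := hgain m (min_le_right _ _) ((min_le_left _ _).trans hR)
    have := min_le_left (g / 4) (1 / 4)
    linarith
  · have hnear : ∀ z : Fin 2 → ℤ, z ≠ 0 → -(1 / 8 * (‖intPt z‖ ^ 4)⁻¹)
        ≤ ∫ v in intCell z ∩ Metric.ball 0 R, (‖v‖ ^ (-α) - ‖intPt z‖ ^ (-α)) := by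
      intro z hz
      rcases le_or_gt R ‖intPt z‖ with h | h
      · refine le_trans ?_ (hfar z hz h)
        have : 0 ≤ (‖intPt z‖ ^ 4)⁻¹ := by positivity
        linarith
      · refine (cell_mean_rpow_ge (by linarith) hα₂.le hz).trans ?_
        have hint : IntegrableOn (fun v : Plane => ‖v‖ ^ (-α) - ‖intPt z‖ ^ (-α)) (intCell z) :=
          (integrableOn_intCell_rpow (by linarith) hz).sub
            (integrableOn_const (by simp [volume_intCell]))
        rw [← integral_inter_add_sdiff (s := intCell z) (t := Metric.ball 0 R)
          measurableSet_ball hint]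
        -- If the centre is in the ball, the points cut away are farther out than the centre, so
        -- cutting them away can only help.
        have : ∫ v in intCell z \ Metric.ball 0 R, (‖v‖ ^ (-α) - ‖intPt z‖ ^ (-α)) ≤ 0 := by
          refine setIntegral_nonpos ((measurableSet_intCell z).diff measurableSet_ball)
            fun v hv => ?_
          have h2 := hv.2
          simp only [Metric.mem_ball, dist_zero_right, not_lt] at h2
          have := Real.rpow_le_rpow_of_nonpos (x := ‖intPt z‖) (y := ‖v‖) (z := -α)
            (norm_intPt_pos hz) (by linarith) (by linarith)
          linarith
        linarith
    have hs : -(10 / 8) ≤ ∑ z ∈ latPunct (R + 1),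
        ((∫ v in intCell z ∩ Metric.ball 0 R, ‖v‖ ^ (-α))
          - cellMass r R z * ‖intPt z‖ ^ (-α)) := by
      calc -(10 / 8 : ℝ) ≤ ∑ z ∈ latPunct (R + 1), -(1 / 8 * (‖intPt z‖ ^ 4)⁻¹) := by
            rw [Finset.sum_neg_distrib, ← Finset.mul_sum]
            have := sum_inv_norm_pow_four_le (latPunct (R + 1))
              fun z hz => (mem_latPunct.1 hz).1
            linarith
        _ ≤ _ := Finset.sum_le_sum fun z hz =>
            (hnear z (mem_latPunct.1 hz).1).trans (hcell z)
    have h3 := hgain (1 / 2) le_rfl (by linarith)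
    -- The integral is 2π/(2-α) · (1/2)^{2-α}, and 0 < 2-α ≤ 1 bounds the factors below by 2π and
    -- 1/2.
    have h4 : Real.pi ≤ ∫ v in Metric.ball (0 : Plane) (1 / 2), ‖v‖ ^ (-α) := by
      rw [integral_ball_rpow hα₂ (by norm_num)]
      have h5 : (1 / 2 : ℝ) ≤ (1 / 2) ^ (2 - α) := by
        conv_lhs => rw [← Real.rpow_one (1 / 2 : ℝ)]
        exact Real.rpow_le_rpow_of_exponent_ge (by norm_num) (by norm_num) (by linarith)
      have h6 : 2 * Real.pi ≤ 2 * Real.pi / (2 - α) := by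
        rw [le_div_iff₀ h2α]
        nlinarith [Real.pi_pos]
      nlinarith [Real.pi_pos]
    have := Real.pi_gt_three
    have := min_le_right (g / 4) (1 / 4)
    linarith

/-! ### Convergence of the normalizing constants -/

/-- The total mass of the jump weights on the unit lattice. -/
def totalWeight (α r R : ℝ) : ℝ := ∑' z, unitWeight α r R z

lemma totalWeight_eq {α r R : ℝ} (hR : 0 ≤ R) {ρ : ℝ} (hρ : R + 1 ≤ ρ) :
    totalWeight α r R = 4 * nnWeight α r R +
      ∑ z ∈ latPunct ρ, cellMass r R z * ‖intPt z‖ ^ (-2 - α) := by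
  rw [totalWeight, tsum_eq_sum (s := latPunct ρ) fun z hz => unitWeight_eq_zero hR hρ hz]
  have := sum_unitWeight_mul (α := α) (r := r) hR hρ fun _ => 1
  simp only [mul_one] at this
  rw [this, sum_nnPts]
  ring

lemma cn_eq {α r M : ℝ} (hα : α < 2) (hM : 0 ≤ M) {n : ℕ} (hn : n ≠ 0) :
    cn α r M n = (totalWeight α r (n * M))⁻¹ := by
  rw [cn, totalWeight, tsum_congr fun z => jumpWeight_eq hα hM hn z]

lemma annulus_disjoint (a b c : ℝ) : Disjoint (annulus a b) (annulus b c) := by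
  rw [Set.disjoint_left]
  intro v h1 h2
  rw [mem_annulus] at h1 h2
  linarith

lemma annulus_union {a b c : ℝ} (hab : a ≤ b) (hbc : b ≤ c) :
    annulus a b ∪ annulus b c = annulus a c := by
  ext v
  simp only [Set.mem_union, mem_annulus]
  constructor
  · rintro (h | h) <;> constructor <;> linarith
  · intro h
    rcases lt_or_ge ‖v‖ b with h1 | h1
    · exact Or.inl ⟨h.1, h1⟩
    · exact Or.inr ⟨h1, h.2⟩

lemma cellMass_sub {a b c : ℝ} (hab : a ≤ b) (hbc : b ≤ c) (z : Fin 2 → ℤ) :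
    cellMass a c z - cellMass a b z = cellMass b c z := by
  rw [cellMass, cellMass, cellMass, ← annulus_union hab hbc, Set.inter_union_distrib_left,
    measureReal_union ((annulus_disjoint a b c).mono Set.inter_subset_right Set.inter_subset_right)
      ((measurableSet_intCell z).inter (measurableSet_annulus _ _))
      (volume_intCell_inter_ne_top _ _) (volume_intCell_inter_ne_top _ _)]
  ring

lemma ballMoment_sub {α : ℝ} (hα2 : α < 2) {a b : ℝ} (ha : 0 < a) (hab : a ≤ b) :
    ballMoment α b - ballMoment α a = ∫ v in annulus a b, ‖v‖ ^ (-α) := by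
  have h0 : annulus 0 a = Metric.ball (0 : Plane) a := by ext v; simp [mem_annulus]
  have h1 : annulus 0 b = Metric.ball (0 : Plane) b := by ext v; simp [mem_annulus]
  rw [ballMoment_eq, ballMoment_eq, ← h0, ← h1, ← annulus_union ha.le hab,
    setIntegral_union (annulus_disjoint _ _ _) (measurableSet_annulus _ _)
      (by rw [h0]; exact integrableOn_ball_rpow hα2 a) (integrableOn_annulus_rpow ha b α)]
  ring

/-- Only the annulus between R and R' matters. Cells inside it contribute second differences, a sum
of |z|^{-α-2} beyond R; the cells cut by either circle, O(R) or O(R') in number, contribute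
|z|^{-α-1} each. Both are O(R^{-α}). -/
lemma exists_nnWeight_sub_le {α r M : ℝ} (hα₁ : 0 < α) (hα₂ : α < 2) (hM : 0 < M) (hr : r ≤ M) :
    ∃ C, 0 ≤ C ∧ ∀ R R', M ≤ R → R ≤ R' →
      |4 * nnWeight α r R' - 4 * nnWeight α r R| ≤ C * R ^ (-α) := by
  obtain ⟨C, hC0, hK⟩ := exists_kernelBound_rpow hα₁
  obtain ⟨Cb, hCb0, hCb⟩ := exists_sum_rpow_le_boundary hM (q := α + 1) (by linarith)
  obtain ⟨Co, hCo0, hCo⟩ := exists_sum_rpow_le_outer (p := α + 2) (by linarith)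
  set A1 := ∫ v in Metric.ball (0 : Plane) 1, ‖v‖ ^ (-α) with hA1
  have hA10 : 0 ≤ A1 := setIntegral_nonneg measurableSet_ball fun v _ => by positivity
  refine ⟨A1 + C * Cb + C * Cb + C * Co, by positivity, fun R R' hR hRR' => ?_⟩
  have hR0 : 0 < R := hM.trans_le hR
  have hint : IntegrableOn (fun v : Plane => ‖v‖ ^ (-α)) (annulus R R') :=
    integrableOn_annulus_rpow hR0 R' α
  set Z := latPunct (R' + 1)
  have hsplit : ∫ v in annulus R R', ‖v‖ ^ (-α) = (∫ v in intCell 0 ∩ annulus R R', ‖v‖ ^ (-α))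
      + ∑ z ∈ Z, ∫ v in intCell z ∩ annulus R R', ‖v‖ ^ (-α) := by
    rw [setIntegral_eq_sum_cells (measurableSet_annulus _ _) hint (latDisk (R' + 1))
      fun v hv => roundPt_mem_latDisk (mem_annulus.1 hv).2.le]
    refine (Finset.add_sum_erase _ _ ?_).symm
    rw [mem_latDisk]; simp; linarith
  have hid : 4 * nnWeight α r R' - 4 * nnWeight α r R
      = (∫ v in intCell 0 ∩ annulus R R', ‖v‖ ^ (-α))
        + ∑ z ∈ Z, ∫ v in intCell z ∩ annulus R R', (‖v‖ ^ (-α) - ‖intPt z‖ ^ (-α)) := by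
    rw [four_mul_nnWeight α r R' le_rfl,
      four_mul_nnWeight α r R (ρ := R' + 1) (by linarith)]
    have : ∀ z ∈ Z, ∫ v in intCell z ∩ annulus R R', (‖v‖ ^ (-α) - ‖intPt z‖ ^ (-α))
        = (∫ v in intCell z ∩ annulus R R', ‖v‖ ^ (-α))
          - (cellMass r R' z * ‖intPt z‖ ^ (-α) - cellMass r R z * ‖intPt z‖ ^ (-α)) := by
      intro z _
      rw [integral_sub (hint.mono_set Set.inter_subset_right)
        (integrableOn_const (volume_intCell_inter_ne_top _ _)), setIntegral_const, smul_eq_mul,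
        ← sub_mul, cellMass_sub (hr.trans hR) hRR']
      rfl
    rw [Finset.sum_congr rfl this, Finset.sum_sub_distrib, Finset.sum_sub_distrib, ← add_sub_assoc,
      ← hsplit, ← ballMoment_sub hα₂ hR0 hRR']
    ring
  -- The central cell meets the annulus only if R < 1, and then R^{-α} ≥ 1.
  have hzero : |∫ v in intCell 0 ∩ annulus R R', ‖v‖ ^ (-α)| ≤ A1 * R ^ (-α) := by
    rw [abs_of_nonneg (setIntegral_nonneg
      ((measurableSet_intCell 0).inter (measurableSet_annulus _ _)) fun v _ => by positivity)]
    have hsub : intCell 0 ∩ annulus R R' ⊆ Metric.ball 0 1 := by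
      intro v hv
      have := norm_sub_le_of_mem_intCell hv.1
      simp only [intPt_zero, sub_zero] at this
      simp only [Metric.mem_ball, dist_zero_right]
      linarith
    rcases lt_or_ge R 1 with h | h
    · have h1 : ∫ v in intCell 0 ∩ annulus R R', ‖v‖ ^ (-α) ≤ A1 :=
        setIntegral_mono_set (integrableOn_ball_rpow hα₂ 1)
          (Eventually.of_forall fun v => by positivity) (LE.le.eventuallyLE hsub)
      have h2 : 1 ≤ R ^ (-α) := Real.one_le_rpow_of_pos_of_le_one_of_nonpos hR0 h.le (by linarith)
      nlinarith
    · have : intCell 0 ∩ annulus R R' = ∅ := by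
        ext v
        simp only [Set.mem_empty_iff_false, iff_false]
        intro hv
        have h1 := hsub hv
        have h2 := (mem_annulus.1 hv.2).1
        simp only [Metric.mem_ball, dist_zero_right] at h1
        linarith
      rw [this]; simp; positivity
  have hcell : ∀ z ∈ Z, |∫ v in intCell z ∩ annulus R R', (‖v‖ ^ (-α) - ‖intPt z‖ ^ (-α))| ≤
      (if R - 1 ≤ ‖intPt z‖ ∧ ‖intPt z‖ ≤ R + 1 then C * ‖intPt z‖ ^ (-(α + 1)) else 0) +
      (if R' - 1 ≤ ‖intPt z‖ ∧ ‖intPt z‖ ≤ R' + 1 then C * ‖intPt z‖ ^ (-(α + 1)) else 0) +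
      (if R ≤ ‖intPt z‖ then C * ‖intPt z‖ ^ (-(α + 2)) else 0) := by
    intro z hz
    have hz0 := (mem_latPunct.1 hz).1
    have hzR := (mem_latPunct.1 hz).2
    have hn1 : 0 ≤ C * ‖intPt z‖ ^ (-(α + 1)) := by positivity
    have hn2 : 0 ≤ C * ‖intPt z‖ ^ (-(α + 2)) := by positivity
    have hpart : |∫ v in intCell z ∩ annulus R R', (‖v‖ ^ (-α) - ‖intPt z‖ ^ (-α))|
        ≤ C * ‖intPt z‖ ^ (-(α + 1)) := by
      refine abs_setIntegral_inter_sub_le hn1 fun v hv => ?_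
      have := hK.abs_sub_le_of_mem_intCell hC0 hz0 hv
      rwa [show -α - 1 = -(α + 1) by ring] at this
    by_cases h1 : ‖intPt z‖ < R - 1
    · have : intCell z ∩ annulus R R' = ∅ := by
        ext v
        simp only [Set.mem_empty_iff_false, iff_false]
        intro hv
        have h1 := norm_le_add_of_mem_intCell hv.1
        have h2 := (mem_annulus.1 hv.2).1
        linarith
      rw [this]
      simp only [setIntegral_empty, abs_zero]
      positivity
    by_cases h2 : ‖intPt z‖ ≤ R + 1
    · rw [if_pos ⟨not_lt.1 h1, h2⟩]
      have : (0 : ℝ) ≤ (if R' - 1 ≤ ‖intPt z‖ ∧ ‖intPt z‖ ≤ R' + 1 then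
        C * ‖intPt z‖ ^ (-(α + 1)) else 0) := by positivity
      have : (0 : ℝ) ≤ (if R ≤ ‖intPt z‖ then C * ‖intPt z‖ ^ (-(α + 2)) else 0) := by positivity
      linarith
    by_cases h3 : R' - 1 ≤ ‖intPt z‖
    · rw [if_pos (show R' - 1 ≤ ‖intPt z‖ ∧ ‖intPt z‖ ≤ R' + 1 from ⟨h3, hzR⟩)]
      have : (0 : ℝ) ≤ (if R - 1 ≤ ‖intPt z‖ ∧ ‖intPt z‖ ≤ R + 1 then
        C * ‖intPt z‖ ^ (-(α + 1)) else 0) := by positivity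
      have : (0 : ℝ) ≤ (if R ≤ ‖intPt z‖ then C * ‖intPt z‖ ^ (-(α + 2)) else 0) := by positivity
      linarith
    · have hsub : intCell z ∩ annulus R R' = intCell z := by
        refine Set.inter_eq_left.2 fun v hv => ?_
        have h4 := norm_le_add_of_mem_intCell hv
        have h5 := norm_intPt_le_add_of_mem_intCell hv
        rw [mem_annulus]
        constructor <;> linarith
      rw [hsub, if_neg (fun h => h2 h.2), if_neg (fun h => h3 h.1),
        if_pos (by linarith : R ≤ ‖intPt z‖)]
      have := abs_setIntegral_intCell_sub_le (integrableOn_intCell_rpow hα₁ hz0)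
        fun w hw => hK.abs_second_le hC0 hz0 hw
      rw [show -α - 2 = -(α + 2) by ring] at this
      linarith
  have hsum : |∑ z ∈ Z, ∫ v in intCell z ∩ annulus R R', (‖v‖ ^ (-α) - ‖intPt z‖ ^ (-α))|
      ≤ C * Cb * R ^ (-α) + C * Cb * R ^ (-α) + C * Co * R ^ (-α) := by
    refine (Finset.abs_sum_le_sum_abs _ _).trans ((Finset.sum_le_sum hcell).trans ?_)
    rw [Finset.sum_add_distrib, Finset.sum_add_distrib, ← Finset.sum_filter, ← Finset.sum_filter,
      ← Finset.sum_filter, ← Finset.mul_sum, ← Finset.mul_sum, ← Finset.mul_sum]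
    have t1 := hCb R (Z.filter fun z => R - 1 ≤ ‖intPt z‖ ∧ ‖intPt z‖ ≤ R + 1) hR fun z hz =>
      ⟨(mem_latPunct.1 (Finset.mem_filter.1 hz).1).1, (Finset.mem_filter.1 hz).2⟩
    have t2 := hCb R' (Z.filter fun z => R' - 1 ≤ ‖intPt z‖ ∧ ‖intPt z‖ ≤ R' + 1)
      (hR.trans hRR') fun z hz =>
      ⟨(mem_latPunct.1 (Finset.mem_filter.1 hz).1).1, (Finset.mem_filter.1 hz).2⟩
    have t3 := hCo R (Z.filter fun z => R ≤ ‖intPt z‖) hR0 fun z hz =>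
      ⟨(mem_latPunct.1 (Finset.mem_filter.1 hz).1).1, (Finset.mem_filter.1 hz).2⟩
    have t4 : R' ^ (-α) ≤ R ^ (-α) := Real.rpow_le_rpow_of_nonpos hR0 hRR' (by linarith)
    rw [show 1 - (α + 1) = -α by ring] at t1 t2
    rw [show 2 - (α + 2) = -α by ring] at t3
    have t5 := t2.trans (mul_le_mul_of_nonneg_left t4 hCb0)
    have := mul_le_mul_of_nonneg_left t1 hC0
    have := mul_le_mul_of_nonneg_left t5 hC0
    have := mul_le_mul_of_nonneg_left t3 hC0
    linarith
  rw [hid]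
  refine (abs_add_le _ _).trans ?_
  linarith

/-- The mass of the jumps beyond R is a tail of the sum of |z|^{-2-α}, of the same order R^{-α} as
the change of the nearest-neighbour weight. -/
lemma exists_totalWeight_sub_le {α r M : ℝ} (hα₁ : 0 < α) (hα₂ : α < 2) (hM : 0 < M)
    (hr : r ≤ M) : ∃ C, 0 ≤ C ∧ ∀ R R', M ≤ R → R ≤ R' →
      |totalWeight α r R' - totalWeight α r R| ≤ C * R ^ (-α) := by
  obtain ⟨C1, hC10, hC1⟩ := exists_nnWeight_sub_le hα₁ hα₂ hM hr
  obtain ⟨Co, hCo0, hCo⟩ := exists_sum_rpow_le_outer (p := 2 + α) (by linarith)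
  refine ⟨C1 + Co * (1 / 2) ^ (-α), by positivity, fun R R' hR hRR' => ?_⟩
  have hR0 : 0 < R := hM.trans_le hR
  have hid : totalWeight α r R' - totalWeight α r R = (4 * nnWeight α r R' - 4 * nnWeight α r R)
      + ∑ z ∈ latPunct (R' + 1), cellMass R R' z * ‖intPt z‖ ^ (-2 - α) := by
    rw [totalWeight_eq (by linarith) le_rfl,
      totalWeight_eq (ρ := R' + 1) hR0.le (by linarith)]
    simp only [← cellMass_sub (hr.trans hR) hRR', sub_mul]
    rw [Finset.sum_sub_distrib]; ring
  have hs0 : 0 ≤ ∑ z ∈ latPunct (R' + 1), cellMass R R' z * ‖intPt z‖ ^ (-2 - α) :=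
    Finset.sum_nonneg fun z _ => mul_nonneg (cellMass_nonneg _ _ _) (by positivity)
  have hs : ∑ z ∈ latPunct (R' + 1), cellMass R R' z * ‖intPt z‖ ^ (-2 - α)
      ≤ Co * (1 / 2) ^ (-α) * R ^ (-α) := by
    calc _ ≤ ∑ z ∈ latPunct (R' + 1),
            if 1 / 2 * R ≤ ‖intPt z‖ then ‖intPt z‖ ^ (-(2 + α)) else 0 := by
          refine Finset.sum_le_sum fun z hz => ?_
          have h1 := one_le_norm_intPt (mem_latPunct.1 hz).1
          rw [show -2 - α = -(2 + α) by ring]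
          split_ifs with h
          · exact mul_le_of_le_one_left (by positivity) (cellMass_le_one _ _ _)
          · have : intCell z ∩ annulus R R' = ∅ := by
              ext v
              simp only [Set.mem_empty_iff_false, iff_false]
              intro hv
              have h2 := norm_le_add_of_mem_intCell hv.1
              have h3 := (mem_annulus.1 hv.2).1
              linarith
            simp [cellMass, this]
      _ ≤ Co * (1 / 2 * R) ^ (2 - (2 + α)) := by
          rw [← Finset.sum_filter]
          exact hCo _ _ (by positivity) fun z hz =>
            ⟨(mem_latPunct.1 (Finset.mem_filter.1 hz).1).1, (Finset.mem_filter.1 hz).2⟩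
      _ = _ := by
          rw [show 2 - (2 + α) = -α by ring, Real.mul_rpow (by norm_num) hR0.le]; ring
  rw [hid]
  refine (abs_add_le _ _).trans ?_
  rw [abs_of_nonneg hs0, add_mul]
  exact add_le_add (hC1 R R' hR hRR') hs

/-- The values along the multiples of M form a Cauchy sequence; comparing a fixed R with far members
of the sequence gives the rate for every R. -/
lemma exists_totalWeight_limit {α r M : ℝ} (hα₁ : 0 < α) (hα₂ : α < 2) (hM : 0 < M)
    (hr : r ≤ M) : ∃ L C, 0 ≤ C ∧ ∀ R, M ≤ R → |totalWeight α r R - L| ≤ C * R ^ (-α) := by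
  obtain ⟨C, hC0, hC⟩ := exists_totalWeight_sub_le hα₁ hα₂ hM hr
  have hpos : ∀ n : ℕ, (0 : ℝ) < (n + 1) * M := fun n => by positivity
  have hge : ∀ n : ℕ, M ≤ (n + 1) * M := fun n => by
    have : (0 : ℝ) ≤ n * M := by positivity
    linarith
  have htop : Tendsto (fun n : ℕ => ((n : ℝ) + 1) * M) atTop atTop :=
    (tendsto_natCast_atTop_atTop.atTop_add tendsto_const_nhds).atTop_mul_const hM
  have hc : CauchySeq fun n : ℕ => totalWeight α r ((n + 1) * M) := by
    refine cauchySeq_of_le_tendsto_0' (fun n : ℕ => C * (((n : ℝ) + 1) * M) ^ (-α)) ?_ ?_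
    · intro n m hnm
      rw [dist_comm, Real.dist_eq]
      exact hC _ _ (hge n) (by gcongr)
    · simpa using ((tendsto_rpow_neg_atTop hα₁).comp htop).const_mul C
  obtain ⟨L, hL⟩ := cauchySeq_tendsto_of_complete hc
  refine ⟨L, C, hC0, fun R hR => ?_⟩
  have h1 : Tendsto (fun n : ℕ => |totalWeight α r R - totalWeight α r ((n + 1) * M)|) atTop
      (𝓝 |totalWeight α r R - L|) := (tendsto_const_nhds.sub hL).abs
  refine le_of_tendsto h1 ?_
  filter_upwards [htop.eventually_ge_atTop R] with n hn
  rw [abs_sub_comm]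
  exact hC R _ hR hn

lemma nnWeight_le_totalWeight {α r R : ℝ} (hR : 0 ≤ R) :
    4 * nnWeight α r R ≤ totalWeight α r R := by
  rw [totalWeight_eq hR le_rfl]
  have : 0 ≤ ∑ z ∈ latPunct (R + 1), cellMass r R z * ‖intPt z‖ ^ (-2 - α) :=
    Finset.sum_nonneg fun z _ => mul_nonneg (cellMass_nonneg _ _ _) (by positivity)
  linarith

/-- The normalizing constants converge to a positive limit, with a rate. -/
lemma exists_cn_rate {α r M : ℝ} (hα₁ : 1 < α) (hα₂ : α < 2) (hr : 0 < r) (hrM : r < M) :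
    Tendsto (fun n : ℕ => cn α r M n) atTop (𝓝 (cLim α r M)) ∧ 0 < cLim α r M ∧
    ∃ C, 0 < C ∧ ∀ n : ℕ, 1 ≤ n → 0 < cn α r M n ∧ (cn α r M n)⁻¹ ≤ C ∧
      |1 - cLim α r M / cn α r M n| ≤ C * (n : ℝ) ^ (-α) := by
  have hM : 0 < M := hr.trans hrM
  obtain ⟨κ, hκ, hκle⟩ := exists_nnWeight_ge (r := r) hα₁ hα₂ hM
  obtain ⟨L, C, hC0, hC⟩ := exists_totalWeight_limit (by linarith : 0 < α) hα₂ hM hrM.le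
  have hge : ∀ n : ℕ, 1 ≤ n → M ≤ n * M := fun n hn => by
    have : (1 : ℝ) ≤ n := by exact_mod_cast hn
    nlinarith
  have htop : Tendsto (fun n : ℕ => (n : ℝ) * M) atTop atTop :=
    tendsto_natCast_atTop_atTop.atTop_mul_const hM
  have hWt : Tendsto (fun n : ℕ => totalWeight α r (n * M)) atTop (𝓝 L) := by
    rw [tendsto_iff_norm_sub_tendsto_zero]
    refine squeeze_zero' (g := fun n : ℕ => C * ((n : ℝ) * M) ^ (-α))
      (Eventually.of_forall fun _ => norm_nonneg _) ?_ ?_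
    · filter_upwards [eventually_ge_atTop 1] with n hn
      exact hC _ (hge n hn)
    · simpa using ((tendsto_rpow_neg_atTop (by linarith : 0 < α)).comp htop).const_mul C
  have hWκ : ∀ n : ℕ, 1 ≤ n → 4 * κ ≤ totalWeight α r (n * M) := fun n hn => by
    have := nnWeight_le_totalWeight (α := α) (r := r) (hM.le.trans (hge n hn))
    have := hκle _ (hge n hn)
    linarith
  have hL : 4 * κ ≤ L := by
    refine ge_of_tendsto hWt ?_
    filter_upwards [eventually_ge_atTop 1] with n hn using hWκ n hn
  have hL0 : 0 < L := by linarith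
  have hcn : Tendsto (fun n : ℕ => cn α r M n) atTop (𝓝 L⁻¹) := by
    refine (hWt.inv₀ hL0.ne').congr' ?_
    filter_upwards [eventually_ge_atTop 1] with n hn
    rw [cn_eq hα₂ hM.le (by omega)]
  have hlim : cLim α r M = L⁻¹ := hcn.limUnder_eq
  rw [hlim]
  -- The first summand bounds 1/c_n, which is the total weight; the second bounds the relative
  -- deviation of the total weight from L.
  refine ⟨hcn, by positivity, (L + C * M ^ (-α)) + L⁻¹ * C * M ^ (-α) + 1, by positivity,
    fun n hn => ?_⟩
  have hn0 : (0 : ℝ) < n := by exact_mod_cast hn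
  have hn1 : (1 : ℝ) ≤ n := by exact_mod_cast hn
  have hW0 : 0 < totalWeight α r (n * M) := by have := hWκ n hn; linarith
  have hd := hC _ (hge n hn)
  rw [Real.mul_rpow hn0.le hM.le] at hd
  have hnα : (n : ℝ) ^ (-α) ≤ 1 := Real.rpow_le_one_of_one_le_of_nonpos hn1 (by linarith)
  have hp1 : 0 ≤ (n : ℝ) ^ (-α) := by positivity
  have hp2 : 0 ≤ C * M ^ (-α) := by positivity
  have hp3 : 0 ≤ L⁻¹ * C * M ^ (-α) := by positivity
  rw [cn_eq hα₂ hM.le (by omega)]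
  refine ⟨by positivity, ?_, ?_⟩
  · rw [inv_inv]
    have := (abs_le.1 hd).2
    nlinarith
  · rw [div_inv_eq_mul, show 1 - L⁻¹ * totalWeight α r (n * M)
      = L⁻¹ * (L - totalWeight α r (n * M)) by field_simp, abs_mul, abs_of_pos (by positivity),
      abs_sub_comm]
    calc L⁻¹ * |totalWeight α r (n * M) - L| ≤ L⁻¹ * (C * ((n : ℝ) ^ (-α) * M ^ (-α))) := by gcongr
      _ = L⁻¹ * C * M ^ (-α) * (n : ℝ) ^ (-α) := by ring
      _ ≤ _ := by
          gcongr
          linarith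

/-! ### Second moments of the jump weights -/

lemma cellMass_comp_iso {r R : ℝ} (L : Plane ≃ₗᵢ[ℝ] Plane)
    (hL : ∀ v, L v ∈ unitCell ↔ v ∈ unitCell) {z z' : Fin 2 → ℤ} (h : intPt z' = L (intPt z)) :
    cellMass r R z' = cellMass r R z := by
  have hpre : L ⁻¹' (intCell z' ∩ annulus r R) = intCell z ∩ annulus r R := by
    ext v
    simp only [Set.mem_preimage, Set.mem_inter_iff, mem_annulus, L.norm_map]
    refine and_congr ?_ Iff.rfl
    change L v - intPt z' ∈ unitCell ↔ v - intPt z ∈ unitCell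
    rw [h, ← map_sub, hL]
  rw [cellMass, cellMass, ← hpre, Measure.real, Measure.real, L.measurePreserving.measure_preimage
    ((measurableSet_intCell z').inter (measurableSet_annulus _ _)).nullMeasurableSet]

/-- The cells and the annulus are invariant under reflection and exchange of the coordinates: the
former kills the mixed moment, the latter equates the diagonal ones, and the trace is the sum of
|z|^{-α}. -/
lemma sum_cellMass_moment {α r R ρ : ℝ} (i j : Fin 2) :
    ∑ z ∈ latPunct ρ, cellMass r R z * ‖intPt z‖ ^ (-2 - α) * (intPt z i * intPt z j) =
      if i = j then (∑ z ∈ latPunct ρ, cellMass r R z * ‖intPt z‖ ^ (-α)) / 2 else 0 := by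
  set T : Fin 2 → Fin 2 → ℝ := fun i j =>
    ∑ z ∈ latPunct ρ, cellMass r R z * ‖intPt z‖ ^ (-2 - α) * (intPt z i * intPt z j) with hT
  have hsw : ∀ z : Fin 2 → ℤ, intPt ![z 1, z 0] = swapIso (intPt z) := by
    intro z; ext i; fin_cases i <;> simp
  have hfl : ∀ z : Fin 2 → ℤ, intPt ![-z 0, z 1] = flipIso (intPt z) := by
    intro z; ext i; fin_cases i <;> simp
  have hmem : ∀ (L : Plane ≃ₗᵢ[ℝ] Plane) (z z' : Fin 2 → ℤ), intPt z' = L (intPt z) →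
      z ∈ latPunct ρ → z' ∈ latPunct ρ := by
    intro L z z' h hz
    rw [mem_latPunct] at hz ⊢
    refine ⟨?_, by rw [h, L.norm_map]; exact hz.2⟩
    rintro rfl
    rw [intPt_zero] at h
    exact hz.1 (intPt_eq_zero.1 (by simpa using h.symm))
  have h01 : T 0 1 = 0 := by
    have : T 0 1 = -T 0 1 := by
      simp only [hT]
      rw [← Finset.sum_neg_distrib]
      refine Finset.sum_nbij' (fun z => ![-z 0, z 1]) (fun z => ![-z 0, z 1])
        (fun z hz => hmem _ _ _ (hfl z) hz) (fun z hz => hmem _ _ _ (hfl z) hz)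
        (fun z _ => by ext i; fin_cases i <;> simp) (fun z _ => by ext i; fin_cases i <;> simp)
        fun z _ => ?_
      rw [cellMass_comp_iso flipIso flipIso_mem_unitCell (hfl z), hfl, flipIso.norm_map]
      simp
    linarith
  have hd : T 0 0 = T 1 1 := by
    simp only [hT]
    refine Finset.sum_nbij' (fun z => ![z 1, z 0]) (fun z => ![z 1, z 0])
      (fun z hz => hmem _ _ _ (hsw z) hz) (fun z hz => hmem _ _ _ (hsw z) hz)
      (fun z _ => by ext i; fin_cases i <;> simp) (fun z _ => by ext i; fin_cases i <;> simp)
      fun z _ => ?_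
    rw [cellMass_comp_iso swapIso swapIso_mem_unitCell (hsw z), hsw, swapIso.norm_map]
    simp
  have ht : ∑ z ∈ latPunct ρ, cellMass r R z * ‖intPt z‖ ^ (-α) = T 0 0 + T 1 1 := by
    simp only [hT]
    rw [← Finset.sum_add_distrib]
    refine Finset.sum_congr rfl fun z hz => ?_
    have hz0 := norm_intPt_pos (mem_latPunct.1 hz).1
    rw [← mul_add, ← pow_two, ← pow_two, ← plane_norm_sq, ← Real.rpow_two, mul_assoc,
      ← Real.rpow_add hz0]
    congr 2; ring
  change T i j = _
  rw [ht]
  fin_cases i <;> fin_cases j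
  · simp only [Fin.zero_eta, if_true]; linarith
  · simpa using h01
  · simp only [Fin.zero_eta, Fin.mk_one, one_ne_zero, if_false]
    rw [← h01]; simp only [hT, mul_comm (intPt _ 1)]
  · simp only [Fin.mk_one, if_true]; linarith

/-- The correction `nnWeight` matches the second moments with those of the continuum kernel. -/
lemma sum_unitWeight_moment {α r R : ℝ} (hR : 0 ≤ R) {ρ : ℝ} (hρ : R + 1 ≤ ρ) (i j : Fin 2) :
    ∑ z ∈ latPunct ρ, unitWeight α r R z * (intPt z i * intPt z j) =
      if i = j then ballMoment α R / 2 else 0 := by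
  rw [sum_unitWeight_mul hR hρ, sum_cellMass_moment, sum_nnPts]
  -- The four neighbours add twice `nnWeight` to each diagonal moment, which is half of the deficit
  -- measured by `four_mul_nnWeight`.
  have h := four_mul_nnWeight α r R hρ
  fin_cases i <;> fin_cases j <;> simp <;> linarith

/-! ### Oscillatory integrals -/

lemma KernelBound.integrableOn_annulus {q C : ℝ} {K : Plane → ℝ} (hK : KernelBound q C K)
    (hm : Measurable K) {a : ℝ} (ha : 0 < a) (b : ℝ) : IntegrableOn K (annulus a b) :=
  ((integrableOn_annulus_rpow ha b q).const_mul C).mono' hm.aestronglyMeasurable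
    (Eventually.of_forall hK.size)

lemma KernelBound.integrableOn_ball {q C : ℝ} {K : Plane → ℝ} (hK : KernelBound q C K)
    (hm : Measurable K) (hq : q < 2) (b : ℝ) : IntegrableOn K (Metric.ball 0 b) :=
  ((integrableOn_ball_rpow hq b).const_mul C).mono' hm.aestronglyMeasurable
    (Eventually.of_forall hK.size)

lemma IntegrableOn.mul_bounded {S : Set Plane} {K c : Plane → ℝ} (hK : IntegrableOn K S)
    (hc : Continuous c) {B : ℝ} (hB : ∀ v, |c v| ≤ B) : IntegrableOn (fun v => K v * c v) S :=
  Integrable.mul_bdd (c := B) hK hc.aestronglyMeasurable (Eventually.of_forall hB)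

lemma abs_integral_le_of_abs_le {X : Type*} [MeasurableSpace X] {μ : Measure X} {f g : X → ℝ}
    (hg : Integrable g μ) (h : ∀ v, |f v| ≤ g v) : |∫ v, f v ∂μ| ≤ ∫ v, g v ∂μ := by
  rw [← Real.norm_eq_abs]
  exact norm_integral_le_of_norm_le hg (Eventually.of_forall h)

lemma integrableOn_mul_cos {S : Set Plane} {K : Plane → ℝ} (hK : IntegrableOn K S) (η : Plane) :
    IntegrableOn (fun v => K v * Real.cos (inner ℝ η v)) S :=
  IntegrableOn.mul_bounded hK (by fun_prop) (B := 1) fun _ => Real.abs_cos_le_one _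

/-- Translation by the half period h = πη/|η|² reverses the sign of the cosine, so twice the
integral is that of (G(v) - G(v+h)) cos(η·v), with G the kernel cut off to the annulus. If both
points lie in the annulus, the Lipschitz bound gains a factor |h|/|v|; if only one does, it lies
within |h| of one of the two circles. The radius 5/|η| ensures |h| ≤ 3a/4, because π < 15/4. The
bound does not depend on R. -/
lemma KernelBound.abs_integral_annulus_mul_cos_le {q C : ℝ} {K : Plane → ℝ}
    (hK : KernelBound q C K) (hm : Measurable K) (hq : 1 < q) (hC : 0 ≤ C) {η : Plane}
    (hη : η ≠ 0) {a : ℝ} (ha : 5 / ‖η‖ ≤ a) (R : ℝ) :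
    |∫ v in annulus a R, K v * Real.cos (inner ℝ η v)|
      ≤ C * (Real.pi ^ 2 * (1 / (q - 1) + 4)) * (a ^ (1 - q) / ‖η‖) := by
  have hη0 : 0 < ‖η‖ := norm_pos_iff.2 hη
  have ha0 : 0 < a := lt_of_lt_of_le (by positivity) ha
  have hq1 : 0 < q - 1 := by linarith
  have hπ := Real.pi_pos
  rcases lt_or_ge R a with hRa | hRa
  · have : annulus a R = ∅ := by
      ext v; simp only [mem_annulus, Set.mem_empty_iff_false, iff_false]; intro h; linarith
    rw [this]; simp only [setIntegral_empty, abs_zero]; positivity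
  set h : Plane := (Real.pi / ‖η‖ ^ 2) • η with hh
  have hnh : ‖h‖ = Real.pi / ‖η‖ := by
    rw [hh, norm_smul, Real.norm_of_nonneg (by positivity)]; field_simp
  have hha : ‖h‖ ≤ 3 / 4 * a := by
    rw [hnh]
    calc Real.pi / ‖η‖ ≤ (3 / 4 * 5) / ‖η‖ := by
          gcongr; have := Real.pi_lt_d2; linarith
      _ = 3 / 4 * (5 / ‖η‖) := by ring
      _ ≤ _ := by gcongr
  have hinner : ∀ v, Real.cos (inner ℝ η (v + h)) = -Real.cos (inner ℝ η v) := by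
    intro v
    rw [inner_add_right, hh, inner_smul_right, real_inner_self_eq_norm_sq,
      div_mul_cancel₀ _ (by positivity), Real.cos_add_pi]
  set A := annulus a R with hA
  have hAm : MeasurableSet A := measurableSet_annulus a R
  set G : Plane → ℝ := A.indicator K with hG
  have hGi : Integrable G := (integrable_indicator_iff hAm).2 (hK.integrableOn_annulus hm ha0 R)
  have hGc : Integrable fun v => G v * Real.cos (inner ℝ η v) := by
    have := integrableOn_mul_cos (S := Set.univ) (integrableOn_univ.2 hGi) η
    exact integrableOn_univ.1 this
  have hGhi : Integrable fun v => G (v + h) := hGi.comp_add_right h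
  have hGhc : Integrable fun v => G (v + h) * Real.cos (inner ℝ η v) := by
    have := integrableOn_mul_cos (S := Set.univ) (integrableOn_univ.2 hGhi) η
    exact integrableOn_univ.1 this
  have hI : ∫ v in A, K v * Real.cos (inner ℝ η v) = ∫ v, G v * Real.cos (inner ℝ η v) := by
    rw [← integral_indicator hAm]
    congr 1; ext v
    by_cases hv : v ∈ A <;> simp [hG, hv]
  have hshift : ∫ v, G v * Real.cos (inner ℝ η v)
      = -∫ v, G (v + h) * Real.cos (inner ℝ η v) := by
    rw [← integral_add_right_eq_self (fun v => G v * Real.cos (inner ℝ η v)) h, ← integral_neg]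
    congr 1; ext v; rw [hinner]; ring
  have h2I : 2 * ∫ v in A, K v * Real.cos (inner ℝ η v)
      = ∫ v, (G v - G (v + h)) * Real.cos (inner ℝ η v) := by
    simp only [sub_mul]
    rw [integral_sub hGc hGhc, hI]
    linarith
  -- The maximum keeps the outer shell away from the origin when the annulus is thinner than |h|.
  set Bd : Set Plane := annulus a (a + ‖h‖) ∪ annulus (max a (R - ‖h‖)) R with hBd
  have hBdm : MeasurableSet Bd := (measurableSet_annulus _ _).union (measurableSet_annulus _ _)
  set N : Plane → ℝ := Bd.indicator fun v => C * ‖v‖ ^ (-q) with hN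
  set D : Plane → ℝ := A.indicator fun v => C * ‖v‖ ^ (-q - 1) * ‖h‖ with hD
  have hN0 : ∀ v, 0 ≤ N v := fun v => Set.indicator_nonneg (fun v _ => by positivity) v
  have hD0 : ∀ v, 0 ≤ D v := fun v => Set.indicator_nonneg (fun v _ => by positivity) v
  have hmax0 : 0 < max a (R - ‖h‖) := lt_max_of_lt_left ha0
  have hBdi : IntegrableOn (fun v : Plane => C * ‖v‖ ^ (-q)) Bd :=
    (((integrableOn_annulus_rpow ha0 _ q).union
      (integrableOn_annulus_rpow hmax0 _ q))).const_mul C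
  have hNi : Integrable N := (integrable_indicator_iff hBdm).2 hBdi
  have hDi : Integrable D := by
    refine (integrable_indicator_iff hAm).2 ?_
    have := ((integrableOn_annulus_rpow ha0 R (q + 1)).const_mul C).mul_const ‖h‖
    rwa [show -(q + 1) = -q - 1 by ring] at this
  have hpt : ∀ v, |G v - G (v + h)| ≤ D v + N v + N (v + h) := by
    intro v
    have t1 := norm_add_le v h
    have t2 : ‖v‖ ≤ ‖v + h‖ + ‖h‖ := by simpa using norm_add_le (v + h) (-h)
    by_cases hv : v ∈ A <;> by_cases hv' : v + h ∈ A
    · rw [hG, Set.indicator_of_mem hv, Set.indicator_of_mem hv', abs_sub_comm]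
      have hw : ‖h‖ ≤ 3 / 4 * ‖v‖ := hha.trans (by have := (mem_annulus.1 hv).1; linarith)
      have h1 := hK.lip v h hw
      have h2 : D v = C * ‖v‖ ^ (-q - 1) * ‖h‖ := Set.indicator_of_mem hv _
      linarith [hN0 v, hN0 (v + h)]
    · rw [hG, Set.indicator_of_mem hv, Set.indicator_of_notMem hv', sub_zero]
      have hb : v ∈ Bd := by
        rw [mem_annulus] at hv
        rw [mem_annulus, not_and_or, not_le, not_lt] at hv'
        rcases hv' with h3 | h3
        · exact Or.inl (mem_annulus.2 ⟨hv.1, by linarith⟩)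
        · exact Or.inr (mem_annulus.2 ⟨max_le hv.1 (by linarith), hv.2⟩)
      have h2 : N v = C * ‖v‖ ^ (-q) := Set.indicator_of_mem hb _
      linarith [hD0 v, hN0 (v + h), hK.size v]
    · rw [hG, Set.indicator_of_notMem hv, Set.indicator_of_mem hv', zero_sub, abs_neg]
      have hb : v + h ∈ Bd := by
        rw [mem_annulus] at hv'
        rw [mem_annulus, not_and_or, not_le, not_lt] at hv
        rcases hv with h3 | h3
        · exact Or.inl (mem_annulus.2 ⟨hv'.1, by linarith⟩)
        · exact Or.inr (mem_annulus.2 ⟨max_le hv'.1 (by linarith), hv'.2⟩)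
      have h2 : N (v + h) = C * ‖v + h‖ ^ (-q) := Set.indicator_of_mem hb _
      linarith [hD0 v, hN0 v, hK.size (v + h)]
    · rw [hG, Set.indicator_of_notMem hv, Set.indicator_of_notMem hv']
      simp only [sub_zero, abs_zero]
      linarith [hD0 v, hN0 v, hN0 (v + h)]
  have hNint : ∫ v, N v ≤ C * (4 * Real.pi * (‖h‖ * a ^ (1 - q))) := by
    rw [hN, integral_indicator hBdm, integral_const_mul]
    gcongr
    have hle : ∫ v in Bd, ‖v‖ ^ (-q) ≤ (∫ v in annulus a (a + ‖h‖), ‖v‖ ^ (-q))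
        + ∫ v in annulus (max a (R - ‖h‖)) R, ‖v‖ ^ (-q) := by
      have i1 := integrableOn_annulus_rpow ha0 (a + ‖h‖) q
      have i2 := integrableOn_annulus_rpow hmax0 R q
      rw [hBd, ← Set.union_sdiff_self, setIntegral_union Set.disjoint_sdiff_right
        ((measurableSet_annulus _ _).diff (measurableSet_annulus _ _)) i1
        (i2.mono_set Set.sdiff_subset)]
      exact add_le_add le_rfl (setIntegral_mono_set i2
        (Eventually.of_forall fun v => by positivity) (LE.le.eventuallyLE Set.sdiff_subset))
    have b1 := integral_annulus_rpow_le ha0 (b := a + ‖h‖) (q := q)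
      (by linarith [norm_nonneg h]) hq.le
    have b2 := integral_annulus_rpow_le hmax0 (b := R) (q := q)
      (max_le hRa (by linarith [norm_nonneg h])) hq.le
    have b3 : max a (R - ‖h‖) ^ (1 - q) ≤ a ^ (1 - q) :=
      Real.rpow_le_rpow_of_nonpos ha0 (le_max_left _ _) (by linarith)
    have b4 : R - max a (R - ‖h‖) ≤ ‖h‖ := by have := le_max_right a (R - ‖h‖); linarith
    have b5 : 0 ≤ max a (R - ‖h‖) ^ (1 - q) := by positivity
    have b6 : (R - max a (R - ‖h‖)) * max a (R - ‖h‖) ^ (1 - q) ≤ ‖h‖ * a ^ (1 - q) :=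
      (mul_le_mul_of_nonneg_right b4 b5).trans (mul_le_mul_of_nonneg_left b3 (norm_nonneg _))
    have b7 := mul_le_mul_of_nonneg_left b6 (by positivity : 0 ≤ 2 * Real.pi)
    rw [add_sub_cancel_left] at b1
    linarith
  have hDint : ∫ v, D v ≤ C * (2 * Real.pi / (q - 1) * (‖h‖ * a ^ (1 - q))) := by
    rw [hD, integral_indicator hAm, integral_mul_const, integral_const_mul, mul_assoc]
    refine mul_le_mul_of_nonneg_left ?_ hC
    have hsub : A ⊆ (Metric.ball (0 : Plane) a)ᶜ := fun v hv => hv.2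
    have i1 := integrableOn_compl_ball_rpow (p := q + 1) (by linarith) ha0
    have i2 := integral_compl_ball_rpow (p := q + 1) (by linarith) ha0
    rw [show -(q + 1) = -q - 1 by ring] at i1 i2
    have : ∫ v in A, ‖v‖ ^ (-q - 1) ≤ ∫ v in (Metric.ball (0 : Plane) a)ᶜ, ‖v‖ ^ (-q - 1) :=
      setIntegral_mono_set i1 (Eventually.of_forall fun v => by positivity)
        (LE.le.eventuallyLE hsub)
    rw [i2, show q + 1 - 2 = q - 1 by ring, show 2 - (q + 1) = 1 - q by ring] at this
    calc _ ≤ 2 * Real.pi / (q - 1) * a ^ (1 - q) * ‖h‖ := by gcongr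
      _ = _ := by ring
  have hfin : |∫ v, (G v - G (v + h)) * Real.cos (inner ℝ η v)|
      ≤ C * (2 * Real.pi / (q - 1) * (‖h‖ * a ^ (1 - q)))
        + C * (4 * Real.pi * (‖h‖ * a ^ (1 - q))) + C * (4 * Real.pi * (‖h‖ * a ^ (1 - q))) := by
    calc _ ≤ ∫ v, (D v + N v + N (v + h)) := by
          refine abs_integral_le_of_abs_le ((hDi.add hNi).add (hNi.comp_add_right h)) fun v => ?_
          rw [abs_mul]
          exact (mul_le_of_le_one_right (abs_nonneg _) (Real.abs_cos_le_one _)).trans (hpt v)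
      _ = (∫ v, D v) + (∫ v, N v) + ∫ v, N (v + h) := by
          rw [← integral_add hDi hNi]
          exact integral_add (hDi.add hNi) (hNi.comp_add_right h)
      _ ≤ _ := by
          rw [integral_add_right_eq_self N h]
          linarith
  rw [← h2I, abs_mul, abs_two, hnh] at hfin
  have e : C * (2 * Real.pi / (q - 1) * (Real.pi / ‖η‖ * a ^ (1 - q)))
        + C * (4 * Real.pi * (Real.pi / ‖η‖ * a ^ (1 - q)))
        + C * (4 * Real.pi * (Real.pi / ‖η‖ * a ^ (1 - q)))
      = 2 * (C * (Real.pi ^ 2 * (1 / (q - 1) + 4)) * (a ^ (1 - q) / ‖η‖)) := by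
    field_simp; ring
  linarith

/-- The Hessian of the continuum symbol. -/
def hessInt (α : ℝ) (i j : Fin 2) (R : ℝ) (η : Plane) : ℝ :=
  ∫ v in Metric.ball (0 : Plane) R, momentKernel α i j v * Real.cos (inner ℝ η v)

lemma measurable_momentKernel (α : ℝ) (i j : Fin 2) : Measurable (momentKernel α i j) := by
  unfold momentKernel
  fun_prop

lemma five_inv_rpow {u e : ℝ} (hu : 0 < u) : (5 / u) ^ e = 5 ^ e * u ^ (-e) := by
  rw [Real.div_rpow (by norm_num) hu.le, Real.rpow_neg hu.le]; rfl

/-- Inside the radius 5/|η| the size |v|^{-α} is integrated; outside, the oscillation is used.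
Uniformity in R matters, since R = nM grows while η stays in a fixed square. -/
lemma exists_hessInt_le {α : ℝ} (hα₁ : 1 < α) (hα₂ : α < 2) (i j : Fin 2) :
    ∃ C, 0 ≤ C ∧ ∀ (R : ℝ) (η : Plane), η ≠ 0 → |hessInt α i j R η| ≤ C * ‖η‖ ^ (α - 2) := by
  obtain ⟨C, hC0, hK⟩ := exists_kernelBound_moment α i j
  have hm := measurable_momentKernel α i j
  have h2α : 0 < 2 - α := by linarith
  have hα1 : 0 < α - 1 := by linarith
  have hπ := Real.pi_pos
  refine ⟨C * (2 * Real.pi / (2 - α) * 5 ^ (2 - α))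
    + C * (Real.pi ^ 2 * (1 / (α - 1) + 4)) * 5 ^ (1 - α), by positivity, fun R η hη => ?_⟩
  have hη0 : 0 < ‖η‖ := norm_pos_iff.2 hη
  set a := 5 / ‖η‖ with ha
  have ha0 : 0 < a := by positivity
  have hsplit : Metric.ball (0 : Plane) R = Metric.ball 0 (min a R) ∪ annulus a R := by
    ext v
    simp only [Set.mem_union, mem_annulus, Metric.mem_ball, dist_zero_right, lt_min_iff]
    constructor
    · intro h
      rcases lt_or_ge ‖v‖ a with h1 | h1
      · exact Or.inl ⟨h1, h⟩
      · exact Or.inr ⟨h1, h⟩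
    · rintro (h | h)
      · exact h.2
      · exact h.2
  have hdisj : Disjoint (Metric.ball (0 : Plane) (min a R)) (annulus a R) := by
    rw [Set.disjoint_left]
    intro v h1 h2
    simp only [Metric.mem_ball, dist_zero_right, lt_min_iff] at h1
    have := (mem_annulus.1 h2).1
    linarith
  have i1 : IntegrableOn (fun v => momentKernel α i j v * Real.cos (inner ℝ η v))
      (Metric.ball 0 (min a R)) := integrableOn_mul_cos (hK.integrableOn_ball hm hα₂ _) η
  have i2 : IntegrableOn (fun v => momentKernel α i j v * Real.cos (inner ℝ η v))
      (annulus a R) := integrableOn_mul_cos (hK.integrableOn_annulus hm ha0 _) η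
  rw [hessInt, hsplit, setIntegral_union hdisj (measurableSet_annulus _ _) i1 i2]
  refine (abs_add_le _ _).trans ?_
  rw [add_mul]
  refine add_le_add ?_ ?_
  · calc |∫ v in Metric.ball 0 (min a R), momentKernel α i j v * Real.cos (inner ℝ η v)|
        ≤ ∫ v in Metric.ball (0 : Plane) (min a R), C * ‖v‖ ^ (-α) := by
          refine abs_integral_le_of_abs_le ((integrableOn_ball_rpow hα₂ _).const_mul C)
            fun v => ?_
          rw [abs_mul]
          exact (mul_le_of_le_one_right (abs_nonneg _) (Real.abs_cos_le_one _)).trans (hK.size v)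
      _ ≤ ∫ v in Metric.ball (0 : Plane) a, C * ‖v‖ ^ (-α) :=
          setIntegral_mono_set ((integrableOn_ball_rpow hα₂ _).const_mul C)
            (Eventually.of_forall fun v => by positivity)
            (LE.le.eventuallyLE (Metric.ball_subset_ball (min_le_left _ _)))
      _ = C * (2 * Real.pi / (2 - α) * 5 ^ (2 - α)) * ‖η‖ ^ (α - 2) := by
          rw [integral_const_mul, integral_ball_rpow hα₂ ha0.le, ha, five_inv_rpow hη0, neg_sub]
          ring
  · refine (hK.abs_integral_annulus_mul_cos_le hm hα₁ hC0 hη le_rfl R).trans (le_of_eq ?_)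
    have e : ‖η‖ ^ (α - 2) = ‖η‖ ^ (α - 1) / ‖η‖ := by
      rw [← Real.rpow_sub_one hη0.ne']; congr 1; ring
    rw [five_inv_rpow hη0, neg_sub, e]
    ring

/-- The Fourier transform of the unit cell. -/
def cellFourier (η : Plane) : ℝ := ∫ w in unitCell, Real.cos (inner ℝ η w)

/-- By reflection the integrand may be replaced by a product of two cosines, both nonnegative since
|η_i w_i| ≤ π/2. On the concentric square of area 1/4 the product is at least 1/2. The bound allows
division by `cellFourier` in `KernelBound.exists_far_cells_le`. -/
lemma cellFourier_ge {η : Plane} (hη : ∀ i, |η i| ≤ Real.pi) : 1 / 8 ≤ cellFourier η := by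
  have hπ := Real.pi_pos
  have hprod : cellFourier η = ∫ w in unitCell, Real.cos (η 0 * w 0) * Real.cos (η 1 * w 1) := by
    have i1 : IntegrableOn (fun w : Plane => Real.cos (η 0 * w 0 + η 1 * w 1)) unitCell :=
      integrableOn_unitCell_of_continuous (by fun_prop)
    have i2 : IntegrableOn (fun w : Plane => Real.cos (η 0 * -w 0 + η 1 * w 1)) unitCell :=
      integrableOn_unitCell_of_continuous (by fun_prop)
    have h1 := setIntegral_comp_iso flipIso flipIso_mem_unitCell
      (fun w => Real.cos (η 0 * w 0 + η 1 * w 1))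
    simp only [flipIso_zero, flipIso_one] at h1
    have h2 : ∫ w in unitCell, Real.cos (η 0 * w 0) * Real.cos (η 1 * w 1)
        = 1 / 2 * ∫ w in unitCell, (Real.cos (η 0 * w 0 + η 1 * w 1)
          + Real.cos (η 0 * -w 0 + η 1 * w 1)) := by
      rw [← integral_const_mul]
      congr 1; ext w
      rw [Real.cos_add, Real.cos_add, mul_neg, Real.cos_neg, Real.sin_neg]; ring
    rw [h2, integral_add i1 i2, h1, cellFourier]
    simp only [plane_inner]
    ring
  have hcos : ∀ (i : Fin 2) (w : Plane) (b : ℝ), 0 ≤ b → b ≤ 1 / 2 → |w i| ≤ b →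
      Real.cos (Real.pi * b) ≤ Real.cos (η i * w i) := by
    intro i w b hb0 hb hw
    rw [← Real.cos_abs (η i * w i)]
    refine Real.cos_le_cos_of_nonneg_of_le_pi (abs_nonneg _) (by nlinarith) ?_
    rw [abs_mul]
    exact mul_le_mul (hη i) hw (abs_nonneg _) hπ.le
  set Q : Set Plane := (fun v : Plane => (2 : ℝ) • v) ⁻¹' unitCell with hQ
  have hQmem : ∀ w ∈ Q, ∀ i, |w i| ≤ 1 / 4 := by
    intro w hw i
    have := hw i
    simp only [PiLp.smul_apply, smul_eq_mul, abs_mul, abs_two] at this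
    linarith
  have hQsub : Q ⊆ unitCell := fun w hw i => (hQmem w hw i).trans (by norm_num)
  have hQm : MeasurableSet Q := measurableSet_unitCell.preimage (by fun_prop)
  have hQv : volume.real Q = 1 / 4 := by
    rw [Measure.real, hQ, Measure.addHaar_preimage_smul volume (by norm_num), volume_unitCell]
    simp; norm_num
  have hci : IntegrableOn (fun w : Plane => Real.cos (η 0 * w 0) * Real.cos (η 1 * w 1))
      unitCell := integrableOn_unitCell_of_continuous (by fun_prop)
  rw [hprod]
  calc (1 / 8 : ℝ) = ∫ w in Q, (1 / 2 : ℝ) := by rw [setIntegral_const, hQv]; norm_num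
    _ ≤ ∫ w in Q, Real.cos (η 0 * w 0) * Real.cos (η 1 * w 1) := by
        refine setIntegral_mono_on (integrableOn_const ?_) (hci.mono_set hQsub) hQm fun w hw => ?_
        · exact ((measure_mono hQsub).trans_lt (by simp [volume_unitCell])).ne
        · have h0 := hcos 0 w (1 / 4) (by norm_num) (by norm_num) (hQmem w hw 0)
          have h1 := hcos 1 w (1 / 4) (by norm_num) (by norm_num) (hQmem w hw 1)
          rw [show Real.pi * (1 / 4) = Real.pi / 4 by ring, Real.cos_pi_div_four] at h0 h1
          have h2 : (Real.sqrt 2 / 2) * (Real.sqrt 2 / 2) = 1 / 2 := by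
            have := Real.mul_self_sqrt (show (0 : ℝ) ≤ 2 by norm_num)
            linarith
          rw [← h2]
          exact mul_le_mul h0 h1 (by positivity) (le_trans (by positivity) h0)
    _ ≤ _ := by
        refine setIntegral_mono_set hci ?_ (LE.le.eventuallyLE hQsub)
        refine (ae_restrict_iff' measurableSet_unitCell).2 (Eventually.of_forall fun w hw => ?_)
        have h0 := hcos 0 w (1 / 2) (by norm_num) le_rfl (hw 0)
        have h1 := hcos 1 w (1 / 2) (by norm_num) le_rfl (hw 1)
        rw [show Real.pi * (1 / 2) = Real.pi / 2 by ring, Real.cos_pi_div_two] at h0 h1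
        exact mul_nonneg h0 h1

lemma one_sub_cos_le (t : ℝ) : 1 - Real.cos t ≤ t ^ 2 / 2 := by
  have := Real.one_sub_sq_div_two_le_cos (x := t)
  linarith

lemma abs_inner_le (η v : Plane) : |inner ℝ η v| ≤ ‖η‖ * ‖v‖ := abs_real_inner_le_norm η v

lemma inner_sq_le (η v : Plane) : (inner ℝ η v) ^ 2 ≤ ‖η‖ ^ 2 * ‖v‖ ^ 2 := by
  rw [← sq_abs, ← mul_pow]
  gcongr
  exact abs_inner_le η v

lemma abs_cos_sub_one_le (η v : Plane) :
    |Real.cos (inner ℝ η v) - 1| ≤ ‖η‖ ^ 2 * ‖v‖ ^ 2 / 2 := by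
  rw [abs_sub_comm, abs_of_nonneg (by linarith [Real.cos_le_one (inner ℝ η v)])]
  refine (one_sub_cos_le _).trans ?_
  have := inner_sq_le η v
  linarith

lemma abs_one_sub_cellFourier_le (η : Plane) : |1 - cellFourier η| ≤ ‖η‖ ^ 2 / 4 := by
  have i1 : IntegrableOn (fun w : Plane => Real.cos (inner ℝ η w)) unitCell :=
    integrableOn_unitCell_of_continuous (by fun_prop)
  have h1 : cellFourier η - 1 = ∫ w in unitCell, (Real.cos (inner ℝ η w) - 1) := by
    rw [integral_sub i1 (integrableOn_const (by simp [volume_unitCell]))]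
    simp [cellFourier, volume_real_unitCell]
  rw [abs_sub_comm, h1]
  have := norm_setIntegral_le_of_norm_le_const (μ := volume) (s := unitCell) (C := ‖η‖ ^ 2 / 4)
    (f := fun w => Real.cos (inner ℝ η w) - 1) (by simp [volume_unitCell]) (fun w hw => by
      refine (abs_cos_sub_one_le η w).trans ?_
      have := norm_sq_le_of_mem_unitCell hw
      nlinarith [sq_nonneg ‖η‖])
  simpa [volume_real_unitCell] using this

/-! ### Comparison of the discrete and continuum Hessians -/

lemma abs_cos_sub_cos_le_mul (x y : ℝ) :
    |Real.cos x - Real.cos y| ≤ |x + y| * |x - y| / 2 := by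
  rw [Real.cos_sub_cos, abs_mul, abs_mul, abs_neg, abs_two]
  have h1 := Real.abs_sin_le_abs (x := (x + y) / 2)
  have h2 := Real.abs_sin_le_abs (x := (x - y) / 2)
  rw [abs_div, abs_two] at h1 h2
  have := mul_le_mul h1 h2 (abs_nonneg _) (by positivity)
  nlinarith

section Kernel

variable {α C : ℝ} {K : Plane → ℝ} {z : Fin 2 → ℤ}

lemma KernelBound.abs_le_of_mem_intCell (hK : KernelBound α C K) (hC : 0 ≤ C) (hz : z ≠ 0)
    {v : Plane} (hv : v ∈ intCell z) : |K v| ≤ 2 * C * ‖intPt z‖ ^ (-α) := by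
  have h1 := hK.abs_sub_le_of_mem_intCell hC hz hv
  have h2 := hK.size (intPt z)
  have h3 : |K v| ≤ |K (intPt z)| + |K v - K (intPt z)| := by
    simpa using abs_add_le (K (intPt z)) (K v - K (intPt z))
  have h4 : ‖intPt z‖ ^ (-α - 1) ≤ ‖intPt z‖ ^ (-α) :=
    Real.rpow_le_rpow_of_exponent_le (one_le_norm_intPt hz) (by linarith)
  nlinarith

/-- Writing the difference as a product of sines keeps two factors of η, at the cost of one factor
|z|. -/
lemma abs_cos_sub_cos_cell_le (η : Plane) (hz : z ≠ 0) {v : Plane} (hv : v ∈ intCell z) :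
    |Real.cos (inner ℝ η v) - Real.cos (inner ℝ η (intPt z))| ≤ 2 * ‖η‖ ^ 2 * ‖intPt z‖ := by
  refine (abs_cos_sub_cos_le_mul _ _).trans ?_
  rw [← inner_add_right, ← inner_sub_right]
  have h1 := abs_inner_le η (v + intPt z)
  have h2 := abs_inner_le η (v - intPt z)
  have h3 := norm_sub_le_of_mem_intCell hv
  have h4 := norm_add_le v (intPt z)
  have h5 := norm_le_add_of_mem_intCell hv
  have h6 := one_le_norm_intPt hz
  have h7 : ‖v + intPt z‖ ≤ 3 * ‖intPt z‖ := by linarith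
  have h8 := mul_le_mul h1 h2 (abs_nonneg _) (by positivity)
  have h9 : ‖v + intPt z‖ * ‖v - intPt z‖ ≤ 3 * ‖intPt z‖ * (3 / 4) :=
    mul_le_mul h7 h3 (norm_nonneg _) (by positivity)
  nlinarith [mul_le_mul_of_nonneg_left h9 (sq_nonneg ‖η‖),
    mul_nonneg (sq_nonneg ‖η‖) (norm_nonneg (intPt z))]

lemma rpow_cell_relations (α : ℝ) {ρ : ℝ} (hρ : 0 < ρ) :
    ρ ^ (-α) = ρ ^ (-(α - 1)) / ρ ∧ ρ ^ (-α - 1) = ρ ^ (-α) / ρ ∧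
      ρ ^ (-α - 2) = ρ ^ (-α) / ρ ^ 2 := by
  refine ⟨?_, ?_, ?_⟩
  · rw [← Real.rpow_sub_one hρ.ne']; congr 1; ring
  · rw [← Real.rpow_sub_one hρ.ne']
  · rw [Real.rpow_sub hρ, Real.rpow_two]

/-- For cells cut by the circle of radius R, at low frequency: quadratic in η, first order in the
kernel. -/
lemma KernelBound.sub_cell_le_sq (hK : KernelBound α C K) (hC : 0 ≤ C) (η : Plane) (hz : z ≠ 0)
    {v : Plane} (hv : v ∈ intCell z) :
    |K v * (Real.cos (inner ℝ η v) - 1)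
        - K (intPt z) * (Real.cos (inner ℝ η (intPt z)) - 1)|
      ≤ 5 * C * ‖η‖ ^ 2 * ‖intPt z‖ ^ (-(α - 1)) := by
  have hρ := norm_intPt_pos hz
  obtain ⟨e1, e2, -⟩ := rpow_cell_relations α hρ
  have h1 := hK.abs_sub_le_of_mem_intCell hC hz hv
  have h2 := hK.abs_le_of_mem_intCell hC hz hv
  have h3 := abs_cos_sub_cos_cell_le η hz hv
  have h4 := abs_cos_sub_one_le η (intPt z)
  have e : K v * (Real.cos (inner ℝ η v) - 1)
      - K (intPt z) * (Real.cos (inner ℝ η (intPt z)) - 1)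
      = (K v - K (intPt z)) * (Real.cos (inner ℝ η (intPt z)) - 1)
        + K v * (Real.cos (inner ℝ η v) - Real.cos (inner ℝ η (intPt z))) := by ring
  rw [e]
  refine (abs_add_le _ _).trans ?_
  rw [abs_mul, abs_mul]
  refine (add_le_add (mul_le_mul h1 h4 (abs_nonneg _) (by positivity))
    (mul_le_mul h2 h3 (abs_nonneg _) (by positivity))).trans ?_
  rw [e2, e1]
  have : 0 ≤ C * ‖η‖ ^ 2 * ‖intPt z‖ ^ (-(α - 1)) := by positivity
  field_simp
  nlinarith

/-- For cells cut by the circle when R|η| ≥ 1, where the boundedness of the cosine is better than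
its smallness. -/
lemma KernelBound.sub_cell_le_lin (hK : KernelBound α C K) (hC : 0 ≤ C) (η : Plane) (hz : z ≠ 0)
    {v : Plane} (hv : v ∈ intCell z) :
    |K v * (Real.cos (inner ℝ η v) - 1)
        - K (intPt z) * (Real.cos (inner ℝ η (intPt z)) - 1)|
      ≤ 2 * C * ‖intPt z‖ ^ (-(α + 1)) + 2 * C * ‖η‖ * ‖intPt z‖ ^ (-α) := by
  have h1 := hK.abs_sub_le_of_mem_intCell hC hz hv
  have h2 := hK.abs_le_of_mem_intCell hC hz hv
  have h3 : |Real.cos (inner ℝ η v) - Real.cos (inner ℝ η (intPt z))| ≤ ‖η‖ := by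
    refine (Real.abs_cos_sub_cos_le _ _).trans ?_
    rw [← inner_sub_right]
    have := norm_sub_le_of_mem_intCell hv
    refine (abs_inner_le _ _).trans (mul_le_of_le_one_right (norm_nonneg _) (by linarith))
  have h4 : |Real.cos (inner ℝ η (intPt z)) - 1| ≤ 2 := by
    have := Real.neg_one_le_cos (inner ℝ η (intPt z))
    have := Real.cos_le_one (inner ℝ η (intPt z))
    exact abs_le.2 ⟨by linarith, by linarith⟩
  have e : K v * (Real.cos (inner ℝ η v) - 1)
      - K (intPt z) * (Real.cos (inner ℝ η (intPt z)) - 1)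
      = (K v - K (intPt z)) * (Real.cos (inner ℝ η (intPt z)) - 1)
        + K v * (Real.cos (inner ℝ η v) - Real.cos (inner ℝ η (intPt z))) := by ring
  rw [e]
  refine (abs_add_le _ _).trans ?_
  rw [abs_mul, abs_mul]
  refine (add_le_add (mul_le_mul h1 h4 (abs_nonneg _) (by positivity))
    (mul_le_mul h2 h3 (abs_nonneg _) (by positivity))).trans ?_
  rw [show -(α + 1) = -α - 1 by ring]
  apply le_of_eq; ring

/-- A discrete Leibniz rule: in each of the four terms the differences falling on the kernel and on
the cosine together leave |η|²|z|^{-α}. -/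
lemma KernelBound.second_cell_le (hK : KernelBound α C K) (hC : 0 ≤ C) (η : Plane) (hz : z ≠ 0)
    {w : Plane} (hw : w ∈ unitCell) :
    |K (intPt z + w) * (Real.cos (inner ℝ η (intPt z + w)) - 1)
        + K (intPt z - w) * (Real.cos (inner ℝ η (intPt z - w)) - 1)
        - 2 * (K (intPt z) * (Real.cos (inner ℝ η (intPt z)) - 1))|
      ≤ 6 * C * ‖η‖ ^ 2 * ‖intPt z‖ ^ (-α) := by
  have hρ := norm_intPt_pos hz
  obtain ⟨-, e2, e3⟩ := rpow_cell_relations α hρ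
  have hp : intPt z + w ∈ intCell z := by simpa [intCell] using hw
  have hm : intPt z - w ∈ intCell z := by
    change intPt z - w - intPt z ∈ unitCell
    rw [sub_sub_cancel_left, neg_mem_unitCell]; exact hw
  have s0 := hK.abs_second_le hC hz hw
  have a1 := hK.abs_sub_le_of_mem_intCell hC hz hp
  have a2 := hK.abs_sub_le_of_mem_intCell hC hz hm
  have c1 := abs_cos_sub_cos_cell_le η hz hp
  have c2 := abs_cos_sub_cos_cell_le η hz hm
  set ζ := intPt z
  have c0 := abs_cos_sub_one_le η ζ
  have k0 := hK.size ζ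
  have c3 : |Real.cos (inner ℝ η (ζ + w)) + Real.cos (inner ℝ η (ζ - w))
      - 2 * Real.cos (inner ℝ η ζ)| ≤ ‖η‖ ^ 2 := by
    rw [inner_add_right, inner_sub_right, Real.cos_add, Real.cos_sub]
    rw [show Real.cos (inner ℝ η ζ) * Real.cos (inner ℝ η w)
        - Real.sin (inner ℝ η ζ) * Real.sin (inner ℝ η w)
        + (Real.cos (inner ℝ η ζ) * Real.cos (inner ℝ η w)
        + Real.sin (inner ℝ η ζ) * Real.sin (inner ℝ η w)) - 2 * Real.cos (inner ℝ η ζ)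
        = 2 * (Real.cos (inner ℝ η ζ) * (Real.cos (inner ℝ η w) - 1)) by ring, abs_mul, abs_mul,
        abs_two]
    have h1 := abs_cos_sub_one_le η w
    have h2 := norm_sq_le_of_mem_unitCell hw
    have h3 := mul_le_mul (Real.abs_cos_le_one (inner ℝ η ζ)) h1 (abs_nonneg _) zero_le_one
    nlinarith [sq_nonneg ‖η‖]
  have e : K (ζ + w) * (Real.cos (inner ℝ η (ζ + w)) - 1)
        + K (ζ - w) * (Real.cos (inner ℝ η (ζ - w)) - 1)
        - 2 * (K ζ * (Real.cos (inner ℝ η ζ) - 1))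
      = (K (ζ + w) + K (ζ - w) - 2 * K ζ) * (Real.cos (inner ℝ η ζ) - 1)
        + K ζ * (Real.cos (inner ℝ η (ζ + w)) + Real.cos (inner ℝ η (ζ - w))
            - 2 * Real.cos (inner ℝ η ζ))
        + (K (ζ + w) - K ζ) * (Real.cos (inner ℝ η (ζ + w)) - Real.cos (inner ℝ η ζ))
        + (K (ζ - w) - K ζ) * (Real.cos (inner ℝ η (ζ - w)) - Real.cos (inner ℝ η ζ)) := by ring
  rw [e]
  refine (abs_add_le _ _).trans ((add_le_add_left ((abs_add_le _ _).trans
    (add_le_add_left (abs_add_le _ _) _)) _).trans ?_)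
  rw [abs_mul, abs_mul, abs_mul, abs_mul]
  refine (add_le_add (add_le_add (add_le_add (mul_le_mul s0 c0 (abs_nonneg _) (by positivity))
    (mul_le_mul k0 c3 (abs_nonneg _) (by positivity)))
    (mul_le_mul a1 c1 (abs_nonneg _) (by positivity)))
    (mul_le_mul a2 c2 (abs_nonneg _) (by positivity))).trans ?_
  rw [e2, e3]
  have : 0 ≤ C * ‖η‖ ^ 2 * ‖ζ‖ ^ (-α) := by positivity
  field_simp
  nlinarith

/-- The mean over a cell of an oscillating kernel factors up to a small error. -/
lemma KernelBound.cell_mul_cos_sub_le (hK : KernelBound α C K) (hm : Measurable K) (hC : 0 ≤ C)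
    (η : Plane) (hz : z ≠ 0) :
    |(∫ v in intCell z, K v * Real.cos (inner ℝ η v))
        - cellFourier η * (K (intPt z) * Real.cos (inner ℝ η (intPt z)))|
      ≤ C * ‖intPt z‖ ^ (-(α + 2)) + C * ‖η‖ * ‖intPt z‖ ^ (-(α + 1)) := by
  have hKi := hK.integrableOn_intCell hm hz
  have hKc := (TruncatedStable.integrableOn_intCell z _).1 (integrableOn_mul_cos hKi η)
  set ζ := intPt z with hζ
  have hci : IntegrableOn (fun w : Plane => Real.cos (inner ℝ η w)) unitCell :=
    integrableOn_unitCell_of_continuous (by fun_prop)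
  have hgi := hKc.sub (hci.mul_const (K ζ * Real.cos (inner ℝ η ζ)))
  have hgi' : IntegrableOn (fun w => K (ζ + -w) * Real.cos (inner ℝ η (ζ + -w))
      - Real.cos (inner ℝ η (-w)) * (K ζ * Real.cos (inner ℝ η ζ))) unitCell := by
    have hpre : (fun w : Plane => -w) ⁻¹' unitCell = unitCell := by
      ext w; exact neg_mem_unitCell
    have := ((Measure.measurePreserving_neg (volume : Measure Plane)).integrableOn_comp_preimage
      (MeasurableEquiv.neg Plane).measurableEmbedding
      (f := fun w => K (ζ + w) * Real.cos (inner ℝ η (ζ + w))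
        - Real.cos (inner ℝ η w) * (K ζ * Real.cos (inner ℝ η ζ)))
      (s := unitCell)).2 hgi
    rw [hpre] at this
    exact this
  have e1 := setIntegral_unitCell_neg (fun w => K (ζ + w) * Real.cos (inner ℝ η (ζ + w))
    - Real.cos (inner ℝ η w) * (K ζ * Real.cos (inner ℝ η ζ)))
  have e0 : (∫ v in intCell z, K v * Real.cos (inner ℝ η v))
        - cellFourier η * (K ζ * Real.cos (inner ℝ η ζ))
      = ∫ w in unitCell, (K (ζ + w) * Real.cos (inner ℝ η (ζ + w))
        - Real.cos (inner ℝ η w) * (K ζ * Real.cos (inner ℝ η ζ))) := by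
    rw [setIntegral_intCell, cellFourier, integral_sub hKc (hci.mul_const _), integral_mul_const]
  -- Symmetrisation in w and the addition formulas leave a second difference of the kernel with a
  -- product of cosines, and a first difference with a product of sines; sin(η·w) supplies the
  -- factor |η|.
  have e2 : 2 * ((∫ v in intCell z, K v * Real.cos (inner ℝ η v))
        - cellFourier η * (K ζ * Real.cos (inner ℝ η ζ)))
      = ∫ w in unitCell, ((K (ζ + w) + K (ζ - w) - 2 * K ζ) *
          (Real.cos (inner ℝ η ζ) * Real.cos (inner ℝ η w))
        - (K (ζ + w) - K (ζ - w)) * (Real.sin (inner ℝ η ζ) * Real.sin (inner ℝ η w))) := by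
    rw [e0, two_mul]
    nth_rewrite 2 [← e1]
    refine (integral_add hgi hgi').symm.trans ?_
    congr 1; ext w
    simp only [Pi.sub_apply, ← sub_eq_add_neg ζ w, inner_neg_right, Real.cos_neg,
      inner_add_right, inner_sub_right, Real.cos_add, Real.cos_sub]
    ring
  have e3 := norm_setIntegral_le_of_norm_le_const (μ := volume) (s := unitCell)
    (C := 2 * (C * ‖ζ‖ ^ (-(α + 2)) + C * ‖η‖ * ‖ζ‖ ^ (-(α + 1))))
    (f := fun w => (K (ζ + w) + K (ζ - w) - 2 * K ζ) *
          (Real.cos (inner ℝ η ζ) * Real.cos (inner ℝ η w))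
        - (K (ζ + w) - K (ζ - w)) * (Real.sin (inner ℝ η ζ) * Real.sin (inner ℝ η w)))
    (by simp [volume_unitCell]) (fun w hw => by
      have hp : ζ + w ∈ intCell z := by simpa [intCell, ζ] using hw
      have hm : ζ - w ∈ intCell z := by
        change ζ - w - intPt z ∈ unitCell
        rw [sub_sub_cancel_left, neg_mem_unitCell]; exact hw
      have s0 := hK.abs_second_le hC hz hw
      have a1 := hK.abs_sub_le_of_mem_intCell hC hz hp
      have a2 := hK.abs_sub_le_of_mem_intCell hC hz hm
      rw [← hζ] at s0 a1 a2
      have a3 : |K (ζ + w) - K (ζ - w)| ≤ 2 * (C * ‖ζ‖ ^ (-α - 1)) := by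
        have := abs_sub (K (ζ + w) - K ζ) (K (ζ - w) - K ζ)
        rw [sub_sub_sub_cancel_right] at this
        linarith
      have c1 : |Real.cos (inner ℝ η ζ) * Real.cos (inner ℝ η w)| ≤ 1 := by
        rw [abs_mul]
        exact mul_le_one₀ (Real.abs_cos_le_one _) (abs_nonneg _) (Real.abs_cos_le_one _)
      have c2 : |Real.sin (inner ℝ η ζ) * Real.sin (inner ℝ η w)| ≤ ‖η‖ := by
        rw [abs_mul]
        have h1 := (Real.abs_sin_le_abs (x := inner ℝ η w)).trans (abs_inner_le η w)
        have h2 := norm_le_of_mem_unitCell hw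
        have h3 := mul_le_mul (Real.abs_sin_le_one (inner ℝ η ζ)) h1 (abs_nonneg _) zero_le_one
        nlinarith [norm_nonneg η]
      rw [Real.norm_eq_abs]
      refine (abs_sub _ _).trans ?_
      rw [abs_mul (K (ζ + w) + K (ζ - w) - 2 * K ζ), abs_mul (K (ζ + w) - K (ζ - w))]
      refine (add_le_add (mul_le_mul s0 c1 (abs_nonneg _) (by positivity))
        (mul_le_mul a3 c2 (abs_nonneg _) (by positivity))).trans ?_
      rw [show -(α + 2) = -α - 2 by ring, show -(α + 1) = -α - 1 by ring]
      have : 0 ≤ C * ‖ζ‖ ^ (-α - 2) := by positivity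
      linarith)
  rw [volume_real_unitCell, mul_one, Real.norm_eq_abs, ← e2, abs_mul, abs_two] at e3
  linarith

end Kernel

lemma mul_rpow_mul_sq {R u α : ℝ} (hR : 0 < R) (hu : 0 < u) :
    R ^ (2 - α) * u ^ 2 = (R * u) ^ (2 - α) * u ^ α := by
  rw [Real.mul_rpow hR.le hu.le, mul_assoc, ← Real.rpow_add hu, ← Real.rpow_two]
  congr 2; ring

lemma inv_rpow_two_sub {u α : ℝ} (hu : 0 < u) : (1 / u) ^ (2 - α) = u ^ (α - 2) := by
  rw [one_div, Real.inv_rpow hu.le, ← Real.rpow_neg hu.le]; congr 1; ring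

lemma setIntegral_ball_eq_sum {R ρ : ℝ} (hρ : R + 1 ≤ ρ) (hR : 0 ≤ R) {g : Plane → ℝ}
    (hg : IntegrableOn g (Metric.ball 0 R)) :
    ∫ v in Metric.ball 0 R, g v = (∫ v in intCell 0 ∩ Metric.ball 0 R, g v) +
      ∑ z ∈ latPunct ρ, ∫ v in intCell z ∩ Metric.ball 0 R, g v := by
  rw [setIntegral_eq_sum_cells measurableSet_ball hg (latDisk ρ), latPunct]
  · refine (Finset.add_sum_erase _ _ ?_).symm
    rw [mem_latDisk]; simp; linarith
  · intro v hv
    simp only [Metric.mem_ball, dist_zero_right] at hv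
    have := mem_latDisk.1 (roundPt_mem_latDisk hv.le)
    exact mem_latDisk.2 (this.trans hρ)

lemma intCell_subset_ball {R : ℝ} {z : Fin 2 → ℤ} (hz : ‖intPt z‖ ≤ R - 1) :
    intCell z ⊆ Metric.ball 0 R := by
  intro v hv
  have := norm_le_add_of_mem_intCell hv
  simp only [Metric.mem_ball, dist_zero_right]
  linarith

lemma intCell_inter_ball {R : ℝ} {z : Fin 2 → ℤ} (hz : ‖intPt z‖ ≤ R - 1) :
    intCell z ∩ Metric.ball 0 R = intCell z :=
  Set.inter_eq_left.2 (intCell_subset_ball hz)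

lemma abs_sum_le_mul_sum {Z : Finset (Fin 2 → ℤ)} {f h : (Fin 2 → ℤ) → ℝ} {c B : ℝ}
    (hf : ∀ z ∈ Z, |f z| ≤ c * h z) (hc : 0 ≤ c) (hB : ∑ z ∈ Z, h z ≤ B) :
    |∑ z ∈ Z, f z| ≤ c * B := by
  refine (Finset.abs_sum_le_sum_abs _ _).trans ((Finset.sum_le_sum hf).trans ?_)
  rw [← Finset.mul_sum]
  exact mul_le_mul_of_nonneg_left hB hc

lemma abs_setIntegral_intCell_inter_le {g : Plane → ℝ} {z : Fin 2 → ℤ} {B : ℝ} (hB : 0 ≤ B)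
    {A : Set Plane} (h : ∀ v ∈ intCell z, |g v| ≤ B) : |∫ v in intCell z ∩ A, g v| ≤ B := by
  simpa using abs_setIntegral_inter_sub_le (g := g) (c := 0) hB (A := A) (by simpa using h)

section Kernel

variable {α C : ℝ} {K : Plane → ℝ}

lemma KernelBound.integrableOn_intCell_mul_cos_sub_one (hK : KernelBound α C K) (hm : Measurable K)
    (η : Plane) {z : Fin 2 → ℤ} (hz : z ≠ 0) :
    IntegrableOn (fun v => K v * (Real.cos (inner ℝ η v) - 1)) (intCell z) := by
  have h := hK.integrableOn_intCell hm hz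
  simp only [mul_sub_one]
  exact (integrableOn_mul_cos h η).sub h

/-- The cell errors of `K (cos - 1)`, bounded quadratically in the frequency. -/
lemma KernelBound.exists_sum_cell_le_sq (hK : KernelBound α C K) (hm : Measurable K) (hC : 0 ≤ C)
    (hα₁ : 1 < α) (hα₂ : α < 2) {M : ℝ} (hM : 0 < M) :
    ∃ D, 0 ≤ D ∧ ∀ (R : ℝ) (η : Plane), M ≤ R →
      |∑ z ∈ latPunct (R + 1), ∫ v in intCell z ∩ Metric.ball 0 R,
        (K v * (Real.cos (inner ℝ η v) - 1)
          - K (intPt z) * (Real.cos (inner ℝ η (intPt z)) - 1))| ≤ D * (R ^ (2 - α) * ‖η‖ ^ 2) := by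
  obtain ⟨C₁, hC₁, h₁⟩ := exists_sum_rpow_le_inner (p := α) (by linarith) hα₂
  obtain ⟨C₂, hC₂, h₂⟩ := exists_sum_rpow_le_boundary hM (q := α - 1) (by linarith)
  refine ⟨3 * C * C₁ + 5 * C * C₂, by positivity, fun R η hR => ?_⟩
  rw [← Finset.sum_filter_add_sum_filter_not _ (fun z => ‖intPt z‖ ≤ R - 1)]
  refine (abs_add_le _ _).trans ?_
  have hin : |∑ z ∈ latPunct (R + 1) with ‖intPt z‖ ≤ R - 1, ∫ v in intCell z ∩ Metric.ball 0 R,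
        (K v * (Real.cos (inner ℝ η v) - 1)
          - K (intPt z) * (Real.cos (inner ℝ η (intPt z)) - 1))|
      ≤ 3 * C * ‖η‖ ^ 2 * (C₁ * R ^ (2 - α)) := by
    refine abs_sum_le_mul_sum (h := fun z => ‖intPt z‖ ^ (-α)) (fun z hz => ?_) (by positivity)
      (h₁ R _ (by linarith) fun z hz => ?_)
    · rw [Finset.mem_filter, mem_latPunct] at hz
      rw [intCell_inter_ball hz.2]
      refine (abs_setIntegral_intCell_sub_le
        (hK.integrableOn_intCell_mul_cos_sub_one hm η hz.1.1)
        (fun w hw => hK.second_cell_le hC η hz.1.1 hw)).trans (le_of_eq (by ring))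
    · rw [Finset.mem_filter, mem_latPunct] at hz
      exact ⟨hz.1.1, by linarith⟩
  have hbd : |∑ z ∈ latPunct (R + 1) with ¬ ‖intPt z‖ ≤ R - 1, ∫ v in intCell z ∩ Metric.ball 0 R,
        (K v * (Real.cos (inner ℝ η v) - 1)
          - K (intPt z) * (Real.cos (inner ℝ η (intPt z)) - 1))|
      ≤ 5 * C * ‖η‖ ^ 2 * (C₂ * R ^ (1 - (α - 1))) := by
    refine abs_sum_le_mul_sum (h := fun z => ‖intPt z‖ ^ (-(α - 1))) (fun z hz => ?_)
      (by positivity) (h₂ R _ hR fun z hz => ?_)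
    · rw [Finset.mem_filter, mem_latPunct] at hz
      exact abs_setIntegral_inter_sub_le (by positivity)
        (fun v hv => hK.sub_cell_le_sq hC η hz.1.1 hv)
    · rw [Finset.mem_filter, mem_latPunct] at hz
      exact ⟨hz.1.1, by linarith, hz.1.2⟩
  rw [show 1 - (α - 1) = 2 - α by ring] at hbd
  linarith

/-- Let Y be the sum of the cell integrals of K cos, X the sum of the values at the centres, and s =
`cellFourier η`. Cell by cell Y is close to sX, up to O(|η|^α) in total, and s(Y - X) = -(1-s)Y + (Y
- sX). Since 1 - s = O(|η|²), Y = O(|η|^{α-2}) and s ≥ 1/8, the difference Y - X is O(|η|^α). Thus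
cancellation in the lattice sum is deduced from that in the integral and need not be proved
separately. -/
lemma KernelBound.exists_far_cells_le (hK : KernelBound α C K) (hm : Measurable K) (hC : 0 ≤ C)
    (hα₁ : 1 < α) :
    ∃ D, 0 ≤ D ∧ ∀ (A : ℝ) (η : Plane) (Z : Finset (Fin 2 → ℤ)), 0 ≤ A → η ≠ 0 →
      (∀ i, |η i| ≤ Real.pi) → (∀ z ∈ Z, z ≠ 0 ∧ 1 / ‖η‖ ≤ ‖intPt z‖) →
      |∑ z ∈ Z, ∫ v in intCell z, K v * Real.cos (inner ℝ η v)| ≤ A * ‖η‖ ^ (α - 2) →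
      |∑ z ∈ Z, ∫ v in intCell z, (K v * (Real.cos (inner ℝ η v) - 1)
          - K (intPt z) * (Real.cos (inner ℝ η (intPt z)) - 1))| ≤ (D + 2 * A) * ‖η‖ ^ α := by
  obtain ⟨C₁, hC₁, h₁⟩ := exists_sum_rpow_le_outer (p := α + 2) (by linarith)
  obtain ⟨C₂, hC₂, h₂⟩ := exists_sum_rpow_le_outer (p := α + 1) (by linarith)
  refine ⟨8 * (C * C₁ + C * C₂) + C * C₁, by positivity, fun A η Z hA hη hbox hZ hY => ?_⟩
  have hu : 0 < ‖η‖ := norm_pos_iff.2 hη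
  have hinv : ∀ e : ℝ, (1 / ‖η‖) ^ (-e) = ‖η‖ ^ e := fun e => by
    rw [one_div, Real.inv_rpow hu.le, ← Real.rpow_neg hu.le, neg_neg]
  have S₁ := h₁ (1 / ‖η‖) Z (by positivity) hZ
  have S₂ := h₂ (1 / ‖η‖) Z (by positivity) hZ
  rw [show 2 - (α + 2) = -α by ring, hinv] at S₁
  rw [show 2 - (α + 1) = -(α - 1) by ring, hinv] at S₂
  have hu1 : ‖η‖ * ‖η‖ ^ (α - 1) = ‖η‖ ^ α := by
    rw [mul_comm, ← Real.rpow_add_one hu.ne', sub_add_cancel]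
  have hu2 : ‖η‖ ^ 2 * ‖η‖ ^ (α - 2) = ‖η‖ ^ α := by
    rw [← Real.rpow_two, ← Real.rpow_add hu]; congr 1; ring
  set s := cellFourier η with hs
  set Y := ∑ z ∈ Z, ∫ v in intCell z, K v * Real.cos (inner ℝ η v) with hYd
  set X := ∑ z ∈ Z, K (intPt z) * Real.cos (inner ℝ η (intPt z)) with hX
  set N := ∑ z ∈ Z, ∫ v in intCell z, (K v - K (intPt z)) with hN
  have hint : ∀ z ∈ Z, IntegrableOn K (intCell z) := fun z hz => hK.integrableOn_intCell hm (hZ z hz).1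
  have hsplit : ∑ z ∈ Z, ∫ v in intCell z, (K v * (Real.cos (inner ℝ η v) - 1)
          - K (intPt z) * (Real.cos (inner ℝ η (intPt z)) - 1)) = (Y - X) - N := by
    rw [hYd, hX, hN, ← Finset.sum_sub_distrib, ← Finset.sum_sub_distrib]
    refine Finset.sum_congr rfl fun z hz => ?_
    have hv : volume.real (intCell z) = 1 := by simp [Measure.real, volume_intCell]
    have hc : ∀ c : ℝ, IntegrableOn (fun _ : Plane => c) (intCell z) := fun c =>
      integrableOn_const (by simp [volume_intCell])
    have i1 := integrableOn_mul_cos (hint z hz) η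
    have e1 : ∫ v in intCell z, (K v - K (intPt z)) = (∫ v in intCell z, K v) - K (intPt z) := by
      rw [integral_sub (hint z hz) (hc _)]; simp [hv]
    have e2 : ∫ v in intCell z, (K v * (Real.cos (inner ℝ η v) - 1)
          - K (intPt z) * (Real.cos (inner ℝ η (intPt z)) - 1))
        = (∫ v in intCell z, K v * Real.cos (inner ℝ η v)) - (∫ v in intCell z, K v)
          - K (intPt z) * (Real.cos (inner ℝ η (intPt z)) - 1) := by
      simp only [mul_sub_one]
      have i2 : IntegrableOn (fun v => K v * Real.cos (inner ℝ η v) - K v) (intCell z) :=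
        i1.sub (hint z hz)
      rw [integral_sub i2 (hc _), integral_sub i1 (hint z hz)]
      simp [hv]
    rw [e1, e2]; ring
  have hNle : |N| ≤ C / 2 * (C₁ * ‖η‖ ^ α) := by
    refine abs_sum_le_mul_sum (h := fun z => ‖intPt z‖ ^ (-(α + 2))) (fun z hz => ?_)
      (by positivity) S₁
    refine (abs_setIntegral_intCell_sub_le (hint z hz)
      (fun w hw => hK.abs_second_le hC (hZ z hz).1 hw)).trans (le_of_eq ?_)
    rw [show -(α + 2) = -α - 2 by ring]; ring
  have hErr : |Y - s * X| ≤ (C * C₁ + C * C₂) * ‖η‖ ^ α := by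
    rw [hYd, hX, Finset.mul_sum, ← Finset.sum_sub_distrib]
    refine (Finset.abs_sum_le_sum_abs _ _).trans ((Finset.sum_le_sum fun z hz =>
      hK.cell_mul_cos_sub_le hm hC η (hZ z hz).1).trans ?_)
    rw [Finset.sum_add_distrib, ← Finset.mul_sum, ← Finset.mul_sum]
    have a1 := mul_le_mul_of_nonneg_left S₁ hC
    have a2 := mul_le_mul_of_nonneg_left S₂ (by positivity : 0 ≤ C * ‖η‖)
    have a3 : C * ‖η‖ * (C₂ * ‖η‖ ^ (α - 1)) = C * C₂ * ‖η‖ ^ α := by rw [← hu1]; ring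
    linarith
  have hs8 : 1 / 8 ≤ s := cellFourier_ge hbox
  have hs0 : 0 < s := by linarith
  have hs1 : |1 - s| ≤ ‖η‖ ^ 2 / 4 := abs_one_sub_cellFourier_le η
  have hYX : s * (Y - X) = -((1 - s) * Y) + (Y - s * X) := by ring
  have h5 : s * |Y - X| ≤ (A / 4 + (C * C₁ + C * C₂)) * ‖η‖ ^ α := by
    rw [show s * |Y - X| = |s * (Y - X)| by rw [abs_mul, abs_of_pos hs0], hYX]
    refine (abs_add_le _ _).trans ?_
    rw [abs_neg, abs_mul]
    have := mul_le_mul hs1 hY (abs_nonneg _) (by positivity)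
    have e : ‖η‖ ^ 2 / 4 * (A * ‖η‖ ^ (α - 2)) = A / 4 * ‖η‖ ^ α := by rw [← hu2]; ring
    linarith
  have h6 : |Y - X| ≤ 8 * ((A / 4 + (C * C₁ + C * C₂)) * ‖η‖ ^ α) := by
    have := mul_le_mul_of_nonneg_right hs8 (abs_nonneg (Y - X))
    linarith
  rw [hsplit]
  refine (abs_sub _ _).trans ?_
  have : 0 ≤ C * C₁ * ‖η‖ ^ α := by positivity
  linarith

end Kernel

section Kernel

variable {α C : ℝ} {K : Plane → ℝ}

/-- The cell errors of `K (cos - 1)`, bounded by `‖η‖ ^ α` once `R ‖η‖ ≥ 1`. -/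
lemma KernelBound.exists_sum_cell_le_rpow (hK : KernelBound α C K) (hm : Measurable K) (hC : 0 ≤ C)
    (hα₁ : 1 < α) (hα₂ : α < 2) {M : ℝ} (hM : 0 < M) {H : ℝ} (hH : 0 ≤ H)
    (hosc : ∀ (R : ℝ) (η : Plane), η ≠ 0 →
      |∫ v in Metric.ball 0 R, K v * Real.cos (inner ℝ η v)| ≤ H * ‖η‖ ^ (α - 2)) :
    ∃ D, 0 ≤ D ∧ ∀ (R : ℝ) (η : Plane), M ≤ R → (∀ i, |η i| ≤ Real.pi) → 1 ≤ R * ‖η‖ →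
      |∑ z ∈ latPunct (R + 1), ∫ v in intCell z ∩ Metric.ball 0 R,
        (K v * (Real.cos (inner ℝ η v) - 1)
          - K (intPt z) * (Real.cos (inner ℝ η (intPt z)) - 1))| ≤ D * ‖η‖ ^ α := by
  obtain ⟨C₁, hC₁, h₁⟩ := exists_sum_rpow_le_inner (p := α) (by linarith) hα₂
  obtain ⟨C₂, hC₂, h₂⟩ := exists_sum_rpow_le_boundary hM (q := α + 1) (by linarith)
  obtain ⟨C₃, hC₃, h₃⟩ := exists_sum_rpow_le_boundary hM (q := α) (by linarith)
  obtain ⟨D, hD, hfar⟩ := hK.exists_far_cells_le hm hC hα₁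
  set I := ∫ v in Metric.ball (0 : Plane) 1, C * ‖v‖ ^ (-α) with hI
  have hI0 : 0 ≤ I := integral_nonneg fun v => by positivity
  -- The far cells are what remains of the ball after the central cell, the cut cells and the near
  -- cells are removed; the summands of `A` bound these contributions. The factors of 5 come from
  -- |η| ≤ 5, used to express everything through |η|^{α-2}.
  set A := H + 5 * I + 2 * C * C₁ + 10 * C * C₃ with hA
  have hA0 : 0 ≤ A := by positivity
  refine ⟨(2 * C * C₂ + 2 * C * C₃) + 3 * C * C₁ + (D + 2 * A), by positivity,
    fun R η hR hbox hRu => ?_⟩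
  have hR0 : 0 < R := hM.trans_le hR
  have hu : 0 < ‖η‖ := by
    by_contra h
    have : ‖η‖ = 0 := le_antisymm (not_lt.1 h) (norm_nonneg _)
    rw [this, mul_zero] at hRu; linarith
  have hη : η ≠ 0 := norm_pos_iff.1 hu
  have hu5 : ‖η‖ ≤ 5 := by
    have h0 := hbox 0
    have h1 := hbox 1
    have := plane_norm_sq η
    have h2 := Real.pi_lt_d2
    have a0 : η 0 ^ 2 ≤ 3.15 ^ 2 := by rw [sq_le_sq]; rw [abs_of_pos (by norm_num : (0:ℝ) < 3.15)]; linarith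
    have a1 : η 1 ^ 2 ≤ 3.15 ^ 2 := by rw [sq_le_sq]; rw [abs_of_pos (by norm_num : (0:ℝ) < 3.15)]; linarith
    nlinarith [norm_nonneg η]
  have hRinv : 1 / ‖η‖ ≤ R := by rw [div_le_iff₀ hu]; exact hRu
  have hR_neg : ∀ e : ℝ, 0 ≤ e → R ^ (-e) ≤ ‖η‖ ^ e := fun e he => by
    have h := Real.rpow_le_rpow_of_nonpos (z := -e) (by positivity) hRinv (by linarith)
    rwa [one_div, Real.inv_rpow hu.le, ← Real.rpow_neg hu.le, neg_neg] at h
  have hu1 : ‖η‖ * ‖η‖ ^ (α - 1) = ‖η‖ ^ α := by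
    rw [mul_comm, ← Real.rpow_add_one hu.ne', sub_add_cancel]
  have hu2 : ‖η‖ ^ 2 * ‖η‖ ^ (α - 2) = ‖η‖ ^ α := by
    rw [← Real.rpow_two, ← Real.rpow_add hu]; congr 1; ring
  have hu3 : ‖η‖ ^ (α - 1) ≤ 5 * ‖η‖ ^ (α - 2) := by
    rw [show α - 1 = α - 2 + 1 by ring, Real.rpow_add_one hu.ne', mul_comm]
    exact mul_le_mul_of_nonneg_right hu5 (by positivity)
  have hu4 : (1 : ℝ) ≤ 5 * ‖η‖ ^ (α - 2) := by
    have h := Real.rpow_le_rpow_of_nonpos (z := α - 2) hu hu5 (by linarith)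
    have h' := Real.rpow_le_rpow_of_exponent_le (x := 5) (by norm_num)
      (show (-1 : ℝ) ≤ α - 2 by linarith)
    rw [Real.rpow_neg_one] at h'
    linarith
  set Z := latPunct (R + 1) with hZ
  set Zb := Z.filter (fun z => ¬ ‖intPt z‖ ≤ R - 1) with hZb
  set Zi := Z.filter (fun z => ‖intPt z‖ ≤ R - 1) with hZi
  -- Below |z| = 1/|η| the second differences suffice: |η|² times the sum of |z|^{-α} is of order
  -- |η|^α.
  set Zn := Zi.filter (fun z => ‖intPt z‖ ≤ 1 / ‖η‖) with hZn
  set Zf := Zi.filter (fun z => ¬ ‖intPt z‖ ≤ 1 / ‖η‖) with hZf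
  have mb : ∀ z ∈ Zb, z ≠ 0 ∧ R - 1 ≤ ‖intPt z‖ ∧ ‖intPt z‖ ≤ R + 1 := fun z hz => by
    rw [Finset.mem_filter, mem_latPunct] at hz
    exact ⟨hz.1.1, by linarith [hz.2], hz.1.2⟩
  have mi : ∀ z ∈ Zi, z ≠ 0 ∧ ‖intPt z‖ ≤ R - 1 := fun z hz => by
    rw [Finset.mem_filter, mem_latPunct] at hz
    exact ⟨hz.1.1, hz.2⟩
  have mn : ∀ z ∈ Zn, z ≠ 0 ∧ ‖intPt z‖ ≤ 1 / ‖η‖ := fun z hz => by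
    rw [Finset.mem_filter] at hz
    exact ⟨(mi z hz.1).1, hz.2⟩
  have mf : ∀ z ∈ Zf, z ≠ 0 ∧ 1 / ‖η‖ ≤ ‖intPt z‖ := fun z hz => by
    rw [Finset.mem_filter] at hz
    exact ⟨(mi z hz.1).1, by linarith [hz.2]⟩
  have mn' : ∀ z ∈ Zn, intCell z ∩ Metric.ball 0 R = intCell z := fun z hz =>
    intCell_inter_ball (mi z (Finset.mem_filter.1 hz).1).2
  have mf' : ∀ z ∈ Zf, intCell z ∩ Metric.ball 0 R = intCell z := fun z hz =>
    intCell_inter_ball (mi z (Finset.mem_filter.1 hz).1).2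
  have hsplit : ∀ g : (Fin 2 → ℤ) → ℝ, ∑ z ∈ Z, g z = ∑ z ∈ Zb, g z + ∑ z ∈ Zn, g z + ∑ z ∈ Zf, g z := by
    intro g
    rw [← Finset.sum_filter_add_sum_filter_not Z (fun z => ‖intPt z‖ ≤ R - 1), ← hZi, ← hZb,
      ← Finset.sum_filter_add_sum_filter_not Zi (fun z => ‖intPt z‖ ≤ 1 / ‖η‖)]
    ring
  have Sn := h₁ (1 / ‖η‖) Zn (by positivity) mn
  rw [inv_rpow_two_sub hu] at Sn
  have Sb2 : ∑ z ∈ Zb, ‖intPt z‖ ^ (-(α + 1)) ≤ C₂ * ‖η‖ ^ α := by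
    refine (h₂ R Zb hR mb).trans (mul_le_mul_of_nonneg_left ?_ hC₂)
    rw [show 1 - (α + 1) = -α by ring]
    exact hR_neg α (by linarith)
  have Sb3 : ∑ z ∈ Zb, ‖intPt z‖ ^ (-α) ≤ C₃ * ‖η‖ ^ (α - 1) := by
    refine (h₃ R Zb hR mb).trans (mul_le_mul_of_nonneg_left ?_ hC₃)
    rw [show 1 - α = -(α - 1) by ring]
    exact hR_neg (α - 1) (by linarith)
  have hcos : ∀ z : Fin 2 → ℤ, z ≠ 0 → ∀ v ∈ intCell z,
      |K v * Real.cos (inner ℝ η v)| ≤ 2 * C * ‖intPt z‖ ^ (-α) := fun z hz v hv => by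
    rw [abs_mul]
    exact (mul_le_of_le_one_right (abs_nonneg _) (Real.abs_cos_le_one _)).trans
      (hK.abs_le_of_mem_intCell hC hz hv)
  have hY : |∑ z ∈ Zf, ∫ v in intCell z, K v * Real.cos (inner ℝ η v)| ≤ A * ‖η‖ ^ (α - 2) := by
    have hKi := hK.integrableOn_ball hm hα₂ R
    have e := setIntegral_ball_eq_sum (ρ := R + 1) le_rfl hR0.le (integrableOn_mul_cos hKi η)
    rw [← hZ, hsplit] at e
    have e0 : |∫ v in intCell 0 ∩ Metric.ball 0 R, K v * Real.cos (inner ℝ η v)| ≤ I := by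
      have hi : IntegrableOn (fun v : Plane => C * ‖v‖ ^ (-α)) (Metric.ball 0 1) :=
        (integrableOn_ball_rpow hα₂ 1).const_mul C
      have hsub : intCell 0 ∩ Metric.ball 0 R ⊆ Metric.ball 0 1 := fun v hv => by
        have := norm_le_add_of_mem_intCell hv.1
        have h0 : ‖intPt 0‖ = 0 := by rw [norm_eq_zero, intPt_eq_zero]
        simp only [Metric.mem_ball, dist_zero_right]
        linarith
      refine (abs_integral_le_of_abs_le (hi.mono_set hsub) fun v => ?_).trans
        (setIntegral_mono_set hi (Eventually.of_forall fun v => by positivity)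
          (LE.le.eventuallyLE hsub))
      rw [abs_mul]
      exact (mul_le_of_le_one_right (abs_nonneg _) (Real.abs_cos_le_one _)).trans (hK.size v)
    have e1 : |∑ z ∈ Zb, ∫ v in intCell z ∩ Metric.ball 0 R, K v * Real.cos (inner ℝ η v)|
        ≤ 2 * C * (C₃ * ‖η‖ ^ (α - 1)) :=
      abs_sum_le_mul_sum (fun z hz => abs_setIntegral_intCell_inter_le (by positivity)
        (hcos z (mb z hz).1)) (by positivity) Sb3
    have e2 : |∑ z ∈ Zn, ∫ v in intCell z ∩ Metric.ball 0 R, K v * Real.cos (inner ℝ η v)|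
        ≤ 2 * C * (C₁ * ‖η‖ ^ (α - 2)) :=
      abs_sum_le_mul_sum (fun z hz => abs_setIntegral_intCell_inter_le (by positivity)
        (hcos z (mn z hz).1)) (by positivity) Sn
    have e3 := hosc R η hη
    have e4 : ∑ z ∈ Zf, ∫ v in intCell z ∩ Metric.ball 0 R, K v * Real.cos (inner ℝ η v)
        = ∑ z ∈ Zf, ∫ v in intCell z, K v * Real.cos (inner ℝ η v) :=
      Finset.sum_congr rfl fun z hz => by rw [mf' z hz]
    rw [e4] at e
    have e5 : 2 * C * (C₃ * ‖η‖ ^ (α - 1)) ≤ 10 * C * C₃ * ‖η‖ ^ (α - 2) := by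
      have := mul_le_mul_of_nonneg_left hu3 (by positivity : 0 ≤ 2 * C * C₃)
      linarith
    have e6 : I ≤ 5 * I * ‖η‖ ^ (α - 2) := by
      have := mul_le_mul_of_nonneg_left hu4 hI0
      linarith
    rw [hA]
    rw [abs_le] at *
    constructor <;> linarith
  have F := hfar A η Zf hA0 hη hbox mf hY
  rw [hsplit]
  have e4 : ∑ z ∈ Zf, ∫ v in intCell z ∩ Metric.ball 0 R, (K v * (Real.cos (inner ℝ η v) - 1)
          - K (intPt z) * (Real.cos (inner ℝ η (intPt z)) - 1))
      = ∑ z ∈ Zf, ∫ v in intCell z, (K v * (Real.cos (inner ℝ η v) - 1)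
          - K (intPt z) * (Real.cos (inner ℝ η (intPt z)) - 1)) :=
    Finset.sum_congr rfl fun z hz => by rw [mf' z hz]
  rw [e4]
  refine (abs_add_le _ _).trans ?_
  refine (add_le_add_left (abs_add_le _ _) _).trans ?_
  have B : |∑ z ∈ Zb, ∫ v in intCell z ∩ Metric.ball 0 R, (K v * (Real.cos (inner ℝ η v) - 1)
          - K (intPt z) * (Real.cos (inner ℝ η (intPt z)) - 1))|
      ≤ (2 * C * C₂ + 2 * C * C₃) * ‖η‖ ^ α := by
    have h := abs_sum_le_mul_sum (Z := Zb) (c := 1)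
      (h := fun z => 2 * C * ‖intPt z‖ ^ (-(α + 1)) + 2 * C * ‖η‖ * ‖intPt z‖ ^ (-α))
      (fun z hz => (abs_setIntegral_inter_sub_le (A := Metric.ball 0 R) (by positivity)
        (fun v hv => hK.sub_cell_le_lin hC η (mb z hz).1 hv)).trans_eq (one_mul _).symm)
      zero_le_one le_rfl
    refine h.trans ?_
    rw [one_mul, Finset.sum_add_distrib, ← Finset.mul_sum, ← Finset.mul_sum]
    have a1 := mul_le_mul_of_nonneg_left Sb2 (by positivity : 0 ≤ 2 * C)
    have a2 := mul_le_mul_of_nonneg_left Sb3 (by positivity : 0 ≤ 2 * C * ‖η‖)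
    have a3 : 2 * C * ‖η‖ * (C₃ * ‖η‖ ^ (α - 1)) = 2 * C * C₃ * ‖η‖ ^ α := by rw [← hu1]; ring
    linarith
  have N : |∑ z ∈ Zn, ∫ v in intCell z ∩ Metric.ball 0 R, (K v * (Real.cos (inner ℝ η v) - 1)
          - K (intPt z) * (Real.cos (inner ℝ η (intPt z)) - 1))|
      ≤ 3 * C * C₁ * ‖η‖ ^ α := by
    refine (abs_sum_le_mul_sum (c := 3 * C * ‖η‖ ^ 2) (fun z hz => ?_) (by positivity) Sn).trans
      (le_of_eq (by rw [← hu2]; ring))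
    rw [mn' z hz]
    exact (abs_setIntegral_intCell_sub_le
        (hK.integrableOn_intCell_mul_cos_sub_one hm η (mn z hz).1)
        (fun w hw => hK.second_cell_le hC η (mn z hz).1 hw)).trans (le_of_eq (by ring))
  linarith

end Kernel

/-- The Hessian of the symbol of the jump weights on the unit lattice. -/
def hessSum (α r : ℝ) (i j : Fin 2) (R : ℝ) (η : Plane) : ℝ :=
  ∑ z ∈ latPunct (R + 1),
    unitWeight α r R z * (intPt z i * intPt z j * Real.cos (inner ℝ η (intPt z)))

lemma integrableOn_momentKernel {α : ℝ} (hα₂ : α < 2) (i j : Fin 2) (R : ℝ) :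
    IntegrableOn (momentKernel α i j) (Metric.ball 0 R) := by
  obtain ⟨C, -, hK⟩ := exists_kernelBound_moment α i j
  exact hK.integrableOn_ball (measurable_momentKernel α i j) hα₂ R

lemma integral_momentKernel {α : ℝ} (hα₂ : α < 2) (i j : Fin 2) (R : ℝ) :
    ∫ v in Metric.ball 0 R, momentKernel α i j v = if i = j then ballMoment α R / 2 else 0 := by
  have h := setIntegral_coord_mul (S := Metric.ball (0 : Plane) R) swapIso_mem_ball flipIso_mem_ball
    (fun t => t ^ (-2 - α)) (fun i => integrableOn_momentKernel hα₂ i i R) i j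
  unfold momentKernel
  rw [h, ballMoment_eq]
  congr 2
  refine setIntegral_congr_ae measurableSet_ball ?_
  have h0 : ∀ᵐ v : Plane, v ≠ 0 := by simp [ae_iff]
  filter_upwards [h0] with v hv _
  rw [← Real.rpow_two, ← Real.rpow_add (norm_pos_iff.2 hv)]
  congr 1; ring

/-- Because the second moments match, both Hessians may be reduced by their common value at η = 0,
which replaces cos by cos - 1. Cutting the ball into cells leaves the nearest neighbours, the mass
removed with B_r, the central cell and the cell errors. -/
lemma hessSum_sub_hessInt {α r R : ℝ} (hα₂ : α < 2) (hR : 0 ≤ R) (hrR : r ≤ R) (hr : 0 ≤ r)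
    (i j : Fin 2) (η : Plane) :
    hessSum α r i j R η - hessInt α i j R η =
      nnWeight α r R * ∑ z ∈ nnPts, intPt z i * intPt z j * (Real.cos (inner ℝ η (intPt z)) - 1)
      - (∑ z ∈ latPunct (R + 1), cellMass 0 r z *
          (momentKernel α i j (intPt z) * (Real.cos (inner ℝ η (intPt z)) - 1)))
      - (∫ v in intCell 0 ∩ Metric.ball 0 R,
          momentKernel α i j v * (Real.cos (inner ℝ η v) - 1))
      - ∑ z ∈ latPunct (R + 1), ∫ v in intCell z ∩ Metric.ball 0 R,
          (momentKernel α i j v * (Real.cos (inner ℝ η v) - 1)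
            - momentKernel α i j (intPt z) * (Real.cos (inner ℝ η (intPt z)) - 1)) := by
  have hKi := integrableOn_momentKernel hα₂ i j R
  have hKc := integrableOn_mul_cos hKi η
  have hgi : IntegrableOn (fun v => momentKernel α i j v * (Real.cos (inner ℝ η v) - 1))
      (Metric.ball 0 R) := by
    simp only [mul_sub_one]
    exact hKc.sub hKi
  have e1 : hessInt α i j R η - (if i = j then ballMoment α R / 2 else 0)
      = ∫ v in Metric.ball 0 R, momentKernel α i j v * (Real.cos (inner ℝ η v) - 1) := by
    rw [← integral_momentKernel hα₂, hessInt]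
    simp only [mul_sub_one]
    rw [integral_sub hKc hKi]
  have e2 : hessSum α r i j R η - (if i = j then ballMoment α R / 2 else 0)
      = ∑ z ∈ latPunct (R + 1), unitWeight α r R z *
        (intPt z i * intPt z j * (Real.cos (inner ℝ η (intPt z)) - 1)) := by
    rw [← sum_unitWeight_moment (r := r) hR le_rfl i j, hessSum, ← Finset.sum_sub_distrib]
    exact Finset.sum_congr rfl fun z _ => by ring
  rw [sum_unitWeight_mul hR le_rfl] at e2
  rw [setIntegral_ball_eq_sum (ρ := R + 1) le_rfl hR hgi] at e1
  have e3 : ∀ z, ∫ v in intCell z ∩ Metric.ball 0 R,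
          (momentKernel α i j v * (Real.cos (inner ℝ η v) - 1)
            - momentKernel α i j (intPt z) * (Real.cos (inner ℝ η (intPt z)) - 1))
      = (∫ v in intCell z ∩ Metric.ball 0 R,
          momentKernel α i j v * (Real.cos (inner ℝ η v) - 1))
        - (cellMass 0 r z + cellMass r R z) *
          (momentKernel α i j (intPt z) * (Real.cos (inner ℝ η (intPt z)) - 1)) := by
    intro z
    rw [integral_sub (hgi.mono_set Set.inter_subset_right)
      (integrableOn_const (volume_intCell_inter_ne_top _ _)), setIntegral_const, smul_eq_mul,
      ← cellMass_sub hr hrR z]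
    congr 2
    simp [cellMass, annulus]
  have e4 : ∑ z ∈ latPunct (R + 1), cellMass r R z * ‖intPt z‖ ^ (-2 - α) *
        (intPt z i * intPt z j * (Real.cos (inner ℝ η (intPt z)) - 1))
      = ∑ z ∈ latPunct (R + 1), cellMass r R z *
        (momentKernel α i j (intPt z) * (Real.cos (inner ℝ η (intPt z)) - 1)) :=
    Finset.sum_congr rfl fun z _ => by unfold momentKernel; ring
  rw [e4] at e2
  simp only [e3, Finset.sum_sub_distrib, add_mul, Finset.sum_add_distrib]
  linarith

lemma norm_le_five {η : Plane} (hbox : ∀ i, |η i| ≤ Real.pi) : ‖η‖ ≤ 5 := by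
  have h0 := hbox 0
  have h1 := hbox 1
  have := plane_norm_sq η
  have h2 := Real.pi_lt_d2
  have a0 : η 0 ^ 2 ≤ 3.15 ^ 2 := by
    rw [sq_le_sq, abs_of_pos (by norm_num : (0:ℝ) < 3.15)]; linarith
  have a1 : η 1 ^ 2 ≤ 3.15 ^ 2 := by
    rw [sq_le_sq, abs_of_pos (by norm_num : (0:ℝ) < 3.15)]; linarith
  nlinarith [norm_nonneg η]

lemma exists_abs_nnWeight_le {α r M : ℝ} (hα₁ : 0 < α) (hα₂ : α < 2) (hM : 0 < M) (hr : r ≤ M) :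
    ∃ B, 0 ≤ B ∧ ∀ R, M ≤ R → |nnWeight α r R| ≤ B := by
  obtain ⟨C, hC, h⟩ := exists_nnWeight_sub_le hα₁ hα₂ hM hr
  refine ⟨|nnWeight α r M| + C * M ^ (-α), by positivity, fun R hR => ?_⟩
  have h1 := h M R le_rfl hR
  rw [← mul_sub, abs_mul, abs_of_pos (by norm_num : (0:ℝ) < 4)] at h1
  have h2 := abs_add_le (nnWeight α r M) (nnWeight α r R - nnWeight α r M)
  rw [add_sub_cancel] at h2
  have := abs_nonneg (nnWeight α r R - nnWeight α r M)
  linarith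

/-- Comparison of the Hessians of the discrete and continuum symbols, at unit lattice scale. -/
lemma exists_hessSum_sub_hessInt_le {α r M : ℝ} (hα₁ : 1 < α) (hα₂ : α < 2) (hr : 0 < r)
    (hrM : r < M) (i j : Fin 2) :
    ∃ D, 0 ≤ D ∧ ∀ (R : ℝ) (η : Plane), M ≤ R → (∀ i, |η i| ≤ Real.pi) →
      |hessSum α r i j R η - hessInt α i j R η| ≤ D * (R ^ (2 - α) * ‖η‖ ^ 2) ∧
      |hessSum α r i j R η - hessInt α i j R η| ≤ D * ‖η‖ ^ α := by
  have hM : 0 < M := hr.trans hrM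
  obtain ⟨C, hC, hK⟩ := exists_kernelBound_moment α i j
  have hm := measurable_momentKernel α i j
  obtain ⟨H, hH, hosc⟩ := exists_hessInt_le hα₁ hα₂ i j
  obtain ⟨D₁, hD₁, h₁⟩ := hK.exists_sum_cell_le_sq hm hC hα₁ hα₂ hM
  obtain ⟨D₂, hD₂, h₂⟩ := hK.exists_sum_cell_le_rpow hm hC hα₁ hα₂ hM hH hosc
  obtain ⟨B, hB, hnn⟩ := exists_abs_nnWeight_le (α := α) (r := r) (by linarith) hα₂ hM hrM.le
  obtain ⟨C₁, hC₁, hin⟩ := exists_sum_rpow_le_inner (p := α) (by linarith) hα₂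
  set S := B * 2 + C * (r + 1) ^ 2 / 2 * (C₁ * (r + 1) ^ (2 - α)) + C / 2 with hS
  have hS0 : 0 ≤ S := by positivity
  -- Apart from the cell errors, every term lives in a region whose size does not depend on R and is
  -- therefore O(|η|²).
  have small : ∀ (R : ℝ) (η : Plane), M ≤ R →
      |hessSum α r i j R η - hessInt α i j R η
        + ∑ z ∈ latPunct (R + 1), ∫ v in intCell z ∩ Metric.ball 0 R,
          (momentKernel α i j v * (Real.cos (inner ℝ η v) - 1)
            - momentKernel α i j (intPt z) * (Real.cos (inner ℝ η (intPt z)) - 1))|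
        ≤ S * ‖η‖ ^ 2 := by
    intro R η hR
    have hg : ∀ v : Plane, |momentKernel α i j v * (Real.cos (inner ℝ η v) - 1)|
        ≤ C * ‖v‖ ^ (-α) * (‖η‖ ^ 2 * ‖v‖ ^ 2 / 2) := fun v => by
      rw [abs_mul]
      exact mul_le_mul (hK.size v) (abs_cos_sub_one_le η v) (abs_nonneg _) (by positivity)
    rw [hessSum_sub_hessInt hα₂ (hM.le.trans hR) (hrM.le.trans hR) hr.le, sub_add_cancel]
    have t1 : |nnWeight α r R * ∑ z ∈ nnPts, intPt z i * intPt z j *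
        (Real.cos (inner ℝ η (intPt z)) - 1)| ≤ B * (2 * ‖η‖ ^ 2) := by
      rw [abs_mul]
      refine mul_le_mul (hnn R hR) ?_ (abs_nonneg _) hB
      have hz : ∀ z ∈ nnPts, |intPt z i * intPt z j * (Real.cos (inner ℝ η (intPt z)) - 1)|
          ≤ ‖η‖ ^ 2 / 2 := fun z hz => by
        have h1 := mem_nnPts.1 hz
        have a := abs_apply_le_norm (intPt z) i
        have b := abs_apply_le_norm (intPt z) j
        have c := abs_cos_sub_one_le η (intPt z)
        rw [h1] at a b c
        rw [abs_mul, abs_mul]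
        have := mul_le_one₀ a (abs_nonneg _) b
        refine (mul_le_of_le_one_left (abs_nonneg _) this).trans (c.trans (by linarith))
      refine (Finset.abs_sum_le_sum_abs _ _).trans ((Finset.sum_le_sum hz).trans ?_)
      rw [sum_nnPts]; linarith
    have t2 : |∑ z ∈ latPunct (R + 1), cellMass 0 r z *
          (momentKernel α i j (intPt z) * (Real.cos (inner ℝ η (intPt z)) - 1))|
        ≤ C * (r + 1) ^ 2 / 2 * ‖η‖ ^ 2 * (C₁ * (r + 1) ^ (2 - α)) := by
      rw [← Finset.sum_filter_add_sum_filter_not _ (fun z => ‖intPt z‖ ≤ r + 1)]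
      have hz0 : ∑ z ∈ latPunct (R + 1) with ¬ ‖intPt z‖ ≤ r + 1, cellMass 0 r z *
          (momentKernel α i j (intPt z) * (Real.cos (inner ℝ η (intPt z)) - 1)) = 0 := by
        refine Finset.sum_eq_zero fun z hz => ?_
        rw [cellMass_eq_zero (not_le.1 (Finset.mem_filter.1 hz).2).le, zero_mul]
      rw [hz0, add_zero]
      refine abs_sum_le_mul_sum (h := fun z => ‖intPt z‖ ^ (-α)) (fun z hz => ?_) (by positivity)
        (hin (r + 1) _ (by linarith) fun z hz => ?_)
      · have hz := (Finset.mem_filter.1 hz).2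
        rw [abs_mul, abs_of_nonneg (cellMass_nonneg _ _ _)]
        refine (mul_le_of_le_one_left (abs_nonneg _) (cellMass_le_one _ _ _)).trans
          ((hg _).trans ?_)
        have : ‖intPt z‖ ^ 2 ≤ (r + 1) ^ 2 := by gcongr
        calc C * ‖intPt z‖ ^ (-α) * (‖η‖ ^ 2 * ‖intPt z‖ ^ 2 / 2)
            ≤ C * ‖intPt z‖ ^ (-α) * (‖η‖ ^ 2 * (r + 1) ^ 2 / 2) := by gcongr
          _ = _ := by ring
      · rw [Finset.mem_filter, mem_latPunct] at hz
        exact ⟨hz.1.1, hz.2⟩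
    have t3 : |∫ v in intCell 0 ∩ Metric.ball 0 R,
          momentKernel α i j v * (Real.cos (inner ℝ η v) - 1)| ≤ C / 2 * ‖η‖ ^ 2 := by
      refine abs_setIntegral_intCell_inter_le (by positivity) fun v hv => ?_
      have hv1 : ‖v‖ ≤ 1 := by
        have := norm_le_add_of_mem_intCell hv
        have h0 : ‖intPt 0‖ = 0 := by rw [norm_eq_zero, intPt_eq_zero]
        linarith
      refine (hg v).trans ?_
      rcases eq_or_ne v 0 with rfl | hv0
      · simp; positivity
      · have hp := norm_pos_iff.2 hv0
        have : ‖v‖ ^ (-α) * ‖v‖ ^ 2 ≤ 1 := by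
          rw [← Real.rpow_two, ← Real.rpow_add hp]
          exact Real.rpow_le_one hp.le hv1 (by linarith)
        calc C * ‖v‖ ^ (-α) * (‖η‖ ^ 2 * ‖v‖ ^ 2 / 2)
            = C / 2 * ‖η‖ ^ 2 * (‖v‖ ^ (-α) * ‖v‖ ^ 2) := by ring
          _ ≤ C / 2 * ‖η‖ ^ 2 * 1 := by gcongr
          _ = _ := mul_one _
    refine (abs_sub _ _).trans ((add_le_add_left (abs_sub _ _) _).trans ?_)
    rw [hS]
    linarith
  refine ⟨S * M ^ (α - 2) + D₁ + (5 * S + D₂), by positivity, fun R η hR hbox => ?_⟩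
  have hR0 : 0 < R := hM.trans_le hR
  have sm := small R η hR
  have q1 := h₁ R η hR
  set E := ∑ z ∈ latPunct (R + 1), ∫ v in intCell z ∩ Metric.ball 0 R,
          (momentKernel α i j v * (Real.cos (inner ℝ η v) - 1)
            - momentKernel α i j (intPt z) * (Real.cos (inner ℝ η (intPt z)) - 1)) with hE
  have hle : |hessSum α r i j R η - hessInt α i j R η| ≤ S * ‖η‖ ^ 2 + |E| := by
    have := abs_sub (hessSum α r i j R η - hessInt α i j R η + E) E
    rw [add_sub_cancel_right] at this
    linarith
  have f1 : |hessSum α r i j R η - hessInt α i j R η|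
      ≤ (S * M ^ (α - 2) + D₁) * (R ^ (2 - α) * ‖η‖ ^ 2) := by
    have h1 : 1 ≤ M ^ (α - 2) * R ^ (2 - α) := by
      rw [show α - 2 = -(2 - α) by ring, Real.rpow_neg hM.le, inv_mul_eq_div,
        one_le_div (by positivity)]
      exact Real.rpow_le_rpow hM.le hR (by linarith)
    have h2 := mul_le_mul_of_nonneg_left h1 (by positivity : 0 ≤ S * ‖η‖ ^ 2)
    linarith
  refine ⟨f1.trans (mul_le_mul_of_nonneg_right (by linarith) (by positivity)), ?_⟩
  rcases eq_or_ne η 0 with rfl | hη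
  · have : |hessSum α r i j R 0 - hessInt α i j R 0| ≤ 0 := by simpa using f1
    exact this.trans (by positivity)
  have hu : 0 < ‖η‖ := norm_pos_iff.2 hη
  have hua : 0 ≤ ‖η‖ ^ α := by positivity
  -- As R^{2-α}|η|² = (R|η|)^{2-α}|η|^α, the first bound already implies the second when R|η| ≤ 1.
  rcases le_total (R * ‖η‖) 1 with h | h
  · rw [mul_rpow_mul_sq hR0 hu] at f1
    have h1 : (R * ‖η‖) ^ (2 - α) ≤ 1 := Real.rpow_le_one (by positivity) h (by linarith)
    refine f1.trans (mul_le_mul ?_ (mul_le_of_le_one_left hua h1) (by positivity) (by positivity))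
    linarith
  · have q2 := h₂ R η hR hbox h
    have h3 : ‖η‖ ^ 2 ≤ 5 * ‖η‖ ^ α := by
      rw [← Real.rpow_two, show (2 : ℝ) = (2 - α) + α by ring, Real.rpow_add hu]
      refine mul_le_mul_of_nonneg_right ?_ hua
      refine (Real.rpow_le_rpow hu.le (norm_le_five hbox) (by linarith)).trans ?_
      refine (Real.rpow_le_rpow_of_exponent_le (by norm_num)
        (show 2 - α ≤ 1 by linarith)).trans ?_
      norm_num
    have h4 := mul_le_mul_of_nonneg_left h3 hS0
    have h5 : 0 ≤ (S * M ^ (α - 2) + D₁) * ‖η‖ ^ α := by positivity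
    linarith

/-! ### Integration by parts over squares -/

/-- The point with `i`-th coordinate `t` and other coordinate `s`. -/
def linePt (i : Fin 2) (t s : ℝ) : Plane := WithLp.toLp 2 fun k => if k = i then t else s

@[simp] lemma linePt_apply (i k : Fin 2) (t s : ℝ) :
    linePt i t s k = if k = i then t else s := rfl

lemma inner_linePt {i j : Fin 2} (hij : i ≠ j) (t s : ℝ) (x : Plane) :
    inner ℝ (linePt i t s) x = t * x i + s * x j := by
  rw [plane_inner]
  fin_cases i <;> fin_cases j <;> simp_all [add_comm]

lemma linePt_add_smul (i : Fin 2) (t s u : ℝ) :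
    linePt i t s + u • EuclideanSpace.single i (1 : ℝ) = linePt i (t + u) s := by
  ext k
  by_cases h : k = i <;> simp [h]

lemma linePt_comm {i j : Fin 2} (hij : i ≠ j) (t s : ℝ) : linePt i t s = linePt j s t := by
  ext k
  fin_cases i <;> fin_cases j <;> fin_cases k <;> simp_all

@[fun_prop]
lemma continuous_linePt (i : Fin 2) {X : Type*} [TopologicalSpace X] {f g : X → ℝ}
    (hf : Continuous f) (hg : Continuous g) : Continuous fun x => linePt i (f x) (g x) := by
  refine (PiLp.continuous_toLp 2 _).comp (continuous_pi fun k => ?_)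
  by_cases h : k = i <;> simp [h, hf, hg]

lemma box_eq_preimage (R : ℝ) :
    box R = (fun v : Plane => (v 0, v 1)) ⁻¹' (Set.Icc (-R) R ×ˢ Set.Icc (-R) R) := by
  ext v
  simp only [box, Fin.forall_fin_two, abs_le, Set.mem_preimage, Set.mem_prod, Set.mem_Icc]
  rfl

lemma measurePreserving_coords :
    MeasurePreserving (fun v : Plane => (v 0, v 1)) volume volume :=
  (volume_preserving_finTwoArrow ℝ).comp
    (EuclideanSpace.volume_preserving_symm_measurableEquiv_toLp (Fin 2))

lemma measurableEmbedding_coords : MeasurableEmbedding (fun v : Plane => (v 0, v 1)) :=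
  ((MeasurableEquiv.toLp 2 (Fin 2 → ℝ)).symm.trans MeasurableEquiv.finTwoArrow).measurableEmbedding

lemma isClosed_box (R : ℝ) : IsClosed (box R) := by
  have : box R = ⋂ i, {v : Plane | |v i| ≤ R} := by ext v; simp [box]
  rw [this]
  exact isClosed_iInter fun i => isClosed_le (by fun_prop) continuous_const

lemma measurableSet_box (R : ℝ) : MeasurableSet (box R) := (isClosed_box R).measurableSet

lemma isCompact_box (R : ℝ) : IsCompact (box R) := by
  refine Metric.isCompact_of_isClosed_isBounded (isClosed_box R) ?_
  rw [isBounded_iff_forall_norm_le]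
  refine ⟨R + R, fun v hv => ?_⟩
  have h := plane_norm_sq v
  have h0 := hv 0
  have h1 := hv 1
  have a0 := abs_nonneg (v 0)
  have a1 := abs_nonneg (v 1)
  rw [← sq_abs (v 0), ← sq_abs (v 1)] at h
  refine abs_le_of_sq_le_sq' ?_ (by linarith) |>.2
  nlinarith

lemma setIntegral_box_zero {R : ℝ} (hR : 0 ≤ R) {g : Plane → ℝ} (hg : Continuous g) :
    ∫ θ in box R, g θ = ∫ t in -R..R, ∫ s in -R..R, g (linePt 0 t s) := by
  have h := measurePreserving_coords.setIntegral_preimage_emb measurableEmbedding_coords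
    (fun p : ℝ × ℝ => g (linePt 0 p.1 p.2)) (Set.Icc (-R) R ×ˢ Set.Icc (-R) R)
  rw [← box_eq_preimage] at h
  have e : ∀ v : Plane, linePt 0 (v 0) (v 1) = v := fun v => by
    ext k; fin_cases k <;> simp
  simp only [e] at h
  have hc : Continuous fun p : ℝ × ℝ => g (linePt 0 p.1 p.2) := by fun_prop
  rw [h, Measure.volume_eq_prod, setIntegral_prod _
    ((hc.continuousOn).integrableOn_compact (isCompact_Icc.prod isCompact_Icc))]
  rw [intervalIntegral.integral_of_le (by linarith), ← integral_Icc_eq_integral_Ioc]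
  refine setIntegral_congr_fun measurableSet_Icc fun t _ => ?_
  rw [intervalIntegral.integral_of_le (by linarith), ← integral_Icc_eq_integral_Ioc]

/-- Fubini on a square, with the `i`-th coordinate integrated first. -/
lemma setIntegral_box {R : ℝ} (hR : 0 ≤ R) {g : Plane → ℝ} (hg : Continuous g) (i : Fin 2) :
    ∫ θ in box R, g θ = ∫ s in -R..R, ∫ t in -R..R, g (linePt i t s) := by
  rw [setIntegral_box_zero hR hg]
  rcases eq_or_ne i 1 with rfl | hi
  · simp only [linePt_comm (show (1 : Fin 2) ≠ 0 by decide)]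
  · obtain rfl : i = 0 := by omega
    have hc : Continuous fun p : ℝ × ℝ => g (linePt 0 p.1 p.2) := by fun_prop
    rw [intervalIntegral_intervalIntegral_swap]
    exact (hc.continuousOn.integrableOn_compact (isCompact_uIcc.prod isCompact_uIcc)).mono_set
      (Set.prod_mono Set.uIoc_subset_uIcc Set.uIoc_subset_uIcc)

/-- Twofold integration by parts against a cosine, over a square. -/
lemma setIntegral_box_cos_mul {f f₁ f₂ : Plane → ℝ} {i j : Fin 2} (hij : i ≠ j)
    (hf : Continuous f) (hf₁ : Continuous f₁) (hf₂ : Continuous f₂)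
    (hd : ∀ t s, HasDerivAt (fun t => f (linePt i t s)) (f₁ (linePt i t s)) t)
    (hd₁ : ∀ t s, HasDerivAt (fun t => f₁ (linePt i t s)) (f₂ (linePt i t s)) t)
    {x : Plane} (hx : x i ≠ 0) {R : ℝ} (hR : 0 ≤ R) :
    ∫ θ in box R, Real.cos (inner ℝ θ x) * f θ =
      (∫ s in -R..R, (Real.sin (R * x i + s * x j) * f (linePt i R s)
          - Real.sin (-R * x i + s * x j) * f (linePt i (-R) s)) / x i)
      + (∫ s in -R..R, (Real.cos (R * x i + s * x j) * f₁ (linePt i R s)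
          - Real.cos (-R * x i + s * x j) * f₁ (linePt i (-R) s)) / x i ^ 2)
      - (∫ θ in box R, Real.cos (inner ℝ θ x) * f₂ θ) / x i ^ 2 := by
  rw [setIntegral_box hR (by fun_prop) i, setIntegral_box hR (by fun_prop) i,
    ← intervalIntegral.integral_div]
  rw [← intervalIntegral.integral_add, ← intervalIntegral.integral_sub]
  rotate_left
  · exact Continuous.intervalIntegrable (by fun_prop) _ _
  · refine Continuous.intervalIntegrable ?_ _ _
    refine Continuous.div_const ?_ _
    exact intervalIntegral.continuous_parametric_intervalIntegral_of_continuous' (by fun_prop) _ _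
  · exact Continuous.intervalIntegrable (by fun_prop) _ _
  · exact Continuous.intervalIntegrable (by fun_prop) _ _
  refine intervalIntegral.integral_congr fun s _ => ?_
  simp only [inner_linePt hij]
  -- A single antiderivative performs both integrations by parts at once.
  have hder : ∀ t ∈ Set.uIcc (-R) R, HasDerivAt
      (fun t => Real.sin (t * x i + s * x j) * f (linePt i t s) / x i
        + Real.cos (t * x i + s * x j) * f₁ (linePt i t s) / x i ^ 2)
      (Real.cos (t * x i + s * x j) * f (linePt i t s)
        + Real.cos (t * x i + s * x j) * f₂ (linePt i t s) / x i ^ 2) t := by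
    intro t _
    have hl : HasDerivAt (fun t => t * x i + s * x j) (x i) t := by
      simpa using ((hasDerivAt_id t).mul_const (x i)).add_const (s * x j)
    have := ((hl.sin.mul (hd t s)).div_const (x i)).add
      ((hl.cos.mul (hd₁ t s)).div_const (x i ^ 2))
    refine this.congr_deriv ?_
    field_simp
    ring
  have h := intervalIntegral.integral_eq_sub_of_hasDerivAt hder
    (Continuous.intervalIntegrable (by fun_prop) _ _)
  rw [intervalIntegral.integral_add (Continuous.intervalIntegrable (by fun_prop) _ _)
    (Continuous.intervalIntegrable (by fun_prop) _ _), intervalIntegral.integral_div] at h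
  rw [eq_sub_iff_add_eq, h]
  ring

/-! ### The symbols and their derivatives -/

/-- A twice continuously differentiable function of the plane with given partial derivatives. -/
structure PlaneC2 (φ : Plane → ℝ) (φ₁ : Fin 2 → Plane → ℝ) (φ₂ : Fin 2 → Fin 2 → Plane → ℝ) :
    Prop where
  cont : Continuous φ
  cont₁ : ∀ i, Continuous (φ₁ i)
  cont₂ : ∀ i j, Continuous (φ₂ i j)
  deriv : ∀ (θ e : Plane) (t : ℝ), HasDerivAt (fun t : ℝ => φ (θ + t • e))
    (e 0 * φ₁ 0 (θ + t • e) + e 1 * φ₁ 1 (θ + t • e)) t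
  deriv₁ : ∀ (i : Fin 2) (θ e : Plane) (t : ℝ), HasDerivAt (fun t : ℝ => φ₁ i (θ + t • e))
    (e 0 * φ₂ i 0 (θ + t • e) + e 1 * φ₂ i 1 (θ + t • e)) t

/-- The symbol of the truncated stable density, without the constant. -/
def contSymb (α M : ℝ) (θ : Plane) : ℝ :=
  ∫ v in Metric.ball (0 : Plane) M, ‖v‖ ^ (-2 - α) * (1 - Real.cos (inner ℝ θ v))

/-- The gradient of `contSymb`. -/
def contGrad (α M : ℝ) (i : Fin 2) (θ : Plane) : ℝ :=
  ∫ v in Metric.ball (0 : Plane) M, ‖v‖ ^ (-2 - α) * (v i * Real.sin (inner ℝ θ v))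

lemma norm_rpow_mul_sq_le (α : ℝ) (v : Plane) : ‖v‖ ^ (-2 - α) * (‖v‖ * ‖v‖) ≤ ‖v‖ ^ (-α) := by
  rcases eq_or_ne v 0 with rfl | hv
  · simp only [norm_zero, mul_zero]; positivity
  · rw [← sq, ← Real.rpow_two, ← Real.rpow_add (norm_pos_iff.2 hv)]
    exact le_of_eq (by congr 1; ring)

lemma abs_kernel_mul_le {α A B : ℝ} {v : Plane} {a b : ℝ} (ha : |a| ≤ A * ‖v‖) (hb : |b| ≤ B * ‖v‖)
    (hA : 0 ≤ A) (hB : 0 ≤ B) : |‖v‖ ^ (-2 - α) * (a * b)| ≤ A * B * ‖v‖ ^ (-α) := by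
  rw [abs_mul, abs_mul, abs_of_nonneg (by positivity : 0 ≤ ‖v‖ ^ (-2 - α))]
  calc ‖v‖ ^ (-2 - α) * (|a| * |b|) ≤ ‖v‖ ^ (-2 - α) * ((A * ‖v‖) * (B * ‖v‖)) := by gcongr
    _ = A * B * (‖v‖ ^ (-2 - α) * (‖v‖ * ‖v‖)) := by ring
    _ ≤ _ := mul_le_mul_of_nonneg_left (norm_rpow_mul_sq_le α v) (by positivity)

lemma abs_sin_inner_le (θ v : Plane) : |Real.sin (inner ℝ θ v)| ≤ ‖θ‖ * ‖v‖ :=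
  (Real.abs_sin_le_abs).trans (abs_inner_le θ v)

lemma abs_one_sub_cos_inner_le (α : ℝ) (θ v : Plane) :
    |‖v‖ ^ (-2 - α) * (1 - Real.cos (inner ℝ θ v))| ≤ ‖θ‖ ^ 2 / 2 * ‖v‖ ^ (-α) := by
  rw [abs_mul, abs_of_nonneg (by positivity : 0 ≤ ‖v‖ ^ (-2 - α)), abs_sub_comm]
  have h1 := abs_cos_sub_one_le θ v
  have h2 := norm_rpow_mul_sq_le α v
  calc ‖v‖ ^ (-2 - α) * |Real.cos (inner ℝ θ v) - 1|
      ≤ ‖v‖ ^ (-2 - α) * (‖θ‖ ^ 2 * ‖v‖ ^ 2 / 2) := by gcongr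
    _ = ‖θ‖ ^ 2 / 2 * (‖v‖ ^ (-2 - α) * (‖v‖ * ‖v‖)) := by ring
    _ ≤ _ := by gcongr

section Cont

variable {α M : ℝ}

lemma integrableOn_contSymb (hα₂ : α < 2) (θ : Plane) :
    IntegrableOn (fun v => ‖v‖ ^ (-2 - α) * (1 - Real.cos (inner ℝ θ v))) (Metric.ball 0 M) :=
  ((integrableOn_ball_rpow hα₂ M).const_mul (‖θ‖ ^ 2 / 2)).mono'
    (by fun_prop) (Eventually.of_forall fun v => abs_one_sub_cos_inner_le α θ v)

lemma integrableOn_contGrad (hα₂ : α < 2) (i : Fin 2) (θ : Plane) :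
    IntegrableOn (fun v => ‖v‖ ^ (-2 - α) * (v i * Real.sin (inner ℝ θ v))) (Metric.ball 0 M) :=
  ((integrableOn_ball_rpow hα₂ M).const_mul (1 * ‖θ‖)).mono'
    (by fun_prop) (Eventually.of_forall fun v => abs_kernel_mul_le
      (by simpa using abs_apply_le_norm v i) (abs_sin_inner_le θ v) zero_le_one (norm_nonneg _))

lemma abs_momentKernel_cos_le (i j : Fin 2) (θ v : Plane) :
    |momentKernel α i j v * Real.cos (inner ℝ θ v)| ≤ ‖v‖ ^ (-α) := by
  rw [abs_mul]
  refine (mul_le_of_le_one_right (abs_nonneg _) (Real.abs_cos_le_one _)).trans ?_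
  have := abs_kernel_mul_le (α := α) (A := 1) (B := 1) (v := v) (by simpa using abs_apply_le_norm v i)
    (by simpa using abs_apply_le_norm v j) zero_le_one zero_le_one
  rw [momentKernel, mul_comm]
  simpa using this

lemma integrableOn_contHess (hα₂ : α < 2) (i j : Fin 2) (θ : Plane) :
    IntegrableOn (fun v => momentKernel α i j v * Real.cos (inner ℝ θ v)) (Metric.ball 0 M) :=
  integrableOn_mul_cos (integrableOn_momentKernel hα₂ i j M) θ

/-- Differentiation under the integral sign: in each case the kernel |v|^{-2-α} meets two factors
|v|, so |v|^{-α}, integrable on the ball, is a dominating function up to constants. -/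
lemma planeC2_contSymb (hα₂ : α < 2) :
    PlaneC2 (contSymb α M) (contGrad α M) (fun i j => hessInt α i j M) := by
  have hb := integrableOn_ball_rpow hα₂ M
  have hmk := measurable_momentKernel α
  constructor
  · refine continuous_iff_continuousAt.2 fun θ => ?_
    refine continuousAt_of_dominated (bound := fun v => (‖θ‖ + 1) ^ 2 / 2 * ‖v‖ ^ (-α))
      (Eventually.of_forall fun θ' => by fun_prop) ?_ (hb.const_mul _)
      (Eventually.of_forall fun v => by fun_prop)
    filter_upwards [Metric.ball_mem_nhds θ one_pos] with θ' hθ'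
    refine Eventually.of_forall fun v => (abs_one_sub_cos_inner_le α θ' v).trans ?_
    have : ‖θ'‖ ≤ ‖θ‖ + 1 := by
      have := norm_le_norm_add_norm_sub' θ' θ
      rw [mem_ball_iff_norm] at hθ'
      linarith
    gcongr
  · intro i
    refine continuous_iff_continuousAt.2 fun θ => ?_
    refine continuousAt_of_dominated (bound := fun v => 1 * (‖θ‖ + 1) * ‖v‖ ^ (-α))
      (Eventually.of_forall fun θ' => by fun_prop) ?_ (hb.const_mul _)
      (Eventually.of_forall fun v => by fun_prop)
    filter_upwards [Metric.ball_mem_nhds θ one_pos] with θ' hθ'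
    have : ‖θ'‖ ≤ ‖θ‖ + 1 := by
      have := norm_le_norm_add_norm_sub' θ' θ
      rw [mem_ball_iff_norm] at hθ'
      linarith
    refine Eventually.of_forall fun v => abs_kernel_mul_le
      (by simpa using abs_apply_le_norm v i) ((abs_sin_inner_le θ' v).trans ?_) zero_le_one
      (by positivity)
    gcongr
  · intro i j
    refine continuous_of_dominated (bound := fun v => ‖v‖ ^ (-α)) (fun θ' => ?_)
      (fun θ => Eventually.of_forall fun v => abs_momentKernel_cos_le i j θ v) hb
      (Eventually.of_forall fun v => by fun_prop)
    have := hmk i j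
    fun_prop
  · intro θ e t
    have h := hasDerivAt_integral_of_dominated_loc_of_deriv_le
      (μ := volume.restrict (Metric.ball (0 : Plane) M)) (x₀ := t) (s := Metric.ball t 1)
      (F := fun τ v => ‖v‖ ^ (-2 - α) * (1 - Real.cos (inner ℝ (θ + τ • e) v)))
      (F' := fun τ v => ‖v‖ ^ (-2 - α) * (inner ℝ e v * Real.sin (inner ℝ (θ + τ • e) v)))
      (bound := fun v => ‖e‖ * (‖θ‖ + (|t| + 1) * ‖e‖) * ‖v‖ ^ (-α))
      (Metric.ball_mem_nhds t one_pos) (Eventually.of_forall fun τ => by fun_prop)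
      (integrableOn_contSymb hα₂ _) (by fun_prop)
      (Eventually.of_forall fun v τ hτ => ?_) (hb.const_mul _)
      (Eventually.of_forall fun v τ _ => ?_)
    · refine h.2.congr_deriv ?_
      rw [contGrad, contGrad, ← integral_const_mul, ← integral_const_mul,
        ← integral_add ((integrableOn_contGrad hα₂ 0 _).const_mul _)
          ((integrableOn_contGrad hα₂ 1 _).const_mul _)]
      refine integral_congr_ae (Eventually.of_forall fun v => ?_)
      simp only [plane_inner e v]
      ring
    · refine abs_kernel_mul_le (abs_inner_le e v) ((abs_sin_inner_le _ v).trans ?_)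
        (norm_nonneg _) (by positivity)
      refine mul_le_mul_of_nonneg_right ?_ (norm_nonneg _)
      refine (norm_add_le _ _).trans (add_le_add_right ?_ _)
      rw [norm_smul, Real.norm_eq_abs]
      refine mul_le_mul_of_nonneg_right ?_ (norm_nonneg _)
      have := abs_add_le t (τ - t)
      rw [add_sub_cancel] at this
      rw [Metric.mem_ball, Real.dist_eq] at hτ
      linarith
    · have hl : HasDerivAt (fun τ : ℝ => inner ℝ (θ + τ • e) v) (inner ℝ e v) τ := by
        simp only [inner_add_left, real_inner_smul_left]
        simpa using ((hasDerivAt_id τ).mul_const (inner ℝ e v)).const_add (inner ℝ θ v)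
      exact ((hl.cos.const_sub 1).const_mul _).congr_deriv (by ring)
  · intro i θ e t
    have h := hasDerivAt_integral_of_dominated_loc_of_deriv_le
      (μ := volume.restrict (Metric.ball (0 : Plane) M)) (x₀ := t) (s := Set.univ)
      (F := fun τ v => ‖v‖ ^ (-2 - α) * (v i * Real.sin (inner ℝ (θ + τ • e) v)))
      (F' := fun τ v => ‖v‖ ^ (-2 - α) * (v i * (inner ℝ e v * Real.cos (inner ℝ (θ + τ • e) v))))
      (bound := fun v => 1 * ‖e‖ * ‖v‖ ^ (-α))
      Filter.univ_mem (Eventually.of_forall fun τ => by fun_prop)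
      (integrableOn_contGrad hα₂ i _) (by fun_prop)
      (Eventually.of_forall fun v τ hτ => ?_) (hb.const_mul _)
      (Eventually.of_forall fun v τ _ => ?_)
    · refine h.2.congr_deriv ?_
      rw [hessInt, hessInt, ← integral_const_mul, ← integral_const_mul,
        ← integral_add ((integrableOn_contHess hα₂ i 0 _).const_mul _)
          ((integrableOn_contHess hα₂ i 1 _).const_mul _)]
      refine integral_congr_ae (Eventually.of_forall fun v => ?_)
      simp only [plane_inner e v, momentKernel]
      ring
    · refine abs_kernel_mul_le (by simpa using abs_apply_le_norm v i) ?_ zero_le_one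
        (norm_nonneg _)
      rw [abs_mul]
      exact (mul_le_of_le_one_right (abs_nonneg _) (Real.abs_cos_le_one _)).trans
        (abs_inner_le e v)
    · have hl : HasDerivAt (fun τ : ℝ => inner ℝ (θ + τ • e) v) (inner ℝ e v) τ := by
        simp only [inner_add_left, real_inner_smul_left]
        simpa using ((hasDerivAt_id τ).mul_const (inner ℝ e v)).const_add (inner ℝ θ v)
      exact ((hl.sin.const_mul (v i)).const_mul _).congr_deriv (by ring)

end Cont

/-- The symbol of the jump weights on `(1/n) ℤ²`, rescaled but not normalized. -/
def discSymb (α r M : ℝ) (n : ℕ) (θ : Plane) : ℝ :=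
  (n : ℝ) ^ α * ∑ z ∈ latPunct (n * M + 1), unitWeight α r (n * M) z *
    (1 - Real.cos (inner ℝ θ (latticePt n z)))

/-- The gradient of `discSymb`. -/
def discGrad (α r M : ℝ) (n : ℕ) (i : Fin 2) (θ : Plane) : ℝ :=
  (n : ℝ) ^ α * ∑ z ∈ latPunct (n * M + 1), unitWeight α r (n * M) z *
    (latticePt n z i * Real.sin (inner ℝ θ (latticePt n z)))

/-- The Hessian of `discSymb`. -/
def discHess (α r M : ℝ) (n : ℕ) (i j : Fin 2) (θ : Plane) : ℝ :=
  (n : ℝ) ^ α * ∑ z ∈ latPunct (n * M + 1), unitWeight α r (n * M) z *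
    (latticePt n z i * latticePt n z j * Real.cos (inner ℝ θ (latticePt n z)))

lemma planeC2_discSymb (α r M : ℝ) (n : ℕ) :
    PlaneC2 (discSymb α r M n) (discGrad α r M n) (discHess α r M n) := by
  constructor
  · unfold discSymb; fun_prop
  · intro i; unfold discGrad; fun_prop
  · intro i j; unfold discHess; fun_prop
  · intro θ e t
    unfold discSymb discGrad
    have hl : ∀ v : Plane, HasDerivAt (fun τ : ℝ => inner ℝ (θ + τ • e) v) (inner ℝ e v) t := by
      intro v
      simp only [inner_add_left, real_inner_smul_left]
      simpa using ((hasDerivAt_id t).mul_const (inner ℝ e v)).const_add (inner ℝ θ v)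
    refine ((HasDerivAt.fun_sum fun z _ =>
      ((hl (latticePt n z)).cos.const_sub 1).const_mul (unitWeight α r (n * M) z)).const_mul
        ((n : ℝ) ^ α)).congr_deriv ?_
    simp only [plane_inner e, Finset.mul_sum, ← Finset.sum_add_distrib]
    refine Finset.sum_congr rfl fun z _ => ?_
    ring
  · intro i θ e t
    unfold discGrad discHess
    have hl : ∀ v : Plane, HasDerivAt (fun τ : ℝ => inner ℝ (θ + τ • e) v) (inner ℝ e v) t := by
      intro v
      simp only [inner_add_left, real_inner_smul_left]
      simpa using ((hasDerivAt_id t).mul_const (inner ℝ e v)).const_add (inner ℝ θ v)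
    refine ((HasDerivAt.fun_sum fun z _ =>
      ((hl (latticePt n z)).sin.const_mul (latticePt n z i)).const_mul
        (unitWeight α r (n * M) z)).const_mul ((n : ℝ) ^ α)).congr_deriv ?_
    simp only [plane_inner e, Finset.mul_sum, ← Finset.sum_add_distrib]
    refine Finset.sum_congr rfl fun z _ => ?_
    ring

/-! ### Bounds on the continuum symbol -/

/-- The order of magnitude of the symbols. -/
def symbSize (α : ℝ) (θ : Plane) : ℝ := min (‖θ‖ ^ 2) (‖θ‖ ^ α)

lemma symbSize_nonneg (α : ℝ) (θ : Plane) : 0 ≤ symbSize α θ := by unfold symbSize; positivity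

lemma symbSize_pos (α : ℝ) {θ : Plane} (hθ : θ ≠ 0) : 0 < symbSize α θ := by
  have := norm_pos_iff.2 hθ
  unfold symbSize; positivity

lemma le_mul_symbSize {α A B C : ℝ} {θ : Plane} {a : ℝ} (h₁ : a ≤ A * ‖θ‖ ^ 2)
    (h₂ : a ≤ B * ‖θ‖ ^ α) (hA : A ≤ C) (hB : B ≤ C) : a ≤ C * symbSize α θ := by
  unfold symbSize
  rcases min_choice (‖θ‖ ^ 2) (‖θ‖ ^ α) with h | h <;> rw [h]
  · exact h₁.trans (by gcongr)
  · exact h₂.trans (by gcongr)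

lemma symbSize_smul_le {α : ℝ} (hα : 0 ≤ α) {t : ℝ} (ht0 : 0 ≤ t) (ht1 : t ≤ 1) (θ : Plane) :
    symbSize α (t • θ) ≤ symbSize α θ := by
  have : ‖t • θ‖ ≤ ‖θ‖ := by
    rw [norm_smul, Real.norm_eq_abs, abs_of_nonneg ht0]
    exact mul_le_of_le_one_left (norm_nonneg _) ht1
  unfold symbSize
  gcongr

section Cont

variable {α M : ℝ}

lemma integral_kernel_inner_sq (hα₂ : α < 2) (R : ℝ) (θ : Plane) :
    IntegrableOn (fun v => ‖v‖ ^ (-2 - α) * (inner ℝ θ v) ^ 2) (Metric.ball 0 R) ∧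
    ∫ v in Metric.ball (0 : Plane) R, ‖v‖ ^ (-2 - α) * (inner ℝ θ v) ^ 2
      = ‖θ‖ ^ 2 * (ballMoment α R / 2) := by
  have e : (fun v : Plane => ‖v‖ ^ (-2 - α) * (inner ℝ θ v) ^ 2)
      = fun v => θ 0 ^ 2 * momentKernel α 0 0 v + 2 * θ 0 * θ 1 * momentKernel α 0 1 v
        + θ 1 ^ 2 * momentKernel α 1 1 v := by
    ext v; simp only [plane_inner, momentKernel]; ring
  have i0 := (integrableOn_momentKernel hα₂ 0 0 R).const_mul (θ 0 ^ 2)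
  have i1 := (integrableOn_momentKernel hα₂ 0 1 R).const_mul (2 * θ 0 * θ 1)
  have i2 := (integrableOn_momentKernel hα₂ 1 1 R).const_mul (θ 1 ^ 2)
  have i01 : IntegrableOn (fun v => θ 0 ^ 2 * momentKernel α 0 0 v
      + 2 * θ 0 * θ 1 * momentKernel α 0 1 v) (Metric.ball 0 R) := i0.add i1
  rw [e]
  refine ⟨i01.add i2, ?_⟩
  rw [integral_add i01 i2, integral_add i0 i1, integral_const_mul, integral_const_mul,
    integral_const_mul, integral_momentKernel hα₂, integral_momentKernel hα₂,
    integral_momentKernel hα₂, plane_norm_sq]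
  simp; ring

/-- The inequality 1 - cos t ≥ 2t²/π² for |t| ≤ π is integrated over the ball of radius M or π/|θ|,
whichever is smaller; there |θ·v| ≤ π. -/
lemma exists_contSymb_ge (hα₂ : α < 2) (hM : 0 < M) :
    ∃ c, 0 < c ∧ ∀ θ, c * symbSize α θ ≤ contSymb α M θ := by
  have hπ := Real.pi_pos
  have h2 : 0 < 2 - α := by linarith
  refine ⟨2 / (Real.pi * (2 - α)) * min (M ^ (2 - α)) 1, by positivity, fun θ => ?_⟩
  have hnn : ∀ v : Plane, 0 ≤ ‖v‖ ^ (-2 - α) * (1 - Real.cos (inner ℝ θ v)) := fun v =>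
    mul_nonneg (by positivity) (by linarith [Real.cos_le_one (inner ℝ θ v)])
  rcases eq_or_ne θ 0 with rfl | hθ
  · simp [symbSize, contSymb, min_eq_left (Real.rpow_nonneg le_rfl α)]
  have hu := norm_pos_iff.2 hθ
  have key : ∀ ρ, 0 < ρ → ρ ≤ M → ρ * ‖θ‖ ≤ Real.pi →
      2 / (Real.pi * (2 - α)) * (ρ ^ (2 - α) * ‖θ‖ ^ 2) ≤ contSymb α M θ := by
    intro ρ hρ hρM hρθ
    obtain ⟨hi, he⟩ := integral_kernel_inner_sq hα₂ ρ θ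
    have h1 : ∫ v in Metric.ball (0 : Plane) ρ,
        2 / Real.pi ^ 2 * (‖v‖ ^ (-2 - α) * (inner ℝ θ v) ^ 2)
        ≤ ∫ v in Metric.ball (0 : Plane) ρ, ‖v‖ ^ (-2 - α) * (1 - Real.cos (inner ℝ θ v)) := by
      refine setIntegral_mono_on (hi.const_mul _) (integrableOn_contSymb hα₂ θ)
        measurableSet_ball fun v hv => ?_
      have hx : |inner ℝ θ v| ≤ Real.pi := by
        refine (abs_inner_le θ v).trans (le_trans ?_ hρθ)
        rw [mul_comm]
        simp only [Metric.mem_ball, dist_zero_right] at hv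
        gcongr
      have := Real.cos_le_one_sub_mul_cos_sq hx
      rw [mul_left_comm]
      gcongr
      linarith
    have h3 : ∫ v in Metric.ball (0 : Plane) ρ, ‖v‖ ^ (-2 - α) * (1 - Real.cos (inner ℝ θ v))
        ≤ contSymb α M θ :=
      setIntegral_mono_set (integrableOn_contSymb hα₂ θ) (Eventually.of_forall hnn)
        (LE.le.eventuallyLE (Metric.ball_subset_ball hρM))
    rw [integral_const_mul, he, ballMoment_value hα₂ hρ.le] at h1
    refine (le_of_eq ?_).trans (h1.trans h3)
    field_simp
  rcases le_total M (Real.pi / ‖θ‖) with h | h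
  · have hk := key M hM le_rfl (by rwa [le_div_iff₀ hu] at h)
    refine le_trans ?_ hk
    rw [mul_assoc]
    refine mul_le_mul_of_nonneg_left ?_ (by positivity)
    exact mul_le_mul (min_le_left _ _) (min_le_left _ _) (symbSize_nonneg _ _) (by positivity)
  · have hk := key (Real.pi / ‖θ‖) (by positivity) h (by field_simp; rfl)
    refine le_trans ?_ hk
    rw [mul_assoc]
    refine mul_le_mul_of_nonneg_left ?_ (by positivity)
    rw [mul_rpow_mul_sq (by positivity) hu, div_mul_cancel₀ _ hu.ne']
    refine mul_le_mul ((min_le_right _ _).trans ?_) (min_le_right _ _) (symbSize_nonneg _ _)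
      (by positivity)
    exact Real.one_le_rpow (by linarith [Real.pi_gt_three]) h2.le

/-- Using |sin(θ·v)| ≤ |θ||v| on the whole ball gives the quadratic bound. For the other one the
ball is split at |v| = 1/|θ|; outside, the sine is bounded by 1 and |v|^{-1-α} is integrable at
infinity since α > 1. -/
lemma exists_contGrad_le (hα₁ : 1 < α) (hα₂ : α < 2) (hM : 0 < M) :
    ∃ C, 0 ≤ C ∧ ∀ i θ, |contGrad α M i θ| * ‖θ‖ ≤ C * symbSize α θ := by
  have hπ := Real.pi_pos
  have h2 : 0 < 2 - α := by linarith
  have h1 : 0 < α - 1 := by linarith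
  have hbm : ballMoment α M = 2 * Real.pi / (2 - α) * M ^ (2 - α) := ballMoment_value hα₂ hM.le
  have hb0 : 0 ≤ ballMoment α M := by rw [hbm]; positivity
  refine ⟨max (ballMoment α M) (2 * Real.pi / (2 - α) + 2 * Real.pi / (α - 1)),
    le_max_of_le_left hb0, fun i θ => ?_⟩
  rcases eq_or_ne θ 0 with rfl | hθ
  · rw [norm_zero, mul_zero]; exact mul_nonneg (le_max_of_le_left hb0) (symbSize_nonneg _ _)
  have hu := norm_pos_iff.2 hθ
  have hv : ∀ v : Plane, |‖v‖ ^ (-2 - α) * (v i * Real.sin (inner ℝ θ v))|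
      ≤ ‖θ‖ * ‖v‖ ^ (-α) := fun v => by
    have := abs_kernel_mul_le (α := α) (A := 1) (v := v) (by simpa using abs_apply_le_norm v i)
      (abs_sin_inner_le θ v) zero_le_one (norm_nonneg _)
    rwa [one_mul] at this
  have hb : ∀ ρ, IntegrableOn (fun v : Plane => ‖θ‖ * ‖v‖ ^ (-α)) (Metric.ball 0 ρ) := fun ρ =>
    (integrableOn_ball_rpow hα₂ ρ).const_mul _
  refine le_mul_symbSize ?_ ?_ (le_max_left _ _) (le_max_right _ _)
  · have := abs_integral_le_of_abs_le (hb M) hv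
    rw [integral_const_mul, ← ballMoment_eq] at this
    calc |contGrad α M i θ| * ‖θ‖ ≤ (‖θ‖ * ballMoment α M) * ‖θ‖ := by gcongr; exact this
      _ = _ := by ring
  · set ρ := 1 / ‖θ‖ with hρ
    have hρ0 : 0 < ρ := by positivity
    have hsplit := integral_inter_add_sdiff (μ := volume) (s := Metric.ball (0 : Plane) M)
      (t := Metric.ball 0 ρ) measurableSet_ball (integrableOn_contGrad hα₂ i θ)
    have a1 : |∫ v in Metric.ball (0 : Plane) M ∩ Metric.ball 0 ρ,
        ‖v‖ ^ (-2 - α) * (v i * Real.sin (inner ℝ θ v))| ≤ ‖θ‖ * (2 * Real.pi / (2 - α) * ρ ^ (2 - α)) := by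
      refine (abs_integral_le_of_abs_le
        ((hb ρ).mono_set Set.inter_subset_right) hv).trans ?_
      refine (setIntegral_mono_set (hb ρ)
        (Eventually.of_forall fun v => by positivity)
        (LE.le.eventuallyLE Set.inter_subset_right)).trans (le_of_eq ?_)
      rw [integral_const_mul, integral_ball_rpow hα₂ hρ0.le]
    have hv2 : ∀ v : Plane, |‖v‖ ^ (-2 - α) * (v i * Real.sin (inner ℝ θ v))|
        ≤ ‖v‖ ^ (-(1 + α)) := fun v => by
      rcases eq_or_ne v 0 with rfl | hv0
      · simp; positivity
      · rw [abs_mul, abs_mul, abs_of_nonneg (by positivity : 0 ≤ ‖v‖ ^ (-2 - α))]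
        have hp := norm_pos_iff.2 hv0
        calc ‖v‖ ^ (-2 - α) * (|v i| * |Real.sin (inner ℝ θ v)|)
            ≤ ‖v‖ ^ (-2 - α) * (‖v‖ * 1) := by
              gcongr
              · exact abs_apply_le_norm v i
              · exact Real.abs_sin_le_one _
          _ = _ := by
              rw [mul_one, ← Real.rpow_add_one hp.ne']; congr 1; ring
    have hc := integrableOn_compl_ball_rpow (p := 1 + α) (by linarith) hρ0
    have hsub : Metric.ball (0 : Plane) M \ Metric.ball 0 ρ ⊆ (Metric.ball 0 ρ)ᶜ := fun v hv => hv.2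
    have a2 : |∫ v in Metric.ball (0 : Plane) M \ Metric.ball 0 ρ,
        ‖v‖ ^ (-2 - α) * (v i * Real.sin (inner ℝ θ v))| ≤ 2 * Real.pi / (α - 1) * ρ ^ (1 - α) := by
      refine (abs_integral_le_of_abs_le (hc.mono_set hsub) hv2).trans ?_
      refine (setIntegral_mono_set hc (Eventually.of_forall fun v => by positivity)
        (LE.le.eventuallyLE hsub)).trans (le_of_eq ?_)
      rw [integral_compl_ball_rpow (by linarith) hρ0]
      congr 2 <;> ring
    have hg : |contGrad α M i θ| ≤ ‖θ‖ * (2 * Real.pi / (2 - α) * ρ ^ (2 - α))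
        + 2 * Real.pi / (α - 1) * ρ ^ (1 - α) := by
      rw [contGrad, ← hsplit]
      exact (abs_add_le _ _).trans (add_le_add a1 a2)
    have e1 : ‖θ‖ * ‖θ‖ * ρ ^ (2 - α) = ‖θ‖ ^ α := by
      rw [hρ, inv_rpow_two_sub hu, ← sq, ← Real.rpow_two, ← Real.rpow_add hu]; congr 1; ring
    have e2 : ρ ^ (1 - α) * ‖θ‖ = ‖θ‖ ^ α := by
      rw [hρ, one_div, Real.inv_rpow hu.le, ← Real.rpow_neg hu.le, ← Real.rpow_add_one hu.ne']
      congr 1; ring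
    calc |contGrad α M i θ| * ‖θ‖ ≤ (‖θ‖ * (2 * Real.pi / (2 - α) * ρ ^ (2 - α))
        + 2 * Real.pi / (α - 1) * ρ ^ (1 - α)) * ‖θ‖ := by gcongr
      _ = 2 * Real.pi / (2 - α) * (‖θ‖ * ‖θ‖ * ρ ^ (2 - α))
          + 2 * Real.pi / (α - 1) * (ρ ^ (1 - α) * ‖θ‖) := by ring
      _ = _ := by rw [e1, e2]; ring

lemma exists_contHess_le (hα₁ : 1 < α) (hα₂ : α < 2) (hM : 0 < M) :
    ∃ C, 0 ≤ C ∧ ∀ i j θ, |hessInt α i j M θ| * ‖θ‖ ^ 2 ≤ C * symbSize α θ := by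
  have h2 : 0 < 2 - α := by linarith
  have hb0 : 0 ≤ ballMoment α M := by
    rw [ballMoment_value hα₂ hM.le]; have := Real.pi_pos; positivity
  choose C hC h using exists_hessInt_le hα₁ hα₂
  set D := C 0 0 + C 0 1 + C 1 0 + C 1 1 with hD
  have hCD : ∀ i j, C i j ≤ D := by
    intro i j
    have a := hC 0 0; have b := hC 0 1; have c := hC 1 0; have d := hC 1 1
    fin_cases i <;> fin_cases j <;> simp only [hD] <;> simp <;> linarith
  refine ⟨max (ballMoment α M) D, le_max_of_le_left hb0, fun i j θ => ?_⟩
  refine le_mul_symbSize ?_ ?_ (le_max_left _ _) (le_max_right _ _)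
  · have := abs_integral_le_of_abs_le (integrableOn_ball_rpow hα₂ M)
      (fun v => abs_momentKernel_cos_le (α := α) i j θ v)
    rw [← ballMoment_eq] at this
    exact mul_le_mul_of_nonneg_right this (by positivity)
  · rcases eq_or_ne θ 0 with rfl | hθ
    · rw [norm_zero, zero_pow two_ne_zero, mul_zero]
      have := (hC 0 0).trans (hCD 0 0)
      positivity
    have hu := norm_pos_iff.2 hθ
    refine (mul_le_mul_of_nonneg_right ((h i j M θ hθ).trans
      (mul_le_mul_of_nonneg_right (hCD i j) (by positivity))) (by positivity)).trans (le_of_eq ?_)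
    rw [mul_assoc, ← Real.rpow_two, ← Real.rpow_add hu]
    congr 2; ring

lemma abs_one_sub_cos_sub_sq_le (x : ℝ) : |1 - Real.cos x - x ^ 2 / 2| ≤ 3 * x ^ 4 := by
  rcases le_total |x| 1 with h | h
  · have := Real.cos_bound h
    rw [pow_abs, abs_of_nonneg (by positivity : 0 ≤ x ^ 4)] at this
    rw [show 1 - Real.cos x - x ^ 2 / 2 = -(Real.cos x - (1 - x ^ 2 / 2)) by ring, abs_neg]
    have h4 : 0 ≤ x ^ 4 := by positivity
    linarith
  · have h1 : 1 ≤ x ^ 2 := by rw [← sq_abs]; exact one_le_pow₀ h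
    have h2 := Real.cos_le_one x
    have h3 := Real.neg_one_le_cos x
    rw [abs_le]
    constructor <;> nlinarith

/-- The symmetry of the ball makes the quadratic part a multiple of |θ|². The fourth-order error is
what keeps the reciprocal within a bounded distance of its quadratic model in
`exists_residPart_sub_le`. -/
lemma exists_contSymb_sub_sq_le (hα₂ : α < 2) (hM : 0 < M) :
    ∃ C, 0 ≤ C ∧ ∀ θ, |contSymb α M θ - ballMoment α M / 4 * ‖θ‖ ^ 2| ≤ C * ‖θ‖ ^ 4 := by
  have h2 : 0 < 2 - α := by linarith
  have hb0 : 0 ≤ ballMoment α M := by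
    rw [ballMoment_value hα₂ hM.le]; have := Real.pi_pos; positivity
  refine ⟨3 * M ^ 2 * ballMoment α M, by positivity, fun θ => ?_⟩
  obtain ⟨hi, he⟩ := integral_kernel_inner_sq hα₂ M θ
  have e1 : contSymb α M θ - ballMoment α M / 4 * ‖θ‖ ^ 2
      = ∫ v in Metric.ball (0 : Plane) M,
        ‖v‖ ^ (-2 - α) * (1 - Real.cos (inner ℝ θ v) - (inner ℝ θ v) ^ 2 / 2) := by
    have : (fun v : Plane => ‖v‖ ^ (-2 - α) * (1 - Real.cos (inner ℝ θ v) - (inner ℝ θ v) ^ 2 / 2))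
        = fun v => ‖v‖ ^ (-2 - α) * (1 - Real.cos (inner ℝ θ v))
          - 1 / 2 * (‖v‖ ^ (-2 - α) * (inner ℝ θ v) ^ 2) := by ext v; ring
    rw [this, integral_sub (integrableOn_contSymb hα₂ θ) (hi.const_mul _), integral_const_mul, he,
      contSymb]
    ring
  rw [e1, ← Real.norm_eq_abs]
  have hg := ((integrableOn_ball_rpow hα₂ M).const_mul (3 * M ^ 2 * ‖θ‖ ^ 4))
  refine (norm_integral_le_of_norm_le hg
    ((ae_restrict_iff' measurableSet_ball).2 (Eventually.of_forall fun v hv => ?_))).trans ?_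
  · simp only [Metric.mem_ball, dist_zero_right] at hv
    rw [Real.norm_eq_abs, abs_mul, abs_of_nonneg (by positivity : 0 ≤ ‖v‖ ^ (-2 - α))]
    have hx : (inner ℝ θ v) ^ 4 ≤ ‖θ‖ ^ 4 * (M ^ 2 * (‖v‖ * ‖v‖)) := by
      calc (inner ℝ θ v) ^ 4 = ((inner ℝ θ v) ^ 2) ^ 2 := by ring
        _ ≤ (‖θ‖ ^ 2 * ‖v‖ ^ 2) ^ 2 := by
          have := inner_sq_le θ v
          gcongr
        _ = ‖θ‖ ^ 4 * (‖v‖ ^ 2 * (‖v‖ * ‖v‖)) := by ring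
        _ ≤ _ := by gcongr
    calc ‖v‖ ^ (-2 - α) * |1 - Real.cos (inner ℝ θ v) - (inner ℝ θ v) ^ 2 / 2|
        ≤ ‖v‖ ^ (-2 - α) * (3 * (‖θ‖ ^ 4 * (M ^ 2 * (‖v‖ * ‖v‖)))) := by
          gcongr
          exact (abs_one_sub_cos_sub_sq_le _).trans (by linarith)
      _ = 3 * M ^ 2 * ‖θ‖ ^ 4 * (‖v‖ ^ (-2 - α) * (‖v‖ * ‖v‖)) := by ring
      _ ≤ _ := by
          gcongr
          exact norm_rpow_mul_sq_le α v
  · rw [integral_const_mul, ← ballMoment_eq]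
    exact le_of_eq (by ring)

end Cont

/-! ### Comparison of the symbols -/

lemma PlaneC2.sub {φ φ' : Plane → ℝ} {φ₁ φ₁' : Fin 2 → Plane → ℝ}
    {φ₂ φ₂' : Fin 2 → Fin 2 → Plane → ℝ} (h : PlaneC2 φ φ₁ φ₂) (h' : PlaneC2 φ' φ₁' φ₂') :
    PlaneC2 (fun θ => φ θ - φ' θ) (fun i θ => φ₁ i θ - φ₁' i θ)
      (fun i j θ => φ₂ i j θ - φ₂' i j θ) where
  cont := h.cont.sub h'.cont
  cont₁ i := (h.cont₁ i).sub (h'.cont₁ i)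
  cont₂ i j := (h.cont₂ i j).sub (h'.cont₂ i j)
  deriv θ e t := ((h.deriv θ e t).sub (h'.deriv θ e t)).congr_deriv (by ring)
  deriv₁ i θ e t := ((h.deriv₁ i θ e t).sub (h'.deriv₁ i θ e t)).congr_deriv (by ring)

/-- A function whose first-order jet vanishes at the origin is bounded along a ray by its
Hessian. -/
lemma PlaneC2.abs_le_of_hess {φ : Plane → ℝ} {φ₁ : Fin 2 → Plane → ℝ}
    {φ₂ : Fin 2 → Fin 2 → Plane → ℝ} (h : PlaneC2 φ φ₁ φ₂) (h0 : φ 0 = 0) (h1 : ∀ i, φ₁ i 0 = 0)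
    {θ : Plane} {B : ℝ} (hB : ∀ i j, ∀ t : ℝ, 0 ≤ t → t ≤ 1 → |φ₂ i j (t • θ)| ≤ B) :
    (∀ i, |φ₁ i θ| ≤ 2 * ‖θ‖ * B) ∧ |φ θ| ≤ 4 * ‖θ‖ ^ 2 * B := by
  have hB0 : 0 ≤ B := (abs_nonneg _).trans (hB 0 0 0 le_rfl zero_le_one)
  have comb : ∀ a b D : ℝ, |a| ≤ D → |b| ≤ D → |θ 0 * a + θ 1 * b| ≤ 2 * ‖θ‖ * D := by
    intro a b D ha hb
    refine (abs_add_le _ _).trans ?_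
    rw [abs_mul, abs_mul]
    have := mul_le_mul (abs_apply_le_norm θ 0) ha (abs_nonneg _) (norm_nonneg _)
    have := mul_le_mul (abs_apply_le_norm θ 1) hb (abs_nonneg _) (norm_nonneg _)
    linarith
  have grad : ∀ i, ∀ s : ℝ, 0 ≤ s → s ≤ 1 → |φ₁ i (s • θ)| ≤ 2 * ‖θ‖ * B := by
    intro i s hs0 hs1
    have hd : ∀ t ∈ Set.Icc (0 : ℝ) 1, HasDerivWithinAt (fun t => φ₁ i (t • (s • θ)))
        ((s • θ) 0 * φ₂ i 0 (t • (s • θ)) + (s • θ) 1 * φ₂ i 1 (t • (s • θ))) (Set.Icc 0 1) t :=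
      fun t _ => by simpa using (h.deriv₁ i 0 (s • θ) t).hasDerivWithinAt
    have := norm_image_sub_le_of_norm_deriv_le_segment_01' hd (C := 2 * ‖θ‖ * B) (fun t ht => by
      have e : (s • θ) 0 * φ₂ i 0 (t • (s • θ)) + (s • θ) 1 * φ₂ i 1 (t • (s • θ))
          = θ 0 * (s * φ₂ i 0 ((t * s) • θ)) + θ 1 * (s * φ₂ i 1 ((t * s) • θ)) := by
        simp only [smul_smul, PiLp.smul_apply, smul_eq_mul]; ring
      rw [e, Real.norm_eq_abs]
      have hts0 : 0 ≤ t * s := mul_nonneg ht.1 hs0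
      have hts1 : t * s ≤ 1 := mul_le_one₀ ht.2.le hs0 hs1
      have hk : ∀ k, |s * φ₂ i k ((t * s) • θ)| ≤ B := fun k => by
        rw [abs_mul, abs_of_nonneg hs0]
        exact (mul_le_of_le_one_left (abs_nonneg _) hs1).trans (hB i k _ hts0 hts1)
      exact comb _ _ _ (hk 0) (hk 1))
    simpa [h1] using this
  refine ⟨fun i => by simpa using grad i 1 zero_le_one le_rfl, ?_⟩
  have hd : ∀ t ∈ Set.Icc (0 : ℝ) 1, HasDerivWithinAt (fun t : ℝ => φ (t • θ))
      (θ 0 * φ₁ 0 (t • θ) + θ 1 * φ₁ 1 (t • θ)) (Set.Icc 0 1) t :=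
    fun t _ => by simpa using (h.deriv 0 θ t).hasDerivWithinAt
  have := norm_image_sub_le_of_norm_deriv_le_segment_01' hd (C := 4 * ‖θ‖ ^ 2 * B)
    (fun t ht => by
      rw [Real.norm_eq_abs]
      refine (comb _ _ _ (grad 0 t ht.1 ht.2.le) (grad 1 t ht.1 ht.2.le)).trans (le_of_eq ?_)
      ring)
  simpa [h0] using this

lemma latticePt_eq_smul {n : ℕ} (z : Fin 2 → ℤ) : latticePt n z = (n : ℝ)⁻¹ • intPt z := by
  ext i; simp [latticePt, div_eq_inv_mul]

section

variable {α r M : ℝ}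

lemma discHess_eq {n : ℕ} (hn : 0 < n) (i j : Fin 2) (θ : Plane) :
    discHess α r M n i j θ = (n : ℝ) ^ (α - 2) * hessSum α r i j (n * M) ((n : ℝ)⁻¹ • θ) := by
  have hn0 : (0 : ℝ) < n := by exact_mod_cast hn
  rw [discHess, hessSum, show α - 2 = α + (-2) by ring, Real.rpow_add hn0, mul_assoc]
  congr 1
  rw [Finset.mul_sum]
  refine Finset.sum_congr rfl fun z _ => ?_
  have : (n : ℝ) ^ (-2 : ℝ) = (n : ℝ)⁻¹ * (n : ℝ)⁻¹ := by
    rw [Real.rpow_neg hn0.le, Real.rpow_two, sq, mul_inv]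
  rw [latticePt_eq_smul, real_inner_smul_right, real_inner_smul_left, this]
  simp only [PiLp.smul_apply, smul_eq_mul]
  ring

open scoped Pointwise in
lemma hessInt_scale {n : ℕ} (hn : 0 < n) (i j : Fin 2) (θ : Plane) :
    hessInt α i j M θ = (n : ℝ) ^ (α - 2) * hessInt α i j (n * M) ((n : ℝ)⁻¹ • θ) := by
  have hn0 : (0 : ℝ) < n := by exact_mod_cast hn
  have h := Measure.setIntegral_comp_smul_of_pos (volume : Measure Plane)
    (fun v => momentKernel α i j v * Real.cos (inner ℝ ((n : ℝ)⁻¹ • θ) v))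
    (Metric.ball (0 : Plane) M) hn0
  have hs : (n : ℝ) • Metric.ball (0 : Plane) M = Metric.ball 0 (n * M) := by
    rw [smul_ball hn0.ne', smul_zero, Real.norm_eq_abs, abs_of_pos hn0]
  rw [hs] at h
  have hk : ∀ v : Plane, momentKernel α i j ((n : ℝ) • v)
      = (n : ℝ) ^ (-α) * momentKernel α i j v := fun v => by
    have : (n : ℝ) ^ (-α) = (n : ℝ) * n * (n : ℝ) ^ (-2 - α) := by
      rw [← sq, ← Real.rpow_two, ← Real.rpow_add hn0]; congr 1; ring
    rw [momentKernel, momentKernel, norm_smul, Real.norm_eq_abs, abs_of_pos hn0,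
      Real.mul_rpow hn0.le (norm_nonneg _), this]
    simp only [PiLp.smul_apply, smul_eq_mul]
    ring
  simp only [hk, real_inner_smul_left, real_inner_smul_right,
    mul_assoc, integral_const_mul, smul_eq_mul] at h
  simp only [finrank_euclideanSpace, Fintype.card_fin] at h
  simp only [hessInt, real_inner_smul_left]
  have e : (n : ℝ) ^ (α - 2) = (n : ℝ) ^ α * ((n : ℝ) ^ 2)⁻¹ := by
    rw [Real.rpow_sub hn0, Real.rpow_two]; rfl
  rw [e, mul_assoc, ← h, Real.rpow_neg hn0.le]
  field_simp

/-- The first two derivatives of the rescaled symbols differ by `O(n⁻²)`. -/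
lemma exists_discSymb_sub_contSymb_le (hα₁ : 1 < α) (hα₂ : α < 2) (hr : 0 < r) (hrM : r < M) :
    ∃ D, 0 ≤ D ∧ ∀ (n : ℕ) (θ : Plane), 1 ≤ n → θ ∈ box (n * Real.pi) →
      (∀ i j, |discHess α r M n i j θ - hessInt α i j M θ| ≤ D * ((n : ℝ) ^ 2)⁻¹ * symbSize α θ) ∧
      (∀ i, |discGrad α r M n i θ - contGrad α M i θ|
        ≤ D * ((n : ℝ) ^ 2)⁻¹ * (‖θ‖ * symbSize α θ)) ∧
      |discSymb α r M n θ - contSymb α M θ| ≤ D * ((n : ℝ) ^ 2)⁻¹ * (‖θ‖ ^ 2 * symbSize α θ) := by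
  have hM : 0 < M := hr.trans hrM
  choose C hC h using exists_hessSum_sub_hessInt_le hα₁ hα₂ hr hrM
  set D := C 0 0 + C 0 1 + C 1 0 + C 1 1 with hD
  have hCD : ∀ i j, C i j ≤ D := by
    intro i j
    have a := hC 0 0; have b := hC 0 1; have c := hC 1 0; have d := hC 1 1
    fin_cases i <;> fin_cases j <;> simp only [hD] <;> simp <;> linarith
  have hD0 : 0 ≤ D := (hC 0 0).trans (hCD 0 0)
  have key : ∀ (n : ℕ) (θ : Plane), 1 ≤ n → θ ∈ box (n * Real.pi) → ∀ i j,
      |discHess α r M n i j θ - hessInt α i j M θ|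
        ≤ D * max (M ^ (2 - α)) 1 * ((n : ℝ) ^ 2)⁻¹ * symbSize α θ := by
    intro n θ hn hθ i j
    have hn0 : (0 : ℝ) < n := by exact_mod_cast hn
    have hR : M ≤ n * M := le_mul_of_one_le_left hM.le (by exact_mod_cast hn)
    have hbox : ∀ k, |((n : ℝ)⁻¹ • θ) k| ≤ Real.pi := fun k => by
      rw [PiLp.smul_apply, smul_eq_mul, abs_mul, abs_of_pos (inv_pos.2 hn0),
        inv_mul_le_iff₀ hn0]
      exact hθ k
    obtain ⟨b1, b2⟩ := h i j (n * M) _ hR hbox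
    have hnorm : ‖(n : ℝ)⁻¹ • θ‖ = (n : ℝ)⁻¹ * ‖θ‖ := by
      rw [norm_smul, Real.norm_eq_abs, abs_of_pos (inv_pos.2 hn0)]
    rw [hnorm] at b1 b2
    have e1 : |discHess α r M n i j θ - hessInt α i j M θ|
        = (n : ℝ) ^ (α - 2) * |hessSum α r i j (n * M) ((n : ℝ)⁻¹ • θ)
          - hessInt α i j (n * M) ((n : ℝ)⁻¹ • θ)| := by
      rw [discHess_eq hn, hessInt_scale hn, ← mul_sub, abs_mul, abs_of_pos (by positivity)]
    have hm := hCD i j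
    have hD1 := hC i j
    -- With these two identities both bounds at unit scale acquire the same factor n^{-2}, one in
    -- front of |θ|² and one in front of |θ|^α.
    have p1 : (n : ℝ) ^ (α - 2) * (n : ℝ) ^ (2 - α) = 1 := by
      rw [← Real.rpow_add hn0, show α - 2 + (2 - α) = 0 by ring, Real.rpow_zero]
    have p2 : (n : ℝ) ^ (α - 2) * ((n : ℝ)⁻¹) ^ α = ((n : ℝ) ^ 2)⁻¹ := by
      rw [Real.inv_rpow hn0.le, ← Real.rpow_neg hn0.le, ← Real.rpow_add hn0,
        show α - 2 + -α = -2 by ring, Real.rpow_neg hn0.le, Real.rpow_two]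
    refine le_mul_symbSize (A := D * M ^ (2 - α) * ((n : ℝ) ^ 2)⁻¹)
      (B := D * ((n : ℝ) ^ 2)⁻¹) ?_ ?_ ?_ ?_
    · rw [e1]
      refine (mul_le_mul_of_nonneg_left b1 (by positivity)).trans ?_
      calc (n : ℝ) ^ (α - 2) * (C i j * (((n : ℝ) * M) ^ (2 - α) * ((n : ℝ)⁻¹ * ‖θ‖) ^ 2))
          = C i j * ((n : ℝ) ^ (α - 2) * (n : ℝ) ^ (2 - α)) * M ^ (2 - α) * ((n : ℝ) ^ 2)⁻¹
              * ‖θ‖ ^ 2 := by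
            rw [Real.mul_rpow hn0.le hM.le, mul_pow, inv_pow]; ring
        _ ≤ _ := by rw [p1, mul_one]; gcongr
    · rw [e1]
      refine (mul_le_mul_of_nonneg_left b2 (by positivity)).trans ?_
      calc (n : ℝ) ^ (α - 2) * (C i j * ((n : ℝ)⁻¹ * ‖θ‖) ^ α)
          = C i j * ((n : ℝ) ^ (α - 2) * ((n : ℝ)⁻¹) ^ α) * ‖θ‖ ^ α := by
            rw [Real.mul_rpow (by positivity) (norm_nonneg _)]; ring
        _ ≤ _ := by rw [p2]; gcongr
    · have := le_max_left (M ^ (2 - α)) 1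
      gcongr
    · have := le_max_right (M ^ (2 - α)) 1
      have h2 : 0 ≤ D * ((n : ℝ) ^ 2)⁻¹ := by positivity
      nlinarith
  refine ⟨4 * (D * max (M ^ (2 - α)) 1), by positivity, fun n θ hn hθ => ?_⟩
  set B := D * max (M ^ (2 - α)) 1 with hBdef
  have hB0 : 0 ≤ B := by positivity
  have hm := symbSize_nonneg α θ
  -- The square is star-shaped about the origin and `symbSize` increases along rays, so the bound at
  -- θ controls the Hessian on the whole segment from 0 to θ.
  have hray := ((planeC2_discSymb α r M n).sub (planeC2_contSymb (M := M) hα₂)).abs_le_of_hess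
    (by simp [discSymb, contSymb]) (by simp [discGrad, contGrad]) (θ := θ)
    (B := B * ((n : ℝ) ^ 2)⁻¹ * symbSize α θ) (fun i j t ht0 ht1 => by
      refine (key n (t • θ) hn (fun k => ?_) i j).trans ?_
      · rw [PiLp.smul_apply, smul_eq_mul, abs_mul, abs_of_nonneg ht0]
        exact (mul_le_of_le_one_left (abs_nonneg _) ht1).trans (hθ k)
      · exact mul_le_mul_of_nonneg_left (symbSize_smul_le (by linarith) ht0 ht1 θ) (by positivity))
  have hpos : 0 ≤ B * ((n : ℝ) ^ 2)⁻¹ * symbSize α θ := by positivity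
  refine ⟨fun i j => (key n θ hn hθ i j).trans (by linarith), fun i => (hray.1 i).trans ?_,
    hray.2.trans (le_of_eq (by ring))⟩
  have : 0 ≤ ‖θ‖ * (B * ((n : ℝ) ^ 2)⁻¹ * symbSize α θ) := by positivity
  linarith

end

/-- Two-sided bounds on a symbol and its derivatives over a set. -/
structure SymbBound (α c C : ℝ) (φ : Plane → ℝ) (φ₁ : Fin 2 → Plane → ℝ)
    (φ₂ : Fin 2 → Fin 2 → Plane → ℝ) (S : Set Plane) : Prop where
  nonneg : ∀ θ, 0 ≤ φ θ
  lower : ∀ θ ∈ S, c * symbSize α θ ≤ φ θ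
  grad : ∀ θ ∈ S, ∀ i, |φ₁ i θ| * ‖θ‖ ≤ C * symbSize α θ
  hess : ∀ θ ∈ S, ∀ i, |φ₂ i i θ| * ‖θ‖ ^ 2 ≤ C * symbSize α θ

lemma norm_le_of_mem_box {R : ℝ} {θ : Plane} (hθ : θ ∈ box (R * Real.pi)) (hR : 0 < R) :
    ‖θ‖ ≤ 5 * R := by
  have h : ‖R⁻¹ • θ‖ ≤ 5 := norm_le_five fun k => by
    rw [PiLp.smul_apply, smul_eq_mul, abs_mul, abs_of_pos (inv_pos.2 hR), inv_mul_le_iff₀ hR]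
    exact hθ k
  rw [norm_smul, Real.norm_eq_abs, abs_of_pos (inv_pos.2 hR), inv_mul_le_iff₀ hR] at h
  linarith

section

variable {α r M : ℝ}

/-- All other jumps contribute nonnegatively, and the nearest-neighbour part vanishes in the square
[-nπ,nπ]² only at the origin when its weight is positive. -/
lemma nnWeight_mul_le_discSymb {n : ℕ} (hM : 0 ≤ M) (θ : Plane) :
    (n : ℝ) ^ α * (nnWeight α r (n * M) *
      (2 * (1 - Real.cos (θ 0 / n)) + 2 * (1 - Real.cos (θ 1 / n)))) ≤ discSymb α r M n θ := by
  rw [discSymb, sum_unitWeight_mul (by positivity) le_rfl]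
  refine mul_le_mul_of_nonneg_left ?_ (by positivity)
  have h1 : ∑ z ∈ nnPts, (1 - Real.cos (inner ℝ θ (latticePt n z)))
      = 2 * (1 - Real.cos (θ 0 / n)) + 2 * (1 - Real.cos (θ 1 / n)) := by
    rw [sum_nnPts]
    simp only [plane_inner, latticePt]
    simp only [Matrix.cons_val_zero, Matrix.cons_val_one, Int.cast_one, Int.cast_neg,
      Int.cast_zero, zero_div, mul_zero, add_zero, zero_add, neg_div, mul_neg, Real.cos_neg,
      mul_one_div]
    ring
  rw [h1]
  refine le_add_of_nonneg_right (Finset.sum_nonneg fun z _ => ?_)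
  have := cellMass_nonneg r (n * M) z
  have := Real.cos_le_one (inner ℝ θ (latticePt n z))
  exact mul_nonneg (by positivity) (by linarith)

lemma discSymb_nonneg (hα₁ : 1 < α) (hα₂ : α < 2) (hM : 0 < M) (n : ℕ) (hn : 1 ≤ n) (θ : Plane) :
    0 ≤ discSymb α r M n θ := by
  obtain ⟨κ, hκ, h⟩ := exists_nnWeight_ge (r := r) hα₁ hα₂ hM
  refine le_trans ?_ (nnWeight_mul_le_discSymb hM.le θ)
  have h1 := h (n * M) (le_mul_of_one_le_left hM.le (by exact_mod_cast hn))
  have := Real.cos_le_one (θ 0 / n)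
  have := Real.cos_le_one (θ 1 / n)
  have := hκ.trans_le h1
  exact mul_nonneg (by positivity) (mul_nonneg this.le (by linarith))

/-- For |θ|² ≤ εn² the discrete symbol is so close to the continuum one that half of the lower bound
of the latter survives. For larger |θ| the nearest-neighbour jumps alone give order n^α, which is
the size of |θ|^α there because |θ| ≤ 5n. -/
lemma exists_discSymb_ge (hα₁ : 1 < α) (hα₂ : α < 2) (hr : 0 < r) (hrM : r < M) :
    ∃ c, 0 < c ∧ ∀ (n : ℕ) (θ : Plane), 1 ≤ n → θ ∈ box (n * Real.pi) →
      c * symbSize α θ ≤ discSymb α r M n θ := by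
  have hM : 0 < M := hr.trans hrM
  have hπ := Real.pi_pos
  obtain ⟨κ, hκ, hnn⟩ := exists_nnWeight_ge (r := r) hα₁ hα₂ hM
  obtain ⟨c, hc, hcont⟩ := exists_contSymb_ge hα₂ hM
  obtain ⟨D, hD, hdiff⟩ := exists_discSymb_sub_contSymb_le hα₁ hα₂ hr hrM
  -- Chosen so that Dε ≤ c/2; the added 1 covers D = 0.
  set ε := c / (2 * (D + 1)) with hε
  have hε0 : 0 < ε := by positivity
  have hc' : 0 < κ * (4 / Real.pi ^ 2) * ε / 5 ^ α := by positivity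
  refine ⟨min (c / 2) (κ * (4 / Real.pi ^ 2) * ε / 5 ^ α), by positivity, fun n θ hn hθ => ?_⟩
  have hn0 : (0 : ℝ) < n := by exact_mod_cast hn
  have hm := symbSize_nonneg α θ
  rcases le_total (‖θ‖ ^ 2) (ε * (n : ℝ) ^ 2) with h | h
  · have h1 := (hdiff n θ hn hθ).2.2
    have h2 := hcont θ
    have h3 : D * ((n : ℝ) ^ 2)⁻¹ * (‖θ‖ ^ 2 * symbSize α θ) ≤ c / 2 * symbSize α θ := by
      have : ((n : ℝ) ^ 2)⁻¹ * ‖θ‖ ^ 2 ≤ ε := by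
        rw [inv_mul_le_iff₀ (by positivity)]; linarith
      calc D * ((n : ℝ) ^ 2)⁻¹ * (‖θ‖ ^ 2 * symbSize α θ)
          = D * (((n : ℝ) ^ 2)⁻¹ * ‖θ‖ ^ 2) * symbSize α θ := by ring
        _ ≤ (D + 1) * ε * symbSize α θ := by gcongr; linarith
        _ = c / 2 * symbSize α θ := by rw [hε]; field_simp
    have h4 : min (c / 2) (κ * (4 / Real.pi ^ 2) * ε / 5 ^ α) * symbSize α θ
        ≤ c / 2 * symbSize α θ := mul_le_mul_of_nonneg_right (min_le_left _ _) hm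
    rw [abs_le] at h1
    linarith [h1.1]
  · refine le_trans ?_ (nnWeight_mul_le_discSymb hM.le θ)
    have h1 := hnn (n * M) (le_mul_of_one_le_left hM.le (by exact_mod_cast hn))
    have hcos : ∀ k, 2 / Real.pi ^ 2 * (θ k / n) ^ 2 ≤ 1 - Real.cos (θ k / n) := fun k => by
      have : |θ k / n| ≤ Real.pi := by
        rw [abs_div, abs_of_pos hn0, div_le_iff₀ hn0, mul_comm]; exact hθ k
      linarith [Real.cos_le_one_sub_mul_cos_sq this]
    have h2 : 4 / Real.pi ^ 2 * ε
        ≤ 2 * (1 - Real.cos (θ 0 / n)) + 2 * (1 - Real.cos (θ 1 / n)) := by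
      have e : 4 / Real.pi ^ 2 * (‖θ‖ ^ 2 / (n : ℝ) ^ 2)
          = 2 * (2 / Real.pi ^ 2 * (θ 0 / n) ^ 2) + 2 * (2 / Real.pi ^ 2 * (θ 1 / n) ^ 2) := by
        rw [plane_norm_sq]; ring
      have : ε ≤ ‖θ‖ ^ 2 / (n : ℝ) ^ 2 := by rwa [le_div_iff₀ (by positivity)]
      have := mul_le_mul_of_nonneg_left this (by positivity : 0 ≤ 4 / Real.pi ^ 2)
      linarith [hcos 0, hcos 1]
    have h3 : symbSize α θ ≤ 5 ^ α * (n : ℝ) ^ α := by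
      rw [← Real.mul_rpow (by norm_num) hn0.le]
      exact (min_le_right _ _).trans
        (Real.rpow_le_rpow (norm_nonneg _) (norm_le_of_mem_box hθ hn0) (by linarith))
    calc min (c / 2) (κ * (4 / Real.pi ^ 2) * ε / 5 ^ α) * symbSize α θ
        ≤ κ * (4 / Real.pi ^ 2) * ε / 5 ^ α * (5 ^ α * (n : ℝ) ^ α) :=
          mul_le_mul (min_le_right _ _) h3 hm hc'.le
      _ = (n : ℝ) ^ α * (κ * (4 / Real.pi ^ 2 * ε)) := by field_simp
      _ ≤ _ := by
          have := hκ.le.trans h1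
          gcongr

/-- The bounds on the symbols that the estimates of the Green's functions rely on. -/
lemma exists_symbBound (hα₁ : 1 < α) (hα₂ : α < 2) (hr : 0 < r) (hrM : r < M) :
    ∃ c C, 0 < c ∧ 0 ≤ C ∧
      SymbBound α c C (contSymb α M) (contGrad α M) (fun i j => hessInt α i j M) Set.univ ∧
      ∀ n : ℕ, 1 ≤ n → SymbBound α c C (discSymb α r M n) (discGrad α r M n) (discHess α r M n)
        (box (n * Real.pi)) := by
  have hM : 0 < M := hr.trans hrM
  obtain ⟨c₁, hc₁, h₁⟩ := exists_contSymb_ge hα₂ hM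
  obtain ⟨c₂, hc₂, h₂⟩ := exists_discSymb_ge hα₁ hα₂ hr hrM
  obtain ⟨C₁, hC₁, g₁⟩ := exists_contGrad_le hα₁ hα₂ hM
  obtain ⟨C₂, hC₂, g₂⟩ := exists_contHess_le hα₁ hα₂ hM
  obtain ⟨D, hD, hdiff⟩ := exists_discSymb_sub_contSymb_le hα₁ hα₂ hr hrM
  have low : ∀ c θ a, min c₁ c₂ ≤ c → c * symbSize α θ ≤ a → min c₁ c₂ * symbSize α θ ≤ a :=
    fun c θ a h h' => (mul_le_mul_of_nonneg_right h (symbSize_nonneg _ _)).trans h'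
  have up : ∀ C θ a, C ≤ C₁ + C₂ + D * 25 → a ≤ C * symbSize α θ →
      a ≤ (C₁ + C₂ + D * 25) * symbSize α θ :=
    fun C θ a h h' => h'.trans (mul_le_mul_of_nonneg_right h (symbSize_nonneg _ _))
  refine ⟨min c₁ c₂, C₁ + C₂ + D * 25, lt_min hc₁ hc₂, by positivity, ?_, fun n hn => ?_⟩
  · refine ⟨fun θ => ?_, fun θ _ => low _ _ _ (min_le_left _ _) (h₁ θ),
      fun θ _ i => up C₁ _ _ (by linarith) (g₁ i θ), fun θ _ i => up C₂ _ _ (by linarith) (g₂ i i θ)⟩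
    exact (mul_nonneg hc₁.le (symbSize_nonneg _ _)).trans (h₁ θ)
  · have hn0 : (0 : ℝ) < n := by exact_mod_cast hn
    -- On the square |θ| ≤ 5n, so an error with the factor n^{-2}|θ|² is of the order of the main
    -- term and only enlarges the constant.
    have hq : ∀ θ ∈ box (n * Real.pi), ((n : ℝ) ^ 2)⁻¹ * ‖θ‖ ^ 2 ≤ 25 := fun θ hθ => by
      rw [inv_mul_le_iff₀ (by positivity)]
      have := norm_le_of_mem_box hθ hn0
      calc ‖θ‖ ^ 2 ≤ (5 * (n : ℝ)) ^ 2 := by gcongr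
        _ = _ := by ring
    refine ⟨discSymb_nonneg hα₁ hα₂ hM n hn, fun θ hθ => low _ _ _ (min_le_right _ _) (h₂ n θ hn hθ),
      fun θ hθ i => up (C₁ + D * 25) _ _ (by linarith) ?_,
      fun θ hθ i => up (C₂ + D * 25) _ _ (by linarith) ?_⟩
    · have a := (hdiff n θ hn hθ).2.1 i
      have b := g₁ i θ
      have e := abs_add_le (contGrad α M i θ) (discGrad α r M n i θ - contGrad α M i θ)
      rw [add_sub_cancel] at e
      have hm := symbSize_nonneg α θ
      calc |discGrad α r M n i θ| * ‖θ‖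
          ≤ (|contGrad α M i θ| + D * ((n : ℝ) ^ 2)⁻¹ * (‖θ‖ * symbSize α θ)) * ‖θ‖ := by
            gcongr; linarith
        _ = |contGrad α M i θ| * ‖θ‖ + D * (((n : ℝ) ^ 2)⁻¹ * ‖θ‖ ^ 2) * symbSize α θ := by ring
        _ ≤ C₁ * symbSize α θ + D * 25 * symbSize α θ := by
            have := hq θ hθ
            gcongr
        _ = _ := by ring
    · have a := (hdiff n θ hn hθ).1 i i
      have b := g₂ i i θ
      have e := abs_add_le (hessInt α i i M θ) (discHess α r M n i i θ - hessInt α i i M θ)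
      rw [add_sub_cancel] at e
      have hm := symbSize_nonneg α θ
      calc |discHess α r M n i i θ| * ‖θ‖ ^ 2
          ≤ (|hessInt α i i M θ| + D * ((n : ℝ) ^ 2)⁻¹ * symbSize α θ) * ‖θ‖ ^ 2 := by
            gcongr; linarith
        _ = |hessInt α i i M θ| * ‖θ‖ ^ 2 + D * (((n : ℝ) ^ 2)⁻¹ * ‖θ‖ ^ 2) * symbSize α θ := by ring
        _ ≤ C₂ * symbSize α θ + D * 25 * symbSize α θ := by
            have := hq θ hθ
            gcongr
        _ = _ := by ring

lemma psiCont_eq (θ : Plane) : psiCont α r M θ = cLim α r M * contSymb α M θ := by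
  rw [psiCont, contSymb]
  congr 1
  refine setIntegral_congr_fun measurableSet_ball fun v _ => ?_
  rw [show -2 - α = -(2 + α) by ring, Real.rpow_neg (norm_nonneg _), div_eq_inv_mul]

lemma psiDisc_eq (hα₂ : α < 2) (hM : 0 ≤ M) {n : ℕ} (hn : 1 ≤ n) (θ : Plane) :
    psiDisc α r M n θ = cn α r M n * discSymb α r M n θ := by
  have hn0 : n ≠ 0 := by omega
  have h : ∑' z, pn α r M n z * (1 - Real.cos (inner ℝ θ (latticePt n z)))
      = ∑ z ∈ latPunct (n * M + 1), pn α r M n z * (1 - Real.cos (inner ℝ θ (latticePt n z))) := by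
    refine tsum_eq_sum fun z hz => ?_
    rw [pn, jumpWeight_eq hα₂ hM hn0, unitWeight_eq_zero (by positivity) le_rfl hz]
    simp
  rw [psiDisc, discSymb, h, mul_left_comm]
  congr 1
  rw [Finset.mul_sum]
  refine Finset.sum_congr rfl fun z _ => ?_
  rw [pn, jumpWeight_eq hα₂ hM hn0, mul_assoc]

lemma inner_latticePt_linePt {n : ℕ} (hn : 1 ≤ n) (i : Fin 2) (s : ℝ) (z : Fin 2 → ℤ) :
    inner ℝ (linePt i (n * Real.pi) s) (latticePt n z)
      = inner ℝ (linePt i (-(n * Real.pi)) s) (latticePt n z) + z i * (2 * Real.pi) := by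
  have hn0 : (n : ℝ) ≠ 0 := by positivity
  obtain ⟨j, hij⟩ : ∃ j : Fin 2, i ≠ j := ⟨1 - i, by fin_cases i <;> decide⟩
  rw [inner_linePt hij, inner_linePt hij]
  simp only [latticePt]
  field_simp
  ring

lemma discSymb_periodic {n : ℕ} (hn : 1 ≤ n) (i : Fin 2) (s : ℝ) :
    discSymb α r M n (linePt i (n * Real.pi) s) = discSymb α r M n (linePt i (-(n * Real.pi)) s) := by
  simp only [discSymb, inner_latticePt_linePt hn, Real.cos_add_int_mul_two_pi]

lemma discGrad_periodic {n : ℕ} (hn : 1 ≤ n) (i k : Fin 2) (s : ℝ) :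
    discGrad α r M n k (linePt i (n * Real.pi) s)
      = discGrad α r M n k (linePt i (-(n * Real.pi)) s) := by
  simp only [discGrad, inner_latticePt_linePt hn, Real.sin_add_int_mul_two_pi]

end

/-! ### Splitting of the reciprocal of a symbol -/

/-- The regular part `1 / (1 + φ) + 1 / (1 + φ) ^ 2` of `1 / φ`. -/
def regPart (φ : Plane → ℝ) (θ : Plane) : ℝ := (1 + φ θ)⁻¹ + (1 + φ θ)⁻¹ ^ 2

/-- The partial derivatives of `regPart`. -/
def regGrad (φ : Plane → ℝ) (φ₁ : Fin 2 → Plane → ℝ) (i : Fin 2) (θ : Plane) : ℝ :=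
  -(((1 + φ θ)⁻¹ ^ 2 + 2 * (1 + φ θ)⁻¹ ^ 3) * φ₁ i θ)

/-- The second partial derivatives of `regPart`. -/
def regHess (φ : Plane → ℝ) (φ₁ : Fin 2 → Plane → ℝ) (φ₂ : Fin 2 → Fin 2 → Plane → ℝ) (i : Fin 2)
    (θ : Plane) : ℝ :=
  (2 * (1 + φ θ)⁻¹ ^ 3 + 6 * (1 + φ θ)⁻¹ ^ 4) * φ₁ i θ ^ 2
    - ((1 + φ θ)⁻¹ ^ 2 + 2 * (1 + φ θ)⁻¹ ^ 3) * φ₂ i i θ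

/-- The absolutely integrable part `1 / φ - regPart φ` of `1 / φ`. -/
def residPart (φ : Plane → ℝ) (θ : Plane) : ℝ := (φ θ)⁻¹ * (1 + φ θ)⁻¹ ^ 2

/-- A finite geometric expansion of 1/φ in powers of (1+φ)^{-1}. Two terms are split off so that the
remainder decays like |θ|^{-3α}: its tail beyond nπ is O(n^{2-3α}), hence O(n^{-α}). After one term
the corresponding bound would be n^{2-2α}, which is too weak for α < 2. -/
lemma inv_eq_regPart_add {φ : Plane → ℝ} {θ : Plane} (h : 0 < φ θ) :
    (φ θ)⁻¹ = regPart φ θ + residPart φ θ := by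
  have : 1 + φ θ ≠ 0 := by positivity
  rw [regPart, residPart]
  field_simp
  ring

section Calculus

variable {φ : Plane → ℝ} {φ₁ : Fin 2 → Plane → ℝ} {φ₂ : Fin 2 → Fin 2 → Plane → ℝ}

lemma PlaneC2.hasDerivAt_linePt (h : PlaneC2 φ φ₁ φ₂) (i : Fin 2) (t s : ℝ) :
    HasDerivAt (fun t => φ (linePt i t s)) (φ₁ i (linePt i t s)) t := by
  have := h.deriv (linePt i 0 s) (EuclideanSpace.single i 1) t
  simp only [linePt_add_smul, zero_add] at this
  refine this.congr_deriv ?_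
  fin_cases i <;> simp

lemma PlaneC2.hasDerivAt_linePt₁ (h : PlaneC2 φ φ₁ φ₂) (i : Fin 2) (t s : ℝ) :
    HasDerivAt (fun t => φ₁ i (linePt i t s)) (φ₂ i i (linePt i t s)) t := by
  have := h.deriv₁ i (linePt i 0 s) (EuclideanSpace.single i 1) t
  simp only [linePt_add_smul, zero_add] at this
  refine this.congr_deriv ?_
  fin_cases i <;> simp

lemma PlaneC2.continuous_inv (h : PlaneC2 φ φ₁ φ₂) (h0 : ∀ θ, 0 ≤ φ θ) :
    Continuous fun θ => (1 + φ θ)⁻¹ :=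
  (continuous_const.add h.cont).inv₀ fun θ => (show 0 < 1 + φ θ by linarith [h0 θ]).ne'

lemma PlaneC2.continuous_regPart (h : PlaneC2 φ φ₁ φ₂) (h0 : ∀ θ, 0 ≤ φ θ) :
    Continuous (regPart φ) := by
  have := h.continuous_inv h0
  unfold regPart
  fun_prop

lemma PlaneC2.continuous_regGrad (h : PlaneC2 φ φ₁ φ₂) (h0 : ∀ θ, 0 ≤ φ θ) (i : Fin 2) :
    Continuous (regGrad φ φ₁ i) := by
  have := h.continuous_inv h0
  have := h.cont₁ i
  unfold regGrad
  fun_prop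

lemma PlaneC2.continuous_regHess (h : PlaneC2 φ φ₁ φ₂) (h0 : ∀ θ, 0 ≤ φ θ) (i : Fin 2) :
    Continuous (regHess φ φ₁ φ₂ i) := by
  have := h.continuous_inv h0
  have := h.cont₁ i
  have := h.cont₂ i i
  unfold regHess
  fun_prop

lemma PlaneC2.hasDerivAt_regPart (h : PlaneC2 φ φ₁ φ₂) (h0 : ∀ θ, 0 ≤ φ θ) (i : Fin 2) (t s : ℝ) :
    HasDerivAt (fun t => regPart φ (linePt i t s)) (regGrad φ φ₁ i (linePt i t s)) t := by
  have hne : 1 + φ (linePt i t s) ≠ 0 := by have := h0 (linePt i t s); positivity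
  have hi : HasDerivAt (fun t => (1 + φ (linePt i t s))⁻¹)
      (-((1 + φ (linePt i t s))⁻¹ ^ 2 * φ₁ i (linePt i t s))) t :=
    (((h.hasDerivAt_linePt i t s).const_add 1).fun_inv hne).congr_deriv (by field_simp)
  refine (hi.add (hi.fun_pow 2)).congr_deriv ?_
  rw [regGrad]
  simp only [Nat.reduceSub, Nat.cast_ofNat, pow_one]
  ring

lemma PlaneC2.hasDerivAt_regGrad (h : PlaneC2 φ φ₁ φ₂) (h0 : ∀ θ, 0 ≤ φ θ) (i : Fin 2) (t s : ℝ) :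
    HasDerivAt (fun t => regGrad φ φ₁ i (linePt i t s)) (regHess φ φ₁ φ₂ i (linePt i t s)) t := by
  have hne : 1 + φ (linePt i t s) ≠ 0 := by have := h0 (linePt i t s); positivity
  have hi : HasDerivAt (fun t => (1 + φ (linePt i t s))⁻¹)
      (-((1 + φ (linePt i t s))⁻¹ ^ 2 * φ₁ i (linePt i t s))) t :=
    (((h.hasDerivAt_linePt i t s).const_add 1).fun_inv hne).congr_deriv (by field_simp)
  have := (((hi.fun_pow 2).fun_add ((hi.fun_pow 3).const_mul 2)).fun_mul
    (h.hasDerivAt_linePt₁ i t s)).fun_neg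
  refine this.congr_deriv ?_
  rw [regHess]
  simp only [Nat.reduceSub, Nat.cast_ofNat, pow_one]
  ring

end Calculus

/-! ### Sizes of the regular and residual parts, and of their differences for two symbols. -/

section Bounds

/-- The reciprocal order of magnitude of `1 + φ`. -/
def symbInv (α : ℝ) (θ : Plane) : ℝ := (1 + symbSize α θ)⁻¹

variable {α : ℝ}

lemma symbInv_pos (α : ℝ) (θ : Plane) : 0 < symbInv α θ := by
  have := symbSize_nonneg α θ
  unfold symbInv; positivity

lemma symbInv_le_one (α : ℝ) (θ : Plane) : symbInv α θ ≤ 1 :=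
  inv_le_one_of_one_le₀ (by linarith [symbSize_nonneg α θ])

lemma symbInv_mul_le_one (α : ℝ) (θ : Plane) : symbInv α θ * symbSize α θ ≤ 1 := by
  have := symbSize_nonneg α θ
  rw [symbInv, inv_mul_le_iff₀ (by positivity)]
  linarith

/-- Near the origin the right side exceeds 1, so the decay at infinity gives a bound at every
nonzero frequency. -/
lemma symbInv_le_rpow (hα₁ : 1 < α) (hα₂ : α < 2) {θ : Plane} (hθ : θ ≠ 0) :
    symbInv α θ ≤ ‖θ‖ ^ (-α) := by
  have hu := norm_pos_iff.2 hθ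
  rw [symbInv, Real.rpow_neg hu.le]
  refine inv_anti₀ (by positivity) ?_
  rcases le_total ‖θ‖ 1 with h | h
  · have := Real.rpow_le_one hu.le h (by linarith : 0 ≤ α)
    linarith [symbSize_nonneg α θ]
  · have : symbSize α θ = ‖θ‖ ^ α := by
      rw [symbSize, min_eq_right]
      rw [← Real.rpow_two]
      exact Real.rpow_le_rpow_of_exponent_le h hα₂.le
    linarith

variable {φ φ' : Plane → ℝ} {φ₁ φ₁' : Fin 2 → Plane → ℝ} {φ₂ φ₂' : Fin 2 → Fin 2 → Plane → ℝ}
  {S S' : Set Plane} {c C D ν B : ℝ} {θ : Plane}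

/-- As B dominates both 1 and c⁻¹, the sum 1 + `symbSize` is at most B(1 + φ). -/
lemma SymbBound.inv_le (h : SymbBound α c C φ φ₁ φ₂ S) (hc : 0 < c) (hB1 : 1 ≤ B) (hB : c⁻¹ ≤ B)
    (hθ : θ ∈ S) : (1 + φ θ)⁻¹ ≤ B * symbInv α θ := by
  have hm := symbSize_nonneg α θ
  have h1 := h.lower θ hθ
  have h0 := h.nonneg θ
  rw [symbInv, inv_le_iff_one_le_mul₀ (by positivity)]
  rw [← div_eq_mul_inv, div_mul_eq_mul_div, one_le_div (by positivity)]
  have h2 : 1 ≤ B * c := by rwa [inv_le_iff_one_le_mul₀ hc] at hB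
  nlinarith [mul_le_mul_of_nonneg_left h1 (by linarith : 0 ≤ B),
    mul_le_mul_of_nonneg_right h2 hm]

lemma SymbBound.inv_pos (h : SymbBound α c C φ φ₁ φ₂ S) : 0 < (1 + φ θ)⁻¹ := by
  have := h.nonneg θ
  positivity

lemma SymbBound.inv_le_one (h : SymbBound α c C φ φ₁ φ₂ S) : (1 + φ θ)⁻¹ ≤ 1 :=
  inv_le_one_of_one_le₀ (by linarith [h.nonneg θ])

lemma SymbBound.abs_regPart_le (h : SymbBound α c C φ φ₁ φ₂ S) (hc : 0 < c) (hB1 : 1 ≤ B)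
    (hB : c⁻¹ ≤ B) (hθ : θ ∈ S) : |regPart φ θ| ≤ 2 * B * symbInv α θ := by
  have h1 := h.inv_le hc hB1 hB hθ
  have h2 := h.inv_pos (θ := θ)
  have h3 := h.inv_le_one (θ := θ)
  rw [regPart, abs_of_nonneg (by positivity)]
  nlinarith

lemma SymbBound.abs_regGrad_le (h : SymbBound α c C φ φ₁ φ₂ S) (hc : 0 < c) (hC : 0 ≤ C)
    (hB1 : 1 ≤ B) (hB : c⁻¹ ≤ B) (hθ : θ ∈ S) (i : Fin 2) :
    |regGrad φ φ₁ i θ| * ‖θ‖ ≤ 3 * B ^ 2 * C * symbInv α θ := by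
  have h1 := h.inv_le hc hB1 hB hθ
  have h2 := h.inv_pos (θ := θ)
  have h3 := h.inv_le_one (θ := θ)
  have hm := symbSize_nonneg α θ
  have hP := symbInv_pos α θ
  have hPm := symbInv_mul_le_one α θ
  have hg := h.grad θ hθ i
  set s := (1 + φ θ)⁻¹ with hs
  set P := symbInv α θ with hPd
  have h4 : s ^ 2 + 2 * s ^ 3 ≤ 3 * (B * P) ^ 2 := by
    have : s ^ 3 ≤ s ^ 2 := pow_le_pow_of_le_one h2.le h3 (by norm_num)
    have : s ^ 2 ≤ (B * P) ^ 2 := pow_le_pow_left₀ h2.le h1 2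
    linarith
  rw [regGrad, abs_neg, abs_mul, abs_of_nonneg (by positivity : 0 ≤ s ^ 2 + 2 * s ^ 3), mul_assoc]
  calc (s ^ 2 + 2 * s ^ 3) * (|φ₁ i θ| * ‖θ‖) ≤ 3 * (B * P) ^ 2 * (C * symbSize α θ) := by gcongr
    _ = 3 * B ^ 2 * C * P * (P * symbSize α θ) := by ring
    _ ≤ 3 * B ^ 2 * C * P * 1 := by gcongr
    _ = _ := mul_one _

/-- The product P²m of P = `symbInv` and m = `symbSize` is kept because it is at most |θ|² near the
origin and at most |θ|^{-α} at infinity. After division by |θ|² the Hessian is bounded at 0 and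
integrable at infinity. -/
lemma SymbBound.abs_regHess_le (h : SymbBound α c C φ φ₁ φ₂ S) (hc : 0 < c) (hC : 0 ≤ C)
    (hB1 : 1 ≤ B) (hB : c⁻¹ ≤ B) (hθ : θ ∈ S) (i : Fin 2) :
    |regHess φ φ₁ φ₂ i θ| * ‖θ‖ ^ 2
      ≤ (8 * B ^ 3 * C ^ 2 + 3 * B ^ 2 * C) * (symbInv α θ ^ 2 * symbSize α θ) := by
  have h1 := h.inv_le hc hB1 hB hθ
  have h2 := h.inv_pos (θ := θ)
  have h3 := h.inv_le_one (θ := θ)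
  have hm := symbSize_nonneg α θ
  have hP := symbInv_pos α θ
  have hPm := symbInv_mul_le_one α θ
  have hg := h.grad θ hθ i
  have hh := h.hess θ hθ i
  set s := (1 + φ θ)⁻¹ with hs
  set P := symbInv α θ with hPd
  set m := symbSize α θ with hmd
  have h4 : s ^ 2 + 2 * s ^ 3 ≤ 3 * (B * P) ^ 2 := by
    have : s ^ 3 ≤ s ^ 2 := pow_le_pow_of_le_one h2.le h3 (by norm_num)
    have : s ^ 2 ≤ (B * P) ^ 2 := pow_le_pow_left₀ h2.le h1 2
    linarith
  have h5 : 2 * s ^ 3 + 6 * s ^ 4 ≤ 8 * (B * P) ^ 3 := by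
    have : s ^ 4 ≤ s ^ 3 := pow_le_pow_of_le_one h2.le h3 (by norm_num)
    have : s ^ 3 ≤ (B * P) ^ 3 := pow_le_pow_left₀ h2.le h1 3
    linarith
  have h6 : |regHess φ φ₁ φ₂ i θ| ≤ (2 * s ^ 3 + 6 * s ^ 4) * |φ₁ i θ| ^ 2
      + (s ^ 2 + 2 * s ^ 3) * |φ₂ i i θ| := by
    refine (abs_sub _ _).trans (le_of_eq ?_)
    rw [← hs, abs_mul, abs_mul, abs_of_nonneg (by positivity : 0 ≤ 2 * s ^ 3 + 6 * s ^ 4),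
      abs_of_nonneg (by positivity : 0 ≤ s ^ 2 + 2 * s ^ 3), abs_pow]
  calc |regHess φ φ₁ φ₂ i θ| * ‖θ‖ ^ 2
      ≤ ((2 * s ^ 3 + 6 * s ^ 4) * |φ₁ i θ| ^ 2 + (s ^ 2 + 2 * s ^ 3) * |φ₂ i i θ|) * ‖θ‖ ^ 2 := by
        gcongr
    _ = (2 * s ^ 3 + 6 * s ^ 4) * (|φ₁ i θ| * ‖θ‖) ^ 2
        + (s ^ 2 + 2 * s ^ 3) * (|φ₂ i i θ| * ‖θ‖ ^ 2) := by ring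
    _ ≤ 8 * (B * P) ^ 3 * (C * m) ^ 2 + 3 * (B * P) ^ 2 * (C * m) := by gcongr
    _ = 8 * B ^ 3 * C ^ 2 * (P ^ 2 * m) * (P * m) + 3 * B ^ 2 * C * (P ^ 2 * m) := by ring
    _ ≤ 8 * B ^ 3 * C ^ 2 * (P ^ 2 * m) * 1 + 3 * B ^ 2 * C * (P ^ 2 * m) := by gcongr
    _ = _ := by ring

lemma SymbBound.abs_inv_sub_le (h : SymbBound α c C φ φ₁ φ₂ S) (h' : SymbBound α c C φ' φ₁' φ₂' S')
    (hc : 0 < c) (hB1 : 1 ≤ B) (hB : c⁻¹ ≤ B) (hθ : θ ∈ S) (hθ' : θ ∈ S') :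
    |(1 + φ θ)⁻¹ - (1 + φ' θ)⁻¹| ≤ (B * symbInv α θ) ^ 2 * |φ' θ - φ θ| := by
  have h0 := h.nonneg θ
  have h0' := h'.nonneg θ
  have e : (1 + φ θ)⁻¹ - (1 + φ' θ)⁻¹ = (1 + φ θ)⁻¹ * (1 + φ' θ)⁻¹ * (φ' θ - φ θ) := by
    field_simp; ring
  rw [e, abs_mul, abs_mul, abs_of_pos h.inv_pos, abs_of_pos h'.inv_pos, sq]
  have := symbInv_pos α θ
  have a := h.inv_le hc hB1 hB hθ
  have b := h'.inv_le hc hB1 hB hθ'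
  have := h'.inv_pos (θ := θ)
  gcongr

/-- The second derivatives of the regular parts of two symbols that are close to second order. -/
lemma SymbBound.abs_regHess_sub_le (h : SymbBound α c C φ φ₁ φ₂ S)
    (h' : SymbBound α c C φ' φ₁' φ₂' S')
    (hc : 0 < c) (hC : 0 ≤ C) (hB1 : 1 ≤ B) (hB : c⁻¹ ≤ B) (hθ : θ ∈ S) (hθ' : θ ∈ S') (h0 : θ ≠ 0)
    (hD : 0 ≤ D) (i : Fin 2)
    (d0 : |φ' θ - φ θ| ≤ D * (‖θ‖ ^ 2 * symbSize α θ))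
    (d1 : |φ₁' i θ - φ₁ i θ| ≤ D * (‖θ‖ * symbSize α θ))
    (d2 : |φ₂' i i θ - φ₂ i i θ| ≤ D * symbSize α θ) :
    |regHess φ φ₁ φ₂ i θ - regHess φ' φ₁' φ₂' i θ|
      ≤ (30 * B ^ 5 * C ^ 2 + 16 * B ^ 3 * C + 8 * B ^ 4 * C + 3 * B ^ 2) * D * symbInv α θ := by
  have hu := norm_pos_iff.2 h0
  have a1 := h.inv_le hc hB1 hB hθ
  have a2 := h.inv_pos (θ := θ)
  have a3 := h.inv_le_one (θ := θ)
  have b1 := h'.inv_le hc hB1 hB hθ'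
  have b2 := h'.inv_pos (θ := θ)
  have b3 := h'.inv_le_one (θ := θ)
  have hds := h.abs_inv_sub_le h' hc hB1 hB hθ hθ'
  have hm := symbSize_nonneg α θ
  have hP := symbInv_pos α θ
  have hP1 := symbInv_le_one α θ
  have hPm := symbInv_mul_le_one α θ
  have hg := h.grad θ hθ i
  have hg' := h'.grad θ hθ' i
  have hh := h.hess θ hθ i
  rw [regHess, regHess]
  set s := (1 + φ θ)⁻¹
  set s' := (1 + φ' θ)⁻¹
  set P := symbInv α θ
  set m := symbSize α θ
  set u := ‖θ‖
  set g := φ₁ i θ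
  set g' := φ₁' i θ
  set k := φ₂ i i θ
  set k' := φ₂' i i θ
  have hs : |s - s'| ≤ (B * P) ^ 2 * (D * (u ^ 2 * m)) :=
    hds.trans (mul_le_mul_of_nonneg_left d0 (by positivity))
  have hBP : B * P ≤ B := mul_le_of_le_one_right (by linarith) hP1
  have hA : |2 * s ^ 3 + 6 * s ^ 4 - (2 * s' ^ 3 + 6 * s' ^ 4)| ≤ 30 * B * (B * P) ^ 2 * |s - s'| := by
    have e : 2 * s ^ 3 + 6 * s ^ 4 - (2 * s' ^ 3 + 6 * s' ^ 4)
        = (2 * (s ^ 2 + s * s' + s' ^ 2) + 6 * (s ^ 3 + s ^ 2 * s' + s * s' ^ 2 + s' ^ 3)) * (s - s') := by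
      ring
    rw [e, abs_mul, abs_of_nonneg (by positivity)]
    refine mul_le_mul_of_nonneg_right ?_ (abs_nonneg _)
    calc 2 * (s ^ 2 + s * s' + s' ^ 2) + 6 * (s ^ 3 + s ^ 2 * s' + s * s' ^ 2 + s' ^ 3)
        ≤ 2 * ((B * P) ^ 2 + (B * P) * (B * P) + (B * P) ^ 2) + 6 * ((B * P) ^ 3
          + (B * P) ^ 2 * (B * P) + (B * P) * (B * P) ^ 2 + (B * P) ^ 3) := by gcongr
      _ = (6 + 24 * (B * P)) * (B * P) ^ 2 := by ring
      _ ≤ _ := by gcongr; linarith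
  have hE : |s ^ 2 + 2 * s ^ 3 - (s' ^ 2 + 2 * s' ^ 3)| ≤ 8 * B * (B * P) * |s - s'| := by
    have e : s ^ 2 + 2 * s ^ 3 - (s' ^ 2 + 2 * s' ^ 3)
        = ((s + s') + 2 * (s ^ 2 + s * s' + s' ^ 2)) * (s - s') := by ring
    rw [e, abs_mul, abs_of_nonneg (by positivity)]
    refine mul_le_mul_of_nonneg_right ?_ (abs_nonneg _)
    calc (s + s') + 2 * (s ^ 2 + s * s' + s' ^ 2)
        ≤ (B * P + B * P) + 2 * ((B * P) ^ 2 + (B * P) * (B * P) + (B * P) ^ 2) := by gcongr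
      _ = (2 + 6 * (B * P)) * (B * P) := by ring
      _ ≤ _ := by gcongr; linarith
  have h4 : s' ^ 2 + 2 * s' ^ 3 ≤ 3 * (B * P) ^ 2 := by
    have : s' ^ 3 ≤ s' ^ 2 := pow_le_pow_of_le_one b2.le b3 (by norm_num)
    have : s' ^ 2 ≤ (B * P) ^ 2 := pow_le_pow_left₀ b2.le b1 2
    linarith
  have h5 : 2 * s' ^ 3 + 6 * s' ^ 4 ≤ 8 * (B * P) ^ 3 := by
    have : s' ^ 4 ≤ s' ^ 3 := pow_le_pow_of_le_one b2.le b3 (by norm_num)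
    have : s' ^ 3 ≤ (B * P) ^ 3 := pow_le_pow_left₀ b2.le b1 3
    linarith
  -- The bounds on the gradients contain the factor |θ|, so the inequality is proved after
  -- multiplication by |θ|, which then cancels.
  have hgs : |g ^ 2 - g' ^ 2| ≤ 2 * C * D * m ^ 2 := by
    have e : |g ^ 2 - g' ^ 2| * u ≤ (D * (u * m)) * (2 * (C * m)) := by
      have : |g ^ 2 - g' ^ 2| ≤ |g' - g| * (|g| + |g'|) := by
        rw [show g ^ 2 - g' ^ 2 = -((g' - g) * (g + g')) by ring, abs_neg, abs_mul]
        gcongr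
        exact abs_add_le _ _
      calc |g ^ 2 - g' ^ 2| * u ≤ |g' - g| * (|g| + |g'|) * u := by gcongr
        _ = |g' - g| * (|g| * u + |g'| * u) := by ring
        _ ≤ (D * (u * m)) * (C * m + C * m) := by gcongr
        _ = _ := by ring
    refine le_of_mul_le_mul_right (e.trans (le_of_eq ?_)) hu
    ring
  have hfin : |(2 * s ^ 3 + 6 * s ^ 4) * g ^ 2 - (s ^ 2 + 2 * s ^ 3) * k
      - ((2 * s' ^ 3 + 6 * s' ^ 4) * g' ^ 2 - (s' ^ 2 + 2 * s' ^ 3) * k')|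
      ≤ |2 * s ^ 3 + 6 * s ^ 4 - (2 * s' ^ 3 + 6 * s' ^ 4)| * g ^ 2
        + (2 * s' ^ 3 + 6 * s' ^ 4) * |g ^ 2 - g' ^ 2|
        + |s ^ 2 + 2 * s ^ 3 - (s' ^ 2 + 2 * s' ^ 3)| * |k|
        + (s' ^ 2 + 2 * s' ^ 3) * |k' - k| := by
    have e : (2 * s ^ 3 + 6 * s ^ 4) * g ^ 2 - (s ^ 2 + 2 * s ^ 3) * k
      - ((2 * s' ^ 3 + 6 * s' ^ 4) * g' ^ 2 - (s' ^ 2 + 2 * s' ^ 3) * k')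
      = (2 * s ^ 3 + 6 * s ^ 4 - (2 * s' ^ 3 + 6 * s' ^ 4)) * g ^ 2
        + (2 * s' ^ 3 + 6 * s' ^ 4) * (g ^ 2 - g' ^ 2)
        - (s ^ 2 + 2 * s ^ 3 - (s' ^ 2 + 2 * s' ^ 3)) * k
        + (s' ^ 2 + 2 * s' ^ 3) * (k' - k) := by ring
    rw [e]
    refine (abs_add_le _ _).trans (add_le_add ((abs_sub _ _).trans
      (add_le_add ((abs_add_le _ _).trans (add_le_add ?_ ?_)) ?_)) ?_)
    · rw [abs_mul, abs_of_nonneg (sq_nonneg g)]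
    · rw [abs_mul, abs_of_nonneg (by positivity : 0 ≤ 2 * s' ^ 3 + 6 * s' ^ 4)]
    · rw [abs_mul]
    · rw [abs_mul, abs_of_nonneg (by positivity : 0 ≤ s' ^ 2 + 2 * s' ^ 3)]
  refine hfin.trans ?_
  have t1 : |2 * s ^ 3 + 6 * s ^ 4 - (2 * s' ^ 3 + 6 * s' ^ 4)| * g ^ 2
      ≤ 30 * B ^ 5 * C ^ 2 * D * P := by
    calc _ ≤ 30 * B * (B * P) ^ 2 * ((B * P) ^ 2 * (D * (u ^ 2 * m))) * |g| ^ 2 := by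
          rw [sq_abs]
          refine mul_le_mul_of_nonneg_right (hA.trans ?_) (sq_nonneg g)
          gcongr
      _ = 30 * B ^ 5 * D * P ^ 4 * m * (|g| * u) ^ 2 := by ring
      _ ≤ 30 * B ^ 5 * D * P ^ 4 * m * (C * m) ^ 2 := by gcongr
      _ = 30 * B ^ 5 * C ^ 2 * D * P * (P * m) ^ 3 := by ring
      _ ≤ 30 * B ^ 5 * C ^ 2 * D * P * 1 := by
          gcongr
          exact pow_le_one₀ (by positivity) hPm
      _ = _ := mul_one _
  have t2 : (2 * s' ^ 3 + 6 * s' ^ 4) * |g ^ 2 - g' ^ 2| ≤ 16 * B ^ 3 * C * D * P := by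
    calc _ ≤ 8 * (B * P) ^ 3 * (2 * C * D * m ^ 2) := by gcongr
      _ = 16 * B ^ 3 * C * D * P * (P * m) ^ 2 := by ring
      _ ≤ 16 * B ^ 3 * C * D * P * 1 := by
          gcongr
          exact pow_le_one₀ (by positivity) hPm
      _ = _ := mul_one _
  have t3 : |s ^ 2 + 2 * s ^ 3 - (s' ^ 2 + 2 * s' ^ 3)| * |k| ≤ 8 * B ^ 4 * C * D * P := by
    calc _ ≤ 8 * B * (B * P) * ((B * P) ^ 2 * (D * (u ^ 2 * m))) * |k| := by
          refine mul_le_mul_of_nonneg_right (hE.trans ?_) (abs_nonneg k)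
          gcongr
      _ = 8 * B ^ 4 * D * P ^ 3 * m * (|k| * u ^ 2) := by ring
      _ ≤ 8 * B ^ 4 * D * P ^ 3 * m * (C * m) := by gcongr
      _ = 8 * B ^ 4 * C * D * P * (P * m) ^ 2 := by ring
      _ ≤ 8 * B ^ 4 * C * D * P * 1 := by
          gcongr
          exact pow_le_one₀ (by positivity) hPm
      _ = _ := mul_one _
  have t4 : (s' ^ 2 + 2 * s' ^ 3) * |k' - k| ≤ 3 * B ^ 2 * D * P := by
    calc _ ≤ 3 * (B * P) ^ 2 * (D * m) := by gcongr
      _ = 3 * B ^ 2 * D * P * (P * m) := by ring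
      _ ≤ 3 * B ^ 2 * D * P * 1 := by gcongr
      _ = _ := mul_one _
  linarith

lemma SymbBound.residPart_nonneg (h : SymbBound α c C φ φ₁ φ₂ S) : 0 ≤ residPart φ θ := by
  have := h.nonneg θ
  unfold residPart; positivity

lemma SymbBound.inv_symb_le (h : SymbBound α c C φ φ₁ φ₂ S) (hc : 0 < c) (hB : c⁻¹ ≤ B)
    (hθ : θ ∈ S) (h0 : θ ≠ 0) : 0 < φ θ ∧ (φ θ)⁻¹ ≤ B * (symbSize α θ)⁻¹ := by
  have hm := symbSize_pos α h0
  have h1 := h.lower θ hθ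
  have h2 : 0 < c * symbSize α θ := by positivity
  refine ⟨h2.trans_le h1, (inv_anti₀ h2 h1).trans ?_⟩
  rw [mul_inv]
  gcongr

lemma SymbBound.residPart_le (h : SymbBound α c C φ φ₁ φ₂ S) (hc : 0 < c) (hB1 : 1 ≤ B)
    (hB : c⁻¹ ≤ B) (hθ : θ ∈ S) (h0 : θ ≠ 0) :
    residPart φ θ ≤ B ^ 3 * (symbInv α θ ^ 2 * (symbSize α θ)⁻¹) := by
  have hm := symbSize_pos α h0
  have hP := symbInv_pos α θ
  have a := (h.inv_symb_le hc hB hθ h0).2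
  have b := h.inv_le hc hB1 hB hθ
  have b2 := h.inv_pos (θ := θ)
  calc residPart φ θ ≤ B * (symbSize α θ)⁻¹ * (B * symbInv α θ) ^ 2 := by
        unfold residPart; gcongr
    _ = _ := by ring

lemma SymbBound.abs_residPart_sub_le (h : SymbBound α c C φ φ₁ φ₂ S)
    (h' : SymbBound α c C φ' φ₁' φ₂' S')
    (hc : 0 < c) (hB1 : 1 ≤ B) (hB : c⁻¹ ≤ B) (hθ : θ ∈ S) (hθ' : θ ∈ S') (h0 : θ ≠ 0)
    (hD : 0 ≤ D) (d0 : |φ' θ - φ θ| ≤ D * (‖θ‖ ^ 2 * symbSize α θ)) :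
    |residPart φ θ - residPart φ' θ|
      ≤ 3 * B ^ 4 * D * (‖θ‖ ^ 2 * (symbInv α θ ^ 2 * (symbSize α θ)⁻¹)) := by
  have a1 := h.inv_le hc hB1 hB hθ
  have a2 := h.inv_pos (θ := θ)
  have b1 := h'.inv_le hc hB1 hB hθ'
  have b2 := h'.inv_pos (θ := θ)
  have hds := h.abs_inv_sub_le h' hc hB1 hB hθ hθ'
  have hm := symbSize_pos α h0
  have hP := symbInv_pos α θ
  have hPm := symbInv_mul_le_one α θ
  obtain ⟨p1, q1⟩ := h.inv_symb_le hc hB hθ h0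
  obtain ⟨p2, q2⟩ := h'.inv_symb_le hc hB hθ' h0
  have e2 : |(φ θ)⁻¹ - (φ' θ)⁻¹| ≤ (B * (symbSize α θ)⁻¹) ^ 2 * |φ' θ - φ θ| := by
    have e : (φ θ)⁻¹ - (φ' θ)⁻¹ = (φ θ)⁻¹ * (φ' θ)⁻¹ * (φ' θ - φ θ) := by field_simp
    rw [e, abs_mul, abs_mul, abs_of_pos (_root_.inv_pos.2 p1), abs_of_pos (_root_.inv_pos.2 p2), sq]
    gcongr
  rw [residPart, residPart]
  set s := (1 + φ θ)⁻¹
  set s' := (1 + φ' θ)⁻¹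
  set P := symbInv α θ
  set m := symbSize α θ
  set u := ‖θ‖
  have hP' : P ≤ m⁻¹ := by rw [le_inv_comm₀ hP hm, ← one_div, le_div_iff₀ hP]; linarith
  have hu : 0 ≤ u := norm_nonneg _
  have e1 : |s ^ 2 - s' ^ 2| ≤ 2 * (B * P) * |s - s'| := by
    rw [show s ^ 2 - s' ^ 2 = (s + s') * (s - s') by ring, abs_mul, abs_of_pos (by positivity)]
    gcongr
    linarith
  have e3 : (φ θ)⁻¹ * s ^ 2 - (φ' θ)⁻¹ * s' ^ 2
      = (φ θ)⁻¹ * (s ^ 2 - s' ^ 2) + s' ^ 2 * ((φ θ)⁻¹ - (φ' θ)⁻¹) := by ring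
  rw [e3]
  refine (abs_add_le _ _).trans ?_
  rw [abs_mul, abs_mul, abs_of_pos (_root_.inv_pos.2 p1), abs_of_pos (by positivity : 0 < s' ^ 2)]
  have t1 : (φ θ)⁻¹ * |s ^ 2 - s' ^ 2| ≤ 2 * B ^ 4 * D * (u ^ 2 * (P ^ 2 * m⁻¹)) := by
    calc _ ≤ (B * m⁻¹) * (2 * (B * P) * ((B * P) ^ 2 * (D * (u ^ 2 * m)))) := by
          gcongr
          exact e1.trans (by gcongr; exact hds.trans (by gcongr))
      _ = 2 * B ^ 4 * D * (u ^ 2 * (P ^ 2 * m⁻¹)) * (P * m) := by ring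
      _ ≤ 2 * B ^ 4 * D * (u ^ 2 * (P ^ 2 * m⁻¹)) * 1 := by gcongr
      _ = _ := mul_one _
  have t2 : s' ^ 2 * |(φ θ)⁻¹ - (φ' θ)⁻¹| ≤ B ^ 4 * D * (u ^ 2 * (P ^ 2 * m⁻¹)) := by
    calc _ ≤ (B * P) ^ 2 * ((B * m⁻¹) ^ 2 * (D * (u ^ 2 * m))) := by
          gcongr
          exact e2.trans (by gcongr)
      _ = B ^ 4 * D * (u ^ 2 * (P ^ 2 * m⁻¹)) * (m⁻¹ * m) := by ring
      _ = _ := by rw [inv_mul_cancel₀ hm.ne', mul_one]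
  linarith

end Bounds

/-! ### Integrable envelopes. -/

/-- The envelope `min 1 ‖θ‖⁻ᵖ`. -/
def decay (p : ℝ) (θ : Plane) : ℝ := min 1 (‖θ‖ ^ (-p))

lemma decay_nonneg (p : ℝ) (θ : Plane) : 0 ≤ decay p θ := by unfold decay; positivity

lemma measurable_decay (p : ℝ) : Measurable (decay p) := by unfold decay; fun_prop

lemma integrable_decay {p : ℝ} (hp : 2 < p) : Integrable (decay p) := by
  rw [← integrableOn_univ, ← Set.union_compl_self (Metric.ball (0 : Plane) 1)]
  have hm := (measurable_decay p).aestronglyMeasurable (μ := (volume : Measure Plane))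
  refine IntegrableOn.union ?_ ?_
  · refine (integrableOn_const (C := (1 : ℝ)) (by finiteness)).mono' hm.restrict
      (Eventually.of_forall fun θ => ?_)
    rw [Real.norm_eq_abs, abs_of_nonneg (decay_nonneg p θ)]
    exact min_le_left _ _
  · refine (integrableOn_compl_ball_rpow hp one_pos).mono' hm.restrict
      (Eventually.of_forall fun θ => ?_)
    rw [Real.norm_eq_abs, abs_of_nonneg (decay_nonneg p θ)]
    exact min_le_right _ _

lemma compl_box_subset (R : ℝ) : (box R)ᶜ ⊆ (Metric.ball (0 : Plane) R)ᶜ := by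
  intro θ hθ h
  refine hθ fun i => ?_
  simp only [Metric.mem_ball, dist_zero_right] at h
  exact (abs_apply_le_norm θ i).trans h.le

lemma setIntegral_compl_box_decay_le {p : ℝ} (hp : 2 < p) {R : ℝ} (hR : 0 < R) :
    ∫ θ in (box R)ᶜ, decay p θ ≤ 2 * Real.pi / (p - 2) * R ^ (2 - p) := by
  have h := integrableOn_compl_ball_rpow hp hR
  rw [← integral_compl_ball_rpow hp hR]
  calc ∫ θ in (box R)ᶜ, decay p θ ≤ ∫ θ in (box R)ᶜ, ‖θ‖ ^ (-p) :=
        setIntegral_mono (integrable_decay hp).integrableOn (h.mono_set (compl_box_subset R))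
          fun θ => min_le_right _ _
    _ ≤ _ := setIntegral_mono_set h (Eventually.of_forall fun θ => by positivity)
        (LE.le.eventuallyLE (compl_box_subset R))

lemma ae_ne_zero : ∀ᵐ θ : Plane, θ ≠ 0 := by simp [ae_iff]

section

variable {α : ℝ} {φ φ' : Plane → ℝ} {φ₁ φ₁' : Fin 2 → Plane → ℝ}
  {φ₂ φ₂' : Fin 2 → Fin 2 → Plane → ℝ} {S S' : Set Plane} {c C D B : ℝ} {θ : Plane}

lemma symbSize_eq_sq (hα₂ : α < 2) (h0 : θ ≠ 0) (h : ‖θ‖ ≤ 1) : symbSize α θ = ‖θ‖ ^ 2 := by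
  rw [symbSize, min_eq_left]
  rw [← Real.rpow_two]
  exact Real.rpow_le_rpow_of_exponent_ge (norm_pos_iff.2 h0) h hα₂.le

lemma symbSize_eq_rpow (hα₂ : α < 2) (h : 1 ≤ ‖θ‖) : symbSize α θ = ‖θ‖ ^ α := by
  rw [symbSize, min_eq_right]
  rw [← Real.rpow_two]
  exact Real.rpow_le_rpow_of_exponent_le h hα₂.le

lemma symbInv_sq_mul_inv_near (hα₂ : α < 2) (h0 : θ ≠ 0) (h : ‖θ‖ ≤ 1) :
    ‖θ‖ ^ 2 * (symbInv α θ ^ 2 * (symbSize α θ)⁻¹) ≤ 1 := by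
  have hu := norm_pos_iff.2 h0
  rw [symbSize_eq_sq hα₂ h0 h, mul_left_comm, mul_inv_cancel₀ (by positivity), mul_one]
  exact pow_le_one₀ (symbInv_pos α θ).le (symbInv_le_one α θ)

lemma symbInv_sq_mul_inv_far (hα₁ : 1 < α) (hα₂ : α < 2) (h : 1 ≤ ‖θ‖) :
    symbInv α θ ^ 2 * (symbSize α θ)⁻¹ ≤ ‖θ‖ ^ (-(3 * α)) := by
  have hu : 0 < ‖θ‖ := by linarith
  have hP := symbInv_pos α θ
  rw [symbSize_eq_rpow hα₂ h, ← Real.rpow_neg hu.le]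
  calc symbInv α θ ^ 2 * ‖θ‖ ^ (-α) ≤ (‖θ‖ ^ (-α)) ^ 2 * ‖θ‖ ^ (-α) := by
        gcongr
        exact symbInv_le_rpow hα₁ hα₂ (norm_pos_iff.1 hu)
    _ = ‖θ‖ ^ (-(3 * α)) := by
        rw [← Real.rpow_natCast, ← Real.rpow_mul hu.le, ← Real.rpow_add hu]
        congr 1; push_cast; ring

lemma decay_of_le_one {p : ℝ} (hp : 0 ≤ p) (h0 : θ ≠ 0) (h : ‖θ‖ ≤ 1) : decay p θ = 1 :=
  min_eq_left (Real.one_le_rpow_of_pos_of_le_one_of_nonpos (norm_pos_iff.2 h0) h (by linarith))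

lemma decay_of_one_le {p : ℝ} (hp : 0 ≤ p) (h : 1 ≤ ‖θ‖) : decay p θ = ‖θ‖ ^ (-p) :=
  min_eq_right (Real.rpow_le_one_of_one_le_of_nonpos h (by linarith))

lemma SymbBound.abs_regPart_le_rpow (h : SymbBound α c C φ φ₁ φ₂ S) (hα₁ : 1 < α) (hα₂ : α < 2)
    (hc : 0 < c) (hB1 : 1 ≤ B) (hB : c⁻¹ ≤ B) (hθ : θ ∈ S) (h0 : θ ≠ 0) :
    |regPart φ θ| ≤ 2 * B * ‖θ‖ ^ (-α) :=
  (h.abs_regPart_le hc hB1 hB hθ).trans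
    (mul_le_mul_of_nonneg_left (symbInv_le_rpow hα₁ hα₂ h0) (by linarith))

lemma SymbBound.abs_regGrad_le_rpow (h : SymbBound α c C φ φ₁ φ₂ S) (hα₁ : 1 < α) (hα₂ : α < 2)
    (hc : 0 < c) (hC : 0 ≤ C) (hB1 : 1 ≤ B) (hB : c⁻¹ ≤ B) (hθ : θ ∈ S) (h0 : θ ≠ 0) (i : Fin 2) :
    |regGrad φ φ₁ i θ| ≤ 3 * B ^ 2 * C * ‖θ‖ ^ (-α - 1) := by
  have hu := norm_pos_iff.2 h0
  have h1 := h.abs_regGrad_le hc hC hB1 hB hθ i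
  rw [Real.rpow_sub_one hu.ne', ← mul_div_assoc, le_div_iff₀ hu]
  exact h1.trans (mul_le_mul_of_nonneg_left (symbInv_le_rpow hα₁ hα₂ h0) (by positivity))

lemma SymbBound.abs_regHess_le_decay (h : SymbBound α c C φ φ₁ φ₂ S) (hα₁ : 1 < α) (hα₂ : α < 2)
    (hc : 0 < c) (hC : 0 ≤ C) (hB1 : 1 ≤ B) (hB : c⁻¹ ≤ B) (hθ : θ ∈ S) (h0 : θ ≠ 0) (i : Fin 2) :
    |regHess φ φ₁ φ₂ i θ| ≤ (8 * B ^ 3 * C ^ 2 + 3 * B ^ 2 * C) * decay (2 + α) θ := by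
  have hu := norm_pos_iff.2 h0
  have hP := symbInv_pos α θ
  have hP1 := symbInv_le_one α θ
  have hm := symbSize_nonneg α θ
  have hPm := symbInv_mul_le_one α θ
  have h1 := h.abs_regHess_le hc hC hB1 hB hθ i
  have hK : 0 ≤ 8 * B ^ 3 * C ^ 2 + 3 * B ^ 2 * C := by positivity
  refine le_of_mul_le_mul_right (h1.trans ?_) (by positivity : 0 < ‖θ‖ ^ 2)
  rw [mul_assoc _ (decay _ _)]
  refine mul_le_mul_of_nonneg_left ?_ hK
  rw [decay]
  rcases min_choice 1 (‖θ‖ ^ (-(2 + α))) with e | e <;> rw [e]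
  · rw [one_mul]
    exact (mul_le_of_le_one_left hm (pow_le_one₀ hP.le hP1)).trans (min_le_left _ _)
  · rw [← Real.rpow_two ‖θ‖, ← Real.rpow_add hu, show -(2 + α) + 2 = -α by ring]
    refine le_trans ?_ (symbInv_le_rpow hα₁ hα₂ h0)
    rw [sq, mul_assoc]
    exact mul_le_of_le_one_right hP.le hPm

lemma abs_cos_sub_cos_inner_le (θ x y : Plane) :
    |Real.cos (inner ℝ θ x) - Real.cos (inner ℝ θ y)| ≤ ‖θ‖ ^ 2 * (‖x‖ ^ 2 + ‖y‖ ^ 2) / 2 := by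
  have h1 := abs_cos_sub_one_le θ x
  have h2 := abs_cos_sub_one_le θ y
  have h3 := abs_sub (Real.cos (inner ℝ θ x) - 1) (Real.cos (inner ℝ θ y) - 1)
  rw [sub_sub_sub_cancel_right] at h3
  linarith

lemma abs_cos_sub_cos_le_two (a b : ℝ) : |Real.cos a - Real.cos b| ≤ 2 := by
  have h1 := Real.abs_cos_le_one a
  have h2 := Real.abs_cos_le_one b
  have h3 := abs_sub (Real.cos a) (Real.cos b)
  linarith

lemma SymbBound.residPart_le_far (h : SymbBound α c C φ φ₁ φ₂ S) (hα₁ : 1 < α) (hα₂ : α < 2)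
    (hc : 0 < c) (hB1 : 1 ≤ B) (hB : c⁻¹ ≤ B) (hθ : θ ∈ S) (h1 : 1 ≤ ‖θ‖) :
    residPart φ θ ≤ B ^ 3 * decay (3 * α) θ := by
  rw [decay_of_one_le (by linarith) h1]
  exact (h.residPart_le hc hB1 hB hθ (norm_pos_iff.1 (by linarith))).trans
    (mul_le_mul_of_nonneg_left (symbInv_sq_mul_inv_far hα₁ hα₂ h1) (by positivity))

/-- The difference of cosines vanishes to second order at the origin and compensates the singularity
|θ|^{-2} of the residual part; this is the purpose of the normalization at y. -/
lemma SymbBound.abs_cos_mul_residPart_le (h : SymbBound α c C φ φ₁ φ₂ S) (hα₁ : 1 < α)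
    (hα₂ : α < 2) (hc : 0 < c) (hB1 : 1 ≤ B) (hB : c⁻¹ ≤ B) (hθ : θ ∈ S) (h0 : θ ≠ 0)
    (x y : Plane) :
    |(Real.cos (inner ℝ θ x) - Real.cos (inner ℝ θ y)) * residPart φ θ|
      ≤ B ^ 3 * (2 + ‖x‖ ^ 2 + ‖y‖ ^ 2) * decay (3 * α) θ := by
  rw [abs_mul, abs_of_nonneg h.residPart_nonneg]
  rcases le_total ‖θ‖ 1 with h1 | h1
  · have hr := h.residPart_le hc hB1 hB hθ h0
    have hn := symbInv_sq_mul_inv_near hα₂ h0 h1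
    rw [decay_of_le_one (by linarith) h0 h1]
    have hQ : 0 ≤ symbInv α θ ^ 2 * (symbSize α θ)⁻¹ := by
      have := symbSize_nonneg α θ
      positivity
    set Q := symbInv α θ ^ 2 * (symbSize α θ)⁻¹
    calc _ ≤ ‖θ‖ ^ 2 * (‖x‖ ^ 2 + ‖y‖ ^ 2) / 2 * (B ^ 3 * Q) :=
          mul_le_mul (abs_cos_sub_cos_inner_le θ x y) hr h.residPart_nonneg (by positivity)
      _ = B ^ 3 * ((‖x‖ ^ 2 + ‖y‖ ^ 2) / 2) * (‖θ‖ ^ 2 * Q) := by ring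
      _ ≤ B ^ 3 * (2 + ‖x‖ ^ 2 + ‖y‖ ^ 2) * 1 := by
          gcongr
          linarith [sq_nonneg ‖x‖, sq_nonneg ‖y‖]
  · have hr := h.residPart_le_far hα₁ hα₂ hc hB1 hB hθ h1
    have hd := decay_nonneg (3 * α) θ
    calc _ ≤ 2 * (B ^ 3 * decay (3 * α) θ) :=
          mul_le_mul (abs_cos_sub_cos_le_two _ _) hr h.residPart_nonneg (by norm_num)
      _ = B ^ 3 * 2 * decay (3 * α) θ := by ring
      _ ≤ _ := by
          gcongr
          linarith [sq_nonneg ‖x‖, sq_nonneg ‖y‖]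

/-- The factor n^{-2}|θ|² is paid for out of the decay |θ|^{-3α}: since |θ| ≤ 5n, n^{-2}|θ|^{2-3α}
is at most 5n^{-α}|θ|^{-2α}, and the exponent 2α > 2 is still integrable. -/
lemma SymbBound.abs_residPart_sub_le_decay (h : SymbBound α c C φ φ₁ φ₂ S)
    (h' : SymbBound α c C φ' φ₁' φ₂' S') (hα₁ : 1 < α) (hα₂ : α < 2)
    (hc : 0 < c) (hB1 : 1 ≤ B) (hB : c⁻¹ ≤ B) (hθ : θ ∈ S) (hθ' : θ ∈ S') (h0 : θ ≠ 0)
    (hD : 0 ≤ D) {n : ℕ} (hn : 1 ≤ n) (hθn : ‖θ‖ ≤ 5 * n)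
    (d0 : |φ' θ - φ θ| ≤ D * ((n : ℝ) ^ 2)⁻¹ * (‖θ‖ ^ 2 * symbSize α θ)) :
    |residPart φ θ - residPart φ' θ| ≤ 15 * B ^ 4 * D * (n : ℝ) ^ (-α) * decay (2 * α) θ := by
  have hn1 : (1 : ℝ) ≤ n := by exact_mod_cast hn
  have hn0 : (0 : ℝ) < n := by linarith
  have hr := h.abs_residPart_sub_le h' hc hB1 hB hθ hθ' h0 (by positivity) d0
  have hu := norm_pos_iff.2 h0
  set Q := symbInv α θ ^ 2 * (symbSize α θ)⁻¹
  refine hr.trans ?_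
  have key : ((n : ℝ) ^ 2)⁻¹ * (‖θ‖ ^ 2 * Q) ≤ 5 * (n : ℝ) ^ (-α) * decay (2 * α) θ := by
    have hnn : ((n : ℝ) ^ 2)⁻¹ ≤ (n : ℝ) ^ (-α) := by
      rw [Real.rpow_neg hn0.le, ← Real.rpow_two]
      exact inv_anti₀ (by positivity) (Real.rpow_le_rpow_of_exponent_le hn1 hα₂.le)
    rcases le_total ‖θ‖ 1 with h1 | h1
    · have hq := symbInv_sq_mul_inv_near hα₂ h0 h1
      rw [decay_of_le_one (by linarith) h0 h1, mul_one]
      calc _ ≤ ((n : ℝ) ^ 2)⁻¹ * 1 := by gcongr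
        _ ≤ (n : ℝ) ^ (-α) := by rw [mul_one]; exact hnn
        _ ≤ _ := le_mul_of_one_le_left (by positivity) (by norm_num)
    · have hq := symbInv_sq_mul_inv_far hα₁ hα₂ h1
      rw [decay_of_one_le (by linarith) h1]
      have e1 : ‖θ‖ ^ 2 * ‖θ‖ ^ (-(3 * α)) = ‖θ‖ ^ (2 - α) * ‖θ‖ ^ (-(2 * α)) := by
        rw [← Real.rpow_two, ← Real.rpow_add hu, ← Real.rpow_add hu]; congr 1; ring
      have e2 : ((n : ℝ) ^ 2)⁻¹ * (n : ℝ) ^ (2 - α) = (n : ℝ) ^ (-α) := by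
        rw [← Real.rpow_two, ← Real.rpow_neg hn0.le, ← Real.rpow_add hn0]; congr 1; ring
      have e3 : (5 : ℝ) ^ (2 - α) ≤ 5 := by
        have := Real.rpow_le_rpow_of_exponent_le (x := 5) (by norm_num) (by linarith : 2 - α ≤ 1)
        rwa [Real.rpow_one] at this
      calc _ ≤ ((n : ℝ) ^ 2)⁻¹ * (‖θ‖ ^ 2 * ‖θ‖ ^ (-(3 * α))) := by gcongr
        _ = ((n : ℝ) ^ 2)⁻¹ * (‖θ‖ ^ (2 - α) * ‖θ‖ ^ (-(2 * α))) := by rw [e1]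
        _ ≤ ((n : ℝ) ^ 2)⁻¹ * ((5 * n) ^ (2 - α) * ‖θ‖ ^ (-(2 * α))) := by
            have : 0 ≤ 2 - α := by linarith
            gcongr
        _ = 5 ^ (2 - α) * (((n : ℝ) ^ 2)⁻¹ * (n : ℝ) ^ (2 - α)) * ‖θ‖ ^ (-(2 * α)) := by
            rw [Real.mul_rpow (by norm_num) hn0.le]; ring
        _ ≤ 5 * (n : ℝ) ^ (-α) * ‖θ‖ ^ (-(2 * α)) := by rw [e2]; gcongr
  calc 3 * B ^ 4 * (D * ((n : ℝ) ^ 2)⁻¹) * (‖θ‖ ^ 2 * Q)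
      = 3 * B ^ 4 * D * (((n : ℝ) ^ 2)⁻¹ * (‖θ‖ ^ 2 * Q)) := by ring
    _ ≤ 3 * B ^ 4 * D * (5 * (n : ℝ) ^ (-α) * decay (2 * α) θ) := by gcongr
    _ = _ := by ring

end

/-! ### Oscillatory integrals of the regular part -/

/-- The boundary term of the twofold integration by parts over `box R`. -/
def bdryTerm (f f₁ : Plane → ℝ) (i j : Fin 2) (x : Plane) (R : ℝ) : ℝ :=
  (∫ s in -R..R, (Real.sin (R * x i + s * x j) * f (linePt i R s)
      - Real.sin (-R * x i + s * x j) * f (linePt i (-R) s)) / x i)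
  + (∫ s in -R..R, (Real.cos (R * x i + s * x j) * f₁ (linePt i R s)
      - Real.cos (-R * x i + s * x j) * f₁ (linePt i (-R) s)) / x i ^ 2)

lemma abs_mul_sub_mul_le {a b p q A : ℝ} (ha : |a| ≤ 1) (hb : |b| ≤ 1) (hp : |p| ≤ A)
    (hq : |q| ≤ A) : |a * p - b * q| ≤ 2 * A := by
  refine (abs_sub _ _).trans ?_
  rw [abs_mul, abs_mul]
  have h1 := mul_le_mul ha hp (abs_nonneg _) zero_le_one
  have h2 := mul_le_mul hb hq (abs_nonneg _) zero_le_one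
  linarith

lemma abs_intervalIntegral_le {g : ℝ → ℝ} {A R : ℝ} (hR : 0 ≤ R)
    (h : ∀ s, |s| ≤ R → |g s| ≤ A) : |∫ s in -R..R, g s| ≤ 2 * R * A := by
  have := intervalIntegral.norm_integral_le_of_norm_le_const (a := -R) (b := R) (C := A) (f := g)
    (fun s hs => by
      rw [Set.uIoc_of_le (by linarith)] at hs
      exact h s (abs_le.2 ⟨hs.1.le, hs.2⟩))
  rw [Real.norm_eq_abs, show R - -R = 2 * R by ring, abs_of_nonneg (by linarith : 0 ≤ 2 * R)] at this
  linarith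

lemma abs_bdryTerm_le {f f₁ : Plane → ℝ} {i j : Fin 2} {x : Plane} {R A A₁ : ℝ} (hR : 0 ≤ R)
    (hx : x i ≠ 0) (hf : ∀ t s, |t| = R → |s| ≤ R → |f (linePt i t s)| ≤ A)
    (hf₁ : ∀ t s, |t| = R → |s| ≤ R → |f₁ (linePt i t s)| ≤ A₁) :
    |bdryTerm f f₁ i j x R| ≤ 4 * R * A / |x i| + 4 * R * A₁ / x i ^ 2 := by
  have h1 : |R| = R := abs_of_nonneg hR
  have h2 : |-R| = R := by rw [abs_neg, h1]
  have hx0 : 0 < |x i| := abs_pos.2 hx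
  refine (abs_add_le _ _).trans (add_le_add ?_ ?_)
  · refine (abs_intervalIntegral_le hR (A := 2 * A / |x i|) fun s hs => ?_).trans (le_of_eq (by ring))
    rw [abs_div]
    gcongr
    exact abs_mul_sub_mul_le (Real.abs_sin_le_one _) (Real.abs_sin_le_one _) (hf _ _ h1 hs)
      (hf _ _ h2 hs)
  · refine (abs_intervalIntegral_le hR (A := 2 * A₁ / x i ^ 2) fun s hs => ?_).trans
      (le_of_eq (by ring))
    rw [abs_div, abs_of_nonneg (sq_nonneg (x i))]
    gcongr
    exact abs_mul_sub_mul_le (Real.abs_cos_le_one _) (Real.abs_cos_le_one _) (hf₁ _ _ h1 hs)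
      (hf₁ _ _ h2 hs)

/-- Equal values on opposite edges let sin(R x_i) be factored out. For R = nπ it vanishes at every
point of the rescaled lattice. -/
lemma bdryTerm_eq_of_periodic {f f₁ : Plane → ℝ} {i j : Fin 2} {x : Plane} {R : ℝ}
    (hf : ∀ s, f (linePt i (-R) s) = f (linePt i R s))
    (hf₁ : ∀ s, f₁ (linePt i (-R) s) = f₁ (linePt i R s)) :
    bdryTerm f f₁ i j x R =
      2 * Real.sin (R * x i) / x i * (∫ s in -R..R, Real.cos (s * x j) * f (linePt i R s))
      - 2 * Real.sin (R * x i) / x i ^ 2 *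
        (∫ s in -R..R, Real.sin (s * x j) * f₁ (linePt i R s)) := by
  rw [bdryTerm, ← intervalIntegral.integral_const_mul, ← intervalIntegral.integral_const_mul,
    sub_eq_add_neg, ← intervalIntegral.integral_neg]
  congr 1 <;> refine intervalIntegral.integral_congr fun s _ => ?_
  · simp only [hf, neg_mul, Real.sin_add, Real.sin_neg, Real.cos_neg]; ring
  · simp only [hf₁, neg_mul, Real.cos_add, Real.sin_neg, Real.cos_neg]; ring

section

variable {φ : Plane → ℝ} {φ₁ : Fin 2 → Plane → ℝ} {φ₂ : Fin 2 → Fin 2 → Plane → ℝ}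
  {α c C B : ℝ} {S : Set Plane}

lemma PlaneC2.setIntegral_box_cos_regPart (h : PlaneC2 φ φ₁ φ₂) (h0 : ∀ θ, 0 ≤ φ θ) {i j : Fin 2}
    (hij : i ≠ j) {x : Plane} (hx : x i ≠ 0) {R : ℝ} (hR : 0 ≤ R) :
    ∫ θ in box R, Real.cos (inner ℝ θ x) * regPart φ θ =
      bdryTerm (regPart φ) (regGrad φ φ₁ i) i j x R
      - (∫ θ in box R, Real.cos (inner ℝ θ x) * regHess φ φ₁ φ₂ i θ) / x i ^ 2 :=
  setIntegral_box_cos_mul hij (h.continuous_regPart h0) (h.continuous_regGrad h0 i)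
    (h.continuous_regHess h0 i) (h.hasDerivAt_regPart h0 i) (h.hasDerivAt_regGrad h0 i) hx hR

lemma linePt_mem_box {i : Fin 2} {t s R : ℝ} (ht : |t| ≤ R) (hs : |s| ≤ R) :
    linePt i t s ∈ box R := by
  intro k
  rw [linePt_apply]
  split_ifs <;> assumption

lemma abs_le_norm_linePt (i : Fin 2) (t s : ℝ) : |t| ≤ ‖linePt i t s‖ := by
  simpa using abs_apply_le_norm (linePt i t s) i

lemma SymbBound.abs_regPart_linePt_le (h : SymbBound α c C φ φ₁ φ₂ S) (hα₁ : 1 < α) (hα₂ : α < 2)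
    (hc : 0 < c) (hB1 : 1 ≤ B) (hB : c⁻¹ ≤ B) {R : ℝ} (hR : 0 < R) (hS : box R ⊆ S)
    (i : Fin 2) {t s : ℝ} (ht : |t| = R) (hs : |s| ≤ R) :
    |regPart φ (linePt i t s)| ≤ 2 * B * R ^ (-α) := by
  have hn := abs_le_norm_linePt i t s
  rw [ht] at hn
  refine (h.abs_regPart_le_rpow hα₁ hα₂ hc hB1 hB (hS (linePt_mem_box ht.le hs))
    (norm_pos_iff.1 (hR.trans_le hn))).trans ?_
  exact mul_le_mul_of_nonneg_left (Real.rpow_le_rpow_of_nonpos hR hn (by linarith)) (by linarith)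

lemma SymbBound.abs_regGrad_linePt_le (h : SymbBound α c C φ φ₁ φ₂ S) (hα₁ : 1 < α) (hα₂ : α < 2)
    (hc : 0 < c) (hC : 0 ≤ C) (hB1 : 1 ≤ B) (hB : c⁻¹ ≤ B) {R : ℝ} (hR : 0 < R) (hS : box R ⊆ S)
    (i k : Fin 2) {t s : ℝ} (ht : |t| = R) (hs : |s| ≤ R) :
    |regGrad φ φ₁ k (linePt i t s)| ≤ 3 * B ^ 2 * C * R ^ (-α - 1) := by
  have hn := abs_le_norm_linePt i t s
  rw [ht] at hn
  refine (h.abs_regGrad_le_rpow hα₁ hα₂ hc hC hB1 hB (hS (linePt_mem_box ht.le hs))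
    (norm_pos_iff.1 (hR.trans_le hn)) k).trans ?_
  exact mul_le_mul_of_nonneg_left (Real.rpow_le_rpow_of_nonpos hR hn (by linarith)) (by positivity)

/-- The edges have length 2R; on them the regular part is O(R^{-α}) and its derivative O(R^{-α-1}).
-/
lemma SymbBound.abs_bdryTerm_le (h : SymbBound α c C φ φ₁ φ₂ S) (hα₁ : 1 < α) (hα₂ : α < 2)
    (hc : 0 < c) (hC : 0 ≤ C) (hB1 : 1 ≤ B) (hB : c⁻¹ ≤ B) {R : ℝ} (hR : 0 < R) (hS : box R ⊆ S)
    {i j : Fin 2} {x : Plane} (hx : x i ≠ 0) :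
    |bdryTerm (regPart φ) (regGrad φ φ₁ i) i j x R|
      ≤ (8 * B + 12 * B ^ 2 * C) * (R ^ (1 - α) / |x i| + R ^ (-α) / x i ^ 2) := by
  have hx0 : 0 < |x i| := abs_pos.2 hx
  refine (TruncatedStable.abs_bdryTerm_le hR.le hx
    (fun t s => h.abs_regPart_linePt_le hα₁ hα₂ hc hB1 hB hR hS i)
    (fun t s => h.abs_regGrad_linePt_le hα₁ hα₂ hc hC hB1 hB hR hS i i)).trans ?_
  have e1 : R * R ^ (-α) = R ^ (1 - α) := by
    rw [mul_comm, ← Real.rpow_add_one hR.ne']; congr 1; ring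
  have e2 : R * R ^ (-α - 1) = R ^ (-α) := by
    rw [mul_comm, ← Real.rpow_add_one hR.ne']; congr 1; ring
  have f1 : 4 * R * (2 * B * R ^ (-α)) / |x i| = 8 * B * (R ^ (1 - α) / |x i|) := by
    rw [← e1]; ring
  have f2 : 4 * R * (3 * B ^ 2 * C * R ^ (-α - 1)) / x i ^ 2
      = 12 * B ^ 2 * C * (R ^ (-α) / x i ^ 2) := by rw [← e2]; ring
  rw [f1, f2, mul_add]
  gcongr
  · linarith [show 0 ≤ 12 * B ^ 2 * C by positivity]
  · linarith

lemma SymbBound.integrable_regHess (h : SymbBound α c C φ φ₁ φ₂ Set.univ) (h2 : PlaneC2 φ φ₁ φ₂)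
    (hα₁ : 1 < α) (hα₂ : α < 2) (hc : 0 < c) (hC : 0 ≤ C) (hB1 : 1 ≤ B) (hB : c⁻¹ ≤ B)
    (i : Fin 2) : Integrable (regHess φ φ₁ φ₂ i) := by
  refine ((integrable_decay (p := 2 + α) (by linarith)).const_mul
    (8 * B ^ 3 * C ^ 2 + 3 * B ^ 2 * C)).mono' (h2.continuous_regHess h.nonneg i).aestronglyMeasurable ?_
  filter_upwards [ae_ne_zero] with θ hθ
  exact h.abs_regHess_le_decay hα₁ hα₂ hc hC hB1 hB (Set.mem_univ θ) hθ i

lemma integrable_cos_mul {f : Plane → ℝ} {μ : Measure Plane} (hf : Integrable f μ) (x : Plane) :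
    Integrable (fun θ => Real.cos (inner ℝ θ x) * f θ) μ :=
  hf.bdd_mul (c := 1) (by fun_prop) (Eventually.of_forall fun _ => Real.abs_cos_le_one _)

lemma abs_cos_mul_le (a b : ℝ) : |Real.cos a * b| ≤ |b| := by
  rw [abs_mul]
  exact mul_le_of_le_one_left (abs_nonneg _) (Real.abs_cos_le_one _)

lemma abs_integral_le_of_ae_le {X : Type*} [MeasurableSpace X] {μ : Measure X} {f g : X → ℝ}
    (hg : Integrable g μ) (h : ∀ᵐ v ∂μ, |f v| ≤ g v) : |∫ v, f v ∂μ| ≤ ∫ v, g v ∂μ := by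
  rw [← Real.norm_eq_abs]
  exact norm_integral_le_of_norm_le hg h

/-- The limit of the integrals of `cos ⟨θ, x⟩ regPart φ` over large squares. -/
def regLimit (φ : Plane → ℝ) (φ₁ : Fin 2 → Plane → ℝ) (φ₂ : Fin 2 → Fin 2 → Plane → ℝ) (i : Fin 2)
    (x : Plane) : ℝ :=
  -(∫ θ, Real.cos (inner ℝ θ x) * regHess φ φ₁ φ₂ i θ) / x i ^ 2

lemma SymbBound.abs_tail_regHess_le (h : SymbBound α c C φ φ₁ φ₂ Set.univ)
    (hα₁ : 1 < α) (hα₂ : α < 2) (hc : 0 < c) (hC : 0 ≤ C) (hB1 : 1 ≤ B) (hB : c⁻¹ ≤ B)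
    (i : Fin 2) (x : Plane) {R : ℝ} (hR : 0 < R) :
    |∫ θ in (box R)ᶜ, Real.cos (inner ℝ θ x) * regHess φ φ₁ φ₂ i θ|
      ≤ (8 * B ^ 3 * C ^ 2 + 3 * B ^ 2 * C) * (2 * Real.pi / α) * R ^ (-α) := by
  have hd := integrable_decay (p := 2 + α) (by linarith)
  refine (abs_integral_le_of_ae_le (hd.integrableOn.const_mul (8 * B ^ 3 * C ^ 2 + 3 * B ^ 2 * C))
    (ae_restrict_of_ae ?_)).trans ?_
  · filter_upwards [ae_ne_zero] with θ hθ
    exact (abs_cos_mul_le _ _).trans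
      (h.abs_regHess_le_decay hα₁ hα₂ hc hC hB1 hB (Set.mem_univ θ) hθ i)
  · rw [integral_const_mul, mul_assoc _ (2 * Real.pi / α)]
    refine mul_le_mul_of_nonneg_left ?_ (by positivity)
    refine (setIntegral_compl_box_decay_le (by linarith) hR).trans (le_of_eq ?_)
    congr 2 <;> ring

lemma integral_eq_box_add_compl {f : Plane → ℝ} (hf : Integrable f) (R : ℝ) :
    ∫ θ, f θ = (∫ θ in box R, f θ) + ∫ θ in (box R)ᶜ, f θ :=
  (integral_add_compl (measurableSet_box R) hf).symm

/-- Convergence of the integrals over large squares, with a rate. -/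
lemma SymbBound.abs_box_sub_regLimit_le (h : SymbBound α c C φ φ₁ φ₂ Set.univ)
    (h2 : PlaneC2 φ φ₁ φ₂) (hα₁ : 1 < α) (hα₂ : α < 2) (hc : 0 < c) (hC : 0 ≤ C) (hB1 : 1 ≤ B)
    (hB : c⁻¹ ≤ B) {i j : Fin 2} (hij : i ≠ j) {x : Plane} (hx : x i ≠ 0) {R : ℝ} (hR : 0 < R) :
    |(∫ θ in box R, Real.cos (inner ℝ θ x) * regPart φ θ) - regLimit φ φ₁ φ₂ i x|
      ≤ (8 * B + 12 * B ^ 2 * C + (8 * B ^ 3 * C ^ 2 + 3 * B ^ 2 * C) * (2 * Real.pi / α))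
        * (R ^ (1 - α) / |x i| + R ^ (-α) / x i ^ 2) := by
  have hπ := Real.pi_pos
  rw [h2.setIntegral_box_cos_regPart h.nonneg hij hx hR.le, regLimit,
    integral_eq_box_add_compl (integrable_cos_mul
      (h.integrable_regHess h2 hα₁ hα₂ hc hC hB1 hB i) x) R]
  have hb := h.abs_bdryTerm_le hα₁ hα₂ hc hC hB1 hB hR (Set.subset_univ _) (j := j) hx
  have ht := h.abs_tail_regHess_le hα₁ hα₂ hc hC hB1 hB i x hR
  set T := ∫ θ in (box R)ᶜ, Real.cos (inner ℝ θ x) * regHess φ φ₁ φ₂ i θ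
  set L := ∫ θ in box R, Real.cos (inner ℝ θ x) * regHess φ φ₁ φ₂ i θ
  set E := bdryTerm (regPart φ) (regGrad φ φ₁ i) i j x R
  have e : E - L / x i ^ 2 - -(L + T) / x i ^ 2 = E + T / x i ^ 2 := by ring
  rw [e]
  refine (abs_add_le _ _).trans ?_
  rw [abs_div, abs_of_nonneg (sq_nonneg (x i)), add_mul]
  refine add_le_add hb ?_
  have hx0 : 0 < |x i| := abs_pos.2 hx
  calc |T| / x i ^ 2 ≤ (8 * B ^ 3 * C ^ 2 + 3 * B ^ 2 * C) * (2 * Real.pi / α) * R ^ (-α) / x i ^ 2 := by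
        gcongr
    _ = (8 * B ^ 3 * C ^ 2 + 3 * B ^ 2 * C) * (2 * Real.pi / α) * (0 + R ^ (-α) / x i ^ 2) := by ring
    _ ≤ _ := by
        gcongr
        positivity

lemma SymbBound.abs_regLimit_le (h : SymbBound α c C φ φ₁ φ₂ Set.univ)
    (hα₁ : 1 < α) (hα₂ : α < 2) (hc : 0 < c) (hC : 0 ≤ C) (hB1 : 1 ≤ B) (hB : c⁻¹ ≤ B)
    (i : Fin 2) (x : Plane) :
    |regLimit φ φ₁ φ₂ i x| ≤ (8 * B ^ 3 * C ^ 2 + 3 * B ^ 2 * C) * (∫ θ, decay (2 + α) θ) / x i ^ 2 := by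
  rw [regLimit, abs_div, abs_neg, abs_of_nonneg (sq_nonneg (x i))]
  gcongr
  rw [← integral_const_mul]
  refine abs_integral_le_of_ae_le ((integrable_decay (p := 2 + α) (by linarith)).const_mul _) ?_
  filter_upwards [ae_ne_zero] with θ hθ
  exact (abs_cos_mul_le _ _).trans
      (h.abs_regHess_le_decay hα₁ hα₂ hc hC hB1 hB (Set.mem_univ θ) hθ i)

end

/-! ### Boundary terms of periodic symbols. -/

section Periodic

variable {φ : Plane → ℝ} {φ₁ : Fin 2 → Plane → ℝ} {φ₂ : Fin 2 → Fin 2 → Plane → ℝ}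
  {α c C B : ℝ} {S : Set Plane}

/-- The boundary term of a periodic symbol, after one more integration by parts along the edge. -/
lemma SymbBound.abs_bdryTerm_periodic_le (h : SymbBound α c C φ φ₁ φ₂ S) (h2 : PlaneC2 φ φ₁ φ₂)
    (hα₁ : 1 < α) (hα₂ : α < 2)
    (hc : 0 < c) (hC : 0 ≤ C) (hB1 : 1 ≤ B) (hB : c⁻¹ ≤ B) {R : ℝ} (hR : 0 < R) (hS : box R ⊆ S)
    {i j : Fin 2} (hij : i ≠ j) {x : Plane} (hx : x i ≠ 0) (hxj : x j ≠ 0)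
    (hp : ∀ s, φ (linePt i (-R) s) = φ (linePt i R s))
    (hp₁ : ∀ s, φ₁ i (linePt i (-R) s) = φ₁ i (linePt i R s)) :
    |bdryTerm (regPart φ) (regGrad φ φ₁ i) i j x R|
      ≤ (8 * B + 12 * B ^ 2 * C) * R ^ (-α) * (1 / (|x i| * |x j|) + 1 / x i ^ 2) := by
  have hxi0 : 0 < |x i| := abs_pos.2 hx
  have hxj0 : 0 < |x j| := abs_pos.2 hxj
  rw [bdryTerm_eq_of_periodic (fun s => by simp only [regPart, hp])
    (fun s => by simp only [regGrad, hp, hp₁])]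
  have e2 : R * R ^ (-α - 1) = R ^ (-α) := by
    rw [mul_comm, ← Real.rpow_add_one hR.ne']; congr 1; ring
  have hRabs : |R| = R := abs_of_pos hR
  have hA := fun s (hs : |s| ≤ R) => h.abs_regPart_linePt_le hα₁ hα₂ hc hB1 hB hR hS i hRabs hs
  have hA₁ := fun k s (hs : |s| ≤ R) =>
    h.abs_regGrad_linePt_le hα₁ hα₂ hc hC hB1 hB hR hS i k hRabs hs
  have hcF := h2.continuous_regPart h.nonneg
  have hcG := h2.continuous_regGrad h.nonneg
  -- Integrating by parts along the edge gains 1/|x_j| and a power of R: the endpoint values and the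
  -- integrated tangential derivative are both O(R^{-α}).
  have hedge : |∫ s in -R..R, Real.cos (s * x j) * regPart φ (linePt i R s)|
      ≤ (4 * B + 6 * B ^ 2 * C) * R ^ (-α) / |x j| := by
    have hder : ∀ s ∈ Set.uIcc (-R) R, HasDerivAt
        (fun s => Real.sin (s * x j) * regPart φ (linePt i R s) / x j)
        (Real.cos (s * x j) * regPart φ (linePt i R s)
          + Real.sin (s * x j) * regGrad φ φ₁ j (linePt i R s) / x j) s := by
      intro s _
      have hl : HasDerivAt (fun s => s * x j) (x j) s := by
        simpa using (hasDerivAt_id s).mul_const (x j)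
      have hd := h2.hasDerivAt_regPart h.nonneg j s R
      simp only [← linePt_comm hij] at hd
      refine ((hl.sin.mul hd).div_const (x j)).congr_deriv ?_
      field_simp
    have hftc := intervalIntegral.integral_eq_sub_of_hasDerivAt hder
      (Continuous.intervalIntegrable (by have := hcG j; fun_prop) _ _)
    have := hcG j
    rw [intervalIntegral.integral_add (Continuous.intervalIntegrable (by fun_prop) _ _)
      (Continuous.intervalIntegrable (by fun_prop) _ _)] at hftc
    rw [eq_sub_of_add_eq hftc]
    refine (abs_sub _ _).trans ?_
    have t1 : |Real.sin (R * x j) * regPart φ (linePt i R R) / x j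
        - Real.sin (-R * x j) * regPart φ (linePt i R (-R)) / x j| ≤ 4 * B * R ^ (-α) / |x j| := by
      rw [← sub_div, abs_div]
      gcongr
      refine (abs_mul_sub_mul_le (Real.abs_sin_le_one _) (Real.abs_sin_le_one _) (hA R hRabs.le)
        (hA (-R) (by rw [abs_neg]; exact hRabs.le))).trans (le_of_eq (by ring))
    have t2 : |∫ s in -R..R, Real.sin (s * x j) * regGrad φ φ₁ j (linePt i R s) / x j|
        ≤ 6 * B ^ 2 * C * R ^ (-α) / |x j| := by
      refine (abs_intervalIntegral_le hR.le (A := 3 * B ^ 2 * C * R ^ (-α - 1) / |x j|)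
        fun s hs => ?_).trans (le_of_eq ?_)
      · rw [abs_div, abs_mul]
        exact div_le_div_of_nonneg_right ((mul_le_of_le_one_left (abs_nonneg _)
          (Real.abs_sin_le_one _)).trans (hA₁ j s hs)) hxj0.le
      · rw [← e2]; ring
    refine (add_le_add t1 t2).trans (le_of_eq (by ring))
  have hside : |∫ s in -R..R, Real.sin (s * x j) * regGrad φ φ₁ i (linePt i R s)|
      ≤ 6 * B ^ 2 * C * R ^ (-α) := by
    refine (abs_intervalIntegral_le hR.le (A := 3 * B ^ 2 * C * R ^ (-α - 1))
      fun s hs => ?_).trans (le_of_eq ?_)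
    · rw [abs_mul]
      exact (mul_le_of_le_one_left (abs_nonneg _) (Real.abs_sin_le_one _)).trans (hA₁ i s hs)
    · rw [← e2]; ring
  have hsin := Real.abs_sin_le_one (R * x i)
  refine (abs_sub _ _).trans ?_
  rw [abs_mul, abs_mul, abs_div, abs_div, abs_mul, abs_two, abs_of_nonneg (sq_nonneg (x i))]
  have u1 : 2 * |Real.sin (R * x i)| / |x i| * |∫ s in -R..R, Real.cos (s * x j) * regPart φ (linePt i R s)|
      ≤ (8 * B + 12 * B ^ 2 * C) * R ^ (-α) * (1 / (|x i| * |x j|)) := by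
    calc _ ≤ 2 * 1 / |x i| * ((4 * B + 6 * B ^ 2 * C) * R ^ (-α) / |x j|) := by gcongr
      _ = _ := by field_simp; ring
  have u2 : 2 * |Real.sin (R * x i)| / x i ^ 2 *
      |∫ s in -R..R, Real.sin (s * x j) * regGrad φ φ₁ i (linePt i R s)|
      ≤ (8 * B + 12 * B ^ 2 * C) * R ^ (-α) * (1 / x i ^ 2) := by
    calc _ ≤ 2 * 1 / x i ^ 2 * (6 * B ^ 2 * C * R ^ (-α)) := by gcongr
      _ = 12 * B ^ 2 * C * R ^ (-α) * (1 / x i ^ 2) := by ring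
      _ ≤ _ := by
          gcongr
          linarith
  linarith

end Periodic

lemma box_subset_ball {n : ℕ} (hn : 1 ≤ n) : box (n * Real.pi) ⊆ Metric.ball (0 : Plane) (6 * n) := by
  intro θ hθ
  have hn0 : (0 : ℝ) < n := by exact_mod_cast hn
  have := norm_le_of_mem_box hθ hn0
  simp only [Metric.mem_ball, dist_zero_right]
  linarith

lemma rpow_mul_pi_le {n : ℕ} (hn : 1 ≤ n) {e : ℝ} (he : e ≤ 0) :
    ((n : ℝ) * Real.pi) ^ e ≤ (n : ℝ) ^ e := by
  have hn0 : (0 : ℝ) < n := by exact_mod_cast hn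
  refine Real.rpow_le_rpow_of_nonpos hn0 ?_ he
  exact le_mul_of_one_le_right hn0.le (by linarith [Real.pi_gt_three])

/-! ### The regular part: discrete against continuum. -/

section

variable {α r M : ℝ}

/-- The integral of the regular part of the discrete symbol, up to the boundary term. -/
lemma exists_disc_reg_sub_le (hα₁ : 1 < α) (hα₂ : α < 2) (hr : 0 < r) (hrM : r < M) :
    ∃ K, 0 ≤ K ∧ ∀ (n : ℕ) (i j : Fin 2) (x : Plane), 1 ≤ n → i ≠ j → x i ≠ 0 →
      |(∫ θ in box (n * Real.pi), Real.cos (inner ℝ θ x) * regPart (discSymb α r M n) θ)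
        - regLimit (contSymb α M) (contGrad α M) (fun i j => hessInt α i j M) i x
        - bdryTerm (regPart (discSymb α r M n)) (regGrad (discSymb α r M n) (discGrad α r M n) i)
            i j x (n * Real.pi)| ≤ K * ((n : ℝ) ^ (-α) / x i ^ 2) := by
  have hπ := Real.pi_pos
  obtain ⟨c, C, hc, hC, hcont, hdisc⟩ := exists_symbBound hα₁ hα₂ hr hrM
  obtain ⟨D, hD, hdiff⟩ := exists_discSymb_sub_contSymb_le hα₁ hα₂ hr hrM
  set B := max 1 c⁻¹ with hBd
  have hB1 : 1 ≤ B := le_max_left _ _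
  have hB : c⁻¹ ≤ B := le_max_right _ _
  have hcC2 : PlaneC2 (contSymb α M) (contGrad α M) (fun i j => hessInt α i j M) :=
    planeC2_contSymb hα₂
  set K₁ := (8 * B ^ 3 * C ^ 2 + 3 * B ^ 2 * C) * (2 * Real.pi / α) with hK₁
  set K₂ := (30 * B ^ 5 * C ^ 2 + 16 * B ^ 3 * C + 8 * B ^ 4 * C + 3 * B ^ 2) * D with hK₂
  have h2α : 0 < 2 - α := by linarith
  have hK₁0 : 0 ≤ K₁ := by positivity
  have hK₂0 : 0 ≤ K₂ := by positivity
  refine ⟨K₁ + K₂ * (2 * Real.pi / (2 - α) * 6 ^ (2 - α)), by positivity,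
    fun n i j x hn hij hx => ?_⟩
  have hn0 : (0 : ℝ) < n := by exact_mod_cast hn
  have hR : 0 < n * Real.pi := by positivity
  have hd := hdisc n hn
  have hdC2 := planeC2_discSymb α r M n
  have hint := hcont.integrable_regHess hcC2 hα₁ hα₂ hc hC hB1 hB i
  rw [hdC2.setIntegral_box_cos_regPart hd.nonneg hij hx hR.le, regLimit,
    integral_eq_box_add_compl (integrable_cos_mul hint x) (n * Real.pi)]
  have ht := hcont.abs_tail_regHess_le hα₁ hα₂ hc hC hB1 hB i x hR
  have hintd : IntegrableOn (regHess (discSymb α r M n) (discGrad α r M n) (discHess α r M n) i)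
      (box (n * Real.pi)) :=
    ((hdC2.continuous_regHess hd.nonneg i).continuousOn).integrableOn_compact (isCompact_box _)
  -- The two Hessians differ by O(n^{-2}|θ|^{-α}), and the integral of |θ|^{-α} over the ball of
  -- radius 6n is O(n^{2-α}).
  have hsub : |(∫ θ in box (n * Real.pi), Real.cos (inner ℝ θ x) *
        regHess (contSymb α M) (contGrad α M) (fun i j => hessInt α i j M) i θ)
      - ∫ θ in box (n * Real.pi), Real.cos (inner ℝ θ x) *
        regHess (discSymb α r M n) (discGrad α r M n) (discHess α r M n) i θ|
      ≤ K₂ * (2 * Real.pi / (2 - α) * 6 ^ (2 - α)) * (n : ℝ) ^ (-α) := by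
    rw [← integral_sub (integrable_cos_mul hint.integrableOn x) (integrable_cos_mul hintd x)]
    simp only [← mul_sub]
    have hb := (integrableOn_ball_rpow hα₂ (6 * n)).const_mul (K₂ * ((n : ℝ) ^ 2)⁻¹)
    refine (abs_integral_le_of_ae_le (g := fun θ => K₂ * ((n : ℝ) ^ 2)⁻¹ * ‖θ‖ ^ (-α))
      (IntegrableOn.mono_set hb (box_subset_ball hn)) ?_).trans ?_
    · rw [ae_restrict_iff' (measurableSet_box _)]
      filter_upwards [ae_ne_zero] with θ hθ0 hθ
      refine (abs_cos_mul_le _ _).trans ?_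
      obtain ⟨d2, d1, d0⟩ := hdiff n θ hn hθ
      refine (hcont.abs_regHess_sub_le hd hc hC hB1 hB (Set.mem_univ _) hθ hθ0
        (by positivity : 0 ≤ D * ((n : ℝ) ^ 2)⁻¹) i d0 (d1 i) (d2 i i)).trans ?_
      rw [← mul_assoc, ← hK₂]
      exact mul_le_mul_of_nonneg_left (symbInv_le_rpow hα₁ hα₂ hθ0) (by positivity)
    · refine (setIntegral_mono_set hb (Eventually.of_forall fun θ => by positivity)
        (LE.le.eventuallyLE (box_subset_ball hn))).trans (le_of_eq ?_)
      rw [integral_const_mul, integral_ball_rpow hα₂ (by positivity),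
        Real.mul_rpow (by norm_num) hn0.le]
      have : ((n : ℝ) ^ 2)⁻¹ * (n : ℝ) ^ (2 - α) = (n : ℝ) ^ (-α) := by
        rw [← Real.rpow_two, ← Real.rpow_neg hn0.le, ← Real.rpow_add hn0]; congr 1; ring
      rw [← this]; ring
  set T := ∫ θ in (box (n * Real.pi))ᶜ, Real.cos (inner ℝ θ x) *
    regHess (contSymb α M) (contGrad α M) (fun i j => hessInt α i j M) i θ
  set L := ∫ θ in box (n * Real.pi), Real.cos (inner ℝ θ x) *
    regHess (contSymb α M) (contGrad α M) (fun i j => hessInt α i j M) i θ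
  set L' := ∫ θ in box (n * Real.pi), Real.cos (inner ℝ θ x) *
    regHess (discSymb α r M n) (discGrad α r M n) (discHess α r M n) i θ
  set E := bdryTerm (regPart (discSymb α r M n)) (regGrad (discSymb α r M n) (discGrad α r M n) i)
            i j x (n * Real.pi)
  have e : E - L' / x i ^ 2 - -(L + T) / x i ^ 2 - E = ((L - L') + T) / x i ^ 2 := by ring
  rw [e, abs_div, abs_of_nonneg (sq_nonneg (x i)), ← mul_div_assoc]
  refine div_le_div_of_nonneg_right ?_ (sq_nonneg _)
  refine (abs_add_le _ _).trans ?_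
  have ht' : |T| ≤ K₁ * (n : ℝ) ^ (-α) :=
    ht.trans (mul_le_mul_of_nonneg_left (rpow_mul_pi_le hn (by linarith)) hK₁0)
  linarith

/-- The integral of the regular part of the discrete symbol: at a general point, at a point where
the boundary term vanishes, and at a point off the axes. -/
lemma exists_disc_reg_le (hα₁ : 1 < α) (hα₂ : α < 2) (hr : 0 < r) (hrM : r < M) :
    ∃ K, 0 ≤ K ∧ ∀ (n : ℕ) (i j : Fin 2) (x : Plane), 1 ≤ n → i ≠ j → x i ≠ 0 →
      |(∫ θ in box (n * Real.pi), Real.cos (inner ℝ θ x) * regPart (discSymb α r M n) θ)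
        - regLimit (contSymb α M) (contGrad α M) (fun i j => hessInt α i j M) i x|
        ≤ K * ((n : ℝ) ^ (1 - α) * (1 / |x i| + 1 / x i ^ 2)) ∧
      (Real.sin (n * Real.pi * x i) = 0 →
      |(∫ θ in box (n * Real.pi), Real.cos (inner ℝ θ x) * regPart (discSymb α r M n) θ)
        - regLimit (contSymb α M) (contGrad α M) (fun i j => hessInt α i j M) i x|
        ≤ K * ((n : ℝ) ^ (-α) * (1 / x i ^ 2))) ∧
      (x j ≠ 0 →
      |(∫ θ in box (n * Real.pi), Real.cos (inner ℝ θ x) * regPart (discSymb α r M n) θ)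
        - regLimit (contSymb α M) (contGrad α M) (fun i j => hessInt α i j M) i x|
        ≤ K * ((n : ℝ) ^ (-α) * (1 / (|x i| * |x j|) + 1 / x i ^ 2))) := by
  obtain ⟨K, hK, hmain⟩ := exists_disc_reg_sub_le hα₁ hα₂ hr hrM
  obtain ⟨c, C, hc, hC, -, hdisc⟩ := exists_symbBound hα₁ hα₂ hr hrM
  set B := max 1 c⁻¹ with hBd
  have hB1 : 1 ≤ B := le_max_left _ _
  have hB : c⁻¹ ≤ B := le_max_right _ _
  have hK' : 0 ≤ 8 * B + 12 * B ^ 2 * C := by positivity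
  set K' := 8 * B + 12 * B ^ 2 * C with hK'd
  refine ⟨K + K', by positivity, fun n i j x hn hij hx => ?_⟩
  have h := hmain n i j x hn hij hx
  have hn0 : (0 : ℝ) < n := by exact_mod_cast hn
  have hn1 : (1 : ℝ) ≤ n := by exact_mod_cast hn
  have hR : 0 < n * Real.pi := by have := Real.pi_pos; positivity
  have hx0 : 0 < |x i| := abs_pos.2 hx
  have hd := hdisc n hn
  have hdC2 := planeC2_discSymb α r M n
  set I := (∫ θ in box (n * Real.pi), Real.cos (inner ℝ θ x) * regPart (discSymb α r M n) θ)
        - regLimit (contSymb α M) (contGrad α M) (fun i j => hessInt α i j M) i x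
  set E := bdryTerm (regPart (discSymb α r M n)) (regGrad (discSymb α r M n) (discGrad α r M n) i)
            i j x (n * Real.pi) with hE
  have hIE : |I| ≤ K * ((n : ℝ) ^ (-α) / x i ^ 2) + |E| := by
    have := abs_add_le (I - E) E
    rw [sub_add_cancel] at this
    linarith
  have hper : ∀ s, discSymb α r M n (linePt i (-(n * Real.pi)) s)
      = discSymb α r M n (linePt i (n * Real.pi) s) := fun s => (discSymb_periodic hn i s).symm
  have hper₁ : ∀ s, discGrad α r M n i (linePt i (-(n * Real.pi)) s)
      = discGrad α r M n i (linePt i (n * Real.pi) s) := fun s => (discGrad_periodic hn i i s).symm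
  have hmono : (n : ℝ) ^ (-α) ≤ (n : ℝ) ^ (1 - α) :=
    Real.rpow_le_rpow_of_exponent_le hn1 (by linarith)
  refine ⟨hIE.trans ?_, fun hs => hIE.trans ?_, fun hxj => hIE.trans ?_⟩
  · have hb := hd.abs_bdryTerm_le hα₁ hα₂ hc hC hB1 hB hR le_rfl (j := j) hx
    rw [← hE, ← hK'd] at hb
    have p1 : (n * Real.pi : ℝ) ^ (1 - α) ≤ (n : ℝ) ^ (1 - α) := rpow_mul_pi_le hn (by linarith)
    have p2 : (n * Real.pi : ℝ) ^ (-α) ≤ (n : ℝ) ^ (1 - α) :=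
      (rpow_mul_pi_le hn (by linarith)).trans hmono
    have q1 : |E| ≤ K' * ((n : ℝ) ^ (1 - α) * (1 / |x i| + 1 / x i ^ 2)) := by
      refine hb.trans (mul_le_mul_of_nonneg_left ?_ hK')
      rw [mul_add, mul_one_div, mul_one_div]
      gcongr
    have q2 : K * ((n : ℝ) ^ (-α) / x i ^ 2) ≤ K * ((n : ℝ) ^ (1 - α) * (1 / |x i| + 1 / x i ^ 2)) := by
      refine mul_le_mul_of_nonneg_left ?_ hK
      rw [div_eq_mul_one_div]
      refine mul_le_mul hmono ?_ (by positivity) (by positivity)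
      exact le_add_of_nonneg_left (by positivity)
    linarith
  · have : E = 0 := by
      rw [hE, bdryTerm_eq_of_periodic (fun s => by simp only [regPart, hper])
        (fun s => by simp only [regGrad, hper, hper₁]), hs]
      simp
    rw [this, abs_zero, add_zero, mul_one_div]
    exact mul_le_mul_of_nonneg_right (by linarith) (by positivity)
  · have hb := hd.abs_bdryTerm_periodic_le hdC2 hα₁ hα₂ hc hC hB1 hB hR le_rfl hij hx hxj hper hper₁
    rw [← hE, ← hK'd] at hb
    have hxj0 : 0 < |x j| := abs_pos.2 hxj
    have p2 : (n * Real.pi : ℝ) ^ (-α) ≤ (n : ℝ) ^ (-α) := rpow_mul_pi_le hn (by linarith)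
    have q1 : |E| ≤ K' * ((n : ℝ) ^ (-α) * (1 / (|x i| * |x j|) + 1 / x i ^ 2)) := by
      refine hb.trans ?_
      rw [mul_assoc]
      gcongr
    have q2 : K * ((n : ℝ) ^ (-α) / x i ^ 2)
        ≤ K * ((n : ℝ) ^ (-α) * (1 / (|x i| * |x j|) + 1 / x i ^ 2)) := by
      refine mul_le_mul_of_nonneg_left ?_ hK
      rw [div_eq_mul_one_div]
      refine mul_le_mul_of_nonneg_left ?_ (by positivity)
      exact le_add_of_nonneg_left (by positivity)
    linarith

end

/-! ### The residual part, and convergence of the improper integral. -/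

/-- The absolutely integrable part of the Green integrand of the symbol `φ`. -/
def residTerm (φ : Plane → ℝ) (y x θ : Plane) : ℝ :=
  (Real.cos (inner ℝ θ x) - Real.cos (inner ℝ θ y)) * residPart φ θ

section

variable {α : ℝ} {φ φ' : Plane → ℝ} {φ₁ φ₁' : Fin 2 → Plane → ℝ}
  {φ₂ φ₂' : Fin 2 → Fin 2 → Plane → ℝ} {S S' : Set Plane} {c C D B : ℝ}

lemma PlaneC2.measurable_residTerm (h : PlaneC2 φ φ₁ φ₂) (y x : Plane) :
    Measurable (residTerm φ y x) := by
  have := h.cont.measurable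
  unfold residTerm residPart
  fun_prop

lemma SymbBound.integrableOn_residTerm (h : SymbBound α c C φ φ₁ φ₂ S) (h2 : PlaneC2 φ φ₁ φ₂)
    (hS : MeasurableSet S) (hα₁ : 1 < α) (hα₂ : α < 2) (hc : 0 < c) (hB1 : 1 ≤ B) (hB : c⁻¹ ≤ B)
    (y x : Plane) : IntegrableOn (residTerm φ y x) S := by
  have hd : IntegrableOn (fun θ => B ^ 3 * (2 + ‖x‖ ^ 2 + ‖y‖ ^ 2) * decay (3 * α) θ) S :=
    ((integrable_decay (by linarith : 2 < 3 * α)).const_mul _).integrableOn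
  refine hd.mono' (h2.measurable_residTerm y x).aestronglyMeasurable ?_
  rw [ae_restrict_iff' hS]
  filter_upwards [ae_ne_zero] with θ h0 hθ
  exact h.abs_cos_mul_residPart_le hα₁ hα₂ hc hB1 hB hθ h0 x y

lemma SymbBound.abs_residTerm_le_far (h : SymbBound α c C φ φ₁ φ₂ S) (hα₁ : 1 < α) (hα₂ : α < 2)
    (hc : 0 < c) (hB1 : 1 ≤ B) (hB : c⁻¹ ≤ B) (y x : Plane) {θ : Plane} (hθ : θ ∈ S)
    (h1 : 1 ≤ ‖θ‖) : |residTerm φ y x θ| ≤ 2 * B ^ 3 * decay (3 * α) θ := by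
  rw [residTerm, abs_mul, abs_of_nonneg h.residPart_nonneg, mul_assoc]
  exact mul_le_mul (abs_cos_sub_cos_le_two _ _) (h.residPart_le_far hα₁ hα₂ hc hB1 hB hθ h1)
    h.residPart_nonneg (by norm_num)

lemma SymbBound.abs_tail_residTerm_le (h : SymbBound α c C φ φ₁ φ₂ Set.univ)
    (hα₁ : 1 < α) (hα₂ : α < 2) (hc : 0 < c) (hB1 : 1 ≤ B) (hB : c⁻¹ ≤ B)
    (y x : Plane) {R : ℝ} (hR : 1 ≤ R) :
    |∫ θ in (box R)ᶜ, residTerm φ y x θ|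
      ≤ 2 * B ^ 3 * (2 * Real.pi / (3 * α - 2)) * R ^ (2 - 3 * α) := by
  have h3 : 2 < 3 * α := by linarith
  have hd : IntegrableOn (fun θ => 2 * B ^ 3 * decay (3 * α) θ) (box R)ᶜ :=
    ((integrable_decay h3).const_mul _).integrableOn
  refine (abs_integral_le_of_ae_le hd ?_).trans ?_
  · rw [ae_restrict_iff' (measurableSet_box R).compl]
    refine Eventually.of_forall fun θ hθ => h.abs_residTerm_le_far hα₁ hα₂ hc hB1 hB y x
      (Set.mem_univ θ) ?_
    have := compl_box_subset R hθ
    simp only [Set.mem_compl_iff, Metric.mem_ball, dist_zero_right, not_lt] at this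
    linarith
  · rw [integral_const_mul, mul_assoc _ (2 * Real.pi / (3 * α - 2))]
    exact mul_le_mul_of_nonneg_left (setIntegral_compl_box_decay_le h3 (by linarith))
      (by positivity)

lemma greenIntegrand_eq {θ : Plane} (h : 0 < φ θ) (a : ℝ) (y x : Plane) :
    greenIntegrand (fun θ => a * φ θ) y x θ = a⁻¹ * ((Real.cos (inner ℝ θ x) * regPart φ θ
      - Real.cos (inner ℝ θ y) * regPart φ θ) + residTerm φ y x θ) := by
  have := inv_eq_regPart_add h
  rw [greenIntegrand, div_eq_mul_inv, mul_inv, this, residTerm]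
  ring

lemma SymbBound.pos (h : SymbBound α c C φ φ₁ φ₂ S) (hc : 0 < c) {θ : Plane} (hθ : θ ∈ S)
    (h0 : θ ≠ 0) : 0 < φ θ :=
  (mul_pos hc (symbSize_pos α h0)).trans_le (h.lower θ hθ)

lemma SymbBound.ae_greenIntegrand_eq (h : SymbBound α c C φ φ₁ φ₂ S) (hc : 0 < c) {R : ℝ}
    (hS : box R ⊆ S) (a : ℝ) (y x : Plane) :
    greenIntegrand (fun θ => a * φ θ) y x =ᵐ[volume.restrict (box R)] fun θ =>
      a⁻¹ * ((Real.cos (inner ℝ θ x) * regPart φ θ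
        - Real.cos (inner ℝ θ y) * regPart φ θ) + residTerm φ y x θ) := by
  rw [EventuallyEq, ae_restrict_iff' (measurableSet_box R)]
  filter_upwards [ae_ne_zero] with θ h0 hθ
  exact greenIntegrand_eq (h.pos hc (hS hθ) h0) a y x

lemma SymbBound.integrableOn_regPart (h : SymbBound α c C φ φ₁ φ₂ S) (h2 : PlaneC2 φ φ₁ φ₂)
    (R : ℝ) : IntegrableOn (regPart φ) (box R) :=
  (h2.continuous_regPart h.nonneg).continuousOn.integrableOn_compact (isCompact_box R)

lemma SymbBound.integrableOn_greenIntegrand (h : SymbBound α c C φ φ₁ φ₂ S) (h2 : PlaneC2 φ φ₁ φ₂)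
    (hα₁ : 1 < α) (hα₂ : α < 2) (hc : 0 < c) (hB1 : 1 ≤ B) (hB : c⁻¹ ≤ B) {R : ℝ}
    (hS : box R ⊆ S) (hSm : MeasurableSet S) (a : ℝ) (y x : Plane) :
    IntegrableOn (greenIntegrand (fun θ => a * φ θ) y x) (box R) := by
  have hr := h.integrableOn_regPart h2 R
  have hres := (h.integrableOn_residTerm h2 hSm hα₁ hα₂ hc hB1 hB y x).mono_set hS
  exact ((((integrable_cos_mul hr x).sub (integrable_cos_mul hr y)).add hres).const_mul a⁻¹).congr
    (h.ae_greenIntegrand_eq hc hS a y x).symm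

lemma SymbBound.setIntegral_greenIntegrand (h : SymbBound α c C φ φ₁ φ₂ S)
    (h2 : PlaneC2 φ φ₁ φ₂)
    (hα₁ : 1 < α) (hα₂ : α < 2) (hc : 0 < c) (hB1 : 1 ≤ B) (hB : c⁻¹ ≤ B) {R : ℝ}
    (hS : box R ⊆ S) (hSm : MeasurableSet S) (a : ℝ) (y x : Plane) :
    ∫ θ in box R, greenIntegrand (fun θ => a * φ θ) y x θ = a⁻¹ *
      ((∫ θ in box R, Real.cos (inner ℝ θ x) * regPart φ θ)
        - (∫ θ in box R, Real.cos (inner ℝ θ y) * regPart φ θ)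
        + ∫ θ in box R, residTerm φ y x θ) := by
  have hr := h.integrableOn_regPart h2 R
  have hx := integrable_cos_mul hr x
  have hy := integrable_cos_mul hr y
  have hres := (h.integrableOn_residTerm h2 hSm hα₁ hα₂ hc hB1 hB y x).mono_set hS
  have hxy : IntegrableOn (fun θ => Real.cos (inner ℝ θ x) * regPart φ θ
    - Real.cos (inner ℝ θ y) * regPart φ θ) (box R) := hx.sub hy
  rw [integral_congr_ae (h.ae_greenIntegrand_eq hc hS a y x), integral_const_mul,
    integral_add hxy hres, integral_sub hx hy]

lemma SymbBound.tendsto_setIntegral_residTerm (h : SymbBound α c C φ φ₁ φ₂ Set.univ)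
    (h2 : PlaneC2 φ φ₁ φ₂) (hα₁ : 1 < α) (hα₂ : α < 2) (hc : 0 < c) (hB1 : 1 ≤ B)
    (hB : c⁻¹ ≤ B) (y x : Plane) :
    Tendsto (fun R : ℝ => ∫ θ in box R, residTerm φ y x θ) atTop (𝓝 (∫ θ, residTerm φ y x θ)) := by
  have hi := h.integrableOn_residTerm h2 MeasurableSet.univ hα₁ hα₂ hc hB1 hB y x
  rw [integrableOn_univ] at hi
  have h0 : Tendsto (fun R : ℝ => 2 * B ^ 3 * (2 * Real.pi / (3 * α - 2)) * R ^ (2 - 3 * α)) atTop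
      (𝓝 0) := by
    have := (tendsto_rpow_neg_atTop (by linarith : 0 < 3 * α - 2)).const_mul
      (2 * B ^ 3 * (2 * Real.pi / (3 * α - 2)))
    simpa using this
  rw [tendsto_iff_norm_sub_tendsto_zero]
  refine squeeze_zero' (Eventually.of_forall fun _ => norm_nonneg _) ?_ h0
  filter_upwards [eventually_ge_atTop 1] with R hR
  rw [integral_eq_box_add_compl hi R, sub_add_cancel_left, norm_neg]
  exact h.abs_tail_residTerm_le hα₁ hα₂ hc hB1 hB y x hR

lemma SymbBound.tendsto_setIntegral_regPart (h : SymbBound α c C φ φ₁ φ₂ Set.univ)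
    (h2 : PlaneC2 φ φ₁ φ₂) (hα₁ : 1 < α) (hα₂ : α < 2) (hc : 0 < c) (hC : 0 ≤ C) (hB1 : 1 ≤ B)
    (hB : c⁻¹ ≤ B) {i j : Fin 2} (hij : i ≠ j) {x : Plane} (hx : x i ≠ 0) :
    Tendsto (fun R : ℝ => ∫ θ in box R, Real.cos (inner ℝ θ x) * regPart φ θ) atTop
      (𝓝 (regLimit φ φ₁ φ₂ i x)) := by
  have t1 := (tendsto_rpow_neg_atTop (by linarith : 0 < α - 1)).div_const |x i|
  have t2 := (tendsto_rpow_neg_atTop (by linarith : 0 < α)).div_const (x i ^ 2)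
  have t3 := (t1.add t2).const_mul
    (8 * B + 12 * B ^ 2 * C + (8 * B ^ 3 * C ^ 2 + 3 * B ^ 2 * C) * (2 * Real.pi / α))
  rw [zero_div, zero_div, add_zero, mul_zero, neg_sub] at t3
  rw [tendsto_iff_norm_sub_tendsto_zero]
  refine squeeze_zero' (Eventually.of_forall fun _ => norm_nonneg _) ?_ t3
  filter_upwards [eventually_gt_atTop 0] with R hR
  exact h.abs_box_sub_regLimit_le h2 hα₁ hα₂ hc hC hB1 hB hij hx hR

/-- The improper integral of the Green integrand converges. -/
lemma SymbBound.tendsto_greenOnBox (h : SymbBound α c C φ φ₁ φ₂ Set.univ)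
    (h2 : PlaneC2 φ φ₁ φ₂) (hα₁ : 1 < α) (hα₂ : α < 2) (hc : 0 < c) (hC : 0 ≤ C) (hB1 : 1 ≤ B)
    (hB : c⁻¹ ≤ B) (a : ℝ) {i j k l : Fin 2} (hij : i ≠ j) (hkl : k ≠ l) {x y : Plane}
    (hx : x i ≠ 0) (hy : y k ≠ 0) :
    Tendsto (fun R : ℝ => greenOnBox (fun θ => a * φ θ) y R x) atTop
      (𝓝 (1 / (2 * Real.pi) ^ 2 * (a⁻¹ * (regLimit φ φ₁ φ₂ i x - regLimit φ φ₁ φ₂ k y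
        + ∫ θ, residTerm φ y x θ)))) := by
  simp only [greenOnBox, h.setIntegral_greenIntegrand h2 hα₁ hα₂ hc hB1 hB (Set.subset_univ _)
    MeasurableSet.univ]
  exact ((((h.tendsto_setIntegral_regPart h2 hα₁ hα₂ hc hC hB1 hB hij hx).sub
    (h.tendsto_setIntegral_regPart h2 hα₁ hα₂ hc hC hB1 hB hkl hy)).add
    (h.tendsto_setIntegral_residTerm h2 hα₁ hα₂ hc hB1 hB y x)).const_mul _).const_mul _

lemma SymbBound.abs_residTerm_sub_le_decay (h : SymbBound α c C φ φ₁ φ₂ S)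
    (h' : SymbBound α c C φ' φ₁' φ₂' S') (hα₁ : 1 < α) (hα₂ : α < 2)
    (hc : 0 < c) (hB1 : 1 ≤ B) (hB : c⁻¹ ≤ B) {θ : Plane} (hθ : θ ∈ S) (hθ' : θ ∈ S')
    (h0 : θ ≠ 0) (hD : 0 ≤ D) {n : ℕ} (hn : 1 ≤ n) (hθn : ‖θ‖ ≤ 5 * n)
    (d0 : |φ' θ - φ θ| ≤ D * ((n : ℝ) ^ 2)⁻¹ * (‖θ‖ ^ 2 * symbSize α θ)) (y x : Plane) :
    |residTerm φ y x θ - residTerm φ' y x θ|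
      ≤ 30 * B ^ 4 * D * (n : ℝ) ^ (-α) * decay (2 * α) θ := by
  rw [residTerm, residTerm, ← mul_sub, abs_mul]
  have := mul_le_mul (abs_cos_sub_cos_le_two (inner ℝ θ x) (inner ℝ θ y))
    (h.abs_residPart_sub_le_decay h' hα₁ hα₂ hc hB1 hB hθ hθ' h0 hD hn hθn d0)
    (abs_nonneg _) (by norm_num)
  linarith

end

section

variable {α r M : ℝ}

/-- The absolutely integrable parts of the discrete and of the continuum Green's function. -/
lemma exists_resid_sub_le (hα₁ : 1 < α) (hα₂ : α < 2) (hr : 0 < r) (hrM : r < M) :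
    ∃ K, 0 ≤ K ∧ ∀ (n : ℕ) (y x : Plane), 1 ≤ n →
      |(∫ θ, residTerm (contSymb α M) y x θ)
        - ∫ θ in box (n * Real.pi), residTerm (discSymb α r M n) y x θ| ≤ K * (n : ℝ) ^ (-α) := by
  have hπ := Real.pi_pos
  obtain ⟨c, C, hc, hC, hcont, hdisc⟩ := exists_symbBound hα₁ hα₂ hr hrM
  obtain ⟨D, hD, hdiff⟩ := exists_discSymb_sub_contSymb_le hα₁ hα₂ hr hrM
  set B := max 1 c⁻¹ with hBd
  have hB1 : 1 ≤ B := le_max_left _ _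
  have hB : c⁻¹ ≤ B := le_max_right _ _
  have hcC2 : PlaneC2 (contSymb α M) (contGrad α M) (fun i j => hessInt α i j M) :=
    planeC2_contSymb hα₂
  set K₁ := 30 * B ^ 4 * D * ∫ θ, decay (2 * α) θ with hK₁
  set K₂ := 2 * B ^ 3 * (2 * Real.pi / (3 * α - 2)) with hK₂
  have hI : 0 ≤ ∫ θ, decay (2 * α) θ := integral_nonneg (decay_nonneg _)
  have h3 : 0 < 3 * α - 2 := by linarith
  have hK₁0 : 0 ≤ K₁ := by positivity
  have hK₂0 : 0 ≤ K₂ := by positivity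
  refine ⟨K₁ + K₂, by positivity, fun n y x hn => ?_⟩
  have hn0 : (0 : ℝ) < n := by exact_mod_cast hn
  have hn1 : (1 : ℝ) ≤ n := by exact_mod_cast hn
  have hd := hdisc n hn
  have hi := hcont.integrableOn_residTerm hcC2 MeasurableSet.univ hα₁ hα₂ hc hB1 hB y x
  rw [integrableOn_univ] at hi
  have hid := hd.integrableOn_residTerm (planeC2_discSymb α r M n) (measurableSet_box _) hα₁ hα₂
    hc hB1 hB y x
  rw [integral_eq_box_add_compl hi (n * Real.pi), add_sub_right_comm,
    ← integral_sub hi.integrableOn hid]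
  have hR : 1 ≤ n * Real.pi := by nlinarith [Real.pi_gt_three]
  have t2 := hcont.abs_tail_residTerm_le hα₁ hα₂ hc hB1 hB y x hR
  -- The tail is small enough because α > 1 gives 2 - 3α ≤ -α; this is where the second term of the
  -- expansion of 1/φ pays off.
  have p2 : (n * Real.pi : ℝ) ^ (2 - 3 * α) ≤ (n : ℝ) ^ (-α) :=
    (rpow_mul_pi_le hn (by linarith)).trans
      (Real.rpow_le_rpow_of_exponent_le hn1 (by linarith))
  have hdec : Integrable (fun θ => 30 * B ^ 4 * D * (n : ℝ) ^ (-α) * decay (2 * α) θ) :=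
    (integrable_decay (by linarith : 2 < 2 * α)).const_mul _
  have t1 : |∫ θ in box (n * Real.pi), (residTerm (contSymb α M) y x θ
      - residTerm (discSymb α r M n) y x θ)| ≤ K₁ * (n : ℝ) ^ (-α) := by
    refine (abs_integral_le_of_ae_le hdec.integrableOn ?_).trans
      ((setIntegral_le_integral hdec (Eventually.of_forall fun θ => ?_)).trans (le_of_eq ?_))
    · rw [ae_restrict_iff' (measurableSet_box _)]
      filter_upwards [ae_ne_zero] with θ h0 hθ
      exact hcont.abs_residTerm_sub_le_decay hd hα₁ hα₂ hc hB1 hB (Set.mem_univ _) hθ h0 hD hn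
        (norm_le_of_mem_box hθ hn0) (hdiff n θ hn hθ).2.2 y x
    · have := decay_nonneg (2 * α) θ
      show (0 : ℝ) ≤ _
      positivity
    · rw [integral_const_mul, hK₁]; ring
  refine (abs_add_le _ _).trans ?_
  have t3 := mul_le_mul_of_nonneg_left p2 hK₂0
  linarith

end

/-- Integrating by parts in the larger coordinate turns 1/x_i² into a multiple of 1/|x|². -/
lemma exists_large_coord {x : Plane} (hx : x ≠ 0) :
    ∃ i j, i ≠ j ∧ x i ≠ 0 ∧ 1 / x i ^ 2 ≤ 2 * (1 / ‖x‖ ^ 2) := by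
  have hs : 0 < ‖x‖ ^ 2 := by have := norm_pos_iff.2 hx; positivity
  have hn := plane_norm_sq x
  have key : ∀ i, ‖x‖ ^ 2 ≤ 2 * x i ^ 2 → x i ≠ 0 ∧ 1 / x i ^ 2 ≤ 2 * (1 / ‖x‖ ^ 2) := by
    intro i hi
    have h0 : 0 < x i ^ 2 := by linarith
    refine ⟨fun h => by simp [h] at h0, ?_⟩
    rw [mul_one_div, div_le_div_iff₀ h0 hs]
    linarith
  rcases le_total (x 0 ^ 2) (x 1 ^ 2) with h | h
  · exact ⟨1, 0, by decide, key 1 (by linarith)⟩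
  · exact ⟨0, 1, by decide, key 0 (by linarith)⟩

/-! ### The Green's functions as sums of regular and residual contributions. -/

section

variable {α r M : ℝ}

/-- The contribution of the regular part of the continuum symbol to the Green's function. -/
def contReg (α M : ℝ) (i : Fin 2) (x : Plane) : ℝ :=
  regLimit (contSymb α M) (contGrad α M) (fun i j => hessInt α i j M) i x

lemma psiCont_eq_mul (α r M : ℝ) :
    psiCont α r M = fun θ => cLim α r M * contSymb α M θ := funext psiCont_eq

lemma psiDisc_eq_mul (hα₂ : α < 2) (hM : 0 ≤ M) {n : ℕ} (hn : 1 ≤ n) :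
    psiDisc α r M n = fun θ => cn α r M n * discSymb α r M n θ := funext (psiDisc_eq hα₂ hM hn)

lemma tendsto_greenOnBox_psiCont (hα₁ : 1 < α) (hα₂ : α < 2) (hr : 0 < r) (hrM : r < M)
    {i j k l : Fin 2} (hij : i ≠ j) (hkl : k ≠ l) {x y : Plane} (hx : x i ≠ 0) (hy : y k ≠ 0) :
    Tendsto (fun R : ℝ => greenOnBox (psiCont α r M) y R x) atTop
      (𝓝 (1 / (2 * Real.pi) ^ 2 * ((cLim α r M)⁻¹ * (contReg α M i x - contReg α M k y
        + ∫ θ, residTerm (contSymb α M) y x θ)))) := by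
  obtain ⟨c, C, hc, hC, hcont, -⟩ := exists_symbBound hα₁ hα₂ hr hrM
  rw [psiCont_eq_mul]
  exact hcont.tendsto_greenOnBox (planeC2_contSymb hα₂) hα₁ hα₂ hc hC (le_max_left 1 c⁻¹)
    (le_max_right _ _) _ hij hkl hx hy

/-- The left side does not involve `i` and `k`, so at each of the two points any nonvanishing
coordinate may be used for the integration by parts. -/
lemma greenCont_eq (hα₁ : 1 < α) (hα₂ : α < 2) (hr : 0 < r) (hrM : r < M)
    {i j k l : Fin 2} (hij : i ≠ j) (hkl : k ≠ l) {x y : Plane} (hx : x i ≠ 0) (hy : y k ≠ 0) :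
    greenCont α r M y x = 1 / (2 * Real.pi) ^ 2 * ((cLim α r M)⁻¹ * (contReg α M i x
      - contReg α M k y + ∫ θ, residTerm (contSymb α M) y x θ)) :=
  (tendsto_greenOnBox_psiCont hα₁ hα₂ hr hrM hij hkl hx hy).limUnder_eq

lemma tendsto_greenCont (hα₁ : 1 < α) (hα₂ : α < 2) (hr : 0 < r) (hrM : r < M)
    {x y : Plane} (hx : x ≠ 0) (hy : y ≠ 0) :
    Tendsto (fun R : ℝ => greenOnBox (psiCont α r M) y R x) atTop (𝓝 (greenCont α r M y x)) := by
  obtain ⟨i, j, hij, hxi, -⟩ := exists_large_coord hx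
  obtain ⟨k, l, hkl, hyk, -⟩ := exists_large_coord hy
  rw [greenCont_eq hα₁ hα₂ hr hrM hij hkl hxi hyk]
  exact tendsto_greenOnBox_psiCont hα₁ hα₂ hr hrM hij hkl hxi hyk

lemma integrableOn_greenIntegrand_psiCont (hα₁ : 1 < α) (hα₂ : α < 2) (hr : 0 < r) (hrM : r < M)
    (y x : Plane) (R : ℝ) : IntegrableOn (greenIntegrand (psiCont α r M) y x) (box R) := by
  obtain ⟨c, C, hc, hC, hcont, -⟩ := exists_symbBound hα₁ hα₂ hr hrM
  rw [psiCont_eq_mul]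
  exact hcont.integrableOn_greenIntegrand (planeC2_contSymb hα₂) hα₁ hα₂ hc (le_max_left 1 c⁻¹)
    (le_max_right _ _) (Set.subset_univ _) MeasurableSet.univ _ y x

lemma integrableOn_greenIntegrand_psiDisc (hα₁ : 1 < α) (hα₂ : α < 2) (hr : 0 < r) (hrM : r < M)
    {n : ℕ} (hn : 1 ≤ n) (y x : Plane) :
    IntegrableOn (greenIntegrand (psiDisc α r M n) y x) (box (n * Real.pi)) := by
  obtain ⟨c, C, hc, hC, -, hdisc⟩ := exists_symbBound hα₁ hα₂ hr hrM
  rw [psiDisc_eq_mul hα₂ (hr.trans hrM).le hn]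
  exact (hdisc n hn).integrableOn_greenIntegrand (planeC2_discSymb α r M n) hα₁ hα₂ hc
    (le_max_left 1 c⁻¹) (le_max_right _ _) le_rfl (measurableSet_box _) _ y x

lemma greenDisc_eq (hα₁ : 1 < α) (hα₂ : α < 2) (hr : 0 < r) (hrM : r < M)
    {n : ℕ} (hn : 1 ≤ n) (y x : Plane) :
    greenDisc α r M y n x = 1 / (2 * Real.pi) ^ 2 * ((cn α r M n)⁻¹ *
      ((∫ θ in box (n * Real.pi), Real.cos (inner ℝ θ x) * regPart (discSymb α r M n) θ)
        - (∫ θ in box (n * Real.pi), Real.cos (inner ℝ θ y) * regPart (discSymb α r M n) θ)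
        + ∫ θ in box (n * Real.pi), residTerm (discSymb α r M n) y x θ)) := by
  obtain ⟨c, C, hc, hC, -, hdisc⟩ := exists_symbBound hα₁ hα₂ hr hrM
  rw [greenDisc, greenOnBox, psiDisc_eq_mul hα₂ (hr.trans hrM).le hn,
    (hdisc n hn).setIntegral_greenIntegrand (planeC2_discSymb α r M n) hα₁ hα₂ hc
    (le_max_left 1 c⁻¹) (le_max_right _ _) le_rfl (measurableSet_box _)]

lemma sin_mul_latticePt {n : ℕ} (hn : 1 ≤ n) (z : Fin 2 → ℤ) (i : Fin 2) :
    Real.sin (n * Real.pi * latticePt n z i) = 0 := by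
  have hn0 : (n : ℝ) ≠ 0 := by positivity
  have : (n * Real.pi * latticePt n z i : ℝ) = z i * Real.pi := by
    simp only [latticePt]
    field_simp
  rw [this, Real.sin_int_mul_pi]

/-- At a point of the unit circle the discrete regular part converges with rate `n^{-α}`. -/
lemma exists_disc_reg_unit_le (hα₁ : 1 < α) (hα₂ : α < 2) (hr : 0 < r) (hrM : r < M)
    {y : Plane} (hy : ‖y‖ = 1) :
    ∃ k l : Fin 2, k ≠ l ∧ y k ≠ 0 ∧ ∃ K, 0 ≤ K ∧ ∀ n : ℕ, 1 ≤ n →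
      |(∫ θ in box (n * Real.pi), Real.cos (inner ℝ θ y) * regPart (discSymb α r M n) θ)
        - contReg α M k y| ≤ K * (n : ℝ) ^ (-α) := by
  obtain ⟨K, hK, h⟩ := exists_disc_reg_le hα₁ hα₂ hr hrM
  obtain ⟨k, l, hkl, hk, -⟩ := exists_large_coord (x := y) (fun h0 => by simp [h0] at hy)
  refine ⟨k, l, hkl, hk, ?_⟩
  -- On an axis |y_k| = 1 and sin(nπy_k) = 0, so the boundary term vanishes. Off the axes the
  -- estimate along the edges applies, with a constant that depends on y.
  by_cases hl : y l = 0
  · have h1 : |y k| = 1 := by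
      have hs := plane_norm_sq y
      rw [hy] at hs
      have : y k ^ 2 = 1 := by
        fin_cases k <;> fin_cases l <;> simp_all
      rw [← Real.sqrt_sq_eq_abs, this, Real.sqrt_one]
    have hsin : ∀ n : ℕ, Real.sin (n * Real.pi * y k) = 0 := by
      intro n
      rcases (abs_eq zero_le_one).1 h1 with e | e <;> rw [e] <;> simp
    refine ⟨K * (1 / y k ^ 2), by positivity, fun n hn => ?_⟩
    refine ((h n k l y hn hkl hk).2.1 (hsin n)).trans (le_of_eq (by ring))
  · refine ⟨K * (1 / (|y k| * |y l|) + 1 / y k ^ 2), by positivity, fun n hn => ?_⟩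
    exact ((h n k l y hn hkl hk).2.2 hl).trans (le_of_eq (by ring))

lemma one_div_abs_le (t : ℝ) : 1 / |t| ≤ 1 + 1 / t ^ 2 := by
  have : 1 / t ^ 2 = (1 / |t|) ^ 2 := by rw [div_pow, one_pow, sq_abs]
  rw [this]
  nlinarith [sq_nonneg (1 / |t| - 1)]

/-- The unnormalized Green's functions: the error is `O(n^{1-α})` in general and `O(n^{-α})` at the
lattice points. -/
lemma exists_green_sub_le (hα₁ : 1 < α) (hα₂ : α < 2) (hr : 0 < r) (hrM : r < M)
    {y : Plane} (hy : ‖y‖ = 1) :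
    ∃ K, 0 ≤ K ∧ ∀ (n : ℕ) (x : Plane), 1 ≤ n → x ≠ 0 →
      |cLim α r M * greenCont α r M y x - cn α r M n * greenDisc α r M y n x|
        ≤ K * (n : ℝ) ^ (1 - α) * (1 + 1 / ‖x‖ ^ 2) ∧
      (x ∈ rescaledLattice n →
        |cLim α r M * greenCont α r M y x - cn α r M n * greenDisc α r M y n x|
        ≤ K * (n : ℝ) ^ (-α) * (1 + 1 / ‖x‖ ^ 2)) := by
  have hπ := Real.pi_gt_three
  obtain ⟨K₁, hK₁, h₁⟩ := exists_disc_reg_le hα₁ hα₂ hr hrM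
  obtain ⟨k, l, hkl, hyk, K₂, hK₂, h₂⟩ := exists_disc_reg_unit_le hα₁ hα₂ hr hrM hy
  obtain ⟨K₃, hK₃, h₃⟩ := exists_resid_sub_le hα₁ hα₂ hr hrM
  obtain ⟨-, hc, C, hC, hcn⟩ := exists_cn_rate hα₁ hα₂ hr hrM
  refine ⟨4 * K₁ + K₂ + K₃, by positivity, fun n x hn hx => ?_⟩
  have hn1 : (1 : ℝ) ≤ n := by exact_mod_cast hn
  have hn0 : (0 : ℝ) < n := by linarith
  obtain ⟨i, j, hij, hxi, hxle⟩ := exists_large_coord hx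
  have hcn0 := (hcn n hn).1
  rw [greenCont_eq hα₁ hα₂ hr hrM hij hkl hxi hyk, greenDisc_eq hα₁ hα₂ hr hrM hn,
    mul_left_comm, mul_inv_cancel_left₀ hc.ne', mul_left_comm, mul_inv_cancel_left₀ hcn0.ne',
    ← mul_sub, abs_mul]
  have g₁ := h₁ n i j x hn hij hxi
  have g₂ := h₂ n hn
  have g₃ := h₃ n y x hn
  have hone : |1 / (2 * Real.pi) ^ 2| ≤ 1 := by
    rw [abs_of_pos (by positivity)]
    exact div_le_one_of_le₀ (by nlinarith) (by positivity)
  change |_ - contReg α M i x| ≤ _ ∧ (_ → |_ - contReg α M i x| ≤ _) ∧ _ at g₁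
  set X := contReg α M i x
  set Y := contReg α M k y
  set Z := ∫ θ, residTerm (contSymb α M) y x θ
  set X' := ∫ θ in box (n * Real.pi), Real.cos (inner ℝ θ x) * regPart (discSymb α r M n) θ
  set Y' := ∫ θ in box (n * Real.pi), Real.cos (inner ℝ θ y) * regPart (discSymb α r M n) θ
  set Z' := ∫ θ in box (n * Real.pi), residTerm (discSymb α r M n) y x θ
  have hsum : |X - Y + Z - (X' - Y' + Z')| ≤ |X' - X| + |Y' - Y| + |Z - Z'| := by
    rw [show X - Y + Z - (X' - Y' + Z') = -(X' - X) + (Y' - Y) + (Z - Z') by ring]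
    refine (abs_add_three _ _ _).trans ?_
    rw [abs_neg]
  have htot : |1 / (2 * Real.pi) ^ 2| * |X - Y + Z - (X' - Y' + Z')|
      ≤ |X' - X| + K₂ * (n : ℝ) ^ (-α) + K₃ * (n : ℝ) ^ (-α) :=
    (mul_le_of_le_one_left (abs_nonneg _) hone).trans (by linarith)
  have hmono : (n : ℝ) ^ (-α) ≤ (n : ℝ) ^ (1 - α) :=
    Real.rpow_le_rpow_of_exponent_le hn1 (by linarith)
  have hu : 0 ≤ 1 / ‖x‖ ^ 2 := by positivity
  have hab := one_div_abs_le (x i)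
  set u := 1 / ‖x‖ ^ 2
  -- One computation for both rates: m is n^{1-α} at a general point and n^{-α} at a lattice point.
  have general : ∀ m : ℝ, 0 ≤ m → (n : ℝ) ^ (-α) ≤ m → |X' - X| ≤ K₁ * (m * (4 * (1 + u))) →
      |X' - X| + K₂ * (n : ℝ) ^ (-α) + K₃ * (n : ℝ) ^ (-α)
        ≤ (4 * K₁ + K₂ + K₃) * m * (1 + u) := by
    intro m hm hmn hX
    have e2 : (K₂ + K₃) * (n : ℝ) ^ (-α) ≤ (K₂ + K₃) * (m * (1 + u)) := by
      refine mul_le_mul_of_nonneg_left (hmn.trans (le_mul_of_one_le_right hm (by linarith)))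
        (by positivity)
    linarith
  refine ⟨htot.trans (general _ (by positivity) hmono (g₁.1.trans ?_)),
    fun hz => htot.trans (general _ (by positivity) le_rfl ((g₁.2.1 ?_).trans ?_))⟩
  · refine mul_le_mul_of_nonneg_left (mul_le_mul_of_nonneg_left ?_ (by positivity)) hK₁
    linarith
  · obtain ⟨z, rfl⟩ := hz
    exact sin_mul_latticePt hn z i
  · refine mul_le_mul_of_nonneg_left (mul_le_mul_of_nonneg_left ?_ (by positivity)) hK₁
    linarith

end

/-! ### Logarithmic growth of the continuum Green's function. -/

/-- The model integral over the unit disk, whose growth in `x` is logarithmic. -/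
def logIntegrand (y x θ : Plane) : ℝ :=
  (Real.cos (inner ℝ θ x) - Real.cos (inner ℝ θ y)) * ‖θ‖ ^ (-2 : ℝ)

lemma measurable_logIntegrand (y x : Plane) : Measurable (logIntegrand y x) := by
  unfold logIntegrand; fun_prop

lemma mul_rpow_neg_two_le {t s : ℝ} {θ : Plane} (h : |t| ≤ ‖θ‖ ^ 2 * s) (hs : 0 ≤ s) :
    |t * ‖θ‖ ^ (-2 : ℝ)| ≤ s := by
  rw [abs_mul, abs_of_nonneg (by positivity : 0 ≤ ‖θ‖ ^ (-2 : ℝ)), Real.rpow_neg (norm_nonneg _),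
    Real.rpow_two]
  rcases eq_or_ne θ 0 with rfl | h0
  · simpa using hs
  · have := norm_pos_iff.2 h0
    rw [← div_eq_mul_inv, div_le_iff₀ (by positivity)]
    linarith

lemma abs_logIntegrand_le (y x θ : Plane) : |logIntegrand y x θ| ≤ (‖x‖ ^ 2 + ‖y‖ ^ 2) / 2 :=
  mul_rpow_neg_two_le ((abs_cos_sub_cos_inner_le θ x y).trans (le_of_eq (by ring))) (by positivity)

lemma abs_setIntegral_ball_le {f : Plane → ℝ} {A R : ℝ} (hR : 0 ≤ R) (h : ∀ θ, |f θ| ≤ A) :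
    |∫ θ in Metric.ball (0 : Plane) R, f θ| ≤ A * (Real.pi * R ^ 2) := by
  have := norm_setIntegral_le_of_norm_le_const (μ := volume) (s := Metric.ball (0 : Plane) R)
    (f := f) (C := A) (by finiteness) fun θ _ => h θ
  rwa [Real.norm_eq_abs, volume_real_ball hR] at this

lemma integrableOn_logIntegrand (y x : Plane) (R : ℝ) :
    IntegrableOn (logIntegrand y x) (Metric.ball 0 R) :=
  (integrableOn_const (C := (‖x‖ ^ 2 + ‖y‖ ^ 2) / 2) (by finiteness)).mono'
    (measurable_logIntegrand y x).aestronglyMeasurable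
    (Eventually.of_forall (abs_logIntegrand_le y x))

lemma abs_log_le {u : ℝ} (hu : 0 < u) : |Real.log u| ≤ u + 1 / u := by
  have h1 := Real.log_le_sub_one_of_pos hu
  have h2 := Real.one_sub_inv_le_log_of_pos hu
  have h3 : 0 < u⁻¹ := inv_pos.2 hu
  rw [one_div, abs_le]
  constructor <;> linarith

/-- For |x| ≥ 5 the disk is cut at ρ = 5/|x|. Inside, the integrand is O(|x|²) on an area
O(|x|^{-2}). Outside, the part with cos(θ·x) is bounded by oscillation, the part with cos(θ·y) - 1
is bounded because |y| = 1, and what is left, minus the integral of |θ|^{-2}, is -2π log(|x|/5). For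
|x| ≤ 5 the integral and the logarithm are estimated separately. -/
lemma exists_logIntegral_le :
    ∃ K, 0 ≤ K ∧ ∀ y x : Plane, ‖y‖ = 1 → x ≠ 0 →
      |(∫ θ in Metric.ball (0 : Plane) 1, logIntegrand y x θ) + 2 * Real.pi * Real.log ‖x‖|
        ≤ K * (1 + 1 / ‖x‖ ^ 2) := by
  have hπ := Real.pi_pos
  obtain ⟨C, hC, hK⟩ := exists_kernelBound_rpow (two_pos : (0 : ℝ) < 2)
  have hm : Measurable fun v : Plane => ‖v‖ ^ (-2 : ℝ) := by fun_prop
  have hlog5 : 0 ≤ Real.log 5 := Real.log_nonneg (by norm_num)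
  set K₁ := C * (Real.pi ^ 2 * (1 / (2 - 1) + 4)) with hK₁
  have hK₁0 : 0 ≤ K₁ := by rw [hK₁]; norm_num; positivity
  refine ⟨50 * Real.pi + K₁ + 2 * Real.pi * Real.log 5, by positivity, fun y x hy hx => ?_⟩
  have hx0 : 0 < ‖x‖ := norm_pos_iff.2 hx
  have hu : 0 ≤ 1 / ‖x‖ ^ 2 := by positivity
  have hab := one_div_abs_le ‖x‖
  rw [abs_of_pos hx0] at hab
  rcases le_total ‖x‖ 5 with h5 | h5
  · have h1 := abs_setIntegral_ball_le zero_le_one (abs_logIntegrand_le y x)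
    have h2 := abs_log_le hx0
    have h3 : |2 * Real.pi * Real.log ‖x‖| ≤ 2 * Real.pi * (6 + 1 / ‖x‖ ^ 2) := by
      rw [abs_mul, abs_of_pos (by positivity : 0 < 2 * Real.pi)]
      exact mul_le_mul_of_nonneg_left (by linarith) (by positivity)
    have h4 : (‖x‖ ^ 2 + ‖y‖ ^ 2) / 2 * (Real.pi * 1 ^ 2) ≤ 13 * Real.pi := by
      have hx2 : ‖x‖ ^ 2 ≤ 25 := by nlinarith
      have := mul_le_mul_of_nonneg_right hx2 hπ.le
      rw [hy]
      linarith
    refine (abs_add_le _ _).trans ?_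
    have h6 : 0 ≤ (K₁ + 2 * Real.pi * Real.log 5) * (1 + 1 / ‖x‖ ^ 2) := by positivity
    have h7 : 0 ≤ Real.pi * (1 / ‖x‖ ^ 2) := by positivity
    linarith
  · set ρ := 5 / ‖x‖ with hρ
    have hρ0 : 0 < ρ := by positivity
    have hρ1 : ρ ≤ 1 := div_le_one_of_le₀ h5 hx0.le
    have b0 : annulus 0 ρ = Metric.ball (0 : Plane) ρ := by ext v; simp [mem_annulus]
    have b1 : annulus 0 1 = Metric.ball (0 : Plane) 1 := by ext v; simp [mem_annulus]
    have hi := integrableOn_logIntegrand y x 1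
    have hia : IntegrableOn (logIntegrand y x) (annulus ρ 1) := hi.mono_set Set.sdiff_subset
    have hsplit : ∫ θ in Metric.ball (0 : Plane) 1, logIntegrand y x θ
        = (∫ θ in Metric.ball (0 : Plane) ρ, logIntegrand y x θ)
          + ∫ θ in annulus ρ 1, logIntegrand y x θ := by
      rw [← b1, ← annulus_union hρ0.le hρ1, setIntegral_union (annulus_disjoint _ _ _)
        (measurableSet_annulus _ _) (by rw [b0]; exact integrableOn_logIntegrand y x ρ) hia, b0]
    have i0 : IntegrableOn (fun v : Plane => ‖v‖ ^ (-2 : ℝ)) (annulus ρ 1) :=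
      integrableOn_annulus_rpow hρ0 1 2
    have i1 := integrableOn_mul_cos i0 x
    have hcosy : ∀ θ : Plane, |(Real.cos (inner ℝ θ y) - 1) * ‖θ‖ ^ (-2 : ℝ)| ≤ 1 / 2 := fun θ =>
      mul_rpow_neg_two_le ((abs_cos_sub_one_le θ y).trans (le_of_eq (by rw [hy]; ring)))
        (by norm_num)
    have i2b : IntegrableOn (fun θ : Plane => (Real.cos (inner ℝ θ y) - 1) * ‖θ‖ ^ (-2 : ℝ))
        (Metric.ball 0 1) :=
      (integrableOn_const (C := (1 / 2 : ℝ)) (by finiteness)).mono'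
        (by fun_prop) (Eventually.of_forall hcosy)
    have i2 := i2b.mono_set (Set.sdiff_subset : annulus ρ 1 ⊆ _)
    have hann : ∫ θ in annulus ρ 1, logIntegrand y x θ
        = (∫ θ in annulus ρ 1, ‖θ‖ ^ (-2 : ℝ) * Real.cos (inner ℝ x θ))
          - (∫ θ in annulus ρ 1, (Real.cos (inner ℝ θ y) - 1) * ‖θ‖ ^ (-2 : ℝ))
          - ∫ θ in annulus ρ 1, ‖θ‖ ^ (-2 : ℝ) := by
      have i12 : IntegrableOn (fun θ : Plane => ‖θ‖ ^ (-2 : ℝ) * Real.cos (inner ℝ x θ)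
        - (Real.cos (inner ℝ θ y) - 1) * ‖θ‖ ^ (-2 : ℝ)) (annulus ρ 1) := i1.sub i2
      rw [← integral_sub i1 i2, ← integral_sub i12 i0]
      refine integral_congr_ae (Eventually.of_forall fun θ => ?_)
      simp only [logIntegrand, real_inner_comm x θ]
      ring
    have e0 : ∫ θ in annulus ρ 1, ‖θ‖ ^ (-2 : ℝ)
        = 2 * Real.pi * Real.log ‖x‖ - 2 * Real.pi * Real.log 5 := by
      rw [integral_annulus_rpow_neg_two hρ0 hρ1, hρ, one_div_div,
        Real.log_div hx0.ne' (by norm_num)]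
      ring
    have e1 := hK.abs_integral_annulus_mul_cos_le hm (by norm_num) hC hx (le_refl ρ) 1
    rw [← hK₁] at e1
    have e1' : ρ ^ (1 - 2 : ℝ) / ‖x‖ ≤ 1 := by
      rw [show (1 - 2 : ℝ) = -1 by norm_num, Real.rpow_neg_one, hρ, inv_div, div_div,
        div_le_one (by positivity)]
      linarith
    have e1'' := mul_le_mul_of_nonneg_left e1' hK₁0
    have e2 : |∫ θ in annulus ρ 1, (Real.cos (inner ℝ θ y) - 1) * ‖θ‖ ^ (-2 : ℝ)|
        ≤ Real.pi := by
      have := norm_setIntegral_le_of_norm_le_const (μ := volume) (s := annulus ρ 1)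
        (f := fun θ : Plane => (Real.cos (inner ℝ θ y) - 1) * ‖θ‖ ^ (-2 : ℝ)) (C := 1 / 2)
        ((measure_mono (Set.sdiff_subset : annulus ρ 1 ⊆ _)).trans_lt (by finiteness))
        fun θ _ => hcosy θ
      have hv : volume.real (annulus ρ 1) ≤ Real.pi * 1 ^ 2 := by
        rw [← volume_real_ball zero_le_one]
        exact measureReal_mono Set.sdiff_subset (by finiteness)
      rw [Real.norm_eq_abs] at this
      linarith
    have e3 := abs_setIntegral_ball_le hρ0.le (abs_logIntegrand_le y x)
    have e3' : (‖x‖ ^ 2 + ‖y‖ ^ 2) / 2 * (Real.pi * ρ ^ 2) ≤ 25 * Real.pi := by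
      have : ρ ^ 2 = 25 / ‖x‖ ^ 2 := by rw [hρ, div_pow]; norm_num
      rw [hy, this, ← mul_div_assoc, ← mul_div_assoc, div_le_iff₀ (by positivity)]
      have hx2 : 25 ≤ ‖x‖ ^ 2 := by nlinarith
      have := mul_le_mul_of_nonneg_right hx2 hπ.le
      linarith
    rw [hsplit, hann, e0]
    set I₁ := ∫ θ in Metric.ball (0 : Plane) ρ, logIntegrand y x θ
    set I₂ := ∫ θ in annulus ρ 1, ‖θ‖ ^ (-2 : ℝ) * Real.cos (inner ℝ x θ)
    set I₃ := ∫ θ in annulus ρ 1, (Real.cos (inner ℝ θ y) - 1) * ‖θ‖ ^ (-2 : ℝ)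
    rw [show I₁ + (I₂ - I₃ - (2 * Real.pi * Real.log ‖x‖ - 2 * Real.pi * Real.log 5))
      + 2 * Real.pi * Real.log ‖x‖ = I₁ + I₂ - I₃ + 2 * Real.pi * Real.log 5 by ring]
    have h6 : 0 ≤ (50 * Real.pi + K₁ + 2 * Real.pi * Real.log 5) * (1 / ‖x‖ ^ 2) := by positivity
    have h7 : 0 ≤ 2 * Real.pi * Real.log 5 := by positivity
    rw [abs_le] at *
    constructor <;> linarith [e1.1, e1.2, e2.1, e2.2, e3.1, e3.2]

section

variable {α r M : ℝ}

lemma ballMoment_pos (hα₂ : α < 2) (hM : 0 < M) : 0 < ballMoment α M := by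
  have h2 : 0 < 2 - α := by linarith
  have := Real.pi_pos
  rw [ballMoment_value hα₂ hM.le]
  positivity

/-- Near the origin, the reciprocal of the symbol is that of its quadratic part, up to a bounded
error. -/
lemma exists_residPart_sub_le (hα₁ : 1 < α) (hα₂ : α < 2) (hr : 0 < r) (hrM : r < M) :
    ∃ K, 0 ≤ K ∧ ∀ θ : Plane, θ ≠ 0 → ‖θ‖ ≤ 1 →
      |residPart (contSymb α M) θ - 4 / ballMoment α M * ‖θ‖ ^ (-2 : ℝ)| ≤ K := by
  have hM : 0 < M := hr.trans hrM
  have hb := ballMoment_pos hα₂ hM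
  obtain ⟨c, C, hc, hC, hcont, -⟩ := exists_symbBound hα₁ hα₂ hr hrM
  obtain ⟨Q, hQ, hsq⟩ := exists_contSymb_sub_sq_le hα₂ hM
  set B := max 1 c⁻¹ with hBd
  have hB1 : 1 ≤ B := le_max_left _ _
  have hB : c⁻¹ ≤ B := le_max_right _ _
  refine ⟨4 * Q / (c * ballMoment α M) + 2 * B, by positivity, fun θ h0 h1 => ?_⟩
  have hθ := norm_pos_iff.2 h0
  have hφ := hcont.pos hc (Set.mem_univ θ) h0
  have hlow := hcont.lower θ (Set.mem_univ θ)
  rw [symbSize_eq_sq hα₂ h0 h1] at hlow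
  have hreg := hcont.abs_regPart_le hc hB1 hB (Set.mem_univ θ)
  have hreg' : |regPart (contSymb α M) θ| ≤ 2 * B :=
    hreg.trans (mul_le_of_le_one_right (by positivity) (symbInv_le_one α θ))
  have hs := hsq θ
  set b := ballMoment α M
  set φ := contSymb α M θ
  -- The residual part is 1/φ minus the bounded regular part. Subtracting the reciprocal of the
  -- quadratic model leaves a fraction whose numerator is O(|θ|⁴) and whose denominator is at least
  -- a multiple of |θ|⁴.
  have e : residPart (contSymb α M) θ - 4 / b * ‖θ‖ ^ (-2 : ℝ)
      = -(4 * (φ - b / 4 * ‖θ‖ ^ 2) / (φ * (b * ‖θ‖ ^ 2))) - regPart (contSymb α M) θ := by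
    have h := inv_eq_regPart_add (φ := contSymb α M) (θ := θ) hφ
    rw [← sub_eq_iff_eq_add'] at h
    rw [← h, Real.rpow_neg hθ.le, Real.rpow_two]
    change φ⁻¹ - _ - _ = _
    field_simp
    ring
  rw [e]
  refine (abs_sub _ _).trans (add_le_add ?_ hreg')
  rw [abs_neg, abs_div, abs_mul, abs_of_pos (by norm_num : (0 : ℝ) < 4),
    abs_of_pos (by positivity : 0 < φ * (b * ‖θ‖ ^ 2)),
    div_le_div_iff₀ (by positivity) (by positivity)]
  calc 4 * |φ - b / 4 * ‖θ‖ ^ 2| * (c * b) ≤ 4 * (Q * ‖θ‖ ^ 4) * (c * b) := by gcongr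
    _ = 4 * Q * ((c * ‖θ‖ ^ 2) * (b * ‖θ‖ ^ 2)) := by ring
    _ ≤ 4 * Q * (φ * (b * ‖θ‖ ^ 2)) := by gcongr

/-- Frequencies outside the unit disk contribute a bounded amount. Inside, replacing the residual
part by (4/b)|θ|^{-2}, with b = `ballMoment α M`, costs a bounded error, and the model integral
supplies -2π log|x|. -/
lemma exists_resid_log_le (hα₁ : 1 < α) (hα₂ : α < 2) (hr : 0 < r) (hrM : r < M) :
    ∃ K, 0 ≤ K ∧ ∀ y x : Plane, ‖y‖ = 1 → x ≠ 0 →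
      |(∫ θ, residTerm (contSymb α M) y x θ) + 8 * Real.pi / ballMoment α M * Real.log ‖x‖|
        ≤ K * (1 + 1 / ‖x‖ ^ 2) := by
  have hM : 0 < M := hr.trans hrM
  have hπ := Real.pi_pos
  have hb := ballMoment_pos hα₂ hM
  obtain ⟨c, C, hc, hC, hcont, -⟩ := exists_symbBound hα₁ hα₂ hr hrM
  obtain ⟨K₁, hK₁, h₁⟩ := exists_residPart_sub_le hα₁ hα₂ hr hrM
  obtain ⟨K₂, hK₂, h₂⟩ := exists_logIntegral_le
  have hcC2 : PlaneC2 (contSymb α M) (contGrad α M) (fun i j => hessInt α i j M) :=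
    planeC2_contSymb hα₂
  set B := max 1 c⁻¹ with hBd
  have hB1 : 1 ≤ B := le_max_left _ _
  have hB : c⁻¹ ≤ B := le_max_right _ _
  have hI : 0 ≤ ∫ θ, decay (3 * α) θ := integral_nonneg (decay_nonneg _)
  refine ⟨2 * B ^ 3 * (∫ θ, decay (3 * α) θ) + 2 * K₁ * Real.pi + 4 / ballMoment α M * K₂,
    by positivity, fun y x hy hx => ?_⟩
  have hi := hcont.integrableOn_residTerm hcC2 MeasurableSet.univ hα₁ hα₂ hc hB1 hB y x
  rw [integrableOn_univ] at hi
  have hdec : Integrable (fun θ => 2 * B ^ 3 * decay (3 * α) θ) :=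
    (integrable_decay (by linarith : 2 < 3 * α)).const_mul _
  have far : |∫ θ in (Metric.ball (0 : Plane) 1)ᶜ, residTerm (contSymb α M) y x θ|
      ≤ 2 * B ^ 3 * ∫ θ, decay (3 * α) θ := by
    rw [← integral_const_mul]
    refine (abs_integral_le_of_ae_le hdec.integrableOn ?_).trans
      (setIntegral_le_integral hdec (Eventually.of_forall fun θ => ?_))
    · rw [ae_restrict_iff' measurableSet_ball.compl]
      refine Eventually.of_forall fun θ hθ => hcont.abs_residTerm_le_far hα₁ hα₂ hc hB1 hB y x
        (Set.mem_univ θ) ?_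
      simpa using hθ
    · have := decay_nonneg (3 * α) θ
      show (0 : ℝ) ≤ _
      positivity
  have near : |(∫ θ in Metric.ball (0 : Plane) 1, residTerm (contSymb α M) y x θ)
      - 4 / ballMoment α M * ∫ θ in Metric.ball (0 : Plane) 1, logIntegrand y x θ|
      ≤ 2 * K₁ * Real.pi := by
    rw [← integral_const_mul, ← integral_sub hi.integrableOn
      ((integrableOn_logIntegrand y x 1).const_mul _)]
    have hk : IntegrableOn (fun _ : Plane => 2 * K₁) (Metric.ball (0 : Plane) 1) :=
      integrableOn_const (by finiteness)
    refine (abs_integral_le_of_ae_le hk ?_).trans (le_of_eq ?_)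
    · rw [ae_restrict_iff' measurableSet_ball]
      filter_upwards [ae_ne_zero] with θ h0 hθ
      rw [Metric.mem_ball, dist_zero_right] at hθ
      rw [residTerm, logIntegrand, mul_left_comm, ← mul_sub, abs_mul]
      exact mul_le_mul (abs_cos_sub_cos_le_two _ _) (h₁ θ h0 hθ.le) (abs_nonneg _) (by norm_num)
    · rw [setIntegral_const, volume_real_ball zero_le_one, smul_eq_mul]
      ring
  have hlog := mul_le_mul_of_nonneg_left (h₂ y x hy hx) (by positivity : 0 ≤ 4 / ballMoment α M)
  rw [← abs_of_nonneg (by positivity : 0 ≤ 4 / ballMoment α M), ← abs_mul,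
    abs_of_nonneg (by positivity : 0 ≤ 4 / ballMoment α M)] at hlog
  rw [← integral_add_compl measurableSet_ball hi (s := Metric.ball (0 : Plane) 1)]
  have hu : 0 ≤ 1 / ‖x‖ ^ 2 := by positivity
  set N := ∫ θ in Metric.ball (0 : Plane) 1, residTerm (contSymb α M) y x θ
  set F := ∫ θ in (Metric.ball (0 : Plane) 1)ᶜ, residTerm (contSymb α M) y x θ
  set J := ∫ θ in Metric.ball (0 : Plane) 1, logIntegrand y x θ
  set b := ballMoment α M
  rw [show N + F + 8 * Real.pi / b * Real.log ‖x‖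
    = F + (N - 4 / b * J) + 4 / b * (J + 2 * Real.pi * Real.log ‖x‖) by ring]
  refine (abs_add_three _ _ _).trans ?_
  have h6 : 0 ≤ (2 * B ^ 3 * (∫ θ, decay (3 * α) θ) + 2 * K₁ * Real.pi) * (1 / ‖x‖ ^ 2) := by
    positivity
  linarith

/-- No condition on x_i is needed: if x_i = 0, both sides vanish by the convention on division by
zero. -/
lemma exists_contReg_le (hα₁ : 1 < α) (hα₂ : α < 2) (hr : 0 < r) (hrM : r < M) :
    ∃ K, 0 ≤ K ∧ ∀ (i : Fin 2) (x : Plane), |contReg α M i x| ≤ K * (1 / x i ^ 2) := by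
  obtain ⟨c, C, hc, hC, hcont, -⟩ := exists_symbBound hα₁ hα₂ hr hrM
  have hI : 0 ≤ ∫ θ, decay (2 + α) θ := integral_nonneg (decay_nonneg _)
  have hB1 : 1 ≤ max 1 c⁻¹ := le_max_left _ _
  refine ⟨(8 * (max 1 c⁻¹) ^ 3 * C ^ 2 + 3 * (max 1 c⁻¹) ^ 2 * C) * ∫ θ, decay (2 + α) θ,
    by positivity, fun i x => ?_⟩
  rw [mul_one_div]
  exact hcont.abs_regLimit_le hα₁ hα₂ hc hC hB1 (le_max_right _ _) i x

/-- The logarithmic growth of the continuum Green's function. -/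
lemma exists_greenCont_log_le (hα₁ : 1 < α) (hα₂ : α < 2) (hr : 0 < r) (hrM : r < M) :
    ∃ K, 0 ≤ K ∧ ∀ y x : Plane, ‖y‖ = 1 → x ≠ 0 →
      |greenCont α r M y x + 2 / (Real.pi * sigmaSq α r M) * Real.log ‖x‖|
        ≤ K * (1 + 1 / ‖x‖ ^ 2) := by
  have hM : 0 < M := hr.trans hrM
  have hπ := Real.pi_pos
  have hb := ballMoment_pos hα₂ hM
  obtain ⟨-, hc, -⟩ := exists_cn_rate hα₁ hα₂ hr hrM
  obtain ⟨K₁, hK₁, h₁⟩ := exists_contReg_le hα₁ hα₂ hr hrM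
  obtain ⟨K₂, hK₂, h₂⟩ := exists_resid_log_le hα₁ hα₂ hr hrM
  refine ⟨1 / (2 * Real.pi) ^ 2 * ((cLim α r M)⁻¹ * (2 * K₁ + K₂)), by positivity,
    fun y x hy hx => ?_⟩
  obtain ⟨i, j, hij, hxi, hxle⟩ := exists_large_coord hx
  obtain ⟨k, l, hkl, hyk, hyle⟩ := exists_large_coord (x := y) (fun h0 => by simp [h0] at hy)
  have g₁ := (h₁ i x).trans (mul_le_mul_of_nonneg_left hxle hK₁)
  have g₂ := (h₁ k y).trans (mul_le_mul_of_nonneg_left hyle hK₁)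
  rw [hy] at g₂
  have g₃ := h₂ y x hy hx
  rw [greenCont_eq hα₁ hα₂ hr hrM hij hkl hxi hyk, sigmaSq]
  set c := cLim α r M
  set b := ballMoment α M
  set X := contReg α M i x
  set Y := contReg α M k y
  set Z := ∫ θ, residTerm (contSymb α M) y x θ
  -- The constants match because 8π/(2π)² = 2/π and σ_M² = cb.
  have e : 1 / (2 * Real.pi) ^ 2 * (c⁻¹ * (X - Y + Z)) + 2 / (Real.pi * (c * b)) * Real.log ‖x‖
      = 1 / (2 * Real.pi) ^ 2 * (c⁻¹ * (X - Y + (Z + 8 * Real.pi / b * Real.log ‖x‖))) := by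
    field_simp
    ring
  rw [e, abs_mul, abs_mul, abs_of_pos (by positivity : 0 < 1 / (2 * Real.pi) ^ 2),
    abs_of_pos (inv_pos.2 hc), mul_assoc, mul_assoc]
  refine mul_le_mul_of_nonneg_left (mul_le_mul_of_nonneg_left ?_ (inv_pos.2 hc).le) (by positivity)
  refine (abs_add_le _ _).trans ?_
  have := abs_sub X Y
  linarith

end

/-! ### The expansion and the uniform convergence. -/

section

variable {α r M : ℝ}

lemma exists_abs_betaN_le (hα₁ : 1 < α) (hα₂ : α < 2) (hr : 0 < r) (hrM : r < M) :
    ∃ K, 0 ≤ K ∧ ∀ n : ℕ, 1 ≤ n → |betaN α r M n| ≤ K * (n : ℝ) ^ (-α) := by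
  obtain ⟨-, hc, C, hC, hcn⟩ := exists_cn_rate hα₁ hα₂ hr hrM
  refine ⟨|2 / (Real.pi * sigmaSq α r M)| * C, by positivity, fun n hn => ?_⟩
  rw [betaN, abs_mul, mul_assoc]
  exact mul_le_mul_of_nonneg_left (hcn n hn).2.2 (abs_nonneg _)

/-- The expansion of the Green's function: the error is `O(n^{1-α})` in general and `O(n^{-α})` at
the lattice points. -/
lemma exists_green_expansion_le (hα₁ : 1 < α) (hα₂ : α < 2) (hr : 0 < r) (hrM : r < M)
    {y : Plane} (hy : ‖y‖ = 1) :
    ∃ K, 0 ≤ K ∧ ∀ (n : ℕ) (x : Plane), 1 ≤ n → x ≠ 0 →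
      |greenCont α r M y x - greenDisc α r M y n x + betaN α r M n * Real.log ‖x‖|
        ≤ K * (n : ℝ) ^ (1 - α) * (1 + 1 / ‖x‖ ^ 2) ∧
      (x ∈ rescaledLattice n →
        |greenCont α r M y x - greenDisc α r M y n x + betaN α r M n * Real.log ‖x‖|
        ≤ K * (n : ℝ) ^ (-α) * (1 + 1 / ‖x‖ ^ 2)) := by
  obtain ⟨-, hc, C, hC, hcn⟩ := exists_cn_rate hα₁ hα₂ hr hrM
  obtain ⟨K₁, hK₁, h₁⟩ := exists_green_sub_le hα₁ hα₂ hr hrM hy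
  obtain ⟨K₂, hK₂, h₂⟩ := exists_greenCont_log_le hα₁ hα₂ hr hrM
  refine ⟨C * K₂ + C * K₁, by positivity, fun n x hn hx => ?_⟩
  obtain ⟨hcn0, hcnle, hrate⟩ := hcn n hn
  obtain ⟨g₁, g₁'⟩ := h₁ n x hn hx
  have g₂ := h₂ y x hy hx
  have hn1 : (1 : ℝ) ≤ n := by exact_mod_cast hn
  have hu : 0 ≤ 1 / ‖x‖ ^ 2 := by positivity
  have hmono : (n : ℝ) ^ (-α) ≤ (n : ℝ) ^ (1 - α) :=
    Real.rpow_le_rpow_of_exponent_le hn1 (by linarith)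
  -- The error of the normalizing constants is separated from the comparison of the symbols. The
  -- term β_n log|x| is exactly what removes the logarithmic growth from the factor multiplying 1 -
  -- c/c_n.
  have e : greenCont α r M y x - greenDisc α r M y n x + betaN α r M n * Real.log ‖x‖
      = (1 - cLim α r M / cn α r M n)
          * (greenCont α r M y x + 2 / (Real.pi * sigmaSq α r M) * Real.log ‖x‖)
        + (cn α r M n)⁻¹
          * (cLim α r M * greenCont α r M y x - cn α r M n * greenDisc α r M y n x) := by
    rw [betaN, mul_sub (cn α r M n)⁻¹, inv_mul_cancel_left₀ hcn0.ne']
    ring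
  rw [e]
  have key : ∀ m : ℝ, (n : ℝ) ^ (-α) ≤ m →
      |cLim α r M * greenCont α r M y x - cn α r M n * greenDisc α r M y n x|
        ≤ K₁ * m * (1 + 1 / ‖x‖ ^ 2) →
      |(1 - cLim α r M / cn α r M n)
          * (greenCont α r M y x + 2 / (Real.pi * sigmaSq α r M) * Real.log ‖x‖)
        + (cn α r M n)⁻¹
          * (cLim α r M * greenCont α r M y x - cn α r M n * greenDisc α r M y n x)|
        ≤ (C * K₂ + C * K₁) * m * (1 + 1 / ‖x‖ ^ 2) := by
    intro m hm hb
    have hm0 : 0 ≤ m := le_trans (by positivity) hm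
    refine (abs_add_le _ _).trans ?_
    rw [abs_mul, abs_mul, abs_of_pos (inv_pos.2 hcn0)]
    have t₁ := mul_le_mul (hrate.trans (mul_le_mul_of_nonneg_left hm hC.le)) g₂ (abs_nonneg _)
      (by positivity)
    have t₂ := mul_le_mul hcnle hb (abs_nonneg _) hC.le
    linarith
  exact ⟨key _ hmono g₁, fun hz => key _ le_rfl (g₁' hz)⟩

/-- On a compact subset of the punctured plane |x| is bounded above and away from 0, so log|x| is
bounded. The rate n^{1-α} valid off the lattice tends to 0 because α > 1. -/
lemma tendstoUniformlyOn_greenDisc (hα₁ : 1 < α) (hα₂ : α < 2) (hr : 0 < r) (hrM : r < M)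
    {y : Plane} (hy : ‖y‖ = 1) {S : Set Plane} (hS : IsCompact S) (h0 : (0 : Plane) ∉ S) :
    TendstoUniformlyOn (fun (n : ℕ) (x : Plane) => greenDisc α r M y n x)
      (greenCont α r M y) atTop S := by
  obtain ⟨K₁, hK₁, h₁⟩ := exists_green_expansion_le hα₁ hα₂ hr hrM hy
  obtain ⟨K₂, hK₂, h₂⟩ := exists_abs_betaN_le hα₁ hα₂ hr hrM
  obtain ⟨δ, hδ, hδS⟩ := Metric.isOpen_iff.1 hS.isClosed.isOpen_compl 0 h0
  obtain ⟨R, hR⟩ := hS.isBounded.subset_closedBall 0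
  have hn : Tendsto (fun n : ℕ => (n : ℝ)) atTop atTop := tendsto_natCast_atTop_atTop
  have t1 := ((tendsto_rpow_neg_atTop (by linarith : 0 < α - 1)).comp hn).const_mul K₁
  have t2 := ((tendsto_rpow_neg_atTop (by linarith : 0 < α)).comp hn).const_mul K₂
  have t3 := (t1.mul_const (1 + 1 / δ ^ 2)).add (t2.mul_const (R + 1 / δ))
  simp only [mul_zero, zero_mul, add_zero, neg_sub] at t3
  rw [Metric.tendstoUniformlyOn_iff]
  intro ε hε
  filter_upwards [t3.eventually_lt_const hε, eventually_ge_atTop 1] with n hlt hn1 x hx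
  refine lt_of_le_of_lt ?_ hlt
  have hxδ : δ ≤ ‖x‖ := by
    by_contra! hlt
    exact hδS (by simpa using hlt) hx
  have hxR : ‖x‖ ≤ R := by simpa using hR hx
  have hx0 : 0 < ‖x‖ := hδ.trans_le hxδ
  have g := (h₁ n x hn1 (norm_pos_iff.1 hx0)).1
  have hb := h₂ n hn1
  have hlog : |Real.log ‖x‖| ≤ R + 1 / δ :=
    (abs_log_le hx0).trans (add_le_add hxR (one_div_le_one_div_of_le hδ hxδ))
  have hbl : |betaN α r M n * Real.log ‖x‖| ≤ K₂ * (n : ℝ) ^ (-α) * (R + 1 / δ) := by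
    rw [abs_mul]
    exact mul_le_mul hb hlog (abs_nonneg _) (by positivity)
  have hu : 1 / ‖x‖ ^ 2 ≤ 1 / δ ^ 2 :=
    one_div_le_one_div_of_le (by positivity) (pow_le_pow_left₀ hδ.le hxδ 2)
  have g' : K₁ * (n : ℝ) ^ (1 - α) * (1 + 1 / ‖x‖ ^ 2) ≤ K₁ * (n : ℝ) ^ (1 - α) * (1 + 1 / δ ^ 2) :=
    mul_le_mul_of_nonneg_left (by linarith) (by positivity)
  rw [Real.dist_eq, show greenCont α r M y x - greenDisc α r M y n x
    = (greenCont α r M y x - greenDisc α r M y n x + betaN α r M n * Real.log ‖x‖)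
      - betaN α r M n * Real.log ‖x‖ by ring]
  exact (abs_sub _ _).trans (add_le_add (g.trans g') hbl)

end

end TruncatedStable

end

open TruncatedStable in
theorem theorem2 (α r M : ℝ) (hα₁ : 1 < α) (hα₂ : α < 2) (hr : 0 < r) (hrM : r < M)
    (hk : 0 < kn α r M 1) (x₀ : Plane) (hx₀ : ‖x₀‖ = 1) :
    -- the limit that defines `c` exists and is positive
    (Tendsto (fun n : ℕ => cn α r M n) atTop (𝓝 (cLim α r M)) ∧ 0 < cLim α r M) ∧
    -- the integrals that define the discrete Green's functions converge absolutely
    (∀ n : ℕ, 1 ≤ n → ∀ x : Plane,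
      IntegrableOn (greenIntegrand (psiDisc α r M n) x₀ x) (box ((n : ℝ) * Real.pi))) ∧
    -- the improper integral that defines the continuum Green's function converges
    (∀ x : Plane, x ≠ 0 →
      (∀ R : ℝ, IntegrableOn (greenIntegrand (psiCont α r M) x₀ x) (box R)) ∧
      Tendsto (fun R : ℝ => greenOnBox (psiCont α r M) x₀ R x) atTop
        (𝓝 (greenCont α r M x₀ x))) ∧
    -- the expansion, with its rate
    (∃ K : ℝ, 0 < K ∧
      (∀ n : ℕ, 1 ≤ n → ∀ x ∈ rescaledLattice n, x ≠ 0 →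
        |greenCont α r M x₀ x - greenDisc α r M x₀ n x + betaN α r M n * Real.log ‖x‖| ≤
          K / (n : ℝ) ^ α * (1 + 1 / ‖x‖ ^ (2 - α) + 1 / ‖x‖ ^ 2)) ∧
      (∀ n : ℕ, 1 ≤ n → |betaN α r M n| ≤ K / (n : ℝ) ^ α)) ∧
    -- uniform convergence on the compact subsets of the punctured plane
    (∀ C : Set Plane, IsCompact C → (0 : Plane) ∉ C →
      TendstoUniformlyOn (fun (n : ℕ) (x : Plane) => greenDisc α r M x₀ n x)
        (greenCont α r M x₀) atTop C) := by
  have hx₀' : x₀ ≠ 0 := fun h => by simp [h] at hx₀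
  obtain ⟨hlim, hc, -⟩ := exists_cn_rate hα₁ hα₂ hr hrM
  refine ⟨⟨hlim, hc⟩,
    fun n hn x => integrableOn_greenIntegrand_psiDisc hα₁ hα₂ hr hrM hn x₀ x,
    fun x hx => ⟨integrableOn_greenIntegrand_psiCont hα₁ hα₂ hr hrM x₀ x,
      tendsto_greenCont hα₁ hα₂ hr hrM hx hx₀'⟩, ?_,
    fun C hC h0 => tendstoUniformlyOn_greenDisc hα₁ hα₂ hr hrM hx₀ hC h0⟩
  obtain ⟨K₁, hK₁, h₁⟩ := exists_green_expansion_le hα₁ hα₂ hr hrM hx₀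
  obtain ⟨K₂, hK₂, h₂⟩ := exists_abs_betaN_le hα₁ hα₂ hr hrM
  have hdiv : ∀ n : ℕ, (K₁ + K₂ + 1) / (n : ℝ) ^ α = (K₁ + K₂ + 1) * (n : ℝ) ^ (-α) := fun n => by
    rw [Real.rpow_neg n.cast_nonneg, div_eq_mul_inv]
  refine ⟨K₁ + K₂ + 1, by positivity, fun n hn x hxn hx => ?_, fun n hn => ?_⟩
  · rw [hdiv]
    refine ((h₁ n x hn hx).2 hxn).trans ?_
    refine mul_le_mul (mul_le_mul_of_nonneg_right (by linarith) (by positivity)) ?_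
      (by positivity) (by positivity)
    -- The estimate holds already without the middle term |x|^{-(2-α)}, which is nonnegative and is
    -- simply added.
    have : 0 ≤ 1 / ‖x‖ ^ (2 - α) := by positivity
    linarith
  · rw [hdiv]
    exact (h₂ n hn).trans (mul_le_mul_of_nonneg_right (by linarith) (by positivity))
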